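/- **Setting.** For a symmetric matrix $M\in\mathbb R^{n\times n}$ with zero diagonal and $\theta\in\mathbb R^n$, the Ising model $I_{(M,\theta)}$ is the distribution on $\{-1,1\}^n$ with $\mathbb P[X=x]\propto\exp(\theta\cdot x+\tfrac12 x\cdot Mx)$. For $V\subseteq[n]$, the censored Markov random field (CMRF) with parameters $(M,\theta)$ and visible set $V$ is the law of $X_V=(X_i)_{i\in V}$, $X\sim I_{(M,\theta)}$; it has $n$ vertices, censored ones included. For $b>0$ and $d\in\mathbb N$ it is called *$(b,d)$-admissible* if every row of $M$ has at most $d$ nonzero entries and $|M_{ij}|\le b$, $|\theta_i|\le b$ for all $i,j$. The earth-mover distance of two distributions on $\{-1,1\}^V$ is the infimum over all couplings $(X,Y)$ of $\mathbb E\,|\{i\in V: X_i\ne Y_i\}|$. For $b>0$ let $$\delta_b=\frac{\sinh^4(2b)}{2\cosh^4(2b)-\sinh^4(2b)},$$ and for $k\ge1$ and $S\subseteq[n]$ with $|S|=2k+2$ let $P_{S,n}$ be the distribution on $\{-1,1\}^n$ with $\mathbb P[X=x]=2^{-n}\bigl[1+\delta_b^k\prod_{i\in S}x_i\bigr]$.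 *Algorithms* are programs for a randomized random access machine with integer variables and integer arrays. It is given $n$; constants, additions, subtractions, array accesses, tests, uniform choices from $\{0,\dots,y\}$ and tosses of coins of fixed real bias (constants of the program) cost one step each, and drawing an independent sample costs one step plus one step per entry. A sample of a CMRF lists the pairs $(i,X_i)$, $i\in V$. Parameters of a CMRF are returned as rational numbers. Time bounds hold for all samples and all random choices. **Theorem.** Let $b,c>0$ be real and let $d,k$ be positive integers such that $d\ge 8$ and $b(d+1)\le\frac12$, and let $\epsilon=2^{-(2k+8)}\delta_b^k/(k+1)$. Assume that there is an algorithm $A$ that, for every $n\ge1$ and every $(b,d)$-admissible CMRF on $n$ vertices, takes samples of the CMRF, runs in time $O(n^c)$ (with a constant that depends neither on $n$ nor on the CMRF) and, with probability at least $\frac12$, returns the parameters of a $(b,d)$-admissible CMRF with the same $n$ vertices and the same visible set that is within earth-mover distance $\epsilon n$ of the original one. Then there is an algorithm $A'$ that, for every $n\ge1$ and every $S\subseteq[n]$ with $|S|=2k+2$, takes samples of $P_{S,n}$, runs in time $O(n^c\log n+n^3)$, and returns $S$ with probability $1-o(1)$, where the constant and the $o(1)$ term (as $n\to\infty$) are uniform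 in $S$. -/

import Mathlib

open Matrix
open scoped ENNReal

noncomputable section

/-! ### Spin configurations, Ising models and censored Markov random fields

The spin space `{-1, 1}` is `ℤˣ`, the group of units of `ℤ`. -/

/-- The real vector with entries `±1` given by a spin configuration. -/
def spinVec {V : Type*} (x : V → ℤˣ) : V → ℝ := fun i => ((x i : ℤ) : ℝ)

/-- The unnormalised weight `exp (θ ⬝ x + (1/2) x ⬝ M x)`. -/
def isingWeight {n : ℕ} (M : Matrix (Fin n) (Fin n) ℝ) (θ : Fin n → ℝ) (x : Fin n → ℤˣ) : ℝ :=
  Real.exp (θ ⬝ᵥ spinVec x + (1 / 2) * (spinVec x ⬝ᵥ (M *ᵥ spinVec x)))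

/-- The partition function. -/
def partitionFunction {n : ℕ} (M : Matrix (Fin n) (Fin n) ℝ) (θ : Fin n → ℝ) : ℝ :=
  ∑ y : Fin n → ℤˣ, isingWeight M θ y

theorem partitionFunction_pos {n : ℕ} (M : Matrix (Fin n) (Fin n) ℝ) (θ : Fin n → ℝ) :
    0 < partitionFunction M θ :=
  Finset.sum_pos (fun _ _ => Real.exp_pos _) Finset.univ_nonempty

/-- A nonnegative real function of total sum one, as a probability distribution. -/
def pmfOfReal {α : Type*} [Fintype α] (f : α → ℝ) (h0 : ∀ a, 0 ≤ f a) (h1 : ∑ a, f a = 1) :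
    PMF α :=
  PMF.ofFintype (fun a => ENNReal.ofReal (f a)) (by
    rw [← ENNReal.ofReal_sum_of_nonneg fun a _ => h0 a, h1, ENNReal.ofReal_one])

/-- The Ising model with edge weights `M` and biases `θ`. -/
def ising {n : ℕ} (M : Matrix (Fin n) (Fin n) ℝ) (θ : Fin n → ℝ) : PMF (Fin n → ℤˣ) :=
  pmfOfReal (fun x => isingWeight M θ x / partitionFunction M θ)
    (fun _ => div_nonneg (Real.exp_pos _).le (partitionFunction_pos M θ).le)
    (by rw [← Finset.sum_div]; exact div_self (partitionFunction_pos M θ).ne')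

/-- The censored Markov random field: the law of `X_S = (X_i : i ∈ S)` for `X` drawn from the
Ising model. -/
def cmrf {n : ℕ} (S : Finset (Fin n)) (M : Matrix (Fin n) (Fin n) ℝ) (θ : Fin n → ℝ) :
    PMF (S → ℤˣ) :=
  (ising M θ).map fun x i => x i

/-- The parameters `(M, θ)` are those of an Ising model of maximum degree at most `d`, all of
whose edge weights and biases are at most `b` in absolute value. -/
structure IsAdmissible {n : ℕ} (b : ℝ) (d : ℕ) (M : Matrix (Fin n) (Fin n) ℝ)
    (θ : Fin n → ℝ) : Prop where
  symm : ∀ i j, M i j = M j i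
  diag : ∀ i, M i i = 0
  degree : ∀ i, {j | M i j ≠ 0}.ncard ≤ d
  weight : ∀ i j, |M i j| ≤ b
  bias : ∀ i, |θ i| ≤ b

/-- The earth-mover distance of two distributions on `V → α`: the infimum, over all couplings, of
the expected number of coordinates in which the two sides differ. -/
def earthMover {V α : Type*} [Fintype V] [DecidableEq α] (P Q : PMF (V → α)) : ℝ≥0∞ :=
  ⨅ (μ : PMF ((V → α) × (V → α))) (_ : μ.map Prod.fst = P ∧ μ.map Prod.snd = Q),
    ∑' z, μ z * (hammingDist z.1 z.2 : ℝ≥0∞)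

/-! ### Sparse parities with noise -/

/-- `δ_b = sinh⁴(2b) / (2 cosh⁴(2b) - sinh⁴(2b))`. -/
def delta (b : ℝ) : ℝ :=
  Real.sinh (2 * b) ^ 4 / (2 * Real.cosh (2 * b) ^ 4 - Real.sinh (2 * b) ^ 4)

theorem sinh_pow_four_lt (x : ℝ) : Real.sinh x ^ 4 < Real.cosh x ^ 4 := by
  have h := Real.cosh_sq x
  have h1 : Real.cosh x ^ 4 = (Real.sinh x ^ 2 + 1) ^ 2 := by rw [← h]; ring
  rw [h1]
  nlinarith [sq_nonneg (Real.sinh x)]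

theorem delta_nonneg (b : ℝ) : 0 ≤ delta b := by
  have h := sinh_pow_four_lt (2 * b)
  have h0 : 0 ≤ Real.sinh (2 * b) ^ 4 := by positivity
  exact div_nonneg h0 (by linarith)

theorem delta_le_one (b : ℝ) : delta b ≤ 1 := by
  have h := sinh_pow_four_lt (2 * b)
  have h0 : 0 ≤ Real.sinh (2 * b) ^ 4 := by positivity
  exact (div_le_one (by linarith)).2 (by linarith)

theorem sum_parity_eq_zero {n : ℕ} (S : Finset (Fin n)) (hS : S.Nonempty) :
    ∑ x : Fin n → ℤˣ, ∏ i ∈ S, spinVec x i = 0 := by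
  obtain ⟨a, ha⟩ := hS
  have key : ∀ x : Fin n → ℤˣ,
      ∏ i ∈ S, spinVec (Function.update x a (-x a)) i = -∏ i ∈ S, spinVec x i := by
    intro x
    rw [← Finset.mul_prod_erase S _ ha, ← Finset.mul_prod_erase S (spinVec x) ha]
    have : ∏ i ∈ S.erase a, spinVec (Function.update x a (-x a)) i
        = ∏ i ∈ S.erase a, spinVec x i :=
      Finset.prod_congr rfl fun i hi => by
        simp [spinVec, Function.update_of_ne (Finset.ne_of_mem_erase hi)]
    rw [this]
    simp [spinVec]
  have inv : Function.Involutive fun x : Fin n → ℤˣ => Function.update x a (-x a) := by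
    intro x
    simp
  have h := Equiv.sum_comp inv.toPerm fun x : Fin n → ℤˣ => ∏ i ∈ S, spinVec x i
  simp only [Function.Involutive.coe_toPerm, key, Finset.sum_neg_distrib] at h
  linarith

/-- The distribution `P_{S,n}` of the noisy parity on the hidden set `S`, `|S| = 2k+2`:
`P[X = x] = 2^{-n} (1 + δ_b^k ∏_{i ∈ S} x_i)`. -/
def noisyParity {n : ℕ} (b : ℝ) (k : ℕ) (S : Finset (Fin n)) (hS : S.card = 2 * k + 2) :
    PMF (Fin n → ℤˣ) :=
  pmfOfReal (fun x => (2 : ℝ)⁻¹ ^ n * (1 + delta b ^ k * ∏ i ∈ S, spinVec x i))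
    (fun x => by
      have h1 : |∏ i ∈ S, spinVec x i| = 1 := by
        rw [Finset.abs_prod]
        refine Finset.prod_eq_one fun i _ => ?_
        rcases Int.units_eq_one_or (x i) with h | h <;> simp [spinVec, h]
      have h2 : |delta b ^ k * ∏ i ∈ S, spinVec x i| ≤ 1 := by
        rw [abs_mul, h1, mul_one, abs_of_nonneg (pow_nonneg (delta_nonneg b) k)]
        exact pow_le_one₀ (delta_nonneg b) (delta_le_one b)
      have h3 := (abs_le.1 h2).1
      exact mul_nonneg (by positivity) (by linarith))
    (by
      rw [← Finset.mul_sum, Finset.sum_add_distrib, ← Finset.mul_sum,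
        sum_parity_eq_zero S (Finset.card_pos.1 (by omega))]
      simp)

/-! ### Randomised random access machines with sample access

A program is a finite structured program over finitely many integer variables and finitely many
integer arrays (indexed by integers). Elementary statements cost one step: integer constants,
addition, subtraction, array access, random choices and tests. Fetching a sample costs one step
for each of its entries. -/

/-- Programs. Variables and arrays are named by natural numbers. -/
inductive Prog : Type
  /-- do nothing -/
  | skip : Prog
  /-- `x := z` -/
  | const (x : ℕ) (z : ℤ) : Prog
  /-- `x := y + z` -/
  | add (x y z : ℕ) : Prog
  /-- `x := y - z` -/
  | sub (x y z : ℕ) : Prog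
  /-- `x := a[y]` -/
  | load (x a y : ℕ) : Prog
  /-- `a[x] := y` -/
  | store (a x y : ℕ) : Prog
  /-- `x := 1` with probability `p`, and `x := 0` otherwise -/
  | flip (x : ℕ) (p : unitInterval) : Prog
  /-- `x :=` a uniformly random element of `{0, …, y}` (`0` if `y < 0`) -/
  | rand (x y : ℕ) : Prog
  /-- draw a fresh sample and write its entries into the array `a` -/
  | sample (a : ℕ) : Prog
  /-- first `p`, then `q` -/
  | seq (p q : Prog) : Prog
  /-- if `x > 0` then `p` else `q` -/
  | ite (x : ℕ) (p q : Prog) : Prog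
  /-- while `x > 0` do `p` -/
  | loop (x : ℕ) (p : Prog) : Prog

/-- The memory: the values of the variables and the contents of the arrays. -/
@[ext]
structure Store : Type where
  var : ℕ → ℤ
  arr : ℕ → ℤ → ℤ

/-- Assign `z` to the variable `x`. -/
def Store.setVar (σ : Store) (x : ℕ) (z : ℤ) : Store :=
  { σ with var := Function.update σ.var x z }

/-- Write `z` into cell `i` of the array `a`. -/
def Store.setArr (σ : Store) (a : ℕ) (i z : ℤ) : Store :=
  { σ with arr := Function.update σ.arr a (Function.update (σ.arr a) i z) }

/-- Write a list of pairs (cell, value) into the array `a`. -/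
def Store.write (σ : Store) (a : ℕ) (l : List (ℤ × ℤ)) : Store :=
  l.foldl (fun τ e => τ.setArr a e.1 e.2) σ

/-- A configuration: the statements that remain to be executed, and the memory. The machine has
halted when no statement remains. -/
abbrev Config : Type := List Prog × Store

/-- One step of the machine. `D` is the law of one sample, presented as the list of its entries
(cell, value); fetching a sample keeps the machine busy for one further step per entry. -/
def step (D : PMF (List (ℤ × ℤ))) : Config → PMF Config
  | ([], σ) => PMF.pure ([], σ)
  | (.skip :: K, σ) => PMF.pure (K, σ)
  | (.const x z :: K, σ) => PMF.pure (K, σ.setVar x z)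
  | (.add x y z :: K, σ) => PMF.pure (K, σ.setVar x (σ.var y + σ.var z))
  | (.sub x y z :: K, σ) => PMF.pure (K, σ.setVar x (σ.var y - σ.var z))
  | (.load x a y :: K, σ) => PMF.pure (K, σ.setVar x (σ.arr a (σ.var y)))
  | (.store a x y :: K, σ) => PMF.pure (K, σ.setArr a (σ.var x) (σ.var y))
  | (.flip x p :: K, σ) =>
      (pmfOfReal (fun t : Bool => if t then (p : ℝ) else 1 - p)
        (fun t => by cases t <;> simp [p.2.1, p.2.2]) (by simp)).map
        fun t => (K, σ.setVar x (if t then 1 else 0))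
  | (.rand x y :: K, σ) =>
      (PMF.uniformOfFintype (Fin ((σ.var y).toNat + 1))).map fun v => (K, σ.setVar x (v : ℕ))
  | (.sample a :: K, σ) =>
      D.map fun l => (List.replicate l.length .skip ++ K, σ.write a l)
  | (.seq p q :: K, σ) => PMF.pure (p :: q :: K, σ)
  | (.ite x p q :: K, σ) => PMF.pure (if 0 < σ.var x then p :: K else q :: K, σ)
  | (.loop x p :: K, σ) => PMF.pure (if 0 < σ.var x then p :: .loop x p :: K else K, σ)

/-- The law of the configuration after `t` steps. -/
def runFrom (D : PMF (List (ℤ × ℤ))) : ℕ → Config → PMF Config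
  | 0, C => PMF.pure C
  | t + 1, C => (step D C).bind (runFrom D t)

/-- The law of the configuration after `t` steps of the program `A` on input `n`: at the start,
variable `0` holds `n`, and all other variables and all cells hold `0`. -/
def run (A : Prog) (n : ℕ) (D : PMF (List (ℤ × ℤ))) (t : ℕ) : PMF Config :=
  runFrom D t ([A], ⟨Function.update (fun _ => 0) 0 (n : ℤ), fun _ _ => 0⟩)

/-- Whatever the samples and the random choices, `A` halts on input `n` within `t` steps. -/
def HaltsWithin (A : Prog) (n : ℕ) (D : PMF (List (ℤ × ℤ))) (t : ℕ) : Prop :=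
  ∀ C ∈ (run A n D t).support, C.1 = []

/-- The probability, over the samples and the random choices, that after `t` steps on input `n`
the program `A` has halted with memory contents in `E`. -/
def outputProb (A : Prog) (n : ℕ) (D : PMF (List (ℤ × ℤ))) (t : ℕ) (E : Set Store) : ℝ≥0∞ :=
  (run A n D t).toOuterMeasure {C | C.1 = [] ∧ C.2 ∈ E}

/-! ### Input and output conventions -/

/-- A sample `(x_i : i ∈ S)` as the list of the pairs `(i, x_i)`, `i ∈ S`, in increasing order. -/
def entries {n : ℕ} (S : Finset (Fin n)) (x : S → ℤˣ) : List (ℤ × ℤ) :=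
  (List.finRange n).filterMap fun i =>
    if h : i ∈ S then some (((i : ℕ) : ℤ), ((x ⟨i, h⟩ : ℤˣ) : ℤ)) else none

/-- Samples of a distribution on `{-1, 1}^S`, as they are handed to a program. -/
def samplesOn {n : ℕ} (S : Finset (Fin n)) (P : PMF (S → ℤˣ)) : PMF (List (ℤ × ℤ)) :=
  P.map (entries S)

/-- Samples of a distribution on `{-1, 1}^n`, as they are handed to a program. -/
def samples {n : ℕ} (P : PMF (Fin n → ℤˣ)) : PMF (List (ℤ × ℤ)) :=
  samplesOn Finset.univ (P.map fun x i => x i.1)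

/-- The edge weights returned by a program: `M i j` is the rational number with numerator in cell
`n * i + j` of array `0` and denominator in the same cell of array `1` (it is `0` if that
denominator is `0`, in particular if nothing has been written there). -/
def outWeights (n : ℕ) (σ : Store) : Matrix (Fin n) (Fin n) ℝ := fun i j =>
  (σ.arr 0 ((n : ℤ) * (i : ℕ) + (j : ℕ)) : ℝ) / (σ.arr 1 ((n : ℤ) * (i : ℕ) + (j : ℕ)) : ℝ)

/-- The biases returned by a program: numerators in array `2`, denominators in array `3`. -/
def outBiases (n : ℕ) (σ : Store) : Fin n → ℝ := fun i =>
  (σ.arr 2 (i : ℕ) : ℝ) / (σ.arr 3 (i : ℕ) : ℝ)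

/-- The set returned by a program: all `i` for which cell `i` of array `0` holds `1`. -/
def outSet (n : ℕ) (σ : Store) : Finset (Fin n) :=
  Finset.univ.filter fun i => σ.arr 0 (i : ℕ) = 1

/-- `A` runs in time `O(n^c)` and properly learns all censored Markov random fields on `n` vertices
of maximum degree at most `d` with edge weights and biases at most `b`: from samples of any such
field, with probability at least `1/2` it returns the parameters of a field of the same kind, with
the same visible vertices, within earth-mover distance `ε n`. -/
def ProperlyLearns (A : Prog) (b : ℝ) (d : ℕ) (c ε : ℝ) : Prop :=
  ∃ C : ℝ, ∀ n : ℕ, 0 < n → ∀ (S : Finset (Fin n)) (M : Matrix (Fin n) (Fin n) ℝ)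
    (θ : Fin n → ℝ), IsAdmissible b d M θ →
      HaltsWithin A n (samplesOn S (cmrf S M θ)) ⌊C * (n : ℝ) ^ c⌋₊ ∧
      1 / 2 ≤ outputProb A n (samplesOn S (cmrf S M θ)) ⌊C * (n : ℝ) ^ c⌋₊
        {σ | IsAdmissible b d (outWeights n σ) (outBiases n σ) ∧
          earthMover (cmrf S M θ) (cmrf S (outWeights n σ) (outBiases n σ)) ≤
            ENNReal.ofReal (ε * n)}

/-- `A` runs in time `O(T n)` and, from samples of the noisy parity on a hidden set `S` of `2k+2`
elements of an `n`-element set, returns `S` with probability `1 - o(1)`, uniformly in `S`. -/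
def RecoversParity (A : Prog) (b : ℝ) (k : ℕ) (T : ℕ → ℝ) : Prop :=
  ∃ (C : ℝ) (η : ℕ → ℝ), Filter.Tendsto η Filter.atTop (nhds 0) ∧
    ∀ n : ℕ, 0 < n → ∀ (S : Finset (Fin n)) (hS : S.card = 2 * k + 2),
      HaltsWithin A n (samples (noisyParity b k S hS)) ⌊C * T n⌋₊ ∧
      ENNReal.ofReal (1 - η n) ≤
        outputProb A n (samples (noisyParity b k S hS)) ⌊C * T n⌋₊ {σ | outSet n σ = S}

end

/-! A proper learner must return a sparse high-temperature graph, and such a graph has to keep the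
spins of every strong high-order correlation close together. A hidden parity can therefore be read
off from the returned graph by local search.

Parities are admissible fields. Four hidden centres, each coupled with strength `b` to four
terminals, one of the four signs being reversed, produce after summation over the centres a constant
multiple of `1 + δ_b t₁t₂t₃t₄` (`gadget_identity`). Chaining `k` gadgets through hidden links
multiplies the factors `δ_b` and leaves a noisy parity of `2k+2` visible spins with amplitude
`δ_b^k` (`GadgetHyp.sum_chain`, `GadgetHyp.cmrf_eq`). Every degree is at most `8`. Samples of
`P_{S,n}`, extended by `n` artificial noisy parities on new coordinates and relabelled by a
uniformly random permutation, are thus samples of an admissible field on `N = (12k+3)n` vertices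
(`gen_wp`, `exists_model`), and the learner can be simulated on them (`simulate`).

Good hypotheses have clusters. Since `b d ≤ 1/2`, resampling single spins shows that the covariance
of two spin products decays like `2^{-t}` in the distance `t` (`IsAdmissible.abs_cov_chi_le`). In a
planted block the full product has mean `δ_b^k` and every proper nonempty subproduct has mean `0`.
If a field reproduces these correlations approximately, its graph cannot separate the block into two
distant parts (`IsAdmissible.unsplittable`), so the block has bounded diameter. The blocks are
disjoint, hence an optimal transport plan disagrees with few of them, and at least `5/8` of the
blocks are clusters (`card_clustered`). The learner cannot distinguish the true block from the
artificial ones, because exchanging two blocks does not change the law; by symmetry the true block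
is a cluster of a successful output with probability at least `1/4` (`quarter_le_clustered`).

Search and verification. Bounded degree and bounded diameter let `2k+2` random walks of constant
length, started in the right vertex, hit all of `S` with a probability that does not depend on `n`
(`cand_wp`). A candidate set is accepted if its empirical parity on `O(log n)` fresh samples exceeds
half of `δ_b^k`; by a Chernoff bound a wrong decision has probability at most `e^{-3L}` for `L =
⌈log₂ n⌉` (`test_exp_le`). All vertices are tried as starting points, and the whole procedure is
repeated `L` times. The probability of never finding `S` is at most `(1-a)^L` with constant `a`, and
that of ever accepting a wrong set is at most `(2k+3) 4^{-L}`; both tend to `0` (`main_fail`). The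
cost is `L` simulations of the learner plus `O(n² L²)` for the search (`mainCost_le`).

Programs are treated by total correctness statements `Tri`, which carry the time bounds, and by
expectation transformers `wp`, which carry the probabilities. -/

noncomputable section

/-! ### Expectations with respect to a discrete distribution -/

/-- The expectation of a nonnegative function. -/
def expect {α : Type*} (ν : PMF α) (f : α → ℝ≥0∞) : ℝ≥0∞ := ∑' a, ν a * f a

section Expect

variable {α β : Type*}

@[simp] theorem expect_pure (a : α) (f : α → ℝ≥0∞) : expect (PMF.pure a) f = f a := by
  rw [expect, tsum_eq_single a]
  · simp
  · intro b hb
    simp [hb]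

@[simp] theorem expect_bind (ν : PMF α) (κ : α → PMF β) (f : β → ℝ≥0∞) :
    expect (ν.bind κ) f = expect ν fun a => expect (κ a) f := by
  simp only [expect, PMF.bind_apply, ← ENNReal.tsum_mul_right, ← ENNReal.tsum_mul_left]
  rw [ENNReal.tsum_comm]
  simp only [mul_assoc]

@[simp] theorem expect_map (ν : PMF α) (g : α → β) (f : β → ℝ≥0∞) :
    expect (ν.map g) f = expect ν fun a => f (g a) := by
  simp [PMF.map, Function.comp_def]

theorem expect_mono {ν : PMF α} {f g : α → ℝ≥0∞} (h : ∀ a ∈ ν.support, f a ≤ g a) :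
    expect ν f ≤ expect ν g := by
  refine ENNReal.tsum_le_tsum fun a => ?_
  by_cases ha : a ∈ ν.support
  · exact mul_le_mul_right (h a ha) _
  · simp [(PMF.apply_eq_zero_iff ν a).2 ha]

theorem expect_congr {ν : PMF α} {f g : α → ℝ≥0∞} (h : ∀ a ∈ ν.support, f a = g a) :
    expect ν f = expect ν g :=
  le_antisymm (expect_mono fun a ha => (h a ha).le) (expect_mono fun a ha => (h a ha).ge)

@[simp] theorem expect_const (ν : PMF α) (c : ℝ≥0∞) : expect ν (fun _ => c) = c := by
  rw [expect, ENNReal.tsum_mul_right, PMF.tsum_coe, one_mul]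

theorem expect_add (ν : PMF α) (f g : α → ℝ≥0∞) :
    expect ν (fun a => f a + g a) = expect ν f + expect ν g := by
  simp only [expect, mul_add, ENNReal.tsum_add]

theorem expect_const_mul (ν : PMF α) (c : ℝ≥0∞) (f : α → ℝ≥0∞) :
    expect ν (fun a => c * f a) = c * expect ν f := by
  simp only [expect, ← ENNReal.tsum_mul_left]
  exact tsum_congr fun a => by ring

theorem expect_finset_sum {ι : Type*} (s : Finset ι) (ν : PMF α) (f : ι → α → ℝ≥0∞) :
    expect ν (fun a => ∑ i ∈ s, f i a) = ∑ i ∈ s, expect ν (f i) := by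
  simp only [expect, Finset.mul_sum]
  exact Summable.tsum_finsetSum fun _ _ => ENNReal.summable

theorem expect_fintype [Fintype α] (ν : PMF α) (f : α → ℝ≥0∞) :
    expect ν f = ∑ a, ν a * f a := tsum_fintype _

theorem expect_indicator (ν : PMF α) (E : Set α) :
    expect ν (E.indicator fun _ => 1) = ν.toOuterMeasure E := by
  rw [PMF.toOuterMeasure_apply, expect]
  refine tsum_congr fun a => ?_
  by_cases h : a ∈ E <;> simp [h]

theorem pmf_ext_expect {ν μ : PMF α} (h : ∀ f : α → ℝ≥0∞, expect ν f = expect μ f) : ν = μ := by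
  classical
  ext a
  have := h fun b => if b = a then 1 else 0
  simpa [expect] using this

theorem expect_congr_fun_support {ν : PMF α} {κ κ' : α → PMF β}
    (h : ∀ a ∈ ν.support, κ a = κ' a) : ν.bind κ = ν.bind κ' :=
  pmf_ext_expect fun f => by
    simp only [expect_bind]
    exact expect_congr fun a ha => by rw [h a ha]

theorem expect_uniform [Fintype α] [Nonempty α] (f : α → ℝ≥0∞) :
    expect (PMF.uniformOfFintype α) f = (Fintype.card α : ℝ≥0∞)⁻¹ * ∑ a, f a := by
  rw [expect_fintype, Finset.mul_sum]
  simp [PMF.uniformOfFintype_apply]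

end Expect

/-! ### Semantics of program fragments -/

theorem runFrom_nil (D : PMF (List (ℤ × ℤ))) (t : ℕ) (σ : Store) :
    runFrom D t ([], σ) = PMF.pure ([], σ) := by
  induction t with
  | zero => rfl
  | succ t ih => rw [runFrom, step, PMF.pure_bind, ih]

theorem runFrom_add (D : PMF (List (ℤ × ℤ))) (s t : ℕ) (C : Config) :
    runFrom D (s + t) C = (runFrom D s C).bind (runFrom D t) := by
  induction s generalizing C with
  | zero => simp [runFrom]
  | succ s ih =>
    rw [Nat.succ_add, runFrom, runFrom, PMF.bind_bind]
    congr 1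
    funext C'
    exact ih C'

/-- After `T` steps from `C` the machine has halted, with memory distributed as `ν`. -/
def HaltsAt (D : PMF (List (ℤ × ℤ))) (T : ℕ) (C : Config) (ν : PMF Store) : Prop :=
  runFrom D T C = ν.map (Prod.mk [])

/-- Halted configurations are fixed points of `step`. All later time bounds can therefore be upper
bounds rather than exact step counts. -/
theorem HaltsAt.mono {D : PMF (List (ℤ × ℤ))} {T T' : ℕ} {C : Config} {ν : PMF Store}
    (h : HaltsAt D T C ν) (hT : T ≤ T') : HaltsAt D T' C ν := by
  obtain ⟨s, rfl⟩ := Nat.exists_eq_add_of_le hT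
  rw [HaltsAt, runFrom_add, h, PMF.bind_map]
  simp only [Function.comp_def, runFrom_nil]
  rfl

/-- Executing the statements `l` from memory `σ` takes at most `B` steps and leads to memory
distributed as `ν`, whatever remains to be executed afterwards. -/
def Spec (D : PMF (List (ℤ × ℤ))) (l : List Prog) (σ : Store) (B : ℕ) (ν : PMF Store) : Prop :=
  ∀ (K : List Prog) (T : ℕ) (ν' : Store → PMF Store),
    (∀ τ ∈ ν.support, HaltsAt D T (K, τ) (ν' τ)) → HaltsAt D (B + T) (l ++ K, σ) (ν.bind ν')

variable {D : PMF (List (ℤ × ℤ))}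

theorem Spec.mono {l : List Prog} {σ : Store} {B B' : ℕ} {ν : PMF Store} (h : Spec D l σ B ν)
    (hB : B ≤ B') : Spec D l σ B' ν := fun K T ν' hK =>
  (h K T ν' hK).mono (by omega)

theorem Spec.nil (σ : Store) : Spec D [] σ 0 (PMF.pure σ) := by
  intro K T ν' hK
  simpa using hK σ (by simp)

/-- This is why `Spec` quantifies over the continuation `K` and its time `T`: the second fragment is
simply part of the continuation of the first. -/
theorem Spec.append {l l' : List Prog} {σ : Store} {B B' : ℕ} {ν : PMF Store}
    {κ : Store → PMF Store} (h : Spec D l σ B ν)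
    (h' : ∀ τ ∈ ν.support, Spec D l' τ B' (κ τ)) : Spec D (l ++ l') σ (B + B') (ν.bind κ) := by
  intro K T ν' hK
  rw [List.append_assoc, PMF.bind_bind, add_assoc]
  refine h (l' ++ K) (B' + T) _ fun τ hτ => h' τ hτ K T ν' fun ρ hρ => hK ρ ?_
  exact (PMF.mem_support_bind_iff _ _ _).2 ⟨τ, hτ, hρ⟩

theorem Spec.of_step {p : Prog} {σ : Store} {B : ℕ} {μ : PMF (List Prog × Store)}
    {κ : List Prog × Store → PMF Store}
    (hs : ∀ K, step D (p :: K, σ) = μ.map fun z => (z.1 ++ K, z.2))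
    (h : ∀ z ∈ μ.support, Spec D z.1 z.2 B (κ z)) : Spec D [p] σ (B + 1) (μ.bind κ) := by
  intro K T ν' hK
  have : B + 1 + T = (B + T) + 1 := by omega
  rw [HaltsAt, this, List.singleton_append, runFrom, hs, PMF.bind_map, PMF.bind_bind, PMF.map_bind]
  refine expect_congr_fun_support fun z hz => h z hz K T ν' fun ρ hρ => hK ρ ?_
  exact (PMF.mem_support_bind_iff _ _ _).2 ⟨z, hz, hρ⟩

theorem Spec.of_pure_step {p : Prog} {l : List Prog} {σ τ : Store} {B : ℕ} {ν : PMF Store}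
    (hs : ∀ K, step D (p :: K, σ) = PMF.pure (l ++ K, τ)) (h : Spec D l τ B ν) :
    Spec D [p] σ (B + 1) ν := by
  have := Spec.of_step (D := D) (p := p) (σ := σ) (B := B) (μ := PMF.pure (l, τ))
    (κ := fun _ => ν) (fun K => by rw [hs, PMF.pure_map]) (by simpa using h)
  simpa using this

theorem Spec.of_random_step {p : Prog} {σ : Store} {μ : PMF Store}
    (hs : ∀ K, step D (p :: K, σ) = μ.map fun τ => (K, τ)) : Spec D [p] σ 1 μ := by
  have := Spec.of_step (D := D) (p := p) (σ := σ) (B := 0) (μ := μ.map fun τ => ([], τ))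
    (κ := fun z => PMF.pure z.2) (fun K => by rw [hs, PMF.map_comp]; rfl) (by
      intro z hz
      obtain ⟨τ, -, rfl⟩ := (PMF.mem_support_map_iff _ _ _).1 hz
      exact Spec.nil τ)
  rwa [PMF.bind_map, Function.comp_def, PMF.bind_pure] at this

/-- With an empty continuation the law of the final memory can be read off from the run itself.
Hence `den` does not depend on the choice made in its definition. -/
theorem Spec.unique {l : List Prog} {σ : Store} {B B' : ℕ} {ν ν' : PMF Store}
    (h : Spec D l σ B ν) (h' : Spec D l σ B' ν') : ν = ν' := by
  have e := (h [] 0 PMF.pure fun τ _ => by simp [HaltsAt, runFrom, PMF.pure_map]).mono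
    (Nat.le_max_left (B + 0) (B' + 0))
  have e' := (h' [] 0 PMF.pure fun τ _ => by simp [HaltsAt, runFrom, PMF.pure_map]).mono
    (Nat.le_max_right (B + 0) (B' + 0))
  rw [PMF.bind_pure] at e e'
  have := e.symm.trans e'
  have hm : ∀ ν : PMF Store, (ν.map (Prod.mk ([] : List Prog))).map Prod.snd = ν := fun ν => by
    rw [PMF.map_comp]
    exact PMF.map_id ν
  rw [← hm ν, ← hm ν']
  exact congrArg (PMF.map Prod.snd) this

open Classical in
/-- The distribution of the memory after executing `p` from `σ`. -/
def den (D : PMF (List (ℤ × ℤ))) (p : Prog) (σ : Store) : PMF Store :=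
  if h : ∃ ν, ∃ B, Spec D [p] σ B ν then h.choose else PMF.pure σ

theorem Spec.den_eq {p : Prog} {σ : Store} {B : ℕ} {ν : PMF Store} (h : Spec D [p] σ B ν) :
    den D p σ = ν := by
  have hex : ∃ ν, ∃ B, Spec D [p] σ B ν := ⟨ν, B, h⟩
  rw [den, dif_pos hex]
  obtain ⟨B', h'⟩ := hex.choose_spec
  exact h'.unique h

/-- Total correctness: from `σ`, the program `p` halts within `B` steps, always in a memory state
satisfying `Q`. -/
def Tri (D : PMF (List (ℤ × ℤ))) (p : Prog) (σ : Store) (B : ℕ) (Q : Store → Prop) : Prop :=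
  Spec D [p] σ B (den D p σ) ∧ ∀ τ ∈ (den D p σ).support, Q τ

/-- The expectation of `f` after executing `p` from `σ`. -/
def wp (D : PMF (List (ℤ × ℤ))) (p : Prog) (f : Store → ℝ≥0∞) (σ : Store) : ℝ≥0∞ :=
  expect (den D p σ) f

theorem Spec.tri {p : Prog} {σ : Store} {B : ℕ} {ν : PMF Store} {Q : Store → Prop}
    (h : Spec D [p] σ B ν) (hQ : ∀ τ ∈ ν.support, Q τ) : Tri D p σ B Q := by
  rw [Tri, h.den_eq]
  exact ⟨h, hQ⟩

theorem Tri.mono {p : Prog} {σ : Store} {B B' : ℕ} {Q Q' : Store → Prop} (h : Tri D p σ B Q)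
    (hB : B ≤ B') (hQ : ∀ τ, Q τ → Q' τ) : Tri D p σ B' Q' :=
  ⟨h.1.mono hB, fun τ hτ => hQ τ (h.2 τ hτ)⟩

theorem Tri.wp_mono {p : Prog} {σ : Store} {B : ℕ} {Q : Store → Prop} (h : Tri D p σ B Q)
    {f g : Store → ℝ≥0∞} (hfg : ∀ τ, Q τ → f τ ≤ g τ) : wp D p f σ ≤ wp D p g σ :=
  expect_mono fun τ hτ => hfg τ (h.2 τ hτ)

theorem Tri.wp_congr {p : Prog} {σ : Store} {B : ℕ} {Q : Store → Prop} (h : Tri D p σ B Q)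
    {f g : Store → ℝ≥0∞} (hfg : ∀ τ, Q τ → f τ = g τ) : wp D p f σ = wp D p g σ :=
  expect_congr fun τ hτ => hfg τ (h.2 τ hτ)

theorem Tri.wp_eq_const {p : Prog} {σ : Store} {B : ℕ} {Q : Store → Prop} (h : Tri D p σ B Q)
    {f : Store → ℝ≥0∞} {c : ℝ≥0∞} (hf : ∀ τ, Q τ → f τ = c) : wp D p f σ = c :=
  (h.wp_congr hf).trans (expect_const _ c)

/-! #### Sequences -/

theorem spec_seq {p q : Prog} {σ : Store} {B B' : ℕ} {ν : PMF Store} {κ : Store → PMF Store}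
    (h : Spec D [p] σ B ν) (h' : ∀ τ ∈ ν.support, Spec D [q] τ B' (κ τ)) :
    Spec D [.seq p q] σ (B + B' + 1) (ν.bind κ) :=
  Spec.of_pure_step (l := [p, q]) (fun K => by simp [step]) (h.append (l' := [q]) h')

theorem Tri.spec_seq {p q : Prog} {σ : Store} {B B' : ℕ} {Q : Store → Prop}
    (h : Tri D p σ B fun τ => Tri D q τ B' Q) :
    Spec D [.seq p q] σ (B + B' + 1) ((den D p σ).bind (den D q)) :=
  _root_.spec_seq h.1 fun τ hτ => (h.2 τ hτ).1

theorem Tri.seq {p q : Prog} {σ : Store} {B B' : ℕ} {Q : Store → Prop}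
    (h : Tri D p σ B fun τ => Tri D q τ B' Q) : Tri D (.seq p q) σ (B + B' + 1) Q := by
  refine h.spec_seq.tri fun τ hτ => ?_
  obtain ⟨ρ, hρ, hτ⟩ := (PMF.mem_support_bind_iff _ _ _).1 hτ
  exact (h.2 ρ hρ).2 τ hτ

theorem Tri.wp_seq {p q : Prog} {σ : Store} {B B' : ℕ} {Q : Store → Prop}
    (h : Tri D p σ B fun τ => Tri D q τ B' Q) (f : Store → ℝ≥0∞) :
    wp D (.seq p q) f σ = wp D p (wp D q f) σ := by
  rw [wp, h.spec_seq.den_eq, expect_bind]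
  rfl

/-! #### Conditionals -/

theorem spec_ite {x : ℕ} {p q : Prog} {σ : Store} {B : ℕ} {ν : PMF Store}
    (h : Spec D [if 0 < σ.var x then p else q] σ B ν) : Spec D [.ite x p q] σ (B + 1) ν :=
  Spec.of_pure_step (fun K => by simp only [step]; split_ifs <;> rfl) h

theorem Tri.ite {x : ℕ} {p q : Prog} {σ : Store} {B : ℕ} {Q : Store → Prop}
    (h : Tri D (if 0 < σ.var x then p else q) σ B Q) : Tri D (.ite x p q) σ (B + 1) Q :=
  (spec_ite h.1).tri h.2

theorem Tri.wp_ite {x : ℕ} {p q : Prog} {σ : Store} {B : ℕ} {Q : Store → Prop}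
    (h : Tri D (if 0 < σ.var x then p else q) σ B Q) (f : Store → ℝ≥0∞) :
    wp D (.ite x p q) f σ = wp D (if 0 < σ.var x then p else q) f σ := by
  rw [wp, (spec_ite h.1).den_eq]
  rfl

/-! #### Loops -/

theorem spec_loop_stop {x : ℕ} {p : Prog} {σ : Store} (h : ¬ 0 < σ.var x) :
    Spec D [.loop x p] σ 1 (PMF.pure σ) :=
  Spec.of_pure_step (l := []) (fun K => by simp [step, h]) (Spec.nil σ)

theorem spec_loop_step {x : ℕ} {p : Prog} {σ : Store} {B : ℕ} {ν : PMF Store} (hx : 0 < σ.var x)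
    (h : Spec D [p, .loop x p] σ B ν) : Spec D [.loop x p] σ (B + 1) ν :=
  Spec.of_pure_step (l := [p, .loop x p]) (fun K => by simp [step, hx]) h

/-- A loop whose guard fails after at most `m` rounds. -/
theorem Tri.while {x : ℕ} {p : Prog} {B : ℕ} {I : ℕ → Store → Prop}
    (h0 : ∀ σ, I 0 σ → ¬ 0 < σ.var x)
    (hs : ∀ i σ, I (i + 1) σ → 0 < σ.var x → Tri D p σ B (I i)) (m : ℕ) (σ : Store)
    (hI : I m σ) : Tri D (.loop x p) σ (m * (B + 1) + 1) (fun τ => (∃ i, I i τ) ∧ ¬ 0 < τ.var x) := by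
  induction m generalizing σ with
  | zero => exact (spec_loop_stop (h0 σ hI)).mono (by omega) |>.tri (by simpa using ⟨⟨0, hI⟩, not_lt.1 (h0 σ hI)⟩)
  | succ m ih =>
    by_cases hx : 0 < σ.var x
    · have h := hs m σ hI hx
      have := spec_loop_step hx (h.1.append (l' := [.loop x p]) fun τ hτ => (ih τ (h.2 τ hτ)).1)
      refine (this.mono (by ring_nf; omega)).tri fun τ hτ => ?_
      obtain ⟨ρ, hρ, hτ⟩ := (PMF.mem_support_bind_iff _ _ _).1 hτ
      exact (ih ρ (h.2 ρ hρ)).2 τ hτ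
    · exact (spec_loop_stop hx).mono (by omega) |>.tri (by
        simpa using ⟨⟨m + 1, hI⟩, not_lt.1 hx⟩)

theorem wp_loop_stop {x : ℕ} {p : Prog} {σ : Store} (h : ¬ 0 < σ.var x) (f : Store → ℝ≥0∞) :
    wp D (.loop x p) f σ = f σ := by
  rw [wp, (spec_loop_stop h).den_eq, expect_pure]

theorem Tri.wp_loop_step {x : ℕ} {p : Prog} {σ : Store} {B B' : ℕ} {Q : Store → Prop}
    (hx : 0 < σ.var x) (h : Tri D p σ B fun τ => Tri D (.loop x p) τ B' Q) (f : Store → ℝ≥0∞) :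
    wp D (.loop x p) f σ = wp D p (wp D (.loop x p) f) σ := by
  rw [wp, (spec_loop_step hx (h.1.append (l' := [.loop x p]) fun τ hτ => (h.2 τ hτ).1)).den_eq,
    expect_bind]
  rfl

end

noncomputable section

variable {D : PMF (List (ℤ × ℤ))}

/-! ### Memory updates -/

@[simp] theorem Store.setVar_var (σ : Store) (x : ℕ) (z : ℤ) (y : ℕ) :
    (σ.setVar x z).var y = if y = x then z else σ.var y := by
  simp [Store.setVar, Function.update_apply]

@[simp] theorem Store.setVar_arr (σ : Store) (x : ℕ) (z : ℤ) : (σ.setVar x z).arr = σ.arr := rfl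

@[simp] theorem Store.setArr_var (σ : Store) (a : ℕ) (i z : ℤ) : (σ.setArr a i z).var = σ.var := rfl

@[simp] theorem Store.setArr_arr (σ : Store) (a : ℕ) (i z : ℤ) (b : ℕ) (j : ℤ) :
    (σ.setArr a i z).arr b j = if b = a ∧ j = i then z else σ.arr b j := by
  by_cases hb : b = a
  · subst hb
    by_cases hj : j = i <;> simp [Store.setArr, hj]
  · simp [Store.setArr, hb]

theorem Store.setArr_arr_of_ne (σ : Store) {a b : ℕ} (i z : ℤ) (h : b ≠ a) :
    (σ.setArr a i z).arr b = σ.arr b := by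
  funext j
  simp [h]

theorem Store.write_var (l : List (ℤ × ℤ)) (σ : Store) (a : ℕ) : (σ.write a l).var = σ.var := by
  induction l generalizing σ with
  | nil => rfl
  | cons e l ih => exact ih _

theorem Store.write_arr_of_ne (l : List (ℤ × ℤ)) (σ : Store) {a b : ℕ} (h : b ≠ a) :
    (σ.write a l).arr b = σ.arr b := by
  induction l generalizing σ with
  | nil => rfl
  | cons e l ih => exact (ih _).trans (σ.setArr_arr_of_ne _ _ h)

/-! ### What a program may modify -/

/-- `p` contains an assignment to the variable `y`. -/
def Prog.wv : Prog → ℕ → Prop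
  | .skip, _ => False
  | .const x _, y => y = x
  | .add x _ _, y => y = x
  | .sub x _ _, y => y = x
  | .load x _ _, y => y = x
  | .store _ _ _, _ => False
  | .flip x _, y => y = x
  | .rand x _, y => y = x
  | .sample _, _ => False
  | .seq p q, y => p.wv y ∨ q.wv y
  | .ite _ p q, y => p.wv y ∨ q.wv y
  | .loop _ p, y => p.wv y

/-- `p` contains a write access to the array `b`. -/
def Prog.wa : Prog → ℕ → Prop
  | .store a _ _, b => b = a
  | .sample a, b => b = a
  | .seq p q, b => p.wa b ∨ q.wa b
  | .ite _ p q, b => p.wa b ∨ q.wa b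
  | .loop _ p, b => p.wa b
  | _, _ => False

/-- `τ` differs from `σ` only in variables and arrays that `p` may modify. -/
def Fr (p : Prog) (σ τ : Store) : Prop :=
  (∀ y, ¬ p.wv y → τ.var y = σ.var y) ∧ ∀ b, ¬ p.wa b → τ.arr b = σ.arr b

theorem step_frame_var {y : ℕ} {C : Config} (hC : ∀ q ∈ C.1, ¬ q.wv y) :
    ∀ C' ∈ (step D C).support, (∀ q ∈ C'.1, ¬ q.wv y) ∧ C'.2.var y = C.2.var y := by
  obtain ⟨K, σ⟩ := C
  cases K with
  | nil => intro C' hC'; simp [step] at hC'; simp [hC']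
  | cons p K =>
    intro C' hC'
    have hp := hC p (by simp)
    have hK : ∀ q ∈ K, ¬ q.wv y := fun q hq => hC q (by simp [hq])
    cases p with
    | flip x p =>
      obtain ⟨t, -, rfl⟩ := (PMF.mem_support_map_iff _ _ _).1 hC'
      exact ⟨hK, by simp_all [Prog.wv]⟩
    | rand x z =>
      obtain ⟨t, -, rfl⟩ := (PMF.mem_support_map_iff _ _ _).1 hC'
      exact ⟨hK, by simp_all [Prog.wv]⟩
    | sample a =>
      obtain ⟨t, -, rfl⟩ := (PMF.mem_support_map_iff _ _ _).1 hC'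
      refine ⟨fun q hq => ?_, by rw [Store.write_var]⟩
      rcases List.mem_append.1 hq with h | h
      · rw [List.eq_of_mem_replicate h]; simp [Prog.wv]
      · exact hK q h
    | ite x p q =>
      simp only [step, PMF.support_pure, Set.mem_singleton_iff] at hC'
      subst hC'
      simp only [Prog.wv, not_or] at hp
      split_ifs <;> simp_all
    | loop x p =>
      simp only [step, PMF.support_pure, Set.mem_singleton_iff] at hC'
      subst hC'
      simp only [Prog.wv] at hp
      split_ifs <;> simp_all [Prog.wv]
    | _ =>
      simp only [step, PMF.support_pure, Set.mem_singleton_iff] at hC'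
      subst hC'
      simp_all [Prog.wv]

theorem step_frame_arr {b : ℕ} {C : Config} (hC : ∀ q ∈ C.1, ¬ q.wa b) :
    ∀ C' ∈ (step D C).support, (∀ q ∈ C'.1, ¬ q.wa b) ∧ C'.2.arr b = C.2.arr b := by
  obtain ⟨K, σ⟩ := C
  cases K with
  | nil => intro C' hC'; simp [step] at hC'; simp [hC']
  | cons p K =>
    intro C' hC'
    have hp := hC p (by simp)
    have hK : ∀ q ∈ K, ¬ q.wa b := fun q hq => hC q (by simp [hq])
    cases p with
    | flip x p =>
      obtain ⟨t, -, rfl⟩ := (PMF.mem_support_map_iff _ _ _).1 hC'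
      exact ⟨hK, rfl⟩
    | rand x z =>
      obtain ⟨t, -, rfl⟩ := (PMF.mem_support_map_iff _ _ _).1 hC'
      exact ⟨hK, rfl⟩
    | sample a =>
      obtain ⟨t, -, rfl⟩ := (PMF.mem_support_map_iff _ _ _).1 hC'
      refine ⟨fun q hq => ?_, Store.write_arr_of_ne _ _ hp⟩
      rcases List.mem_append.1 hq with h | h
      · rw [List.eq_of_mem_replicate h]; simp [Prog.wa]
      · exact hK q h
    | store a x z =>
      simp only [step, PMF.support_pure, Set.mem_singleton_iff] at hC'
      subst hC'
      exact ⟨hK, σ.setArr_arr_of_ne _ _ hp⟩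
    | ite x p q =>
      simp only [step, PMF.support_pure, Set.mem_singleton_iff] at hC'
      subst hC'
      simp only [Prog.wa, not_or] at hp
      split_ifs <;> simp_all
    | loop x p =>
      simp only [step, PMF.support_pure, Set.mem_singleton_iff] at hC'
      subst hC'
      simp only [Prog.wa] at hp
      split_ifs <;> simp_all [Prog.wa]
    | _ =>
      simp only [step, PMF.support_pure, Set.mem_singleton_iff] at hC'
      subst hC'
      simp_all [Prog.wa]

theorem runFrom_induction {I : Config → Prop} (hI : ∀ C, I C → ∀ C' ∈ (step D C).support, I C')
    (T : ℕ) (C : Config) (hC : I C) : ∀ C' ∈ (runFrom D T C).support, I C' := by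
  induction T generalizing C with
  | zero =>
    intro C' h
    simp only [runFrom, PMF.support_pure, Set.mem_singleton_iff] at h
    exact h ▸ hC
  | succ T ih =>
    intro C' h
    obtain ⟨C1, h1, h⟩ := (PMF.mem_support_bind_iff _ _ _).1 h
    exact ih C1 (hI C hC C1 h1) C' h

/-- The syntactic sets `wv` and `wa` bound what any single step can change, and this passes to whole
runs. Loop invariants need only mention what the loop body modifies; everything else comes from
`Fr`. -/
theorem Spec.frame {p : Prog} {σ : Store} {B : ℕ} {ν : PMF Store} (h : Spec D [p] σ B ν) :
    ∀ τ ∈ ν.support, Fr p σ τ := by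
  intro τ hτ
  have e := h [] 0 PMF.pure fun τ _ => by simp [HaltsAt, runFrom, PMF.pure_map]
  rw [PMF.bind_pure] at e
  have hm : (([], τ) : Config) ∈ (runFrom D (B + 0) ([p] ++ [], σ)).support := by
    rw [e]
    exact (PMF.mem_support_map_iff _ _ _).2 ⟨τ, hτ, rfl⟩
  constructor
  · intro y hy
    refine (runFrom_induction (D := D)
      (I := fun C => (∀ q ∈ C.1, ¬ q.wv y) ∧ C.2.var y = σ.var y) ?_ _ _ ?_ _ hm).2
    · intro C hC C' hC'
      have := step_frame_var hC.1 C' hC'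
      exact ⟨this.1, this.2.trans hC.2⟩
    · simpa using hy
  · intro b hb
    refine (runFrom_induction (D := D)
      (I := fun C => (∀ q ∈ C.1, ¬ q.wa b) ∧ C.2.arr b = σ.arr b) ?_ _ _ ?_ _ hm).2
    · intro C hC C' hC'
      have := step_frame_arr hC.1 C' hC'
      exact ⟨this.1, this.2.trans hC.2⟩
    · simpa using hb

theorem Tri.frame {p : Prog} {σ : Store} {B : ℕ} {Q : Store → Prop} (h : Tri D p σ B Q) :
    Tri D p σ B fun τ => Q τ ∧ Fr p σ τ :=
  ⟨h.1, fun τ hτ => ⟨h.2 τ hτ, h.1.frame τ hτ⟩⟩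

/-! ### Straight-line programs -/

/-- Programs without loops, randomness and samples. -/
def Prog.straight : Prog → Prop
  | .flip _ _ | .rand _ _ | .sample _ | .loop _ _ => False
  | .seq p q | .ite _ p q => p.straight ∧ q.straight
  | _ => True

/-- A bound for the running time of a straight-line program. -/
def Prog.cost : Prog → ℕ
  | .seq p q => p.cost + q.cost + 1
  | .ite _ p q => max p.cost q.cost + 1
  | _ => 1

/-- The effect of a straight-line program. -/
def Prog.exec : Prog → Store → Store
  | .const x z, σ => σ.setVar x z
  | .add x y z, σ => σ.setVar x (σ.var y + σ.var z)
  | .sub x y z, σ => σ.setVar x (σ.var y - σ.var z)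
  | .load x a y, σ => σ.setVar x (σ.arr a (σ.var y))
  | .store a x y, σ => σ.setArr a (σ.var x) (σ.var y)
  | .seq p q, σ => q.exec (p.exec σ)
  | .ite x p q, σ => if 0 < σ.var x then p.exec σ else q.exec σ
  | _, σ => σ

/-- Deterministic fragments are reduced to the function `exec`, so that their correctness becomes a
computation by `simp`. -/
theorem Prog.spec_straight (p : Prog) (hp : p.straight) (σ : Store) :
    Spec D [p] σ p.cost (PMF.pure (p.exec σ)) := by
  induction p generalizing σ with
  | seq p q ihp ihq =>
    have := spec_seq (ihp hp.1 σ) (B' := q.cost) (κ := fun τ => PMF.pure (q.exec τ))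
      fun τ _ => ihq hp.2 τ
    simpa [Prog.cost, Prog.exec] using this
  | ite x p q ihp ihq =>
    rw [Prog.exec, Prog.cost]
    refine spec_ite ?_
    split_ifs
    · exact (ihp hp.1 σ).mono (le_max_left _ _)
    · exact (ihq hp.2 σ).mono (le_max_right _ _)
  | flip | rand | sample | loop => exact hp.elim
  | _ => exact Spec.of_pure_step (l := []) (fun K => rfl) (Spec.nil _)

theorem Prog.den_straight {p : Prog} (hp : p.straight) (σ : Store) :
    den D p σ = PMF.pure (p.exec σ) := (p.spec_straight hp σ).den_eq

theorem Tri.straight {p : Prog} (hp : p.straight) {σ : Store} {B : ℕ} {Q : Store → Prop}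
    (hB : p.cost ≤ B) (hQ : Q (p.exec σ)) : Tri D p σ B Q :=
  ((p.spec_straight hp σ).mono hB).tri (by simpa using hQ)

theorem wp_straight {p : Prog} (hp : p.straight) (f : Store → ℝ≥0∞) (σ : Store) :
    wp D p f σ = f (p.exec σ) := by
  rw [wp, Prog.den_straight hp, expect_pure]

theorem Tri.wp_straight_seq {p q : Prog} (hp : p.straight) {σ : Store} {B : ℕ} {Q : Store → Prop}
    (h : Tri D q (p.exec σ) B Q) (f : Store → ℝ≥0∞) :
    wp D (.seq p q) f σ = wp D q f (p.exec σ) := by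
  rw [Tri.wp_seq (B := p.cost) (B' := B) (Q := Q) (Tri.straight hp le_rfl h), wp_straight hp]

theorem Tri.straight_seq {p q : Prog} (hp : p.straight) {σ : Store} {B : ℕ} {Q : Store → Prop}
    (h : Tri D q (p.exec σ) B Q) : Tri D (.seq p q) σ (p.cost + B + 1) Q :=
  Tri.seq (Tri.straight hp le_rfl h)

/-! ### Random choices and samples -/

theorem wp_flip (x : ℕ) (p : unitInterval) (f : Store → ℝ≥0∞) (σ : Store) :
    wp D (.flip x p) f σ = ENNReal.ofReal p * f (σ.setVar x 1)
      + ENNReal.ofReal (1 - p) * f (σ.setVar x 0) := by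
  rw [wp, (Spec.of_random_step (p := .flip x p) (σ := σ) (μ := (pmfOfReal
    (fun t : Bool => if t then (p : ℝ) else 1 - p)
        (fun t => by cases t <;> simp [p.2.1, p.2.2]) (by simp)).map
        fun t => σ.setVar x (if t then 1 else 0)) ?_).den_eq, expect_map, expect_fintype]
  · simp [pmfOfReal]
  · intro K
    rw [step, PMF.map_comp]
    rfl

theorem Tri.flip {x : ℕ} {p : unitInterval} {σ : Store} {Q : Store → Prop}
    (h : ∀ z, z = 0 ∨ z = 1 → Q (σ.setVar x z)) : Tri D (.flip x p) σ 1 Q := by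
  refine (Spec.of_random_step (p := .flip x p) (σ := σ) (μ := (pmfOfReal
    (fun t : Bool => if t then (p : ℝ) else 1 - p)
        (fun t => by cases t <;> simp [p.2.1, p.2.2]) (by simp)).map
        fun t => σ.setVar x (if t then 1 else 0)) ?_).tri ?_
  · intro K
    rw [step, PMF.map_comp]
    rfl
  · intro τ hτ
    obtain ⟨t, -, rfl⟩ := (PMF.mem_support_map_iff _ _ _).1 hτ
    exact h _ (by cases t <;> simp)

theorem spec_rand {x y : ℕ} {σ : Store} {m : ℕ} (hy : σ.var y = m) :
    Spec D [.rand x y] σ 1 ((PMF.uniformOfFintype (Fin (m + 1))).map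
      fun v : Fin (m + 1) => σ.setVar x ((v : ℕ) : ℤ)) := by
  refine Spec.of_random_step fun K => ?_
  have : (σ.var y).toNat = m := by simp [hy]
  subst this
  rw [step, PMF.map_comp]
  exact PMF.map_comp (fun v : Fin ((σ.var y).toNat + 1) => (v : ℕ))
    (PMF.uniformOfFintype (Fin ((σ.var y).toNat + 1))) fun v : ℕ => (K, σ.setVar x (v : ℤ))

theorem wp_rand {x y : ℕ} {σ : Store} {m : ℕ} (hy : σ.var y = m) (f : Store → ℝ≥0∞) :
    wp D (.rand x y) f σ = ((m + 1 : ℕ) : ℝ≥0∞)⁻¹ * ∑ v : Fin (m + 1), f (σ.setVar x (v : ℕ)) := by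
  rw [wp, (spec_rand hy).den_eq, expect_map, expect_uniform, Fintype.card_fin]

theorem Tri.rand {x y : ℕ} {σ : Store} {m : ℕ} {Q : Store → Prop} (hy : σ.var y = m)
    (h : ∀ v : ℕ, v ≤ m → Q (σ.setVar x v)) : Tri D (.rand x y) σ 1 Q := by
  refine (spec_rand hy).tri fun τ hτ => ?_
  obtain ⟨v, -, rfl⟩ := (PMF.mem_support_map_iff _ _ _).1 hτ
  exact h v (Nat.lt_succ_iff.1 v.2)

theorem spec_skips (l : ℕ) (σ : Store) :
    Spec D (List.replicate l .skip) σ l (PMF.pure σ) := by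
  induction l with
  | zero => exact Spec.nil σ
  | succ l ih =>
    have := (Spec.of_pure_step (D := D) (p := .skip) (l := []) (σ := σ) (fun K => rfl)
      (Spec.nil σ)).append (l' := List.replicate l .skip) (κ := fun _ => PMF.pure σ) (B' := l)
      (by simpa using ih)
    rw [PMF.pure_bind] at this
    exact this.mono (by omega)

theorem spec_sample {a m : ℕ} {σ : Store} (hD : ∀ l ∈ D.support, l.length ≤ m) :
    Spec D [.sample a] σ (m + 1) (D.map fun l => σ.write a l) := by
  have := Spec.of_step (D := D) (p := .sample a) (σ := σ) (B := m)
    (μ := D.map fun l => (List.replicate l.length .skip, σ.write a l))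
    (κ := fun z => PMF.pure z.2) (fun K => by rw [PMF.map_comp]; rfl) (by
      intro z hz
      obtain ⟨l, hl, rfl⟩ := (PMF.mem_support_map_iff _ _ _).1 hz
      exact (spec_skips _ _).mono (hD l hl))
  rwa [PMF.bind_map] at this

theorem Tri.sample {a m : ℕ} {σ : Store} {Q : Store → Prop}
    (hD : ∀ l ∈ D.support, l.length ≤ m) (h : ∀ l ∈ D.support, Q (σ.write a l)) :
    Tri D (.sample a) σ (m + 1) Q := by
  refine (spec_sample hD).tri fun τ hτ => ?_
  obtain ⟨l, hl, rfl⟩ := (PMF.mem_support_map_iff _ _ _).1 hτ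
  exact h l hl

theorem wp_sample {a m : ℕ} {σ : Store} (hD : ∀ l ∈ D.support, l.length ≤ m)
    (f : Store → ℝ≥0∞) : wp D (.sample a) f σ = expect D fun l => f (σ.write a l) := by
  rw [wp, (spec_sample hD).den_eq, expect_map]

/-! ### Counting loops

Variable `1` is reserved for the constant one, variable `9` for the constant zero. -/

/-- For `c = m - 1, …, 0` execute `p`, where `m` is a variable. -/
def forTo (c m : ℕ) (p : Prog) : Prog := .seq (.add c m 9) (.loop c (.seq (.sub c c 1) p))

@[simp] theorem forTo_wv (c m : ℕ) (p : Prog) (y : ℕ) : (forTo c m p).wv y ↔ y = c ∨ p.wv y := by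
  simp [forTo, Prog.wv]

@[simp] theorem forTo_wa (c m : ℕ) (p : Prog) (b : ℕ) : (forTo c m p).wa b ↔ p.wa b := by
  simp [forTo, Prog.wa]

section ForTo

variable {c m : ℕ} {p : Prog} {M B : ℕ} {I : ℕ → Store → Prop} {σ : Store}

/-- The hypotheses of the rules for counting loops. -/
structure ForHyp (D : PMF (List (ℤ × ℤ))) (c m : ℕ) (p : Prog) (M B : ℕ) (I : ℕ → Store → Prop)
    (σ : Store) : Prop where
  bound : σ.var m = M
  one : σ.var 1 = 1
  zero : σ.var 9 = 0
  ne : c ≠ 1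
  counter : ¬ p.wv c
  wone : ¬ p.wv 1
  init : I M (σ.setVar c M)
  body : ∀ i < M, ∀ τ, I (i + 1) τ → τ.var c = (i + 1 : ℕ) → Fr (forTo c m p) σ τ →
    Tri D p (τ.setVar c i) B (I i)

theorem Fr.trans {p : Prog} {σ τ ρ : Store} (h : Fr p σ τ) (h' : Fr p τ ρ) : Fr p σ ρ :=
  ⟨fun y hy => (h'.1 y hy).trans (h.1 y hy), fun b hb => (h'.2 b hb).trans (h.2 b hb)⟩

/-- The counter is decremented before the body runs. The index of the invariant is the number of
rounds that remain, so the body leads from `I (i + 1)` to `I i` while the counter shows `i`. -/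
theorem ForHyp.round (h : ForHyp D c m p M B I σ) {i : ℕ} (hi : i < M) {τ : Store}
    (hI : I (i + 1) τ) (hc : τ.var c = (i + 1 : ℕ)) (hF : Fr (forTo c m p) σ τ) :
    Tri D (.seq (.sub c c 1) p) τ (B + 2)
      (fun τ => I i τ ∧ τ.var c = i ∧ Fr (forTo c m p) σ τ) ∧
    ∀ f, wp D (.seq (.sub c c 1) p) f τ = wp D p f (τ.setVar c i) := by
  have hone : τ.var 1 = 1 := by
    rw [hF.1 1 (by simp [h.wone, h.ne.symm]), h.one]
  have hex : (Prog.sub c c 1).exec τ = τ.setVar c i := by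
    simp only [Prog.exec, hone, hc]
    push_cast
    rw [add_sub_cancel_right]
  have hb := (h.body i hi τ hI hc hF).frame
  have hb' : Tri D p ((Prog.sub c c 1).exec τ) B
      (fun τ => I i τ ∧ τ.var c = i ∧ Fr (forTo c m p) σ τ) := by
    rw [hex]
    refine hb.mono le_rfl fun ρ hρ => ⟨hρ.1, ?_, hF.trans ⟨fun y hy => ?_, fun b hb => ?_⟩⟩
    · rw [hρ.2.1 c h.counter]; simp
    · rw [forTo_wv, not_or] at hy
      rw [hρ.2.1 y hy.2]
      simp [hy.1]
    · rw [forTo_wa] at hb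
      exact hρ.2.2 b hb
  refine ⟨(Tri.straight_seq (p := .sub c c 1) trivial hb').mono (by simp [Prog.cost]; omega) fun _ h => h,
    fun f => ?_⟩
  rw [hb'.wp_straight_seq (p := .sub c c 1) trivial, hex]

theorem ForHyp.start (h : ForHyp D c m p M B I σ) :
    (Prog.add c m 9).exec σ = σ.setVar c M := by
  simp [Prog.exec, h.bound, h.zero]

theorem ForHyp.start_frame (_ : ForHyp D c m p M B I σ) :
    Fr (forTo c m p) σ (σ.setVar c M) := by
  refine ⟨fun y hy => ?_, fun b _ => rfl⟩
  rw [forTo_wv, not_or] at hy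
  simp [hy.1]

theorem ForHyp.loop (h : ForHyp D c m p M B I σ) (i : ℕ) (hi : i ≤ M) (τ : Store) (hI : I i τ)
    (hc : τ.var c = i) (hF : Fr (forTo c m p) σ τ) :
    Tri D (.loop c (.seq (.sub c c 1) p)) τ (i * (B + 3) + 1)
      fun τ => I 0 τ ∧ τ.var c = 0 ∧ Fr (forTo c m p) σ τ := by
  refine (Tri.while (D := D) (x := c) (p := .seq (.sub c c 1) p) (B := B + 2)
    (I := fun i τ => i ≤ M ∧ I i τ ∧ τ.var c = i ∧ Fr (forTo c m p) σ τ) ?_ ?_ i τ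
    ⟨hi, hI, hc, hF⟩).mono le_rfl ?_
  · rintro τ ⟨-, -, hc, -⟩
    simp [hc]
  · rintro j τ ⟨hj, hI, hc, hF⟩ -
    exact (h.round hj hI hc hF).1.mono le_rfl fun _ hτ => ⟨by omega, hτ⟩
  · rintro τ ⟨⟨j, hj, hI, hc, hF⟩, hx⟩
    obtain rfl : j = 0 := by rw [hc] at hx; omega
    exact ⟨hI, by simpa using hc, hF⟩

theorem ForHyp.tri (h : ForHyp D c m p M B I σ) :
    Tri D (forTo c m p) σ (M * (B + 3) + 3)
      fun τ => I 0 τ ∧ τ.var c = 0 ∧ Fr (forTo c m p) σ τ := by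
  have := h.loop M le_rfl (σ.setVar c M) h.init (by simp) h.start_frame
  rw [← h.start] at this
  exact (Tri.straight_seq (p := .add c m 9) trivial this).mono (by simp [Prog.cost]; omega) fun _ h => h

theorem ForHyp.wp_eq_loop (h : ForHyp D c m p M B I σ) (f : Store → ℝ≥0∞) :
    wp D (forTo c m p) f σ = wp D (.loop c (.seq (.sub c c 1) p)) f (σ.setVar c M) := by
  have := h.loop M le_rfl (σ.setVar c M) h.init (by simp) h.start_frame
  rw [← h.start] at this ⊢
  exact this.wp_straight_seq (p := .add c m 9) trivial f

/-- The function `f i` is a potential for `i` remaining rounds. Keeping the relation `r` abstract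
gives upper bounds, lower bounds and equalities by one induction. -/
theorem ForHyp.wp_loop (h : ForHyp D c m p M B I σ) (f : ℕ → Store → ℝ≥0∞)
    (r : ℝ≥0∞ → ℝ≥0∞ → Prop) (hrefl : ∀ a, r a a) (htrans : ∀ a b c, r a b → r b c → r a c)
    (hmono : ∀ (q : Prog) (τ : Store) (B : ℕ) (Q : Store → Prop), Tri D q τ B Q →
      ∀ f g : Store → ℝ≥0∞, (∀ τ, Q τ → r (f τ) (g τ)) → r (wp D q f τ) (wp D q g τ))
    (hf : ∀ i < M, ∀ τ, I (i + 1) τ → τ.var c = (i + 1 : ℕ) → Fr (forTo c m p) σ τ →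
      r (wp D p (f i) (τ.setVar c i)) (f (i + 1) τ)) :
    r (wp D (forTo c m p) (f 0) σ) (f M (σ.setVar c M)) := by
  rw [h.wp_eq_loop]
  suffices H : ∀ i ≤ M, ∀ τ, I i τ → τ.var c = i → Fr (forTo c m p) σ τ →
      r (wp D (.loop c (.seq (.sub c c 1) p)) (f 0) τ) (f i τ) from
    H M le_rfl _ h.init (by simp) h.start_frame
  intro i
  induction i with
  | zero =>
    intro _ τ _ hc _
    rw [wp_loop_stop (by simp [hc])]
    exact hrefl _
  | succ i ih =>
    intro hi τ hI hc hF
    obtain ⟨h1, h2⟩ := h.round hi hI hc hF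
    rw [Tri.wp_loop_step (by rw [hc]; positivity) (h1.mono le_rfl fun τ hτ =>
      h.loop i (by omega) τ hτ.1 hτ.2.1 hτ.2.2)]
    refine htrans _ _ _ (hmono _ _ _ _ h1 _ (f i) fun ρ hρ =>
      ih (by omega) ρ hρ.1 hρ.2.1 hρ.2.2) ?_
    rw [h2]
    exact hf i hi τ hI hc hF

theorem ForHyp.wp_le (h : ForHyp D c m p M B I σ) (f : ℕ → Store → ℝ≥0∞)
    (hf : ∀ i < M, ∀ τ, I (i + 1) τ → τ.var c = (i + 1 : ℕ) → Fr (forTo c m p) σ τ →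
      wp D p (f i) (τ.setVar c i) ≤ f (i + 1) τ) :
    wp D (forTo c m p) (f 0) σ ≤ f M (σ.setVar c M) :=
  h.wp_loop f (· ≤ ·) (fun _ => le_rfl) (fun _ _ _ => le_trans)
    (fun _ _ _ _ ht _ _ hfg => ht.wp_mono hfg) hf

theorem ForHyp.le_wp (h : ForHyp D c m p M B I σ) (f : ℕ → Store → ℝ≥0∞)
    (hf : ∀ i < M, ∀ τ, I (i + 1) τ → τ.var c = (i + 1 : ℕ) → Fr (forTo c m p) σ τ →
      f (i + 1) τ ≤ wp D p (f i) (τ.setVar c i)) :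
    f M (σ.setVar c M) ≤ wp D (forTo c m p) (f 0) σ :=
  h.wp_loop f (· ≥ ·) (fun _ => le_rfl) (fun _ _ _ => ge_trans)
    (fun _ _ _ _ ht _ _ hfg => ht.wp_mono hfg) hf

theorem ForHyp.wp_eq (h : ForHyp D c m p M B I σ) (f : ℕ → Store → ℝ≥0∞)
    (hf : ∀ i < M, ∀ τ, I (i + 1) τ → τ.var c = (i + 1 : ℕ) → Fr (forTo c m p) σ τ →
      wp D p (f i) (τ.setVar c i) = f (i + 1) τ) :
    wp D (forTo c m p) (f 0) σ = f M (σ.setVar c M) :=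
  le_antisymm (h.wp_le f fun i hi τ a b c => (hf i hi τ a b c).le)
    (h.le_wp f fun i hi τ a b c => (hf i hi τ a b c).ge)

end ForTo

/-! ### Complete runs -/

theorem Spec.run {A : Prog} {n B T : ℕ} {ν : PMF Store}
    (h : Spec D [A] ⟨Function.update (fun _ => 0) 0 (n : ℤ), fun _ _ => 0⟩ B ν) (hT : B ≤ T) :
    run A n D T = ν.map (Prod.mk []) := by
  have e := (h [] 0 PMF.pure fun τ _ => by simp [HaltsAt, runFrom, PMF.pure_map]).mono
    (show B + 0 ≤ T from hT)
  rw [PMF.bind_pure] at e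
  exact e

theorem Spec.haltsWithin {A : Prog} {n B T : ℕ} {ν : PMF Store}
    (h : Spec D [A] ⟨Function.update (fun _ => 0) 0 (n : ℤ), fun _ _ => 0⟩ B ν) (hT : B ≤ T) :
    HaltsWithin A n D T := by
  intro C hC
  rw [h.run hT] at hC
  obtain ⟨τ, -, rfl⟩ := (PMF.mem_support_map_iff _ _ _).1 hC
  rfl

theorem Spec.outputProb {A : Prog} {n B T : ℕ} {ν : PMF Store}
    (h : Spec D [A] ⟨Function.update (fun _ => 0) 0 (n : ℤ), fun _ _ => 0⟩ B ν) (hT : B ≤ T)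
    (E : Set Store) : outputProb A n D T E = ν.toOuterMeasure E := by
  rw [_root_.outputProb, h.run hT, PMF.toOuterMeasure_map_apply]
  simp

end

noncomputable section

variable {D : PMF (List (ℤ × ℤ))}

/-! ### Simulating a program with resettable memory

Variable `x` of the simulated program is kept in variable `x + 60`, array `a` in array `2 a + 10`.
Cell `i` of array `2 a + 11` records in which round the cell `i` of array `a` was last written; it
counts as empty unless this is the current round, which is kept in variable `4`. -/

/-- The program `p` with its memory relocated, and samples produced by `gen`. -/
def tr (gen : ℕ → Prog) : Prog → Prog
  | .skip => .skip
  | .const x z => .const (x + 60) z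
  | .add x y z => .add (x + 60) (y + 60) (z + 60)
  | .sub x y z => .sub (x + 60) (y + 60) (z + 60)
  | .load x a y => .seq (.load 50 (2 * a + 11) (y + 60)) (.seq (.sub 50 4 50)
      (.ite 50 (.const (x + 60) 0) (.load (x + 60) (2 * a + 10) (y + 60))))
  | .store a x y => .seq (.store (2 * a + 10) (x + 60) (y + 60)) (.store (2 * a + 11) (x + 60) 4)
  | .flip x p => .flip (x + 60) p
  | .rand x y => .rand (x + 60) (y + 60)
  | .sample a => gen a
  | .seq p q => .seq (tr gen p) (tr gen q)
  | .ite x p q => .ite (x + 60) (tr gen p) (tr gen q)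
  | .loop x p => .loop (x + 60) (tr gen p)

/-- The simulated memory. -/
def Store.decode (σ : Store) : Store where
  var x := σ.var (x + 60)
  arr a i := if σ.arr (2 * a + 11) i = σ.var 4 then σ.arr (2 * a + 10) i else 0

/-- No cell carries a future stamp. -/
def Stamped (σ : Store) : Prop := ∀ a i, σ.arr (2 * a + 11) i ≤ σ.var 4

theorem decode_setVar (σ : Store) (x : ℕ) (z : ℤ) :
    (σ.setVar (x + 60) z).decode = σ.decode.setVar x z := by
  ext a
  · simp [Store.decode]
  · simp [Store.decode]

theorem decode_congr {σ τ : Store} (hv : ∀ y, 60 ≤ y ∨ y = 4 → τ.var y = σ.var y)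
    (ha : ∀ b, 10 ≤ b → τ.arr b = σ.arr b) : τ.decode = σ.decode := by
  ext a i
  · simp [Store.decode, hv]
  · simp [Store.decode, hv, ha]

theorem Spec.cons_of_pure_step {p : Prog} {l l' : List Prog} {σ τ : Store} {B : ℕ}
    {ν : PMF Store} (hs : ∀ K, step D (p :: K, σ) = PMF.pure (l ++ K, τ))
    (h : Spec D (l ++ l') τ B ν) : Spec D (p :: l') σ (B + 1) ν := by
  intro K T ν' hK
  have : B + 1 + T = (B + T) + 1 := by omega
  rw [HaltsAt, this, List.cons_append, runFrom, hs, PMF.pure_bind, ← List.append_assoc]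
  exact h K T ν' hK

theorem runFrom_skips (t r : ℕ) (K : List Prog) (s : Store) :
    runFrom D t (List.replicate (t + r) .skip ++ K, s)
      = PMF.pure (List.replicate r .skip ++ K, s) := by
  induction t with
  | zero => simp [runFrom]
  | succ t ih =>
    rw [Nat.succ_add, List.replicate_succ, List.cons_append, runFrom, step, PMF.pure_bind, ih]

/-- The machine has halted after `T` steps from `C`. -/
def AllHalted (D : PMF (List (ℤ × ℤ))) (T : ℕ) (C : Config) : Prop :=
  ∀ C' ∈ (runFrom D T C).support, C'.1 = []

theorem AllHalted.of_bind {T T' : ℕ} {C : Config} {μ : PMF Store} {F : Store → Config}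
    (h : AllHalted D T C) (e : runFrom D T C = μ.bind fun s => runFrom D T' (F s)) {s : Store}
    (hs : s ∈ μ.support) : AllHalted D T' (F s) := by
  intro C' hC'
  refine h C' ?_
  rw [e]
  exact (PMF.mem_support_bind_iff _ _ _).2 ⟨s, hs, hC'⟩

section Simulation

variable {DA : PMF (List (ℤ × ℤ))} {gen : ℕ → Prog} {G : Store → Prop} {c₀ : ℕ}

/-- The statements `K` are simulated from `σ`, in time `c₀ T`. -/
def Simulates (D DA : PMF (List (ℤ × ℤ))) (gen : ℕ → Prog) (G : Store → Prop) (c₀ T : ℕ)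
    (K : List Prog) (σ : Store) : Prop :=
  ∃ ν, Spec D (K.map (tr gen)) σ (c₀ * T) ν ∧ (∀ τ ∈ ν.support, G τ) ∧
    ν.map Store.decode = (runFrom DA T (K, σ.decode)).map Prod.snd

/-- The number `ℓ` counts the busy steps that follow the statement `p`: only fetching a sample has
`ℓ > 0`. The simulated machine then spends `ℓ + 1` steps on `p`, which pays for `c₀ * (ℓ + 1)` steps
of the simulation. -/
theorem Simulates.cons {p : Prog} {K : List Prog} {σ : Store} {T ℓ B : ℕ} {μ ν₀ : PMF Store}
    (ih : ∀ τ, G τ → AllHalted DA (T - ℓ) (K, τ.decode) → Simulates D DA gen G c₀ (T - ℓ) K τ)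
    (hA : AllHalted DA (T + 1) (p :: K, σ.decode)) (hℓ : ℓ ≤ T)
    (hrun : runFrom DA (T + 1) (p :: K, σ.decode) = μ.bind fun s => runFrom DA (T - ℓ) (K, s))
    (hs : Spec D [tr gen p] σ B ν₀) (hB : B ≤ c₀ * (ℓ + 1)) (hG : ∀ τ ∈ ν₀.support, G τ)
    (hμ : ν₀.map Store.decode = μ) : Simulates D DA gen G c₀ (T + 1) (p :: K) σ := by
  have h : ∀ τ ∈ ν₀.support, Simulates D DA gen G c₀ (T - ℓ) K τ := fun τ hτ =>
    ih τ (hG τ hτ) (hA.of_bind hrun (by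
      rw [← hμ]
      exact (PMF.mem_support_map_iff _ _ _).2 ⟨τ, hτ, rfl⟩))
  choose! κ hκ using h
  refine ⟨ν₀.bind κ, ((hs.append fun τ hτ => (hκ τ hτ).1).mono ?_), ?_, ?_⟩
  · calc B + c₀ * (T - ℓ) ≤ c₀ * (ℓ + 1) + c₀ * (T - ℓ) := by omega
      _ = c₀ * (T + 1) := by rw [← mul_add]; congr 1; omega
  · intro τ hτ
    obtain ⟨ρ, hρ, hτ⟩ := (PMF.mem_support_bind_iff _ _ _).1 hτ
    exact (hκ ρ hρ).2.1 τ hτ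
  · rw [hrun, PMF.map_bind, PMF.map_bind, ← hμ, PMF.bind_map]
    exact expect_congr_fun_support fun τ hτ => (hκ τ hτ).2.2

theorem Simulates.of_step {p : Prog} {K : List Prog} {σ : Store} {T B : ℕ} {μ ν₀ : PMF Store}
    (ih : ∀ τ, G τ → AllHalted DA T (K, τ.decode) → Simulates D DA gen G c₀ T K τ)
    (hA : AllHalted DA (T + 1) (p :: K, σ.decode))
    (hstep : step DA (p :: K, σ.decode) = μ.map fun s => (K, s))
    (hs : Spec D [tr gen p] σ B ν₀) (hB : B ≤ c₀) (hG : ∀ τ ∈ ν₀.support, G τ)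
    (hμ : ν₀.map Store.decode = μ) : Simulates D DA gen G c₀ (T + 1) (p :: K) σ :=
  Simulates.cons (ℓ := 0) ih hA (Nat.zero_le _) (by rw [runFrom, hstep, PMF.bind_map]; rfl) hs
    (by omega) hG hμ

theorem Simulates.of_exec {p : Prog} {K : List Prog} {σ s : Store} {T : ℕ}
    (ih : ∀ τ, G τ → AllHalted DA T (K, τ.decode) → Simulates D DA gen G c₀ T K τ)
    (hA : AllHalted DA (T + 1) (p :: K, σ.decode))
    (hstep : step DA (p :: K, σ.decode) = PMF.pure (K, s))
    (hp : (tr gen p).straight) (hB : (tr gen p).cost ≤ c₀) (hG : G ((tr gen p).exec σ))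
    (hμ : ((tr gen p).exec σ).decode = s) : Simulates D DA gen G c₀ (T + 1) (p :: K) σ :=
  Simulates.of_step (μ := PMF.pure s) ih hA (by rw [hstep, PMF.pure_map])
    ((tr gen p).spec_straight hp σ) hB (by simpa using hG) (by rw [PMF.pure_map, hμ])

/-- The requirements on the invariant `G` and on the sample generator. -/
structure SimHyp (D DA : PMF (List (ℤ × ℤ))) (gen : ℕ → Prog) (G : Store → Prop) (c₀ : ℕ) :
    Prop where
  cost : 10 ≤ c₀
  stamped : ∀ σ, G σ → Stamped σ
  congr : ∀ σ τ, G σ → (∀ y, y < 60 → y ≠ 50 → τ.var y = σ.var y) →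
    (∀ b, b < 10 → τ.arr b = σ.arr b) → Stamped τ → G τ
  gen : ∃ m, (∀ l ∈ DA.support, l.length = m) ∧ ∀ a σ, G σ → ∃ ν,
    Spec D [gen a] σ (c₀ * (m + 1)) ν ∧ (∀ τ ∈ ν.support, G τ) ∧
    ν.map Store.decode = DA.map fun l => σ.decode.write a l

theorem SimHyp.setVar (h : SimHyp D DA gen G c₀) {σ : Store} (hσ : G σ) (x : ℕ) (z : ℤ)
    (hx : 60 ≤ x ∨ x = 50) : G (σ.setVar x z) := by
  refine h.congr σ _ hσ (fun y hy hy' => ?_) (fun _ _ => rfl) fun a i => ?_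
  · rw [Store.setVar_var, if_neg (by omega)]
  · rw [Store.setVar_var, if_neg (by omega)]
    exact h.stamped σ hσ a i

/-- Strong induction on the remaining time of the simulated machine. Each statement is replaced by a
fragment of bounded cost, and control statements are translated homomorphically. A sample of length
`m` advances the simulated time by `m + 1` at once; this is where all samples must have the same
length. -/
theorem simulate (h : SimHyp D DA gen G c₀) (T : ℕ) (K : List Prog) (σ : Store) (hG : G σ)
    (hA : AllHalted DA T (K, σ.decode)) : Simulates D DA gen G c₀ T K σ := by
  have hc := h.cost
  induction T using Nat.strong_induction_on generalizing K σ with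
  | _ T ih =>
  cases K with
  | nil =>
    refine ⟨PMF.pure σ, (Spec.nil σ).mono (Nat.zero_le _), by simpa using hG, ?_⟩
    rw [runFrom_nil, PMF.pure_map, PMF.pure_map]
  | cons p K =>
  cases T with
  | zero => exact absurd (hA (p :: K, σ.decode) (by simp [runFrom])) (by simp)
  | succ T =>
  have ih' := ih T (Nat.lt_succ_self T)
  have ihK := ih' K
  -- control statements
  have hctl : ∀ l : List Prog, (∀ K', step D (tr gen p :: K', σ) = PMF.pure (l.map (tr gen) ++ K', σ))
      → step DA (p :: K, σ.decode) = PMF.pure (l ++ K, σ.decode) →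
      Simulates D DA gen G c₀ (T + 1) (p :: K) σ := by
    intro l hs hsA
    have hrun : runFrom DA (T + 1) (p :: K, σ.decode) = runFrom DA T (l ++ K, σ.decode) := by
      rw [runFrom, hsA, PMF.pure_bind]
    have hA' : AllHalted DA T (l ++ K, σ.decode) := by rwa [AllHalted, ← hrun]
    obtain ⟨ν, h1, h2, h3⟩ := ih' (l ++ K) σ hG hA'
    refine ⟨ν, ?_, h2, by rw [h3, hrun]⟩
    rw [List.map_append] at h1
    exact (Spec.cons_of_pure_step hs h1).mono (by rw [mul_add]; omega)
  cases p with
  | skip => exact hctl [] (fun _ => rfl) rfl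
  | seq p q => exact hctl [p, q] (fun _ => rfl) rfl
  | ite x p q =>
    refine hctl (if 0 < σ.decode.var x then [p] else [q]) (fun K' => ?_) ?_
    · by_cases hx : 0 < σ.var (x + 60) <;> simp [tr, step, Store.decode, hx]
    · by_cases hx : 0 < σ.var (x + 60) <;> simp [step, Store.decode, hx]
  | loop x p =>
    refine hctl (if 0 < σ.decode.var x then [p, .loop x p] else []) (fun K' => ?_) ?_
    · by_cases hx : 0 < σ.var (x + 60) <;> simp [tr, step, Store.decode, hx]
    · by_cases hx : 0 < σ.var (x + 60) <;> simp [step, Store.decode, hx]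
  | const x z =>
    exact Simulates.of_exec ihK hA rfl trivial (by simp [tr, Prog.cost]; omega)
      (h.setVar hG _ _ (by omega)) (decode_setVar _ _ _)
  | add x y z =>
    exact Simulates.of_exec ihK hA rfl trivial (by simp [tr, Prog.cost]; omega)
      (h.setVar hG _ _ (by omega)) (decode_setVar _ _ _)
  | sub x y z =>
    exact Simulates.of_exec ihK hA rfl trivial (by simp [tr, Prog.cost]; omega)
      (h.setVar hG _ _ (by omega)) (decode_setVar _ _ _)
  | load x a y =>
    -- The machine can only test for positivity. As no stamp lies in the future, the current round
    -- minus the stamp is positive exactly for outdated cells.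
    have hst := h.stamped σ hG a (σ.var (y + 60))
    have hdec : ∀ z w, ((σ.setVar 50 z).setVar 50 w).decode = σ.decode := fun z w =>
      decode_congr (fun y hy => by simp; omega) fun _ _ => rfl
    refine Simulates.of_exec ihK hA rfl (by simp [tr, Prog.straight]) (by simp [tr, Prog.cost]; omega) ?_ ?_
    · have h50 := h.setVar (h.setVar hG 50 (σ.arr (2 * a + 11) (σ.var (y + 60))) (by simp)) 50
        (σ.var 4 - σ.arr (2 * a + 11) (σ.var (y + 60))) (by simp)
      simp only [tr, Prog.exec, Store.setVar_var, Store.setVar_arr, if_true,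
        show ¬ (y + 60 = 50) by omega, if_false, show ¬ (4 = 50) by omega]
      split_ifs <;> exact h.setVar h50 _ _ (by omega)
    · simp only [tr, Prog.exec, Store.setVar_var, Store.setVar_arr, if_true,
        show ¬ (y + 60 = 50) by omega, if_false, show ¬ (4 = 50) by omega]
      by_cases hs : σ.arr (2 * a + 11) (σ.var (y + 60)) = σ.var 4
      · rw [if_neg (by omega), decode_setVar, hdec]
        simp [Store.decode, hs]
      · rw [if_pos (by omega), decode_setVar, hdec]
        simp [Store.decode, hs]
  | store a x y =>
    refine Simulates.of_exec ihK hA rfl (by simp [tr, Prog.straight]) (by simp [tr, Prog.cost]; omega) ?_ ?_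
    · refine h.congr σ _ hG (fun _ _ _ => rfl) (fun b hb => ?_) fun b i => ?_
      · simp only [tr, Prog.exec]
        rw [Store.setArr_arr_of_ne _ _ _ (by omega), Store.setArr_arr_of_ne _ _ _ (by omega)]
      · have := h.stamped σ hG b i
        simp only [tr, Prog.exec, Store.setArr_arr, Store.setArr_var]
        split_ifs <;> omega
    · ext b i
      · simp [tr, Prog.exec, Store.decode]
      · simp only [tr, Prog.exec, Store.decode, Store.setArr_arr, Store.setArr_var]
        by_cases hb : b = a
        · subst hb
          by_cases hi : i = σ.var (x + 60)
          · simp [hi]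
          · simp [hi]
        · simp only [show ¬ (2 * b + 11 = 2 * a + 11) by omega, show ¬ (2 * b + 10 = 2 * a + 10) by omega,
            show ¬ (2 * b + 11 = 2 * a + 10) by omega, show ¬ (2 * b + 10 = 2 * a + 11) by omega, hb,
            false_and, if_false]
  | flip x p =>
    refine Simulates.of_step (ν₀ := (pmfOfReal (fun t : Bool => if t then (p : ℝ) else 1 - p)
        (fun t => by cases t <;> simp [p.2.1, p.2.2]) (by simp)).map
        fun t => σ.setVar (x + 60) (if t then 1 else 0)) (B := 1) ihK hA (p := .flip x p) ?_
        (Spec.of_random_step fun K => by rw [PMF.map_comp]; rfl) (by omega) ?_ rfl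
    · rw [PMF.map_comp, PMF.map_comp]
      simp only [Function.comp_def, decode_setVar]
      rfl
    · intro τ hτ
      obtain ⟨t, -, rfl⟩ := (PMF.mem_support_map_iff _ _ _).1 hτ
      exact h.setVar hG _ _ (by omega)
  | rand x y =>
    refine Simulates.of_step (p := .rand x y)
      (ν₀ := (PMF.uniformOfFintype (Fin ((σ.var (y + 60)).toNat + 1))).map
        fun v : Fin _ => σ.setVar (x + 60) ((v : ℕ) : ℤ)) (B := 1) ihK hA ?_
        (Spec.of_random_step fun K => ?_) (by omega) ?_ rfl
    · rw [PMF.map_comp, PMF.map_comp]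
      simp only [Function.comp_def, decode_setVar]
      exact PMF.map_comp (fun v : Fin _ => (v : ℕ)) _ fun v : ℕ => (K, σ.decode.setVar x (v : ℤ))
    · rw [PMF.map_comp]
      exact PMF.map_comp (fun v : Fin _ => (v : ℕ)) _ fun v : ℕ => (K, σ.setVar (x + 60) (v : ℤ))
    · intro τ hτ
      obtain ⟨t, -, rfl⟩ := (PMF.mem_support_map_iff _ _ _).1 hτ
      exact h.setVar hG _ _ (by omega)
  | sample a =>
    obtain ⟨m, hm, hgen⟩ := h.gen
    obtain ⟨ν, h1, h2, h3⟩ := hgen a σ hG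
    have hrun : runFrom DA (T + 1) (.sample a :: K, σ.decode) = DA.bind fun l =>
        runFrom DA T (List.replicate m .skip ++ K, σ.decode.write a l) := by
      rw [runFrom, step, PMF.bind_map]
      refine expect_congr_fun_support fun l hl => ?_
      rw [Function.comp_apply, hm l hl]
    -- If there were less time, the machine would stop in the middle of the `m` idle steps, with
    -- statements left to execute, which contradicts halting.
    have hmT : m ≤ T := by
      by_contra hlt
      obtain ⟨l, hl⟩ := DA.support_nonempty
      obtain ⟨r, rfl⟩ := Nat.exists_eq_add_of_lt (not_le.1 hlt)
      have := hA (List.replicate (r + 1) .skip ++ K, σ.decode.write a l) (by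
        rw [hrun]
        refine (PMF.mem_support_bind_iff _ _ _).2 ⟨l, hl, ?_⟩
        rw [add_assoc, runFrom_skips]
        simp)
      simp at this
    refine Simulates.cons (ℓ := m) (fun τ => ih (T - m) (by omega) K τ) hA hmT ?_ h1 le_rfl h2 h3
    rw [hrun, PMF.bind_map]
    congr 1
    funext l
    obtain ⟨r, rfl⟩ := Nat.exists_eq_add_of_le hmT
    rw [runFrom_add]
    have := runFrom_skips (D := DA) m 0 K (σ.decode.write a l)
    rw [add_zero] at this
    rw [this, PMF.pure_bind, Nat.add_sub_cancel_left]
    rfl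

end Simulation

end

noncomputable section

/-! ### Averaging over spins -/

section Averaging

variable {ι κ : Type*} [Fintype ι] [DecidableEq ι]

theorem sum_eq_sum_average (v : ι) (G : (ι → ℤˣ) → ℝ) :
    ∑ x, G x = ∑ x, 2⁻¹ * (G (Function.update x v 1) + G (Function.update x v (-1))) := by
  have inv : Function.Involutive fun x : ι → ℤˣ => Function.update x v (-x v) := by
    intro x
    simp
  have h := Equiv.sum_comp inv.toPerm G
  have h2 : ∑ x, G x = ∑ x, 2⁻¹ * (G x + G (Function.update x v (-x v))) := by
    rw [← Finset.mul_sum, Finset.sum_add_distrib]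
    simp only [Function.Involutive.coe_toPerm] at h
    rw [h]
    ring
  rw [h2]
  refine Finset.sum_congr rfl fun x _ => ?_
  rcases Int.units_eq_one_or (x v) with hx | hx
  · rw [hx, ← hx, Function.update_eq_self, hx]
  · have : Function.update x v (-1) = x := by rw [← hx, Function.update_eq_self]
    rw [hx, this, neg_neg, add_comm]

/-- The spins at the distinct sites `u i` are averaged one at a time; each of them enters only its
own factor. This rule sums out the centres and the links of the gadgets and also normalises the
product of parities. -/
theorem sum_prod_average (I : Finset κ) (u : κ → ι)
    (hu : ∀ i ∈ I, ∀ j ∈ I, u i = u j → i = j) (φ : κ → ℤˣ → (ι → ℤˣ) → ℝ)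
    (hφ : ∀ i ∈ I, ∀ j ∈ I, ∀ s t x, φ i s (Function.update x (u j) t) = φ i s x)
    (F : (ι → ℤˣ) → ℝ) (hF : ∀ j ∈ I, ∀ t x, F (Function.update x (u j) t) = F x) :
    ∑ x, F x * ∏ i ∈ I, φ i (x (u i)) x = ∑ x, F x * ∏ i ∈ I, 2⁻¹ * (φ i 1 x + φ i (-1) x) := by
  classical
  induction I using Finset.induction_on generalizing F with
  | empty => simp
  | insert a I ha ih =>
    have hne : ∀ j ∈ I, u a ≠ u j := fun j hj h =>
      ha (hu a (by simp) j (by simp [hj]) h ▸ hj)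
    have h1 := ih (fun i hi j hj => hu i (by simp [hi]) j (by simp [hj]))
      (fun i hi j hj => hφ i (by simp [hi]) j (by simp [hj]))
      (fun x => F x * φ a (x (u a)) x) (fun j hj t x => by
        rw [hF j (by simp [hj]), hφ a (by simp) j (by simp [hj]), Function.update_of_ne (hne j hj)])
    simp only [Finset.prod_insert ha, ← mul_assoc] at h1 ⊢
    rw [h1, sum_eq_sum_average (u a)]
    refine Finset.sum_congr rfl fun x _ => ?_
    have h2 : ∀ t, ∏ i ∈ I, 2⁻¹ * (φ i 1 (Function.update x (u a) t)
        + φ i (-1) (Function.update x (u a) t)) = ∏ i ∈ I, 2⁻¹ * (φ i 1 x + φ i (-1) x) := fun t =>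
      Finset.prod_congr rfl fun i hi => by
        rw [hφ i (by simp [hi]) a (by simp), hφ i (by simp [hi]) a (by simp)]
    simp only [h2, hF a (by simp), hφ a (by simp) a (by simp), Function.update_self]
    ring

/-- The value of a spin as a real number. -/
def sgn (s : ℤˣ) : ℝ := ((s : ℤ) : ℝ)

@[simp] theorem sgn_one : sgn 1 = 1 := by simp [sgn]

@[simp] theorem sgn_neg (s : ℤˣ) : sgn (-s) = -sgn s := by simp [sgn]

theorem sgn_cases (s : ℤˣ) : sgn s = 1 ∨ sgn s = -1 := by
  rcases Int.units_eq_one_or s with h | h <;> simp [h]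

theorem abs_prod_sgn (T : Finset κ) (y : κ → ℤˣ) : |∏ i ∈ T, sgn (y i)| = 1 := by
  rw [Finset.abs_prod]
  exact Finset.prod_eq_one fun i _ => by rcases sgn_cases (y i) with h | h <;> simp [h]

end Averaging

/-! ### Realising products of noisy parities as a censored field -/

/-- The signs of the couplings of the four centres of a gadget with its four terminals. -/
def gsign (q a : Fin 4) : ℝ := if a = q then -1 else 1

/-- Changing the sign of one term turns the sum of four spins with product `1` into `±2` for every
`q`, which gives `cosh(2b)^4`. If the product is `-1`, one spin is the odd one out: its own `q`
gives `±4` and the other three give `0`, so the product is `cosh(4b)`. The two values are the mean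
times `1 ± δ_b`, because `cosh(4b) = cosh(2b)^4 - sinh(2b)^4`. -/
theorem gadget_identity (b : ℝ) (t : Fin 4 → ℤˣ) :
    ∏ q, Real.cosh (b * ∑ a, gsign q a * sgn (t a))
      = (Real.cosh (4 * b) + Real.cosh (2 * b) ^ 4) / 2 * (1 + delta b * ∏ a, sgn (t a)) := by
  have h4 : Real.cosh (4 * b) = Real.cosh (2 * b) ^ 4 - Real.sinh (2 * b) ^ 4 := by
    rw [show 4 * b = 2 * (2 * b) by ring, Real.cosh_two_mul]
    have := Real.cosh_sq (2 * b)
    nlinarith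
  have hpos := sinh_pow_four_lt (2 * b)
  have h0 : 0 ≤ Real.sinh (2 * b) ^ 4 := by positivity
  have hδ : (2 * Real.cosh (2 * b) ^ 4 - Real.sinh (2 * b) ^ 4) * delta b = Real.sinh (2 * b) ^ 4 := by
    rw [delta, mul_div_cancel₀]
    linarith
  have hp : (Real.cosh (4 * b) + Real.cosh (2 * b) ^ 4) / 2 * (1 + delta b)
      = Real.cosh (2 * b) ^ 4 := by
    rw [h4]; linear_combination (1 / 2 : ℝ) * hδ
  have hm : (Real.cosh (4 * b) + Real.cosh (2 * b) ^ 4) / 2 * (1 + -delta b)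
      = Real.cosh (4 * b) := by
    rw [h4]; linear_combination (-1 / 2 : ℝ) * hδ
  have e2 : b * 2 = 2 * b := by ring
  have e4 : b * 4 = 4 * b := by ring
  have n2 : b * -2 = -(2 * b) := by ring
  have n4 : b * -4 = -(4 * b) := by ring
  simp only [Fin.prod_univ_four, Fin.sum_univ_four, gsign]
  rcases sgn_cases (t 0) with h | h <;> rcases sgn_cases (t 1) with h' | h' <;>
    rcases sgn_cases (t 2) with h'' | h'' <;> rcases sgn_cases (t 3) with h''' | h''' <;>
    simp only [h, h', h'', h''', Fin.reduceEq, if_true, if_false] <;> norm_num [e2, e4, n2, n4, Real.cosh_neg, hp, hm] <;> ring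

section Gadget

set_option linter.unusedSectionVars false

variable {N k : ℕ} {J : Type*} [Fintype J] [DecidableEq J] {V : Finset (Fin N)}
  (sv : J → ℕ → V) (hid : J × (Fin k × Fin 4 ⊕ Fin k) → Fin N)

/-- The `g`-th link of the chain of gadgets of `j`; the first and the last one are visible. -/
def linkV (j : J) (g : ℕ) : Fin N :=
  if g = 0 then sv j 0 else if h : g < k then hid (j, .inr ⟨g, h⟩) else sv j (2 * k + 1)

/-- The terminals of the `g`-th gadget of `j`. -/
def term (e : J × Fin k) : Fin 4 → Fin N :=
  ![linkV sv hid e.1 e.2, sv e.1 (2 * e.2 + 1), sv e.1 (2 * e.2 + 2), linkV sv hid e.1 (e.2 + 1)]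

/-- The centres of a gadget. -/
def ctr (e : J × Fin k) (q : Fin 4) : Fin N := hid (e.1, .inl (e.2, q))

/-- The couplings, oriented from centres to terminals. -/
def halfWeights (b : ℝ) : Matrix (Fin N) (Fin N) ℝ := fun v w =>
  ∑ e : J × Fin k, ∑ q, ∑ a, if v = ctr hid e q ∧ w = term sv hid e a then b * gsign q a else 0

/-- The couplings of the chains of gadgets. -/
def gadgetWeights (b : ℝ) : Matrix (Fin N) (Fin N) ℝ := fun v w =>
  halfWeights sv hid b v w + halfWeights sv hid b w v

/-- The visible spins of the chains and the hidden spins are pairwise distinct. -/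
structure GadgetHyp : Prop where
  pos : 0 < k
  sv_inj : ∀ j j' l l', l < 2 * k + 2 → l' < 2 * k + 2 → sv j l = sv j' l' → j = j' ∧ l = l'
  hid_inj : Function.Injective hid
  hid_not_mem : ∀ h, hid h ∉ V

variable {sv hid}

theorem GadgetHyp.sv_ne (h : GadgetHyp sv hid) (j : J) (l : ℕ) (e) : (sv j l : Fin N) ≠ hid e :=
  fun he => h.hid_not_mem e (he ▸ (sv j l).2)

theorem GadgetHyp.link_cases (h : GadgetHyp sv hid) {j : J} {g : ℕ} (hg : g ≤ k) :
    (g = 0 ∧ linkV sv hid j g = sv j 0) ∨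
    (∃ hk : g < k, 0 < g ∧ linkV sv hid j g = hid (j, .inr ⟨g, hk⟩)) ∨
    (g = k ∧ linkV sv hid j g = sv j (2 * k + 1)) := by
  have := h.pos
  rcases Nat.eq_zero_or_pos g with h0 | h0
  · exact .inl ⟨h0, by simp [linkV, h0]⟩
  · rcases Nat.lt_or_ge g k with hk | hk
    · exact .inr (.inl ⟨hk, h0, by simp [linkV, h0.ne', hk]⟩)
    · obtain rfl : g = k := by omega
      exact .inr (.inr ⟨rfl, by simp [linkV, h0.ne']⟩)

theorem GadgetHyp.link_inj (h : GadgetHyp sv hid) {j j' : J} {g g' : ℕ} (hg : g ≤ k) (hg' : g' ≤ k)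
    (he : linkV sv hid j g = linkV sv hid j' g') : j = j' ∧ g = g' := by
  have := h.pos
  rcases h.link_cases (j := j) hg with ⟨h1, h2⟩ | ⟨hk, h1, h2⟩ | ⟨h1, h2⟩ <;>
  rcases h.link_cases (j := j') hg' with ⟨h3, h4⟩ | ⟨hk', h3, h4⟩ | ⟨h3, h4⟩ <;>
  rw [h2, h4] at he
  · exact ⟨(h.sv_inj _ _ _ _ (by omega) (by omega) (Subtype.ext he)).1, by omega⟩
  · exact absurd he (h.sv_ne _ _ _)
  · have := (h.sv_inj _ _ _ _ (by omega) (by omega) (Subtype.ext he)).2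
    omega
  · exact absurd he.symm (h.sv_ne _ _ _)
  · have := h.hid_inj he
    simp only [Prod.mk.injEq, Sum.inr.injEq, Fin.mk.injEq] at this
    exact this
  · exact absurd he.symm (h.sv_ne _ _ _)
  · have := (h.sv_inj _ _ _ _ (by omega) (by omega) (Subtype.ext he)).2
    omega
  · exact absurd he (h.sv_ne _ _ _)
  · exact ⟨(h.sv_inj _ _ _ _ (by omega) (by omega) (Subtype.ext he)).1, by omega⟩

theorem GadgetHyp.sv_ne_link (h : GadgetHyp sv hid) {j j' : J} {l g : ℕ} (hl : 0 < l)
    (hl' : l < 2 * k + 1) (hg : g ≤ k) : (sv j l : Fin N) ≠ linkV sv hid j' g := by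
  intro he
  rcases h.link_cases (j := j') hg with ⟨h3, h4⟩ | ⟨hk', h3, h4⟩ | ⟨h3, h4⟩ <;> rw [h4] at he
  · have := (h.sv_inj _ _ _ _ (by omega) (by omega) (Subtype.ext he)).2
    omega
  · exact absurd he (h.sv_ne _ _ _)
  · have := (h.sv_inj _ _ _ _ (by omega) (by omega) (Subtype.ext he)).2
    omega

theorem GadgetHyp.link_ne_ctr (h : GadgetHyp sv hid) {j : J} {g : ℕ} (hg : g ≤ k) (e : J × Fin k)
    (q : Fin 4) : linkV sv hid j g ≠ ctr hid e q := by
  intro he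
  rcases h.link_cases (j := j) hg with ⟨h3, h4⟩ | ⟨hk', h3, h4⟩ | ⟨h3, h4⟩ <;> rw [h4, ctr] at he
  · exact absurd he (h.sv_ne _ _ _)
  · have := h.hid_inj he
    simp at this
  · exact absurd he (h.sv_ne _ _ _)

theorem GadgetHyp.term_ne_ctr (h : GadgetHyp sv hid) (e e' : J × Fin k) (a q : Fin 4) :
    term sv hid e a ≠ ctr hid e' q := by
  fin_cases a
  · exact h.link_ne_ctr e.2.2.le _ _
  · exact h.sv_ne _ _ _
  · exact h.sv_ne _ _ _
  · exact h.link_ne_ctr (Nat.succ_le_of_lt e.2.2) _ _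

theorem GadgetHyp.ctr_inj (h : GadgetHyp sv hid) {e e' : J × Fin k} {q q' : Fin 4}
    (he : ctr hid e q = ctr hid e' q') : e = e' ∧ q = q' := by
  have := h.hid_inj he
  simp only [Prod.mk.injEq, Sum.inl.injEq] at this
  exact ⟨Prod.ext this.1 this.2.1, this.2.2⟩

theorem GadgetHyp.term_inj (h : GadgetHyp sv hid) (e : J × Fin k) :
    Function.Injective (term sv hid e) := by
  have := e.2.2
  have h1 : ∀ l g, 0 < l → l < 2 * k + 1 → g ≤ k → (sv e.1 l : Fin N) ≠ linkV sv hid e.1 g :=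
    fun l g a b c => h.sv_ne_link a b c
  have h2 : sv e.1 (2 * e.2 + 1) ≠ sv e.1 (2 * e.2 + 2) := fun he => by
    have := (h.sv_inj _ _ _ _ (by omega) (by omega) he).2
    omega
  have h3 : linkV sv hid e.1 e.2 ≠ linkV sv hid e.1 (e.2 + 1) := fun he => by
    have := (h.link_inj (by omega) (by omega) he).2
    omega
  have a1 := h1 (2 * e.2 + 1) e.2 (by omega) (by omega) (by omega)
  have a2 := h1 (2 * e.2 + 2) e.2 (by omega) (by omega) (by omega)
  have a3 := h1 (2 * e.2 + 1) (e.2 + 1) (by omega) (by omega) (by omega)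
  have a4 := h1 (2 * e.2 + 2) (e.2 + 1) (by omega) (by omega) (by omega)
  intro a a' haa
  fin_cases a <;> fin_cases a' <;> simp [term] at haa ⊢ <;>
    first | exact absurd haa (by assumption) | exact absurd haa.symm (by assumption)

theorem GadgetHyp.term_cases (h : GadgetHyp sv hid) (e : J × Fin k) (a : Fin 4) :
    (∃ l, 0 < l ∧ l < 2 * k + 1 ∧ (l - 1) / 2 = e.2 ∧ term sv hid e a = sv e.1 l) ∨
    ∃ g ≤ k, (g = e.2 ∨ g = e.2 + 1) ∧ term sv hid e a = linkV sv hid e.1 g := by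
  have := e.2.2
  have := h.pos
  fin_cases a
  · exact .inr ⟨e.2, by omega, .inl rfl, rfl⟩
  · exact .inl ⟨2 * e.2 + 1, by omega, by omega, by omega, rfl⟩
  · exact .inl ⟨2 * e.2 + 2, by omega, by omega, by omega, rfl⟩
  · exact .inr ⟨e.2 + 1, by omega, .inr rfl, rfl⟩

/-- A vertex belongs to at most two gadgets as a terminal. -/
theorem GadgetHyp.card_gadgets (h : GadgetHyp sv hid) (v : Fin N) :
    (Finset.univ.filter fun e : J × Fin k => ∃ a, term sv hid e a = v).card ≤ 2 := by
  rcases (Finset.univ.filter fun e : J × Fin k => ∃ a, term sv hid e a = v).eq_empty_or_nonempty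
    with h0 | ⟨e₀, h0⟩
  · rw [h0]; simp
  -- Link `g` is the first terminal of gadget `g` and the last one of gadget `g - 1`; an inner
  -- visible spin belongs to a single gadget. Truncated subtraction at `g = 0` does no harm.
  suffices H : ∃ g : ℕ, ∀ e a, term sv hid e a = v →
      e.1 = e₀.1 ∧ ((e.2 : ℕ) = g ∨ (e.2 : ℕ) = g - 1) by
    obtain ⟨g, hg⟩ := H
    refine le_trans (Finset.card_le_card_of_injOn (t := {g, g - 1}) (fun e => (e.2 : ℕ)) ?_ ?_)
      Finset.card_le_two
    · intro e he
      obtain ⟨a, ha⟩ := (Finset.mem_filter.1 he).2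
      simpa using (hg e a ha).2
    · intro e he e' he' hee
      obtain ⟨a, ha⟩ := (Finset.mem_filter.1 he).2
      obtain ⟨a', ha'⟩ := (Finset.mem_filter.1 he').2
      exact Prod.ext ((hg e a ha).1.trans (hg e' a' ha').1.symm) (Fin.ext hee)
  obtain ⟨a₀, ha₀⟩ := (Finset.mem_filter.1 h0).2
  rcases h.term_cases e₀ a₀ with ⟨l, hl, hl', hle, hv⟩ | ⟨g, hg, hge, hv⟩
  · refine ⟨(l - 1) / 2, fun e a ha => ?_⟩
    rw [← ha₀, hv] at ha
    rcases h.term_cases e a with ⟨l', hl2, hl2', hle', hv'⟩ | ⟨g, hg, hge, hv'⟩ <;> rw [hv'] at ha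
    · obtain ⟨h1, rfl⟩ := h.sv_inj _ _ _ _ (by omega) (by omega) (Subtype.ext ha)
      exact ⟨h1, by omega⟩
    · exact absurd ha.symm (h.sv_ne_link hl hl' hg)
  · refine ⟨g, fun e a ha => ?_⟩
    rw [← ha₀, hv] at ha
    rcases h.term_cases e a with ⟨l', hl2, hl2', hle', hv'⟩ | ⟨g', hg', hge', hv'⟩ <;> rw [hv'] at ha
    · exact absurd ha (h.sv_ne_link hl2 hl2' hg)
    · obtain ⟨h1, rfl⟩ := h.link_inj hg' hg ha
      exact ⟨h1, by omega⟩

theorem GadgetHyp.halfWeights_eq (h : GadgetHyp sv hid) (b : ℝ) (e : J × Fin k) (q a : Fin 4) :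
    halfWeights sv hid b (ctr hid e q) (term sv hid e a) = b * gsign q a := by
  rw [halfWeights, Finset.sum_eq_single e, Finset.sum_eq_single q, Finset.sum_eq_single a]
  · simp
  · intro a' _ ha'
    rw [if_neg]
    exact fun hh => ha' (h.term_inj e hh.2).symm
  · simp
  · intro q' _ hq'
    refine Finset.sum_eq_zero fun a' _ => if_neg fun hh => hq' (h.ctr_inj hh.1).2.symm
  · simp
  · intro e' _ he'
    refine Finset.sum_eq_zero fun q' _ => Finset.sum_eq_zero fun a' _ => if_neg fun hh =>
      he' (h.ctr_inj hh.1).1.symm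
  · simp

theorem halfWeights_ne_zero {b : ℝ} {v w : Fin N} (hne : halfWeights sv hid b v w ≠ 0) :
    ∃ e q a, v = ctr hid e q ∧ w = term sv hid e a := by
  by_contra hcon
  push Not at hcon
  refine hne (Finset.sum_eq_zero fun e _ => Finset.sum_eq_zero fun q _ =>
    Finset.sum_eq_zero fun a _ => if_neg fun hh => hcon e q a hh.1 hh.2)

/-- A centre has its four terminals as neighbours. A terminal belongs to at most two gadgets with
four centres each, which is where `8 ≤ d` comes from. No vertex is both a centre and a terminal, so
the two orientations in `gadgetWeights` never add up on one pair. -/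
theorem GadgetHyp.isAdmissible (h : GadgetHyp sv hid) {b : ℝ} (hb : 0 < b) {d : ℕ} (hd : 8 ≤ d) :
    IsAdmissible b d (gadgetWeights sv hid b) 0 where
  symm v w := add_comm _ _
  diag v := by
    have : halfWeights sv hid b v v = 0 := by
      by_contra hne
      obtain ⟨e, q, a, h1, h2⟩ := halfWeights_ne_zero hne
      exact h.term_ne_ctr e e a q (h2.symm.trans h1)
    simp [gadgetWeights, this]
  bias v := by simpa using hb.le
  weight v w := by
    have key : ∀ v w, halfWeights sv hid b v w ≠ 0 →
        |halfWeights sv hid b v w| ≤ b ∧ halfWeights sv hid b w v = 0 := by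
      intro v w hne
      obtain ⟨e, q, a, rfl, rfl⟩ := halfWeights_ne_zero hne
      refine ⟨?_, ?_⟩
      · rw [h.halfWeights_eq, abs_mul, abs_of_pos hb, gsign]
        split_ifs <;> simp
      · by_contra hne'
        obtain ⟨e', q', a', h1, h2⟩ := halfWeights_ne_zero hne'
        exact h.term_ne_ctr _ _ _ _ h1
    rw [gadgetWeights]
    by_cases h1 : halfWeights sv hid b v w = 0
    · by_cases h2 : halfWeights sv hid b w v = 0
      · simpa [h1, h2] using hb.le
      · simpa [h1] using (key w v h2).1
    · rw [(key v w h1).2, add_zero]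
      exact (key v w h1).1
  degree v := by
    classical
    refine le_trans ?_ hd
    by_cases hv : ∃ e q, v = ctr hid e q
    · obtain ⟨e, q, rfl⟩ := hv
      have hsub : {w | gadgetWeights sv hid b (ctr hid e q) w ≠ 0}
          ⊆ ((Finset.univ.image (term sv hid e) : Finset (Fin N)) : Set (Fin N)) := by
        intro w hw
        have h0 : halfWeights sv hid b w (ctr hid e q) = 0 := by
          by_contra hne
          obtain ⟨e', q', a', h1, h2⟩ := halfWeights_ne_zero hne
          exact h.term_ne_ctr _ _ _ _ h2.symm
        simp only [gadgetWeights, h0, add_zero, Set.mem_ofPred_eq] at hw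
        obtain ⟨e', q', a', h1, h2⟩ := halfWeights_ne_zero hw
        obtain ⟨rfl, -⟩ := h.ctr_inj h1
        simp [h2]
      refine (Set.ncard_le_ncard hsub (Finset.finite_toSet _)).trans ?_
      rw [Set.ncard_coe_finset]
      exact (Finset.card_image_le).trans (by simp)
    · have hsub : {w | gadgetWeights sv hid b v w ≠ 0} ⊆
          (((Finset.univ.filter fun e : J × Fin k => ∃ a, term sv hid e a = v) ×ˢ
            (Finset.univ : Finset (Fin 4))).image fun z => ctr hid z.1 z.2 : Finset (Fin N)) := by
        intro w hw
        have h0 : halfWeights sv hid b v w = 0 := by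
          by_contra hne
          obtain ⟨e', q', a', h1, h2⟩ := halfWeights_ne_zero hne
          exact hv ⟨e', q', h1⟩
        simp only [gadgetWeights, h0, zero_add, Set.mem_ofPred_eq] at hw
        obtain ⟨e', q', a', h1, h2⟩ := halfWeights_ne_zero hw
        simp only [Finset.coe_image, Set.mem_image, Finset.mem_coe, Finset.mem_product,
          Finset.mem_filter, Finset.mem_univ, true_and, and_true]
        exact ⟨(e', q'), ⟨a', h2.symm⟩, h1.symm⟩
      refine (Set.ncard_le_ncard hsub (Finset.finite_toSet _)).trans ?_
      rw [Set.ncard_coe_finset]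
      refine (Finset.card_image_le).trans ?_
      rw [Finset.card_product]
      have := h.card_gadgets v
      simp only [Finset.card_univ, Fintype.card_fin]
      omega

/-- The factor `1/2` of the quadratic form cancels the symmetrisation of the oriented couplings, and
the weight splits into one factor for each centre. -/
theorem gadget_energy (b : ℝ) (x : Fin N → ℤˣ) :
    isingWeight (gadgetWeights sv hid b) 0 x = ∏ z : (J × Fin k) × Fin 4,
      Real.exp (b * (sgn (x (ctr hid z.1 z.2)) * ∑ a, gsign z.2 a * sgn (x (term sv hid z.1 a)))) := by
  rw [isingWeight, ← Real.exp_sum, zero_dotProduct, zero_add]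
  congr 1
  have h1 : ∀ s : Fin N → ℝ, s ⬝ᵥ (gadgetWeights sv hid b *ᵥ s)
      = 2 * ∑ v, ∑ w, s v * s w * halfWeights sv hid b v w := by
    intro s
    have e1 : s ⬝ᵥ (gadgetWeights sv hid b *ᵥ s)
        = ∑ v, ∑ w, (s v * s w * halfWeights sv hid b v w + s v * s w * halfWeights sv hid b w v) := by
      simp only [dotProduct, mulVec, gadgetWeights, Finset.mul_sum]
      refine Finset.sum_congr rfl fun v _ => Finset.sum_congr rfl fun w _ => by ring
    have e2 : ∑ v, ∑ w, s v * s w * halfWeights sv hid b w v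
        = ∑ v, ∑ w, s v * s w * halfWeights sv hid b v w := by
      rw [Finset.sum_comm]
      refine Finset.sum_congr rfl fun v _ => Finset.sum_congr rfl fun w _ => by ring
    rw [e1]
    simp only [Finset.sum_add_distrib]
    rw [e2]
    ring
  have h2 : ∀ s : Fin N → ℝ, ∑ v, ∑ w, s v * s w * halfWeights sv hid b v w
      = ∑ e, ∑ q, ∑ a, s (ctr hid e q) * s (term sv hid e a) * (b * gsign q a) := by
    intro s
    simp only [halfWeights, Finset.mul_sum]
    have : ∀ v : Fin N, ∑ w, ∑ e : J × Fin k, ∑ q, ∑ a,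
        s v * s w * (if v = ctr hid e q ∧ w = term sv hid e a then b * gsign q a else 0)
        = ∑ e : J × Fin k, ∑ q, ∑ a, if v = ctr hid e q then
          s v * s (term sv hid e a) * (b * gsign q a) else 0 := by
      intro v
      rw [Finset.sum_comm]
      refine Finset.sum_congr rfl fun e _ => ?_
      rw [Finset.sum_comm]
      refine Finset.sum_congr rfl fun q _ => ?_
      rw [Finset.sum_comm]
      refine Finset.sum_congr rfl fun a _ => ?_
      rw [Finset.sum_eq_single (term sv hid e a)]
      · simp
      · intro w _ hw
        simp [hw]
      · simp
    simp only [this]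
    rw [Finset.sum_comm]
    refine Finset.sum_congr rfl fun e _ => ?_
    rw [Finset.sum_comm]
    refine Finset.sum_congr rfl fun q _ => ?_
    rw [Finset.sum_comm]
    refine Finset.sum_congr rfl fun a _ => ?_
    simp
  rw [h1, h2, ← mul_assoc, show (1 / 2 : ℝ) * 2 = 1 by norm_num, one_mul]
  refine Eq.trans ?_ (Fintype.sum_prod_type _).symm
  refine Finset.sum_congr rfl fun e _ => Finset.sum_congr rfl fun q _ => ?_
  rw [Finset.mul_sum, Finset.mul_sum]
  refine Finset.sum_congr rfl fun a _ => ?_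
  simp only [spinVec, sgn]
  ring

/-- The product of the spins at the first `m` gadgets of the chain of `j`. -/
def chainProd (sv : J → ℕ → V) (x : Fin N → ℤˣ) (j : J) (m : ℕ) : ℝ :=
  sgn (x (sv j 0)) * ∏ g ∈ Finset.range m,
    (sgn (x (sv j (2 * g + 1))) * sgn (x (sv j (2 * g + 2))))

theorem chainProd_eq (x : Fin N → ℤˣ) (j : J) (m : ℕ) :
    chainProd sv x j m = ∏ l ∈ Finset.range (2 * m + 1), sgn (x (sv j l)) := by
  induction m with
  | zero => simp [chainProd]
  | succ m ih =>
    rw [show 2 * (m + 1) + 1 = 2 * m + 1 + 1 + 1 by ring, Finset.prod_range_succ,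
      Finset.prod_range_succ, ← ih, chainProd, chainProd, Finset.prod_range_succ]
    ring

/-- The product of the spins at the terminals of the `g`-th gadget of `j`. -/
def gadgetProd (sv : J → ℕ → V) (hid : J × (Fin k × Fin 4 ⊕ Fin k) → Fin N) (x : Fin N → ℤˣ)
    (j : J) (g : ℕ) : ℝ :=
  sgn (x (linkV sv hid j g)) * (sgn (x (sv j (2 * g + 1))) * sgn (x (sv j (2 * g + 2))))
    * sgn (x (linkV sv hid j (g + 1)))

theorem GadgetHyp.update_link (h : GadgetHyp sv hid) {j j' : J} {g m : ℕ} (hg : g ≤ k) (hm : m < k)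
    (hne : g ≠ m) (x : Fin N → ℤˣ) (t : ℤˣ) :
    Function.update x (linkV sv hid j' m) t (linkV sv hid j g) = x (linkV sv hid j g) :=
  Function.update_of_ne (fun he => hne (h.link_inj hg hm.le he).2) _ _

theorem GadgetHyp.update_sv (h : GadgetHyp sv hid) {j j' : J} {l m : ℕ} (hm : m < k)
    (hm0 : 0 < m) (x : Fin N → ℤˣ) (t : ℤˣ) :
    Function.update x (linkV sv hid j' m) t (sv j l) = x (sv j l) := by
  refine Function.update_of_ne (fun he => ?_) _ _
  rw [linkV, if_neg hm0.ne', dif_pos hm] at he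
  exact h.sv_ne _ _ _ he

/-- The inner links are summed out one after the other, simultaneously in all chains. Averaging `(1
+ δ s A)(1 + δ^(m+1) C s)` over the spin `s` of a link leaves `1 + δ^(m+2) A C`: the linear terms
vanish and the amplitudes multiply. -/
theorem GadgetHyp.sum_chain (h : GadgetHyp sv hid) (δ : ℝ) (F : (Fin N → ℤˣ) → ℝ)
    (hF : ∀ e t x, F (Function.update x (hid e) t) = F x) (m : ℕ) (hm : m + 1 ≤ k) :
    ∑ x, F x * ∏ j, ∏ g ∈ Finset.range k, (1 + δ * gadgetProd sv hid x j g)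
      = ∑ x, F x * ((∏ j, ∏ g ∈ Finset.Ico (m + 1) k, (1 + δ * gadgetProd sv hid x j g))
        * ∏ j, (1 + δ ^ (m + 1) * chainProd sv x j (m + 1) * sgn (x (linkV sv hid j (m + 1))))) := by
  induction m with
  | zero =>
    refine Finset.sum_congr rfl fun x _ => ?_
    congr 1
    rw [← Finset.prod_mul_distrib]
    refine Finset.prod_congr rfl fun j _ => ?_
    rw [Finset.range_eq_Ico, Finset.prod_eq_prod_Ico_succ_bot (by omega), mul_comm]
    congr 2
    simp [gadgetProd, chainProd, linkV]
    ring
  | succ m ih =>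
    rw [ih (by omega)]
    have hm0 : 0 < m + 1 := by omega
    have hmk : m + 1 < k := hm
    have hlink : ∀ j, linkV sv hid j (m + 1) = hid (j, .inr ⟨m + 1, hmk⟩) := fun j => by
      simp [linkV, hmk]
    have hgad : ∀ x j j' t, ∀ g ∈ Finset.Ico (m + 2) k,
        gadgetProd sv hid (Function.update x (linkV sv hid j' (m + 1)) t) j g
          = gadgetProd sv hid x j g := by
      intro x j j' t g hg
      rw [Finset.mem_Ico] at hg
      simp only [gadgetProd]
      rw [h.update_link (by omega) hmk (by omega), h.update_link (by omega) hmk (by omega),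
        h.update_sv hmk hm0, h.update_sv hmk hm0]
    have hav := sum_prod_average Finset.univ (fun j => linkV sv hid j (m + 1))
      (fun i _ j _ hij => (h.link_inj hmk.le hmk.le hij).1)
      (fun j s x => (1 + δ * (s * (sgn (x (sv j (2 * (m + 1) + 1))) *
          sgn (x (sv j (2 * (m + 1) + 2)))) * sgn (x (linkV sv hid j (m + 2))))) *
        (1 + δ ^ (m + 1) * chainProd sv x j (m + 1) * sgn s))
      (fun i _ j _ s t x => by
        simp only [chainProd]
        rw [h.update_link (by omega) hmk (by omega)]
        simp only [h.update_sv hmk hm0])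
      (fun x => F x * ∏ j, ∏ g ∈ Finset.Ico (m + 2) k, (1 + δ * gadgetProd sv hid x j g))
      (fun j _ t x => by
        rw [hlink, hF, ← hlink]
        congr 1
        refine Finset.prod_congr rfl fun i _ => Finset.prod_congr rfl fun g hg => ?_
        rw [hgad x i j t g hg])
    refine Eq.trans ?_ (hav.trans ?_)
    · refine Finset.sum_congr rfl fun x _ => ?_
      rw [mul_assoc]
      congr 1
      rw [← Finset.prod_mul_distrib, ← Finset.prod_mul_distrib]
      refine Finset.prod_congr rfl fun j _ => ?_
      rw [Finset.prod_eq_prod_Ico_succ_bot (by omega)]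
      simp only [gadgetProd, sgn]
      ring
    · refine Finset.sum_congr rfl fun x _ => ?_
      rw [mul_assoc]
      congr 2
      refine Finset.prod_congr rfl fun j _ => ?_
      have hc : chainProd sv x j (m + 1 + 1) = chainProd sv x j (m + 1) *
          (sgn (x (sv j (2 * (m + 1) + 1))) * sgn (x (sv j (2 * (m + 1) + 2)))) := by
        rw [chainProd, chainProd, Finset.prod_range_succ]
        ring
      rw [hc]
      simp [sgn]
      ring

end Gadget

end

noncomputable section

section Gadget

set_option linter.unusedSectionVars false

variable {N k : ℕ} {J : Type*} [Fintype J] [DecidableEq J] {V : Finset (Fin N)}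
  {sv : J → ℕ → V} {hid : J × (Fin k × Fin 4 ⊕ Fin k) → Fin N}

/-- The density, up to normalisation, of a product of noisy parities. -/
def parityDensity (δ : ℝ) (k : ℕ) (sv : J → ℕ → V) (y : V → ℤˣ) : ℝ :=
  ∏ j, (1 + δ ^ k * ∏ l ∈ Finset.range (2 * k + 2), sgn (y (sv j l)))

/-- For a fixed visible configuration, averaging over the centres turns exponentials into hyperbolic
cosines, hence into gadget factors, and averaging over the links contracts each chain to one parity.
The indicator of the visible configuration does not see hidden spins, as both averages require. -/
theorem GadgetHyp.sum_weight (h : GadgetHyp sv hid) (b : ℝ) (y : V → ℤˣ) :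
    ∑ x : Fin N → ℤˣ, (if (fun i : V => x i) = y then 1 else 0) *
        isingWeight (gadgetWeights sv hid b) 0 x
      = ((Real.cosh (4 * b) + Real.cosh (2 * b) ^ 4) / 2) ^ (Fintype.card J * k) *
        parityDensity (delta b) k sv y * ∑ x : Fin N → ℤˣ, (if (fun i : V => x i) = y then 1 else 0) := by
  have hk := h.pos
  set F : (Fin N → ℤˣ) → ℝ := fun x => if (fun i : V => x i) = y then 1 else 0 with hF
  have hFu : ∀ e t x, F (Function.update x (hid e) t) = F x := by
    intro e t x
    have : (fun i : V => Function.update x (hid e) t i) = fun i : V => x i := by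
      funext i
      exact Function.update_of_ne (fun he : (i : Fin N) = hid e => h.hid_not_mem e (he ▸ i.2)) _ _
    simp only [hF, this]
  set A : (J × Fin k) × Fin 4 → (Fin N → ℤˣ) → ℝ := fun z x =>
    ∑ a, gsign z.2 a * sgn (x (term sv hid z.1 a)) with hA
  have hAu : ∀ (z z' : (J × Fin k) × Fin 4) t x, A z (Function.update x (ctr hid z'.1 z'.2) t) = A z x := by
    intro z z' t x
    refine Finset.sum_congr rfl fun a _ => ?_
    rw [Function.update_of_ne (h.term_ne_ctr _ _ _ _)]
  have h1 := sum_prod_average Finset.univ (fun z : (J × Fin k) × Fin 4 => ctr hid z.1 z.2)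
    (fun z _ z' _ hz => Prod.ext (h.ctr_inj hz).1 (h.ctr_inj hz).2)
    (fun z s x => Real.exp (b * (sgn s * A z x)))
    (fun z _ z' _ s t x => by rw [hAu]) F (fun z _ t x => hFu _ t x)
  have h2 : ∀ x, ∏ z, 2⁻¹ * (Real.exp (b * (sgn 1 * A z x)) + Real.exp (b * (sgn (-1) * A z x)))
      = ((Real.cosh (4 * b) + Real.cosh (2 * b) ^ 4) / 2) ^ (Fintype.card J * k) *
        ∏ j, ∏ g ∈ Finset.range k, (1 + delta b * gadgetProd sv hid x j g) := by
    intro x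
    have e1 : ∀ z, 2⁻¹ * (Real.exp (b * (sgn 1 * A z x)) + Real.exp (b * (sgn (-1) * A z x)))
        = Real.cosh (b * A z x) := by
      intro z
      rw [Real.cosh_eq, sgn_neg, sgn_one, one_mul, show b * (-1 * A z x) = -(b * A z x) by ring]
      ring
    rw [Finset.prod_congr rfl fun z _ => e1 z, Fintype.prod_prod_type]
    have e2 : ∀ e : J × Fin k, ∏ q, Real.cosh (b * A (e, q) x)
        = (Real.cosh (4 * b) + Real.cosh (2 * b) ^ 4) / 2 *
          (1 + delta b * gadgetProd sv hid x e.1 e.2) := by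
      intro e
      simp only [hA]
      rw [gadget_identity b fun a => x (term sv hid e a), Fin.prod_univ_four]
      simp only [gadgetProd, term]
      simp
      ring_nf
      simp
    rw [Finset.prod_congr rfl fun e _ => e2 e, Finset.prod_mul_distrib, Finset.prod_const,
      Finset.card_univ, Fintype.card_prod, Fintype.card_fin]
    congr 1
    rw [Fintype.prod_prod_type]
    refine Finset.prod_congr rfl fun j _ => ?_
    exact (Finset.prod_range fun g => 1 + delta b * gadgetProd sv hid x j g).symm
  -- With `m = k - 1` no gadget is left over, and the remaining link is the visible end of the
  -- chain.
  have h3 := h.sum_chain (delta b) F hFu (k - 1) (by omega)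
  simp only [gadget_energy]
  rw [h1]
  simp only [h2]
  have h4 : ∀ x, F x * (((Real.cosh (4 * b) + Real.cosh (2 * b) ^ 4) / 2) ^ (Fintype.card J * k) *
        ∏ j, ∏ g ∈ Finset.range k, (1 + delta b * gadgetProd sv hid x j g))
      = ((Real.cosh (4 * b) + Real.cosh (2 * b) ^ 4) / 2) ^ (Fintype.card J * k) *
        (F x * ∏ j, ∏ g ∈ Finset.range k, (1 + delta b * gadgetProd sv hid x j g)) := fun x => by ring
  rw [Finset.sum_congr rfl fun x _ => h4 x, ← Finset.mul_sum, h3, mul_assoc]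
  congr 1
  rw [Finset.mul_sum]
  refine Finset.sum_congr rfl fun x _ => ?_
  by_cases hx : (fun i : V => x i) = y
  · have hF1 : F x = 1 := by simp [hF, hx]
    rw [if_pos hx, hF1, one_mul, mul_one, Nat.sub_add_cancel h.pos, Finset.Ico_self, parityDensity]
    simp only [Finset.prod_empty, Finset.prod_const_one, one_mul]
    refine Finset.prod_congr rfl fun j _ => ?_
    rw [chainProd_eq, linkV, if_neg hk.ne', dif_neg (lt_irrefl k), Finset.prod_range_succ _ (2 * k + 1),
      mul_assoc]
    simp [← hx]
  · have hF0 : F x = 0 := by simp [hF, hx]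
    rw [if_neg hx, hF0]
    ring

/-- Multiplication by an extension of `y` is a bijection between the extensions of `1` and those of
`y`. -/
theorem sum_restrict_eq (y : V → ℤˣ) :
    ∑ x : Fin N → ℤˣ, (if (fun i : V => x i) = y then (1 : ℝ) else 0)
      = ∑ x : Fin N → ℤˣ, if (fun i : V => x i) = 1 then (1 : ℝ) else 0 := by
  classical
  set z : Fin N → ℤˣ := fun i => if h : i ∈ V then y ⟨i, h⟩ else 1 with hz
  rw [← Equiv.sum_comp (Equiv.mulLeft z)]
  refine Finset.sum_congr rfl fun x _ => ?_
  congr 1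
  have : (fun i : V => (Equiv.mulLeft z) x i) = y * fun i : V => x i := by
    funext i
    simp [hz]
  rw [this]
  simp

theorem cmrf_apply (M : Matrix (Fin N) (Fin N) ℝ) (θ : Fin N → ℝ) (y : V → ℤˣ) :
    cmrf V M θ y = ENNReal.ofReal ((∑ x : Fin N → ℤˣ, (if (fun i : V => x i) = y then 1 else 0) *
      isingWeight M θ x) / partitionFunction M θ) := by
  rw [cmrf, PMF.map_apply, tsum_fintype, Finset.sum_div, ENNReal.ofReal_sum_of_nonneg]
  · refine Finset.sum_congr rfl fun x _ => ?_
    by_cases hx : (fun i : V => x i) = y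
    · simp [hx, ising, pmfOfReal]
    · simp [hx, Ne.symm hx]
  · intro x _
    have := (partitionFunction_pos M θ).le
    have h2 : 0 ≤ isingWeight M θ x := (Real.exp_pos _).le
    positivity

/-- Averaging over the first spin of each block removes its parity and leaves the factor `1`. -/
theorem sum_parityDensity (δ : ℝ) (hk : 0 < k)
    (hsv : ∀ j j' l l', l < 2 * k + 2 → l' < 2 * k + 2 → sv j l = sv j' l' → j = j' ∧ l = l') :
    ∑ y, parityDensity δ k sv y = 2 ^ V.card := by
  have := sum_prod_average (ι := V) Finset.univ (fun j : J => sv j 0)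
    (fun i _ j _ hij => (hsv _ _ _ _ (by omega) (by omega) hij).1)
    (fun j s y => 1 + δ ^ k * (sgn s * ∏ l ∈ Finset.range (2 * k + 1), sgn (y (sv j (l + 1)))))
    (fun i _ j _ s t y => by
      congr 3
      refine Finset.prod_congr rfl fun l hl => ?_
      rw [Finset.mem_range] at hl
      rw [Function.update_of_ne]
      intro he
      have := (hsv _ _ _ _ (by omega) (by omega) he).2
      omega) (fun _ => 1) (fun _ _ _ _ => rfl)
  have h1 : ∀ y, parityDensity δ k sv y = 1 * ∏ j : J, (1 + δ ^ k * (sgn (y (sv j 0)) *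
      ∏ l ∈ Finset.range (2 * k + 1), sgn (y (sv j (l + 1))))) := by
    intro y
    rw [one_mul, parityDensity]
    refine Finset.prod_congr rfl fun j _ => ?_
    rw [Finset.prod_range_succ']
    ring
  rw [Finset.sum_congr rfl fun y _ => h1 y, this]
  have h2 : ∀ y : V → ℤˣ, ∏ j : J, 2⁻¹ *
      ((1 + δ ^ k * (sgn 1 * ∏ l ∈ Finset.range (2 * k + 1), sgn (y (sv j (l + 1)))))
      + (1 + δ ^ k * (sgn (-1) * ∏ l ∈ Finset.range (2 * k + 1), sgn (y (sv j (l + 1)))))) = 1 := by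
    intro y
    refine Finset.prod_eq_one fun j _ => ?_
    rw [sgn_neg, sgn_one]
    ring
  simp only [h2]
  simp

theorem one_add_mul_prod_nonneg {ι : Type*} {δ : ℝ} (h0 : 0 ≤ δ) (h1 : δ ≤ 1) (T : Finset ι)
    (y : ι → ℤˣ) : 0 ≤ 1 + δ * ∏ i ∈ T, sgn (y i) := by
  have := abs_prod_sgn T y
  rcases abs_eq (by norm_num) |>.1 this with h | h <;> rw [h] <;> linarith

theorem parityDensity_nonneg {δ : ℝ} (h0 : 0 ≤ δ) (h1 : δ ≤ 1) (y : V → ℤˣ) :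
    0 ≤ parityDensity δ k sv y :=
  Finset.prod_nonneg fun j _ =>
    one_add_mul_prod_nonneg (pow_nonneg h0 k) (pow_le_one₀ h0 h1) _ fun l => y (sv j l)

/-- A product of noisy parities is a censored Markov random field. -/
theorem GadgetHyp.cmrf_eq (h : GadgetHyp sv hid) (b : ℝ) (y : V → ℤˣ) :
    cmrf V (gadgetWeights sv hid b) 0 y
      = ENNReal.ofReal ((2 : ℝ)⁻¹ ^ V.card * parityDensity (delta b) k sv y) := by
  set κ : ℝ := ((Real.cosh (4 * b) + Real.cosh (2 * b) ^ 4) / 2) ^ (Fintype.card J * k) *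
    (∑ x : Fin N → ℤˣ, if (fun i : V => x i) = 1 then (1 : ℝ) else 0) /
    partitionFunction (gadgetWeights sv hid b) 0 with hκ
  have hy : ∀ y, cmrf V (gadgetWeights sv hid b) 0 y
      = ENNReal.ofReal (κ * parityDensity (delta b) k sv y) := by
    intro y
    rw [cmrf_apply, h.sum_weight, sum_restrict_eq, hκ]
    congr 1
    ring
  have hκ0 : 0 ≤ κ := by
    have h1 := (partitionFunction_pos (gadgetWeights sv hid b) 0).le
    have h2 : 0 ≤ ∑ x : Fin N → ℤˣ, if (fun i : V => x i) = 1 then (1 : ℝ) else 0 :=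
      Finset.sum_nonneg fun x _ => by positivity
    have h3 := (Real.cosh_pos (4 * b)).le
    positivity
  -- The constant `κ` need not be evaluated: the law is proportional to the density, whose total
  -- mass is known.
  have hsum : ∑ y, cmrf V (gadgetWeights sv hid b) 0 y = 1 := by
    rw [← tsum_fintype (L := .unconditional _)]
    exact PMF.tsum_coe _
  have hδ0 := delta_nonneg b
  have hδ1 := delta_le_one b
  rw [Finset.sum_congr rfl fun y _ => hy y, ← ENNReal.ofReal_sum_of_nonneg (fun y _ =>
    mul_nonneg hκ0 (parityDensity_nonneg hδ0 hδ1 y)), ← Finset.mul_sum,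
    sum_parityDensity _ h.pos h.sv_inj, ENNReal.ofReal_eq_one] at hsum
  rw [hy]
  congr 2
  rw [inv_pow]
  exact eq_inv_of_mul_eq_one_left hsum

end Gadget

end

noncomputable section

/-! ### Decay of correlations at high temperature -/

theorem abs_sigmoid_sub_le (u v : ℝ) : |Real.sigmoid u - Real.sigmoid v| ≤ 1 / 4 * |u - v| := by
  have h := Convex.norm_image_sub_le_of_norm_hasDerivWithin_le (f := Real.sigmoid)
    (f' := fun x => Real.sigmoid x * (1 - Real.sigmoid x)) (s := Set.univ) (C := 1 / 4) (x := v)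
    (y := u) (fun x _ => (Real.hasDerivAt_sigmoid x).hasDerivWithinAt) (fun x _ => ?_) convex_univ
    (Set.mem_univ _) (Set.mem_univ _)
  · simpa [Real.norm_eq_abs] using h
  · have h0 := Real.sigmoid_nonneg x
    have h1 := Real.sigmoid_le_one x
    rw [Real.norm_eq_abs, abs_of_nonneg (mul_nonneg h0 (by linarith))]
    nlinarith [sq_nonneg (Real.sigmoid x - 1 / 2)]

section Decay

variable {N : ℕ} (M : Matrix (Fin N) (Fin N) ℝ) (θ : Fin N → ℝ)

/-- The expectation with respect to an Ising model. -/
def mean (f : (Fin N → ℤˣ) → ℝ) : ℝ :=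
  (∑ x, isingWeight M θ x * f x) / partitionFunction M θ

theorem mean_add (f g : (Fin N → ℤˣ) → ℝ) : mean M θ (fun x => f x + g x) = mean M θ f + mean M θ g := by
  simp only [mean, mul_add, Finset.sum_add_distrib, add_div]

theorem mean_const_mul (c : ℝ) (f : (Fin N → ℤˣ) → ℝ) :
    mean M θ (fun x => c * f x) = c * mean M θ f := by
  simp only [mean, mul_left_comm _ c, ← Finset.mul_sum, mul_div_assoc]

theorem mean_const (c : ℝ) : mean M θ (fun _ => c) = c := by
  rw [mean, ← Finset.sum_mul, mul_comm, mul_div_assoc]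
  exact (congrArg _ (div_self (partitionFunction_pos M θ).ne')).trans (mul_one c)

theorem mean_mono {f g : (Fin N → ℤˣ) → ℝ} (h : ∀ x, f x ≤ g x) : mean M θ f ≤ mean M θ g := by
  refine div_le_div_of_nonneg_right (Finset.sum_le_sum fun x _ => ?_) (partitionFunction_pos M θ).le
  exact mul_le_mul_of_nonneg_left (h x) (Real.exp_pos _).le

theorem abs_mean_le {f : (Fin N → ℤˣ) → ℝ} {c : ℝ} (h : ∀ x, |f x| ≤ c) : |mean M θ f| ≤ c := by
  rw [abs_le]
  constructor
  · rw [← mean_const M θ (-c)]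
    exact mean_mono M θ fun x => (abs_le.1 (h x)).1
  · rw [← mean_const M θ c]
    exact mean_mono M θ fun x => (abs_le.1 (h x)).2

/-- The product of the spins in `T`. -/
def chi {ι : Type*} (T : Finset ι) (x : ι → ℤˣ) : ℝ := ∏ i ∈ T, sgn (x i)

theorem abs_chi {ι : Type*} (T : Finset ι) (x : ι → ℤˣ) : |chi T x| = 1 := abs_prod_sgn T x

theorem chi_update_of_not_mem {ι : Type*} [DecidableEq ι] {T : Finset ι} {v : ι} (hv : v ∉ T)
    (x : ι → ℤˣ) (s : ℤˣ) : chi T (Function.update x v s) = chi T x :=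
  Finset.prod_congr rfl fun i hi => by
    rw [Function.update_of_ne]
    rintro rfl
    exact hv hi

/-- The covariance of `g` with the product of the spins in `B`. -/
def cov (B : Finset (Fin N)) (g : (Fin N → ℤˣ) → ℝ) : ℝ :=
  mean M θ (fun x => g x * chi B x) - mean M θ g * mean M θ (chi B)

/-- The probability of spin `+1` at `i`, given the other spins. -/
def upProb (i : Fin N) (x : Fin N → ℤˣ) : ℝ :=
  Real.sigmoid (2 * (θ i + ∑ l, M i l * sgn (x l)))

/-- Resampling the spin at `i`. -/
def resample (i : Fin N) (g : (Fin N → ℤˣ) → ℝ) (x : Fin N → ℤˣ) : ℝ :=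
  upProb M θ i x * g (Function.update x i 1) + (1 - upProb M θ i x) * g (Function.update x i (-1))

/-- Flipping the spin at `j` changes `g` by at most `o j`. -/
def HasOsc (g : (Fin N → ℤˣ) → ℝ) (o : Fin N → ℝ) : Prop :=
  ∀ x j, |g (Function.update x j 1) - g (Function.update x j (-1))| ≤ o j

/-- The covariance with the spins in `B` is bounded in terms of oscillations, with weights `a`. -/
def Estimate (B : Finset (Fin N)) (a : Fin N → ℝ) : Prop :=
  ∀ g o, HasOsc g o → |cov M θ B g| ≤ ∑ j, a j * o j

variable {M θ}

theorem HasOsc.abs_sub_le {g : (Fin N → ℤˣ) → ℝ} {o : Fin N → ℝ} (h : HasOsc g o) (x : Fin N → ℤˣ)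
    (j : Fin N) (s t : ℤˣ) : |g (Function.update x j s) - g (Function.update x j t)| ≤ o j := by
  have h0 := (abs_nonneg _).trans (h x j)
  rcases Int.units_eq_one_or s with rfl | rfl <;> rcases Int.units_eq_one_or t with rfl | rfl
  · simpa using h0
  · exact h x j
  · rw [abs_sub_comm]
    exact h x j
  · simpa using h0

theorem HasOsc.abs_sub_le_sum {g : (Fin N → ℤˣ) → ℝ} {o : Fin N → ℝ} (h : HasOsc g o)
    (x y : Fin N → ℤˣ) : |g x - g y| ≤ ∑ j, o j := by
  have key : ∀ s : Finset (Fin N), |g (s.piecewise x y) - g y| ≤ ∑ j ∈ s, o j := by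
    intro s
    induction s using Finset.induction_on with
    | empty => simp
    | insert a s ha ih =>
      rw [Finset.sum_insert ha, Finset.piecewise_insert]
      have h1 := h.abs_sub_le (s.piecewise x y) a (x a) ((s.piecewise x y) a)
      rw [Function.update_eq_self] at h1
      exact (_root_.abs_sub_le _ (g (s.piecewise x y)) _).trans (add_le_add h1 ih)
  have := key Finset.univ
  rwa [Finset.piecewise_univ] at this

/-- Subtracting a value of `g` does not affect the covariance, and the difference is bounded by the
sum of all oscillations. Both terms of the covariance contribute this bound once. -/
theorem estimate_two (B : Finset (Fin N)) : Estimate M θ B fun _ => 2 := by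
  intro g o h
  set x₀ : Fin N → ℤˣ := fun _ => 1
  set g' : (Fin N → ℤˣ) → ℝ := fun x => g x - g x₀ with hg'
  have hg : g = fun x => g' x + g x₀ := by simp [hg']
  have hb : ∀ x, |g' x| ≤ ∑ j, o j := fun x => h.abs_sub_le_sum x x₀
  have e : cov M θ B g = mean M θ (fun x => g' x * chi B x) - mean M θ g' * mean M θ (chi B) := by
    have e1 : (fun x => g x * chi B x) = fun x => g' x * chi B x + g x₀ * chi B x := by
      funext x
      simp only [hg']
      ring
    have e2 : mean M θ g = mean M θ g' + g x₀ := by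
      conv_lhs => rw [hg]
      rw [mean_add, mean_const]
    rw [cov, e1, mean_add, mean_const_mul, e2]
    ring
  rw [e, ← Finset.mul_sum, two_mul]
  refine (abs_sub _ _).trans (add_le_add ?_ ?_)
  · refine abs_mean_le M θ fun x => ?_
    rw [abs_mul, abs_chi, mul_one]
    exact hb x
  · rw [abs_mul]
    have h1 := abs_mean_le M θ hb
    have h2 : |mean M θ (chi B)| ≤ 1 := abs_mean_le M θ fun x => (abs_chi B x).le
    calc _ ≤ (∑ j, o j) * 1 := mul_le_mul h1 h2 (abs_nonneg _) ((abs_nonneg _).trans h1)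
      _ = _ := mul_one _

variable {b : ℝ} {d : ℕ}

theorem IsAdmissible.isingWeight_update (hM : IsAdmissible b d M θ) (i : Fin N) (x : Fin N → ℤˣ) :
    isingWeight M θ (Function.update x i 1) = isingWeight M θ (Function.update x i (-1)) *
      Real.exp (2 * (θ i + ∑ l, M i l * sgn (x l))) := by
  rw [isingWeight, isingWeight, ← Real.exp_add]
  congr 1
  set s := spinVec (Function.update x i (-1)) with hs
  have h1 : spinVec (Function.update x i 1) = s + Pi.single i 2 := by
    funext j
    by_cases hj : j = i
    · subst hj
      simp [hs, spinVec]
      norm_num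
    · simp [hs, spinVec, hj]
  have h2 : ∑ l, M i l * sgn (x l) = ∑ l, M i l * s l := by
    refine Finset.sum_congr rfl fun l _ => ?_
    by_cases hl : l = i
    · subst hl
      rw [hM.diag]
      simp
    · simp [hs, spinVec, hl, sgn]
  have h3 : s ⬝ᵥ (M *ᵥ Pi.single i 2) = 2 * ∑ l, M i l * s l := by
    simp only [dotProduct, mulVec_single, Finset.mul_sum]
    refine Finset.sum_congr rfl fun l _ => ?_
    simp [hM.symm l i]
    ring
  have h4 : Pi.single i (2 : ℝ) ⬝ᵥ (M *ᵥ s) = 2 * ∑ l, M i l * s l := by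
    rw [single_dotProduct]
    rfl
  have h5 : Pi.single i (2 : ℝ) ⬝ᵥ (M *ᵥ Pi.single i 2) = 0 := by
    simp [mulVec_single, hM.diag]
  have h6 : θ ⬝ᵥ Pi.single i (2 : ℝ) = θ i * 2 := by simp
  rw [h1, h2, dotProduct_add, mulVec_add, dotProduct_add, add_dotProduct, add_dotProduct, h3, h4, h5,
    h6]
  ring

theorem IsAdmissible.weight_eq (hM : IsAdmissible b d M θ) (i : Fin N) (x : Fin N → ℤˣ) :
    isingWeight M θ (Function.update x i 1) = upProb M θ i x *
      (isingWeight M θ (Function.update x i 1) + isingWeight M θ (Function.update x i (-1))) := by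
  have h := hM.isingWeight_update i x
  have hp := Real.exp_pos (-(2 * (θ i + ∑ l, M i l * sgn (x l))))
  rw [upProb, Real.sigmoid_def, eq_inv_mul_iff_mul_eq₀ (by positivity), add_mul, one_mul]
  congr 1
  rw [h, mul_left_comm, ← Real.exp_add]
  simp

/-- The Ising measure is invariant under resampling the spin at `i` from its conditional law, also
in the presence of a factor that does not depend on this spin. -/
theorem IsAdmissible.sum_resample (hM : IsAdmissible b d M θ) (i : Fin N)
    (g f : (Fin N → ℤˣ) → ℝ) (hf : ∀ x s, f (Function.update x i s) = f x) :
    mean M θ (fun x => resample M θ i g x * f x) = mean M θ (fun x => g x * f x) := by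
  rw [mean, mean]
  congr 1
  rw [sum_eq_sum_average i, sum_eq_sum_average i fun x => isingWeight M θ x * (g x * f x)]
  refine Finset.sum_congr rfl fun x _ => ?_
  have hu : ∀ s, upProb M θ i (Function.update x i s) = upProb M θ i x := by
    intro s
    rw [upProb, upProb]
    congr 3
    refine Finset.sum_congr rfl fun l _ => ?_
    by_cases hl : l = i
    · subst hl
      rw [hM.diag]
      simp
    · simp [hl]
  have h1 := hM.weight_eq i x
  simp only [resample, hf, hu, Function.update_idem]
  set A := isingWeight M θ (Function.update x i 1)
  set A' := isingWeight M θ (Function.update x i (-1))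
  set p := upProb M θ i x
  have h2 : A' = (1 - p) * (A + A') := by linear_combination -h1
  linear_combination (-(2⁻¹ : ℝ)) * (g (Function.update x i 1) * f x) * h1
    + (-(2⁻¹ : ℝ)) * (g (Function.update x i (-1)) * f x) * h2

theorem IsAdmissible.cov_resample (hM : IsAdmissible b d M θ) {B : Finset (Fin N)} {i : Fin N}
    (hi : i ∉ B) (g : (Fin N → ℤˣ) → ℝ) : cov M θ B (resample M θ i g) = cov M θ B g := by
  rw [cov, cov, hM.sum_resample i g (chi B) fun x s => chi_update_of_not_mem hi x s]
  have := hM.sum_resample i g (fun _ => 1) fun _ _ => rfl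
  simp only [mul_one] at this
  rw [this]

/-- Flipping the spin at `j` changes the argument of the sigmoid by `4 M i j`, and the sigmoid has
Lipschitz constant `1/4`. -/
theorem IsAdmissible.abs_upProb_sub_le (i j : Fin N)
    (x : Fin N → ℤˣ) :
    |upProb M θ i (Function.update x j 1) - upProb M θ i (Function.update x j (-1))| ≤ |M i j| := by
  refine (abs_sigmoid_sub_le _ _).trans ?_
  have : ∑ l, M i l * sgn (Function.update x j 1 l) - ∑ l, M i l * sgn (Function.update x j (-1) l)
      = 2 * M i j := by
    rw [← Finset.sum_sub_distrib, Finset.sum_eq_single j]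
    · simp
      ring
    · intro l _ hl
      simp [hl]
    · simp
  rw [show ∀ t u v : ℝ, 2 * (t + u) - 2 * (t + v) = 2 * (u - v) by intros; ring, this, abs_mul, abs_mul]
  norm_num
  linarith [abs_nonneg (M i j)]

/-- Resampling at `i` removes the dependence on the spin at `i` and hands its oscillation on to the
other sites, damped by `|M i j|`, through the dependence of the conditional probability on them. The
entry at `i` involves `M i i`, which vanishes for admissible parameters. -/
theorem HasOsc.resample {g : (Fin N → ℤˣ) → ℝ} {o : Fin N → ℝ} (h : HasOsc g o) (i : Fin N) :
    HasOsc (resample M θ i g)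
      (Function.update (fun j => o j + |M i j| * o i) i (|M i i| * o i)) := by
  intro x j
  have hp := IsAdmissible.abs_upProb_sub_le (M := M) (θ := θ) i j x
  set p₁ := upProb M θ i (Function.update x j 1) with hp1
  set p₂ := upProb M θ i (Function.update x j (-1)) with hp2
  have h01 : 0 ≤ p₁ := Real.sigmoid_nonneg _
  have h11 : p₁ ≤ 1 := Real.sigmoid_le_one _
  simp only [_root_.resample, ← hp1, ← hp2]
  by_cases hj : j = i
  · subst hj
    simp only [Function.update_idem, Function.update_self]
    have e : p₁ * g (Function.update x j 1) + (1 - p₁) * g (Function.update x j (-1))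
        - (p₂ * g (Function.update x j 1) + (1 - p₂) * g (Function.update x j (-1)))
        = (p₁ - p₂) * (g (Function.update x j 1) - g (Function.update x j (-1))) := by ring
    rw [e, abs_mul]
    exact mul_le_mul hp (h x j) (abs_nonneg _) (abs_nonneg _)
  · rw [Function.update_of_ne hj]
    have c : ∀ s t, Function.update (Function.update x j s) i t
        = Function.update (Function.update x i t) j s := fun s t => Function.update_comm hj s t x
    simp only [c]
    have hA := h (Function.update x i 1) j
    have hB := h (Function.update x i (-1)) j
    have hC := h (Function.update x j (-1)) i
    simp only [c] at hC
    set A₁ := g (Function.update (Function.update x i 1) j 1)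
    set A₂ := g (Function.update (Function.update x i 1) j (-1))
    set B₁ := g (Function.update (Function.update x i (-1)) j 1)
    set B₂ := g (Function.update (Function.update x i (-1)) j (-1))
    have e : p₁ * A₁ + (1 - p₁) * B₁ - (p₂ * A₂ + (1 - p₂) * B₂)
        = p₁ * (A₁ - A₂) + (1 - p₁) * (B₁ - B₂) + (p₁ - p₂) * (A₂ - B₂) := by ring
    rw [e]
    refine (abs_add_three _ _ _).trans ?_
    rw [abs_mul, abs_mul, abs_mul, abs_of_nonneg h01, abs_of_nonneg (sub_nonneg.2 h11)]
    have t1 := mul_le_mul_of_nonneg_left hA h01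
    have t2 := mul_le_mul_of_nonneg_left hB (sub_nonneg.2 h11)
    have t3 := mul_le_mul hp hC (abs_nonneg _) (abs_nonneg _)
    linarith

/-- For `i ∉ B` the covariance is unchanged by resampling at `i`. Applying the known estimate to the
resampled function transposes the transfer of oscillations: the weight at `i` becomes the average of
the others against `|M i j|`. -/
theorem IsAdmissible.estimate_update (hM : IsAdmissible b d M θ) {B : Finset (Fin N)}
    {a : Fin N → ℝ} (ha : Estimate M θ B a) {i : Fin N} (hi : i ∉ B) :
    Estimate M θ B (Function.update a i (∑ j, |M i j| * a j)) := by
  intro g o h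
  rw [← hM.cov_resample hi]
  refine (ha _ _ (h.resample (θ := θ) i)).trans (le_of_eq ?_)
  rw [hM.diag, abs_zero, zero_mul, ← Finset.add_sum_erase _ _ (Finset.mem_univ i),
    ← Finset.add_sum_erase (f := fun j => Function.update a i (∑ j, |M i j| * a j) j * o j) _
      (Finset.mem_univ i), ← Finset.add_sum_erase (f := fun j => |M i j| * a j) _ (Finset.mem_univ i)]
  simp only [Function.update_self, hM.diag, abs_zero, zero_mul, mul_zero, zero_add]
  rw [Finset.sum_mul, ← Finset.sum_add_distrib]
  refine Finset.sum_congr rfl fun j hj => ?_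
  rw [Function.update_of_ne (Finset.ne_of_mem_erase hj), Function.update_of_ne (Finset.ne_of_mem_erase hj)]
  ring

/-- `v` cannot be connected to `B` with fewer than `t` steps. -/
def Far (M : Matrix (Fin N) (Fin N) ℝ) (B : Finset (Fin N)) : ℕ → Fin N → Prop
  | 0, _ => True
  | t + 1, v => v ∉ B ∧ Far M B t v ∧ ∀ u, M v u ≠ 0 → Far M B t u

theorem IsAdmissible.row_sum_le (hM : IsAdmissible b d M θ) (hb : b * d ≤ 1 / 2) (i : Fin N) :
    ∑ j, |M i j| ≤ 1 / 2 := by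
  classical
  have h1 : ∑ j, |M i j| = ∑ j ∈ Finset.univ.filter (fun j => M i j ≠ 0), |M i j| := by
    rw [Finset.sum_filter]
    refine Finset.sum_congr rfl fun j _ => ?_
    by_cases h : M i j = 0 <;> simp [h]
  have hd := hM.degree i
  rw [show {j | M i j ≠ 0} = ((Finset.univ.filter fun j => M i j ≠ 0 : Finset (Fin N)) : Set (Fin N))
    by ext; simp, Set.ncard_coe_finset] at hd
  have hb0 : 0 ≤ b := (abs_nonneg _).trans (hM.bias i)
  rw [h1]
  refine (Finset.sum_le_card_nsmul _ _ b fun j _ => hM.weight i j).trans ?_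
  rw [nsmul_eq_mul]
  have : ((Finset.univ.filter fun j => M i j ≠ 0).card : ℝ) ≤ d := by exact_mod_cast hd
  nlinarith

/-- Dobrushin's argument. One sweep over the sites far from `B` replaces each of their weights by a
combination of the weights of the neighbours, with total mass at most `1/2`. Each sweep thus gains a
factor of two and costs one unit of distance from `B`. -/
theorem IsAdmissible.exists_estimate (hM : IsAdmissible b d M θ) (hb : b * d ≤ 1 / 2)
    (B : Finset (Fin N)) (t : ℕ) :
    ∃ a, Estimate M θ B a ∧ ∀ v, Far M B t v → a v ≤ 2 * 2⁻¹ ^ t := by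
  classical
  induction t with
  | zero => exact ⟨fun _ => 2, estimate_two B, fun v _ => by simp⟩
  | succ t ih =>
    obtain ⟨a, ha, hat⟩ := ih
    -- Sites are updated singly, so the old bound at distance `t` has to survive during the sweep;
    -- the new weights are even smaller.
    have key : ∀ s : Finset (Fin N), (∀ v ∈ s, Far M B (t + 1) v) → ∃ a, Estimate M θ B a ∧
        (∀ v, Far M B t v → a v ≤ 2 * 2⁻¹ ^ t) ∧ ∀ v ∈ s, a v ≤ 2 * 2⁻¹ ^ (t + 1) := by
      intro s
      induction s using Finset.induction_on with
      | empty => exact fun _ => ⟨a, ha, hat, by simp⟩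
      | insert i s _ ih =>
        intro hs
        obtain ⟨a, ha, hat, has⟩ := ih fun v hv => hs v (by simp [hv])
        obtain ⟨hiB, hit, hin⟩ := hs i (by simp)
        have hnew : ∑ j, |M i j| * a j ≤ 2 * 2⁻¹ ^ (t + 1) := by
          calc ∑ j, |M i j| * a j ≤ ∑ j, |M i j| * (2 * 2⁻¹ ^ t) := by
                refine Finset.sum_le_sum fun j _ => ?_
                by_cases hj : M i j = 0
                · simp [hj]
                · exact mul_le_mul_of_nonneg_left (hat j (hin j hj)) (abs_nonneg _)
            _ = (∑ j, |M i j|) * (2 * 2⁻¹ ^ t) := (Finset.sum_mul _ _ _).symm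
            _ ≤ 1 / 2 * (2 * 2⁻¹ ^ t) :=
                mul_le_mul_of_nonneg_right (hM.row_sum_le hb i) (by positivity)
            _ = 2 * 2⁻¹ ^ (t + 1) := by rw [pow_succ]; ring
        have hle : (2 : ℝ) * 2⁻¹ ^ (t + 1) ≤ 2 * 2⁻¹ ^ t := by
          rw [pow_succ]
          have : (0 : ℝ) < 2⁻¹ ^ t := by positivity
          linarith
        refine ⟨_, hM.estimate_update ha hiB, fun v hv => ?_, fun v hv => ?_⟩
        · by_cases hvi : v = i
          · subst hvi
            rw [Function.update_self]
            exact hnew.trans hle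
          · rw [Function.update_of_ne hvi]
            exact hat v hv
        · by_cases hvi : v = i
          · subst hvi
            rw [Function.update_self]
            exact hnew
          · rw [Function.update_of_ne hvi]
            exact has v (Finset.mem_of_mem_insert_of_ne hv hvi)
    obtain ⟨a, ha, -, has⟩ := key (Finset.univ.filter fun v => Far M B (t + 1) v) (by simp)
    exact ⟨a, ha, fun v hv => has v (by simpa using hv)⟩

/-- Correlations of distant sets of spins are small. -/
theorem IsAdmissible.abs_cov_chi_le (hM : IsAdmissible b d M θ) (hb : b * d ≤ 1 / 2)
    {A B : Finset (Fin N)} {t : ℕ} (hA : ∀ v ∈ A, Far M B t v) :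
    |cov M θ B (chi A)| ≤ A.card * (4 * 2⁻¹ ^ t) := by
  classical
  obtain ⟨a, ha, hat⟩ := hM.exists_estimate hb B t
  -- A product of spins oscillates by `2` at its own sites and not at all elsewhere. With the weight
  -- `2 * 2⁻¹ ^ t` this gives the constant `4`.
  refine (ha (chi A) (fun j => if j ∈ A then 2 else 0) fun x j => ?_).trans ?_
  · beta_reduce
    split_ifs with hj
    · refine (abs_sub _ _).trans ?_
      rw [abs_chi, abs_chi]
      norm_num
    · rw [chi_update_of_not_mem hj, chi_update_of_not_mem hj]
      simp
  · simp only [mul_ite, mul_zero]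
    rw [Finset.sum_ite_mem, Finset.univ_inter, ← nsmul_eq_mul]
    refine Finset.sum_le_card_nsmul _ _ _ fun v hv => ?_
    linarith [hat v (hA v hv)]

end Decay

end

noncomputable section

/-! ### Clusters in the learned graph -/

section Reach

variable {N : ℕ} {M : Matrix (Fin N) (Fin N) ℝ}

/-- There is a walk of `t` steps from `v` to `w`; each step follows an edge or stays. -/
def Reach (M : Matrix (Fin N) (Fin N) ℝ) : ℕ → Fin N → Fin N → Prop
  | 0, v, w => v = w
  | t + 1, v, w => ∃ u, (u = v ∨ M v u ≠ 0) ∧ Reach M t u w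

theorem Reach.refl (t : ℕ) (v : Fin N) : Reach M t v v := by
  induction t with
  | zero => rfl
  | succ t ih => exact ⟨v, .inl rfl, ih⟩

theorem Reach.trans {s t : ℕ} {u v w : Fin N} (h : Reach M s u v) (h' : Reach M t v w) :
    Reach M (s + t) u w := by
  induction s generalizing u with
  | zero =>
    obtain rfl : u = v := h
    rwa [zero_add]
  | succ s ih =>
    obtain ⟨x, hx, h⟩ := h
    rw [Nat.succ_add]
    exact ⟨x, hx, ih h⟩

theorem Reach.mono {s t : ℕ} {u v : Fin N} (h : Reach M s u v) (hst : s ≤ t) : Reach M t u v := by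
  obtain ⟨r, rfl⟩ := Nat.exists_eq_add_of_le hst
  exact h.trans (Reach.refl r v)

theorem exists_reach_of_not_far {B : Finset (Fin N)} {t : ℕ} {v : Fin N} (h : ¬ Far M B t v) :
    ∃ w ∈ B, Reach M t v w := by
  induction t generalizing v with
  | zero => exact absurd trivial h
  | succ t ih =>
    simp only [Far, not_and_or, not_not, not_forall] at h
    rcases h with h | h | ⟨u, hu, h⟩
    · exact ⟨v, h, Reach.refl _ _⟩
    · obtain ⟨w, hw, h⟩ := ih h
      exact ⟨w, hw, v, .inl rfl, h⟩
    · obtain ⟨w, hw, h⟩ := ih h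
      exact ⟨w, hw, u, .inr hu, h⟩

/-- The set of elements of `S` reached from `v` within `m R` steps acquires a new element whenever
`m` grows by one, until it is all of `S`. At most `S.card` rounds are needed. -/
theorem reach_of_unsplittable {S : Finset (Fin N)} {R : ℕ}
    (hS : ∀ A ⊆ S, A.Nonempty → (S \ A).Nonempty → ∃ v ∈ A, ¬ Far M (S \ A) R v)
    {v w : Fin N} (hv : v ∈ S) (hw : w ∈ S) : Reach M (S.card * R) v w := by
  classical
  set A : ℕ → Finset (Fin N) := fun m => S.filter fun w => Reach M (m * R) v w with hA
  have hsub : ∀ m, A m ⊆ S := fun m => Finset.filter_subset _ _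
  have hmono : ∀ m, A m ⊆ A (m + 1) := fun m w hw => by
    rw [Finset.mem_filter] at hw ⊢
    exact ⟨hw.1, hw.2.mono (Nat.mul_le_mul_right R (Nat.le_succ m))⟩
  have key : ∀ m, A m = S ∨ m + 1 ≤ (A m).card := by
    intro m
    induction m with
    | zero =>
      right
      exact Finset.card_pos.2 ⟨v, by simp [hA, hv, Reach.refl]⟩
    | succ m ih =>
      rcases ih with ih | ih
      · left
        exact (hsub _).antisymm (ih ▸ hmono m)
      · by_cases hne : (S \ A m).Nonempty
        · right
          obtain ⟨x, hx, hfar⟩ := hS (A m) (hsub m) (Finset.card_pos.1 (by omega)) hne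
          obtain ⟨w, hw, hxw⟩ := exists_reach_of_not_far hfar
          rw [Finset.mem_sdiff] at hw
          have hw' : w ∈ A (m + 1) := by
            rw [Finset.mem_filter]
            refine ⟨hw.1, ?_⟩
            rw [Nat.succ_mul]
            exact (Finset.mem_filter.1 hx).2.trans hxw
          have : A m ⊂ A (m + 1) :=
            (Finset.ssubset_iff_of_subset (hmono m)).2 ⟨w, hw', hw.2⟩
          have := Finset.card_lt_card this
          omega
        · left
          rw [Finset.not_nonempty_iff_eq_empty, Finset.sdiff_eq_empty_iff_subset] at hne
          exact (hsub _).antisymm (hne.trans (hmono m))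
  have hfin : A S.card = S := by
    rcases key S.card with h | h
    · exact h
    · have := Finset.card_le_card (hsub S.card)
      omega
  have := hfin ▸ hw
  rw [hA] at this
  exact (Finset.mem_filter.1 this).2

/-- If all of `A` were far from the rest of `S`, the mean of the full product, which is nearly `δ`,
would differ from the product of two nearly vanishing means by at most `δ/2`. But `δ - δ/8 - δ²/64 >
δ/2`. -/
theorem IsAdmissible.unsplittable {θ : Fin N → ℝ} {b : ℝ} {d : ℕ} (hM : IsAdmissible b d M θ)
    (hb : b * d ≤ 1 / 2) {S : Finset (Fin N)} {R : ℕ} {δ p : ℝ} (hδ : 0 < δ) (hδ1 : δ ≤ 1)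
    (hR : (S.card : ℝ) * (4 * 2⁻¹ ^ R) ≤ δ / 2) (hp : p ≤ δ / 16)
    (hfull : |mean M θ (chi S) - δ| ≤ 2 * p)
    (hpart : ∀ T ⊆ S, T.Nonempty → T ≠ S → |mean M θ (chi T)| ≤ 2 * p)
    (A : Finset (Fin N)) (hAS : A ⊆ S) (hA : A.Nonempty) (hB : (S \ A).Nonempty) :
    ∃ v ∈ A, ¬ Far M (S \ A) R v := by
  by_contra hcon
  push Not at hcon
  have h := hM.abs_cov_chi_le hb hcon
  have hne : A ≠ S := by
    rintro rfl
    simp at hB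
  have hne' : S \ A ≠ S := by
    intro he
    obtain ⟨a, ha⟩ := hA
    have := he ▸ hAS ha
    exact (Finset.mem_sdiff.1 this).2 ha
  have h1 := hpart A hAS hA hne
  have h2 := hpart (S \ A) Finset.sdiff_subset hB hne'
  have hprod : (fun x => chi A x * chi (S \ A) x) = chi S := by
    funext x
    rw [mul_comm]
    exact Finset.prod_sdiff hAS
  rw [cov, hprod] at h
  have hcard : (A.card : ℝ) ≤ S.card := by exact_mod_cast Finset.card_le_card hAS
  have h3 : (A.card : ℝ) * (4 * 2⁻¹ ^ R) ≤ δ / 2 :=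
    (mul_le_mul_of_nonneg_right hcard (by positivity)).trans hR
  have h4 : mean M θ (chi A) * mean M θ (chi (S \ A)) ≤ δ / 8 * (δ / 8) := by
    refine (le_abs_self _).trans ?_
    rw [abs_mul]
    exact mul_le_mul (by linarith) (by linarith) (abs_nonneg _) (by linarith)
  have h5 := (abs_le.1 hfull).1
  have h6 := (abs_le.1 h).2
  nlinarith

end Reach

/-! ### Earth-mover distance and correlations -/

section Transport

/-- The expectation of a real function on a finite type. -/
def realE {α : Type*} [Fintype α] (P : PMF α) (f : α → ℝ) : ℝ := ∑ a, (P a).toReal * f a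

variable {α β : Type*} [Fintype α] [Fintype β]

theorem realE_map (P : PMF α) (g : α → β) (f : β → ℝ) :
    realE (P.map g) f = realE P fun a => f (g a) := by
  classical
  have h : ∀ c, ((P.map g) c).toReal = ∑ a, if c = g a then (P a).toReal else 0 := by
    intro c
    rw [PMF.map_apply, tsum_fintype, ENNReal.toReal_sum]
    · refine Finset.sum_congr rfl fun a _ => ?_
      split_ifs <;> simp
    · intro a _
      split_ifs
      · exact PMF.apply_ne_top _ _
      · simp
  simp only [realE, h, Finset.sum_mul]
  rw [Finset.sum_comm]
  refine Finset.sum_congr rfl fun a _ => ?_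
  simp

theorem realE_sub (P : PMF α) (f g : α → ℝ) :
    realE P f - realE P g = realE P fun a => f a - g a := by
  simp only [realE, ← Finset.sum_sub_distrib, mul_sub]

theorem abs_realE_le (P : PMF α) {f g : α → ℝ} (h : ∀ a, |f a| ≤ g a) : |realE P f| ≤ realE P g := by
  refine (Finset.abs_sum_le_sum_abs _ _).trans (Finset.sum_le_sum fun a _ => ?_)
  rw [abs_mul, abs_of_nonneg ENNReal.toReal_nonneg]
  exact mul_le_mul_of_nonneg_left (h a) ENNReal.toReal_nonneg

theorem realE_cmrf {N : ℕ} (V : Finset (Fin N)) (M : Matrix (Fin N) (Fin N) ℝ) (θ : Fin N → ℝ)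
    (f : (V → ℤˣ) → ℝ) : realE (cmrf V M θ) f = mean M θ fun x => f fun i => x i := by
  classical
  rw [cmrf, realE_map, realE, mean, Finset.sum_div]
  refine Finset.sum_congr rfl fun x _ => ?_
  have h : 0 ≤ isingWeight M θ x / partitionFunction M θ :=
    div_nonneg (Real.exp_pos _).le (partitionFunction_pos M θ).le
  simp only [ising, pmfOfReal, PMF.ofFintype_apply, ENNReal.toReal_ofReal h]
  ring

/-- A transport plan of cost at most `2 x`, if the earth-mover distance is at most `x`. -/
theorem exists_coupling {V : Type*} [Fintype V] [DecidableEq V] {P Q : PMF (V → ℤˣ)} {x : ℝ} (hx : 0 < x)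
    (h : earthMover P Q ≤ ENNReal.ofReal x) :
    ∃ μ : PMF ((V → ℤˣ) × (V → ℤˣ)), μ.map Prod.fst = P ∧ μ.map Prod.snd = Q ∧
      realE μ (fun z => hammingDist z.1 z.2) ≤ 2 * x := by
  classical
  -- The factor two makes the inequality strict, so that a coupling can be chosen without showing
  -- that the infimum is attained.
  have hlt : earthMover P Q < ENNReal.ofReal (2 * x) :=
    h.trans_lt ((ENNReal.ofReal_lt_ofReal_iff (by linarith)).2 (by linarith))
  rw [earthMover, iInf_lt_iff] at hlt
  obtain ⟨μ, hμ⟩ := hlt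
  rw [iInf_lt_iff] at hμ
  obtain ⟨⟨h1, h2⟩, hμ⟩ := hμ
  refine ⟨μ, h1, h2, ?_⟩
  have := hμ.le
  rw [tsum_fintype] at this
  have h3 := ENNReal.toReal_mono ENNReal.ofReal_ne_top this
  rw [ENNReal.toReal_ofReal (by linarith), ENNReal.toReal_sum (fun z _ =>
    ENNReal.mul_ne_top (PMF.apply_ne_top _ _) (ENNReal.natCast_ne_top _))] at h3
  simpa [realE, ENNReal.toReal_mul] using h3

end Transport

/-! ### Correlations of products of noisy parities -/

section Parity

variable {ι : Type*}

theorem chi_mul (T : Finset ι) (z y : ι → ℤˣ) : chi T (z * y) = chi T z * chi T y := by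
  simp only [chi, ← Finset.prod_mul_distrib]
  refine Finset.prod_congr rfl fun i _ => ?_
  simp [sgn]

variable [DecidableEq ι]

/-- The configuration with a single negative spin. -/
def flipAt (u : ι) : ι → ℤˣ := Function.update 1 u (-1)

theorem chi_flipAt (T : Finset ι) (u : ι) : chi T (flipAt u) = if u ∈ T then -1 else 1 := by
  split_ifs with h
  · rw [chi, Finset.prod_eq_single u]
    · simp [flipAt]
    · intro v _ hv
      simp [flipAt, hv]
    · exact fun hu => absurd h hu
  · refine Finset.prod_eq_one fun v hv => ?_
    have : v ≠ u := by
      rintro rfl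
      exact h hv
    simp [flipAt, this]

theorem sum_eq_zero_of_flip [Fintype ι] (z : ι → ℤˣ) (f : (ι → ℤˣ) → ℝ) (h : ∀ y, f (z * y) = -f y) :
    ∑ y, f y = 0 := by
  have h1 := Equiv.sum_comp (Equiv.mulLeft z) f
  simp only [Equiv.coe_mulLeft, h, Finset.sum_neg_distrib] at h1
  linarith

end Parity

/-! ### Correlations inside planted blocks, and clusters in a good hypothesis -/

section Planted

set_option linter.unusedSectionVars false

variable {N k : ℕ} {J : Type*} [Fintype J] [DecidableEq J] {V : Finset (Fin N)} {sv : J → ℕ → V}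
  {δ : ℝ} {P : PMF (V → ℤˣ)}

/-- The support of the `j`-th parity. -/
def block (k : ℕ) (sv : J → ℕ → V) (j : J) : Finset V := (Finset.range (2 * k + 2)).image (sv j)

/-- The distribution `P` is a product of parities with noise on disjoint supports. -/
structure PlantedHyp (δ : ℝ) (k : ℕ) (sv : J → ℕ → V) (P : PMF (V → ℤˣ)) : Prop where
  pos : 0 < k
  inj : ∀ j j' l l', l < 2 * k + 2 → l' < 2 * k + 2 → sv j l = sv j' l' → j = j' ∧ l = l'
  nonneg : 0 ≤ δ
  le_one : δ ≤ 1
  law : ∀ y, P y = ENNReal.ofReal ((2 : ℝ)⁻¹ ^ V.card * parityDensity δ k sv y)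

theorem PlantedHyp.density_eq (h : PlantedHyp δ k sv P) (y : V → ℤˣ) :
    parityDensity δ k sv y = ∏ j, (1 + δ ^ k * chi (block k sv j) y) := by
  refine Finset.prod_congr rfl fun j _ => ?_
  rw [chi, block, Finset.prod_image]
  intro l hl l' hl' he
  simp only [Finset.coe_range, Set.mem_Iio] at hl hl'
  exact (h.inj j j l l' hl hl' he).2

theorem PlantedHyp.disjoint (h : PlantedHyp δ k sv P) {j j' : J} {u : V} (hu : u ∈ block k sv j)
    (hu' : u ∈ block k sv j') : j = j' := by
  obtain ⟨l, hl, rfl⟩ := Finset.mem_image.1 hu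
  obtain ⟨l', hl', he⟩ := Finset.mem_image.1 hu'
  exact (h.inj _ _ _ _ (Finset.mem_range.1 hl) (Finset.mem_range.1 hl') he.symm).1

theorem PlantedHyp.card_block (h : PlantedHyp δ k sv P) (j : J) :
    (block k sv j).card = 2 * k + 2 := by
  rw [block, Finset.card_image_of_injOn, Finset.card_range]
  intro l hl l' hl' he
  simp only [Finset.coe_range, Set.mem_Iio] at hl hl'
  exact (h.inj j j l l' hl hl' he).2

theorem PlantedHyp.realE_eq (h : PlantedHyp δ k sv P) (f : (V → ℤˣ) → ℝ) :
    realE P f = 2⁻¹ ^ V.card * ∑ y, parityDensity δ k sv y * f y := by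
  rw [realE, Finset.mul_sum]
  refine Finset.sum_congr rfl fun y _ => ?_
  have := parityDensity_nonneg (k := k) (sv := sv) h.nonneg h.le_one y
  rw [h.law, ENNReal.toReal_ofReal (by positivity)]
  ring

/-- Flip one spin in `T` and one in the block outside `T`. Every block parity is preserved, and so
is the density, but the product over `T` changes sign. -/
theorem PlantedHyp.realE_part (h : PlantedHyp δ k sv P) {j : J} {T : Finset V}
    (hT : T ⊆ block k sv j) (hne : T.Nonempty) (hT' : T ≠ block k sv j) : realE P (chi T) = 0 := by
  obtain ⟨u, hu⟩ := hne
  obtain ⟨v, hv, hvT⟩ : ∃ v ∈ block k sv j, v ∉ T := by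
    by_contra hcon
    push Not at hcon
    exact hT' (hT.antisymm hcon)
  have huv : u ≠ v := by
    rintro rfl
    exact hvT hu
  rw [h.realE_eq, sum_eq_zero_of_flip (flipAt u * flipAt v), mul_zero]
  intro y
  have h1 : parityDensity δ k sv (flipAt u * flipAt v * y) = parityDensity δ k sv y := by
    rw [h.density_eq, h.density_eq]
    refine Finset.prod_congr rfl fun j' _ => ?_
    rw [chi_mul, chi_mul, chi_flipAt, chi_flipAt]
    by_cases hj : j' = j
    · subst hj
      simp [hT hu, hv]
    · rw [if_neg fun hu' => hj (h.disjoint hu' (hT hu)), if_neg fun hv' => hj (h.disjoint hv' hv)]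
      simp
  rw [h1, chi_mul, chi_mul, chi_flipAt, chi_flipAt, if_pos hu, if_neg hvT]
  ring

/-- The density is `(1 + δ^k χ) R`, where `χ` is the parity of the block and `R` does not involve
the block. Flipping one spin of the block shows that `χ R` sums to zero, and `χ² = 1` produces the
amplitude. -/
theorem PlantedHyp.realE_block (h : PlantedHyp δ k sv P) (j : J) :
    realE P (chi (block k sv j)) = δ ^ k := by
  set R : (V → ℤˣ) → ℝ := fun y => ∏ j' ∈ Finset.univ.erase j, (1 + δ ^ k * chi (block k sv j') y)
    with hR
  have hd : ∀ y, parityDensity δ k sv y = (1 + δ ^ k * chi (block k sv j) y) * R y := fun y => by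
    rw [h.density_eq, ← Finset.mul_prod_erase _ _ (Finset.mem_univ j)]
  have hu : sv j 0 ∈ block k sv j := Finset.mem_image.2 ⟨0, by simp, rfl⟩
  have h0 : ∑ y, chi (block k sv j) y * R y = 0 := by
    refine sum_eq_zero_of_flip (flipAt (sv j 0)) _ fun y => ?_
    have : R (flipAt (sv j 0) * y) = R y := by
      refine Finset.prod_congr rfl fun j' hj' => ?_
      rw [chi_mul, chi_flipAt, if_neg fun hu' => Finset.ne_of_mem_erase hj' (h.disjoint hu' hu), one_mul]
    rw [this, chi_mul, chi_flipAt, if_pos hu]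
    ring
  have hs : ∑ y, parityDensity δ k sv y = ∑ y, R y := by
    have : ∀ y, parityDensity δ k sv y = R y + δ ^ k * (chi (block k sv j) y * R y) := fun y => by
      rw [hd]
      ring
    rw [Finset.sum_congr rfl fun y _ => this y, Finset.sum_add_distrib, ← Finset.mul_sum, h0, mul_zero,
      add_zero]
  have hs2 : ∑ y, parityDensity δ k sv y * chi (block k sv j) y = δ ^ k * ∑ y, R y := by
    have : ∀ y, parityDensity δ k sv y * chi (block k sv j) y
        = chi (block k sv j) y * R y + δ ^ k * R y := fun y => by
      have hsq : chi (block k sv j) y * chi (block k sv j) y = 1 := by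
        rw [← abs_mul_abs_self, abs_chi, one_mul]
      rw [hd]
      linear_combination (δ ^ k * R y) * hsq
    rw [Finset.sum_congr rfl fun y _ => this y, Finset.sum_add_distrib, ← Finset.mul_sum, h0, zero_add]
  rw [h.realE_eq, hs2, ← hs, sum_parityDensity _ h.pos h.inj, mul_left_comm, ← mul_pow]
  norm_num

/-- If the learned field is close to a product of parities, then most of their supports are
clusters of its graph. -/
theorem PlantedHyp.card_bad_le (h : PlantedHyp δ k sv P) (hδ : 0 < δ) {b : ℝ} {d R : ℕ}
    (hb : b * d ≤ 1 / 2) (hR : ((2 * k + 2 : ℕ) : ℝ) * (4 * 2⁻¹ ^ R) ≤ δ ^ k / 2)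
    {M : Matrix (Fin N) (Fin N) ℝ} {θ : Fin N → ℝ} (hM : IsAdmissible b d M θ) {x : ℝ} (hx : 0 < x)
    (hE : earthMover P (cmrf V M θ) ≤ ENNReal.ofReal x) (bad : Finset J)
    (hbad : ∀ j ∈ bad, ∃ l < 2 * k + 2, ∃ l' < 2 * k + 2,
      ¬ Reach M ((2 * k + 2) * R) (sv j l) (sv j l')) :
    (bad.card : ℝ) * (δ ^ k / 16) ≤ 2 * x := by
  classical
  obtain ⟨μ, hμ1, hμ2, hμ⟩ := exists_coupling hx hE
  set D : J → (V → ℤˣ) × (V → ℤˣ) → ℝ := fun j z => if ∃ u ∈ block k sv j, z.1 u ≠ z.2 u then 1 else 0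
    with hD
  -- The blocks are disjoint, so each block on which the two sides of the coupling differ
  -- contributes its own unit to the Hamming distance.
  have hsum : ∑ j ∈ bad, realE μ (D j) ≤ 2 * x := by
    refine le_trans ?_ hμ
    simp only [realE]
    rw [Finset.sum_comm]
    refine Finset.sum_le_sum fun z _ => ?_
    rw [← Finset.mul_sum]
    refine mul_le_mul_of_nonneg_left ?_ ENNReal.toReal_nonneg
    simp only [hD]
    rw [Finset.sum_boole, hammingDist]
    norm_cast
    have hex : ∀ j ∈ bad.filter (fun j => ∃ u ∈ block k sv j, z.1 u ≠ z.2 u),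
        ∃ u, u ∈ block k sv j ∧ z.1 u ≠ z.2 u := fun j hj => by
      simpa using (Finset.mem_filter.1 hj).2
    have : J → Nonempty V := fun j => ⟨sv j 0⟩
    rcases isEmpty_or_nonempty J with hJ | ⟨⟨j₀⟩⟩
    · simp [Finset.eq_empty_of_isEmpty bad]
    have := this j₀
    choose! f hf using hex
    refine Finset.card_le_card_of_injOn f (fun j hj => ?_) fun j hj j' hj' he => ?_
    · simpa using (hf j hj).2
    · exact h.disjoint (hf j hj).1 (he ▸ (hf j' hj').1)
  -- A block on which the coupling rarely disagrees keeps its correlations in the learned field. It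
  -- is then unsplittable, hence a cluster, and cannot be bad.
  have hlow : ∀ j ∈ bad, δ ^ k / 16 ≤ realE μ (D j) := by
    intro j hj
    by_contra hcon
    push Not at hcon
    obtain ⟨l, hl, l', hl', hreach⟩ := hbad j hj
    set S : Finset (Fin N) := (block k sv j).map ⟨Subtype.val, Subtype.val_injective⟩ with hS
    -- Spin products take the values `±1`; they agree where the coupling agrees on the block and
    -- differ by at most `2` elsewhere.
    have hclose : ∀ T ⊆ block k sv j, |mean M θ (chi (T.map ⟨Subtype.val, Subtype.val_injective⟩))
        - realE P (chi T)| ≤ 2 * realE μ (D j) := by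
      intro T hT
      have e1 : mean M θ (chi (T.map ⟨Subtype.val, Subtype.val_injective⟩))
          = realE (cmrf V M θ) (chi T) := by
        rw [realE_cmrf]
        congr 1
        funext y
        simp [chi]
      rw [e1, ← hμ2, ← hμ1, realE_map, realE_map, realE_sub]
      have e2 : 2 * realE μ (D j) = realE μ fun z => 2 * D j z := by
        simp only [realE, Finset.mul_sum]
        exact Finset.sum_congr rfl fun z _ => by ring
      rw [e2]
      refine abs_realE_le μ fun z => ?_
      simp only [hD]
      split_ifs with hz
      · have h1 := abs_le.1 (abs_chi T z.1).le
        have h2 := abs_le.1 (abs_chi T z.2).le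
        exact abs_le.2 ⟨by linarith [h1.2, h2.1], by linarith [h1.1, h2.2]⟩
      · push Not at hz
        have : chi T z.1 = chi T z.2 := Finset.prod_congr rfl fun u hu => by rw [hz u (hT hu)]
        simp [this]
    have hcard : S.card = 2 * k + 2 := by rw [hS, Finset.card_map, h.card_block]
    have hun := hM.unsplittable hb (S := S) (R := R) (pow_pos hδ k) (pow_le_one₀ h.nonneg h.le_one)
      (by rw [hcard]; exact hR) hcon.le
      (by
        have := hclose _ (Finset.Subset.refl _)
        rwa [h.realE_block] at this)
      (by
        intro T hT hTne hTS
        obtain ⟨T', hT', rfl⟩ := Finset.subset_map_iff.1 hT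
        have := hclose T' hT'
        rwa [h.realE_part hT' (by simpa using hTne) (by rintro rfl; exact hTS rfl), sub_zero] at this)
    refine hreach ?_
    rw [← hcard]
    refine reach_of_unsplittable hun ?_ ?_
    · exact Finset.mem_map.2 ⟨sv j l, Finset.mem_image.2 ⟨l, by simpa using hl, rfl⟩, rfl⟩
    · exact Finset.mem_map.2 ⟨sv j l', Finset.mem_image.2 ⟨l', by simpa using hl', rfl⟩, rfl⟩
  rw [← nsmul_eq_mul]
  exact (Finset.card_nsmul_le_sum _ _ _ hlow).trans hsum

end Planted

end

noncomputable section

/-! ### Samples -/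

section Samples

theorem Store.write_arr_filterMap {n : ℕ} (f : Fin n → Option ℤ) (l : List (Fin n)) (hl : l.Nodup)
    (σ : Store) (a : ℕ) (i : Fin n) :
    (σ.write a (l.filterMap fun i => (f i).map fun z => (((i : ℕ) : ℤ), z))).arr a (i : ℕ)
      = if i ∈ l then (f i).getD (σ.arr a (i : ℕ)) else σ.arr a (i : ℕ) := by
  induction l generalizing σ with
  | nil => rfl
  | cons j l ih =>
    rw [List.nodup_cons] at hl
    rw [List.filterMap_cons]
    cases hf : f j with
    | none =>
      simp only [Option.map_none]
      rw [ih hl.2]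
      by_cases hij : i = j
      · subst hij
        simp [hl.1, hf]
      · simp [hij]
    | some z =>
      simp only [Option.map_some]
      rw [Store.write, List.foldl_cons, ← Store.write, ih hl.2]
      by_cases hij : i = j
      · subst hij
        simp [hl.1, hf]
      · have : ((i : ℕ) : ℤ) ≠ ((j : ℕ) : ℤ) := by
          simpa [Fin.ext_iff] using hij
        simp [hij, this]

theorem entries_eq {n : ℕ} (S : Finset (Fin n)) (x : S → ℤˣ) :
    entries S x = (List.finRange n).filterMap fun i =>
      (if h : i ∈ S then some ((x ⟨i, h⟩ : ℤˣ) : ℤ) else none).map fun z => (((i : ℕ) : ℤ), z) := by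
  rw [entries]
  congr 1
  funext i
  split_ifs <;> rfl

theorem write_entries_arr {n : ℕ} (S : Finset (Fin n)) (x : S → ℤˣ) (σ : Store) (a : ℕ) {i : Fin n}
    (hi : i ∈ S) : (σ.write a (entries S x)).arr a (i : ℕ) = (x ⟨i, hi⟩ : ℤˣ) := by
  rw [entries_eq, Store.write_arr_filterMap _ _ (List.nodup_finRange n)]
  simp [hi]

theorem Store.write_arr_of_not_mem (l : List (ℤ × ℤ)) (σ : Store) (a : ℕ) (i : ℤ)
    (h : ∀ e ∈ l, e.1 ≠ i) : (σ.write a l).arr a i = σ.arr a i := by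
  induction l generalizing σ with
  | nil => rfl
  | cons e l ih =>
    rw [Store.write, List.foldl_cons, ← Store.write, ih _ fun e he => h e (by simp [he])]
    have := (h e (by simp)).symm
    simp [this]

theorem write_entries_arr_of_not_mem {n : ℕ} (S : Finset (Fin n)) (x : S → ℤˣ) (σ : Store) (a : ℕ)
    {i : ℤ} (hi : ∀ v ∈ S, ((v : ℕ) : ℤ) ≠ i) : (σ.write a (entries S x)).arr a i = σ.arr a i := by
  refine Store.write_arr_of_not_mem _ _ _ _ fun e he => ?_
  simp only [entries, List.mem_filterMap] at he
  obtain ⟨v, -, hv⟩ := he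
  split_ifs at hv with h
  simp only [Option.some.injEq] at hv
  rw [← hv]
  exact hi v h

theorem length_entries {n : ℕ} (S : Finset (Fin n)) (x : S → ℤˣ) : (entries S x).length = S.card := by
  rw [entries, List.length_filterMap_eq_countP]
  have : (fun i : Fin n => (if h : i ∈ S then
      some (((i : ℕ) : ℤ), ((x ⟨i, h⟩ : ℤˣ) : ℤ)) else none).isSome) = fun i => decide (i ∈ S) := by
    funext i
    by_cases h : i ∈ S <;> simp [h]
  rw [this, List.countP_eq_length_filter]
  have h2 : ((List.finRange n).filter fun i => decide (i ∈ S)).toFinset = S := by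
    ext i
    simp
  rw [← List.toFinset_card_of_nodup ((List.nodup_finRange n).filter _), h2]

/-- A full configuration as a list of entries. -/
def fullEntries {n : ℕ} (x : Fin n → ℤˣ) : List (ℤ × ℤ) := entries Finset.univ fun i => x i.1

theorem samples_eq {n : ℕ} (P : PMF (Fin n → ℤˣ)) : samples P = P.map fullEntries := by
  rw [samples, samplesOn, PMF.map_comp]
  rfl

theorem length_of_mem_samples {n : ℕ} {P : PMF (Fin n → ℤˣ)} {l : List (ℤ × ℤ)}
    (hl : l ∈ (samples P).support) : l.length ≤ n := by
  rw [samples_eq] at hl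
  obtain ⟨x, -, rfl⟩ := (PMF.mem_support_map_iff _ _ _).1 hl
  rw [fullEntries, length_entries]
  simp

theorem write_fullEntries_arr {n : ℕ} (x : Fin n → ℤˣ) (σ : Store) (a : ℕ) (i : Fin n) :
    (σ.write a (fullEntries x)).arr a (i : ℕ) = (x i : ℤ) :=
  write_entries_arr _ _ _ _ (Finset.mem_univ i)

theorem tri_sample {n : ℕ} {P : PMF (Fin n → ℤˣ)} {a : ℕ} {σ : Store} {Q : Store → Prop}
    (h : ∀ x : Fin n → ℤˣ, Q (σ.write a (fullEntries x))) : Tri (samples P) (.sample a) σ (n + 1) Q := by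
  refine Tri.sample (fun l hl => length_of_mem_samples hl) fun l hl => ?_
  rw [samples_eq] at hl
  obtain ⟨x, -, rfl⟩ := (PMF.mem_support_map_iff _ _ _).1 hl
  exact h x

theorem wp_samples {n : ℕ} {P : PMF (Fin n → ℤˣ)} {a : ℕ} {σ : Store} (f : Store → ℝ≥0∞) :
    wp (samples P) (.sample a) f σ = ∑ x, P x * f (σ.write a (fullEntries x)) := by
  rw [wp_sample (fun l hl => length_of_mem_samples hl), samples_eq, expect_map, expect_fintype]

end Samples

/-! ### The parity test -/

section Test

/-- Multiply variable `31` by the spin at position `20` of the sample, if that position is marked. -/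
def coordProg : Prog :=
  .seq (.load 32 3 20) (.ite 32 (.seq (.load 33 4 20) (.ite 33 .skip (.sub 31 9 31))) .skip)

/-- Add to variable `30` the product of the marked spins of a fresh sample. -/
def roundProg : Prog :=
  .seq (.sample 4) (.seq (.const 31 1) (.seq (forTo 20 0 coordProg) (.add 30 30 31)))

/-- Sum the products of the marked spins of several samples. -/
def scoreProg : Prog := .seq (.const 30 0) (forTo 19 6 roundProg)

/-- The marked positions. -/
def marked (n : ℕ) (σ : Store) : Finset (Fin n) := Finset.univ.filter fun i => 0 < σ.arr 3 (i : ℕ)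

/-- The values of the reserved variables that hold constants. -/
structure Consts (n : ℕ) (σ : Store) : Prop where
  size : σ.var 0 = n
  one : σ.var 1 = 1
  zero : σ.var 9 = 0

theorem Consts.congr {n : ℕ} {σ τ : Store} (h : Consts n σ) (h0 : τ.var 0 = σ.var 0)
    (h1 : τ.var 1 = σ.var 1) (h9 : τ.var 9 = σ.var 9) : Consts n τ :=
  ⟨h0.trans h.size, h1.trans h.one, h9.trans h.zero⟩

variable {n : ℕ} {P : PMF (Fin n → ℤˣ)}

/-- The product of the marked spins at the positions from `i` on. -/
def partialProd (T : Finset (Fin n)) (x : Fin n → ℤˣ) (i : ℕ) : ℤ :=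
  ∏ v ∈ T.filter fun v : Fin n => i ≤ (v : ℕ), (x v : ℤ)

theorem partialProd_zero (T : Finset (Fin n)) (x : Fin n → ℤˣ) : (partialProd T x 0 : ℝ) = chi T x := by
  simp [partialProd, chi, sgn]

theorem partialProd_self (T : Finset (Fin n)) (x : Fin n → ℤˣ) : partialProd T x n = 1 := by
  refine Finset.prod_eq_one fun v hv => ?_
  have := v.2
  simp only [Finset.mem_filter] at hv
  omega

theorem partialProd_step (T : Finset (Fin n)) (x : Fin n → ℤˣ) {i : ℕ} (hi : i < n) :
    partialProd T x i = (if (⟨i, hi⟩ : Fin n) ∈ T then (x ⟨i, hi⟩ : ℤ) else 1) * partialProd T x (i + 1) := by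
  have h : T.filter (fun v : Fin n => i ≤ (v : ℕ))
      = (T.filter fun v : Fin n => (v : ℕ) = i) ∪ T.filter fun v : Fin n => i + 1 ≤ (v : ℕ) := by
    ext v
    simp only [Finset.mem_filter, Finset.mem_union, ← and_or_left]
    refine and_congr_right fun _ => ?_
    omega
  rw [partialProd, h, Finset.prod_union, partialProd]
  · congr 1
    have h2 : T.filter (fun v : Fin n => (v : ℕ) = i) = if (⟨i, hi⟩ : Fin n) ∈ T then {⟨i, hi⟩} else ∅ := by
      ext v
      split_ifs with hT <;> simp only [Finset.mem_filter, Finset.mem_singleton, Fin.ext_iff,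
        Finset.notMem_empty, iff_false, not_and]
      · constructor
        · exact And.right
        · rintro rfl
          exact ⟨hT, rfl⟩
      · rintro hv rfl
        exact hT hv
    rw [h2]
    split_ifs <;> simp
  · rw [Finset.disjoint_left]
    intro v hv hv'
    simp only [Finset.mem_filter] at hv hv'
    omega

theorem coord_hyp {σ : Store} (hσ : Consts n σ) (x : Fin n → ℤˣ) (h31 : σ.var 31 = 1)
    (hx : ∀ i : Fin n, σ.arr 4 (i : ℕ) = (x i : ℤ)) {D : PMF (List (ℤ × ℤ))} :
    ForHyp D 20 0 coordProg n 8 (fun i τ => τ.var 31 = partialProd (marked n σ) x i) σ where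
  bound := hσ.size
  one := hσ.one
  zero := hσ.zero
  ne := by decide
  counter := by simp [coordProg, Prog.wv]
  wone := by simp [coordProg, Prog.wv]
  init := by simp [partialProd_self, h31]
  body := by
    intro i hi τ hI hc hF
    have h9 : τ.var 9 = 0 := by rw [hF.1 9 (by simp [coordProg, Prog.wv]), hσ.zero]
    have h3 : τ.arr 3 = σ.arr 3 := hF.2 3 (by simp [coordProg, Prog.wa])
    have h4 : τ.arr 4 = σ.arr 4 := hF.2 4 (by simp [coordProg, Prog.wa])
    refine Tri.straight (by simp [coordProg, Prog.straight]) (by simp [coordProg, Prog.cost]) ?_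
    have hxi := hx ⟨i, hi⟩
    simp only at hxi
    rw [partialProd_step _ _ hi, ← hI]
    simp only [coordProg, Prog.exec, Store.setVar_var, Store.setVar_arr, h3, h4, marked,
      Finset.mem_filter, Finset.mem_univ, true_and]
    by_cases hm : 0 < σ.arr 3 (i : ℕ)
    · rcases Int.units_eq_one_or (x ⟨i, hi⟩) with h | h
      · simp [hm, hxi, h]
      · simp [hm, hxi, h, h9]
    · simp [hm]

theorem round_tail {σ : Store} (hσ : Consts n σ) (x : Fin n → ℤˣ)
    (hx : ∀ i : Fin n, σ.arr 4 (i : ℕ) = (x i : ℤ)) {D : PMF (List (ℤ × ℤ))} :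
    Tri D (.seq (.const 31 1) (.seq (forTo 20 0 coordProg) (.add 30 30 31))) σ (11 * n + 7)
      fun τ => (τ.var 30 : ℝ) = σ.var 30 + chi (marked n σ) x := by
  have hσ' : Consts n ((Prog.const 31 1).exec σ) :=
    hσ.congr (by simp [Prog.exec]) (by simp [Prog.exec]) (by simp [Prog.exec])
  have h := (coord_hyp (D := D) hσ' x (by simp [Prog.exec]) hx).tri
  have h2 : Tri D (.seq (forTo 20 0 coordProg) (.add 30 30 31)) ((Prog.const 31 1).exec σ)
      (11 * n + 5) fun τ => (τ.var 30 : ℝ) = σ.var 30 + chi (marked n σ) x := by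
    refine (Tri.seq (B' := 1) (h.mono le_rfl fun τ hτ => ?_)).mono (by omega) fun _ h => h
    refine Tri.straight (p := .add 30 30 31) trivial le_rfl ?_
    obtain ⟨h1, -, hF⟩ := hτ
    have h30 := hF.1 30 (by simp [coordProg, Prog.wv])
    simp only [Prog.exec, Store.setVar_var, if_true, h30, h1]
    push_cast
    rw [partialProd_zero]
    rfl
  refine (Tri.straight_seq (p := .const 31 1) trivial h2).mono ?_ fun _ h => h
  have : (Prog.const 31 1).cost = 1 := rfl
  omega

theorem Consts.write {σ : Store} (hσ : Consts n σ) (a : ℕ) (l : List (ℤ × ℤ)) :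
    Consts n (σ.write a l) :=
  hσ.congr (by rw [Store.write_var]) (by rw [Store.write_var]) (by rw [Store.write_var])

theorem round_tri' {σ : Store} (hσ : Consts n σ) (x : Fin n → ℤˣ) {D : PMF (List (ℤ × ℤ))} :
    Tri D (.seq (.const 31 1) (.seq (forTo 20 0 coordProg) (.add 30 30 31)))
      (σ.write 4 (fullEntries x)) (11 * n + 7)
      fun τ => (τ.var 30 : ℝ) = σ.var 30 + chi (marked n σ) x := by
  have := round_tail (hσ.write 4 (fullEntries x)) x (write_fullEntries_arr x σ 4) (D := D)
  have h3 : marked n (σ.write 4 (fullEntries x)) = marked n σ := by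
    rw [marked, Store.write_arr_of_ne _ _ (by decide), marked]
  rwa [h3, Store.write_var] at this

theorem round_tri {σ : Store} (hσ : Consts n σ) :
    Tri (samples P) roundProg σ (12 * n + 9) fun _ => True :=
  (Tri.seq (tri_sample fun x => (round_tri' hσ x).mono le_rfl fun _ _ => trivial)).mono (by omega)
    fun _ h => h

theorem round_wp {σ : Store} (hσ : Consts n σ) (g : ℝ) :
    wp (samples P) roundProg (fun τ => ENNReal.ofReal (Real.exp (g * τ.var 30))) σ
      = (∑ x, P x * ENNReal.ofReal (Real.exp (g * chi (marked n σ) x)))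
        * ENNReal.ofReal (Real.exp (g * σ.var 30)) := by
  rw [roundProg, Tri.wp_seq (tri_sample fun x => (round_tri' hσ x).mono le_rfl fun _ _ => trivial),
    wp_samples, Finset.sum_mul]
  refine Finset.sum_congr rfl fun x _ => ?_
  rw [(round_tri' hσ x).wp_eq_const (c := ENNReal.ofReal (Real.exp (g * (σ.var 30 + chi (marked n σ) x))))
    fun τ hτ => by rw [hτ], mul_add, Real.exp_add, ENNReal.ofReal_mul (Real.exp_pos _).le]
  ring

theorem marked_congr {σ τ : Store} (h : τ.arr 3 = σ.arr 3) : marked n τ = marked n σ := by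
  rw [marked, marked, h]

theorem score_hyp {σ : Store} {t : ℕ} (hσ : Consts n σ) (ht : σ.var 6 = t) :
    ForHyp (samples P) 19 6 roundProg t (12 * n + 9) (fun _ _ => True) σ where
  bound := ht
  one := hσ.one
  zero := hσ.zero
  ne := by decide
  counter := by simp [roundProg, coordProg, Prog.wv]
  wone := by simp [roundProg, coordProg, Prog.wv]
  init := trivial
  body := fun i _ τ _ _ hF => round_tri (hσ.congr
    (by simp [hF.1 0 (by simp [roundProg, coordProg, Prog.wv])])
    (by simp [hF.1 1 (by simp [roundProg, coordProg, Prog.wv])])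
    (by simp [hF.1 9 (by simp [roundProg, coordProg, Prog.wv])]))

theorem score_tri {σ : Store} {t : ℕ} (hσ : Consts n σ) (ht : σ.var 6 = t) :
    Tri (samples P) scoreProg σ (t * (12 * n + 12) + 5) fun _ => True := by
  refine (Tri.straight_seq (p := .const 30 0) trivial ((score_hyp (hσ.congr (τ := σ.setVar 30 0)
    (by simp) (by simp) (by simp)) (t := t) (by simpa using ht)).tri)).mono ?_ fun _ _ => trivial
  have : (Prog.const 30 0).cost = 1 := rfl
  rw [this, show 12 * n + 9 + 3 = 12 * n + 12 by omega]
  omega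

/-- Samples are independent, so the exponential moment of the score is a power of the exponential
moment of one product of marked spins. -/
theorem score_wp {σ : Store} {t : ℕ} (hσ : Consts n σ) (ht : σ.var 6 = t) (g : ℝ) :
    wp (samples P) scoreProg (fun τ => ENNReal.ofReal (Real.exp (g * τ.var 30))) σ
      = (∑ x, P x * ENNReal.ofReal (Real.exp (g * chi (marked n σ) x))) ^ t := by
  have hσ' : Consts n (σ.setVar 30 0) := hσ.congr (by simp) (by simp) (by simp)
  have hh : ForHyp (samples P) 19 6 roundProg t (12 * n + 9) (fun _ _ => True) (σ.setVar 30 0) :=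
    score_hyp hσ' (by simpa using ht)
  rw [scoreProg, Tri.wp_straight_seq (p := .const 30 0) trivial hh.tri, Prog.exec]
  set m : ℝ≥0∞ := ∑ x, P x * ENNReal.ofReal (Real.exp (g * chi (marked n σ) x)) with hm
  have := hh.wp_eq (fun i τ => m ^ i * ENNReal.ofReal (Real.exp (g * τ.var 30)))
    (fun i _ τ _ _ hF => ?_)
  · simpa using this
  · have hτ : Consts n (τ.setVar 19 i) := hσ'.congr
      (by simp [hF.1 0 (by simp [roundProg, coordProg, Prog.wv])])
      (by simp [hF.1 1 (by simp [roundProg, coordProg, Prog.wv])])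
      (by simp [hF.1 9 (by simp [roundProg, coordProg, Prog.wv])])
    have h3 : marked n (τ.setVar 19 i) = marked n σ :=
      marked_congr (hF.2 3 (by simp [roundProg, coordProg, Prog.wa]))
    have := round_wp (P := P) hτ g
    rw [h3, ← hm] at this
    simp only [wp] at this ⊢
    rw [expect_const_mul, this]
    simp
    ring

/-- Add the marked positions to the output. -/
def unionProg : Prog := forTo 21 0 (.seq (.load 35 3 21) (.ite 35 (.store 0 21 1) .skip))

/-- Add the marked positions to the output if the product of the marked spins is often positive. -/
def testProg : Prog := .seq scoreProg (.seq (.sub 34 30 7) (.ite 34 unionProg .skip))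

theorem union_tri {σ : Store} (hσ : Consts n σ) {D : PMF (List (ℤ × ℤ))} :
    Tri D unionProg σ (7 * n + 3) fun τ => outSet n τ = outSet n σ ∪ marked n σ := by
  have h : ForHyp D 21 0 (.seq (.load 35 3 21) (.ite 35 (.store 0 21 1) .skip)) n 4
      (fun i τ => ∀ v : Fin n, τ.arr 0 (v : ℕ) = if i ≤ v ∧ v ∈ marked n σ then 1 else σ.arr 0 (v : ℕ)) σ :=
    { bound := hσ.size
      one := hσ.one
      zero := hσ.zero
      ne := by decide
      counter := by simp [Prog.wv]
      wone := by simp [Prog.wv]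
      init := fun v => by simp [not_le.2 v.2]
      body := by
        intro i hi τ hI hc hF
        have h1 : τ.var 1 = 1 := by rw [hF.1 1 (by simp [Prog.wv]), hσ.one]
        have h3 : τ.arr 3 = σ.arr 3 := hF.2 3 (by simp [Prog.wa])
        refine Tri.straight (by simp [Prog.straight]) (by simp [Prog.cost]) fun v => ?_
        have hv := hI v
        have hmem : v ∈ marked n σ ↔ 0 < σ.arr 3 (v : ℕ) := by simp [marked]
        simp only [hmem] at hv ⊢
        by_cases hm : 0 < σ.arr 3 (i : ℕ)
        · simp only [Prog.exec, Store.setVar_var, Store.setVar_arr, h3, hm, if_true, Store.setArr_arr,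
            hv, h1]
          by_cases hvi : (v : ℕ) = i
          · simp [hvi, hm]
          · have hle : i + 1 ≤ (v : ℕ) ↔ i ≤ (v : ℕ) := by omega
            simp [hvi, hle]
        · simp only [Prog.exec, Store.setVar_var, Store.setVar_arr, h3, hm, if_true, if_false, hv]
          by_cases hvi : (v : ℕ) = i
          · simp [hvi, hm]
          · have hle : i + 1 ≤ (v : ℕ) ↔ i ≤ (v : ℕ) := by omega
            simp [hle] }
  refine h.tri.mono (by omega) fun τ hτ => ?_
  ext v
  simp only [outSet, Finset.mem_filter, Finset.mem_univ, true_and, Finset.mem_union, hτ.1 v, zero_le]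
  split_ifs with hm <;> simp [hm]

theorem outSet_congr {σ τ : Store} (h : τ.arr 0 = σ.arr 0) : outSet n τ = outSet n σ := by
  rw [outSet, outSet, h]

/-- What the second half of the test does to the output. -/
def TestPost (n : ℕ) (σ : Store) (s : ℤ) (τ : Store) : Prop :=
  (σ.var 7 < s → outSet n τ = outSet n σ ∪ marked n σ) ∧ (¬ σ.var 7 < s → outSet n τ = outSet n σ)

theorem test_tail {σ : Store} (hσ : Consts n σ) {D : PMF (List (ℤ × ℤ))} :
    Tri D (.seq (.sub 34 30 7) (.ite 34 unionProg .skip)) σ (7 * n + 6)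
      (TestPost n σ (σ.var 30)) := by
  refine (Tri.straight_seq (p := .sub 34 30 7) trivial (Tri.ite (B := 7 * n + 3) ?_)).mono
    (by simp [Prog.cost]; omega) fun _ h => h
  have hσ' : Consts n ((Prog.sub 34 30 7).exec σ) :=
    hσ.congr (by simp [Prog.exec]) (by simp [Prog.exec]) (by simp [Prog.exec])
  by_cases h : σ.var 7 < σ.var 30
  · rw [if_pos (by simp [Prog.exec, h])]
    exact (union_tri hσ').mono le_rfl fun τ hτ => ⟨fun _ => hτ, fun h' => absurd h h'⟩
  · rw [if_neg (by simpa [Prog.exec] using h)]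
    exact Tri.straight (p := .skip) trivial (by simp [Prog.cost]) ⟨fun h' => absurd h' h, fun _ => rfl⟩

theorem test_seq {σ : Store} {t : ℕ} (hσ : Consts n σ) (ht : σ.var 6 = t) :
    Tri (samples P) scoreProg σ (t * (12 * n + 12) + 5) fun τ => Tri (samples P)
      (.seq (.sub 34 30 7) (.ite 34 unionProg .skip)) τ (7 * n + 6) (TestPost n σ (τ.var 30)) := by
  refine (score_tri hσ ht).frame.mono le_rfl fun τ hτ => ?_
  have hF := hτ.2
  have h := test_tail (D := samples P) (hσ.congr (τ := τ)
    (hF.1 0 (by simp [scoreProg, roundProg, coordProg, Prog.wv]))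
    (hF.1 1 (by simp [scoreProg, roundProg, coordProg, Prog.wv]))
    (hF.1 9 (by simp [scoreProg, roundProg, coordProg, Prog.wv])))
  have e1 : outSet n τ = outSet n σ :=
    outSet_congr (hF.2 0 (by simp [scoreProg, roundProg, coordProg, Prog.wa]))
  have e2 : marked n τ = marked n σ :=
    marked_congr (hF.2 3 (by simp [scoreProg, roundProg, coordProg, Prog.wa]))
  have e3 : τ.var 7 = σ.var 7 := hF.1 7 (by simp [scoreProg, roundProg, coordProg, Prog.wv])
  have e4 : TestPost n τ = TestPost n σ := by
    funext s ρ
    rw [TestPost, TestPost, e1, e2, e3]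
  rwa [e4] at h

theorem test_tri {σ : Store} {t : ℕ} (hσ : Consts n σ) (ht : σ.var 6 = t) :
    Tri (samples P) testProg σ (t * (12 * n + 12) + 7 * n + 12) fun τ =>
      outSet n τ = outSet n σ ∨ outSet n τ = outSet n σ ∪ marked n σ := by
  refine (Tri.seq ((test_seq hσ ht).mono le_rfl fun τ hτ => hτ.mono le_rfl fun ρ hρ => ?_)).mono
    (by omega) fun _ h => h
  by_cases h : σ.var 7 < τ.var 30
  · exact Or.inr (hρ.1 h)
  · exact Or.inl (hρ.2 h)

/-- Markov's inequality for the exponential moment. A positive `g` serves against false acceptance,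
a negative `g` against false rejection. -/
theorem test_wp_le {σ : Store} {t : ℕ} (hσ : Consts n σ) (ht : σ.var 6 = t) (g : ℝ)
    (f : Store → ℝ≥0∞)
    (hf : ∀ s τ, TestPost n σ s τ → f τ ≤ ENNReal.ofReal (Real.exp (g * (s - σ.var 7)))) :
    wp (samples P) testProg f σ ≤ ENNReal.ofReal (Real.exp (-(g * σ.var 7)))
      * (∑ x, P x * ENNReal.ofReal (Real.exp (g * chi (marked n σ) x))) ^ t := by
  have h := test_seq (P := P) hσ ht
  rw [testProg, Tri.wp_seq (h.mono le_rfl fun τ hτ => hτ.mono le_rfl fun _ _ => trivial),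
    ← score_wp hσ ht]
  simp only [wp]
  rw [← expect_const_mul]
  refine h.wp_mono fun τ hτ => ?_
  calc wp (samples P) _ f τ ≤ wp (samples P) _ (fun _ => ENNReal.ofReal (Real.exp (g * (τ.var 30 - σ.var 7)))) τ :=
        hτ.wp_mono fun ρ hρ => hf _ _ hρ
    _ = _ := by
      rw [wp, expect_const, ← ENNReal.ofReal_mul (Real.exp_pos _).le, ← Real.exp_add]
      congr 2
      ring

end Test

/-! ### The test succeeds -/

section TestSuccess

theorem sum_mul_ofReal {α : Type*} [Fintype α] (P : PMF α) {h : α → ℝ} (h0 : ∀ a, 0 ≤ h a) :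
    ∑ a, P a * ENNReal.ofReal (h a) = ENNReal.ofReal (realE P h) := by
  rw [realE, ENNReal.ofReal_sum_of_nonneg fun a _ => mul_nonneg ENNReal.toReal_nonneg (h0 a)]
  refine Finset.sum_congr rfl fun a _ => ?_
  rw [ENNReal.ofReal_mul ENNReal.toReal_nonneg, ENNReal.ofReal_toReal (PMF.apply_ne_top _ _)]

variable {n k : ℕ} {b : ℝ} {S : Finset (Fin n)} {hS : S.card = 2 * k + 2}

theorem noisyParity_apply (x : Fin n → ℤˣ) : noisyParity b k S hS x
    = ENNReal.ofReal ((2 : ℝ)⁻¹ ^ n * (1 + delta b ^ k * chi S x)) := rfl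

theorem realE_noisyParity (f : (Fin n → ℤˣ) → ℝ) : realE (noisyParity b k S hS) f
    = 2⁻¹ ^ n * ∑ x, (1 + delta b ^ k * chi S x) * f x := by
  rw [realE, Finset.mul_sum]
  refine Finset.sum_congr rfl fun x _ => ?_
  have : 0 ≤ (1 + delta b ^ k * chi S x) := one_add_mul_prod_nonneg (pow_nonneg (delta_nonneg b) k)
    (pow_le_one₀ (delta_nonneg b) (delta_le_one b)) _ fun i => x i
  rw [noisyParity_apply, ENNReal.toReal_ofReal (by positivity)]
  ring

theorem sum_chi_eq_zero {T : Finset (Fin n)} (hT : T.Nonempty) : ∑ x, chi T x = 0 := by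
  obtain ⟨u, hu⟩ := hT
  refine sum_eq_zero_of_flip (flipAt u) _ fun y => ?_
  rw [chi_mul, chi_flipAt, if_pos hu]
  ring

/-- Flipping a spin in the symmetric difference of `S` and `T` reverses the sign of the product of
the two parities. -/
theorem realE_noisyParity_chi {T : Finset (Fin n)} (hT : T.Nonempty) (hTS : T ≠ S) :
    realE (noisyParity b k S hS) (chi T) = 0 := by
  have h2 : ∑ x : Fin n → ℤˣ, chi S x * chi T x = 0 := by
    obtain ⟨u, hu⟩ : ∃ u, ¬ (u ∈ S ↔ u ∈ T) := by
      by_contra hcon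
      push Not at hcon
      exact hTS (Finset.ext fun u => (hcon u).symm)
    refine sum_eq_zero_of_flip (flipAt u) _ fun y => ?_
    rw [chi_mul, chi_mul, chi_flipAt, chi_flipAt]
    by_cases h1 : u ∈ S <;> by_cases h2 : u ∈ T <;> simp_all
  simp only [realE_noisyParity, add_mul, one_mul, Finset.sum_add_distrib, mul_assoc, ← Finset.mul_sum,
    h2, sum_chi_eq_zero hT, mul_zero, add_zero]

theorem realE_noisyParity_self : realE (noisyParity b k S hS) (chi S) = delta b ^ k := by
  have h : ∀ x : Fin n → ℤˣ, (1 + delta b ^ k * chi S x) * chi S x = chi S x + delta b ^ k := fun x => by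
    have hsq : chi S x * chi S x = 1 := by rw [← abs_mul_abs_self, abs_chi, one_mul]
    linear_combination (delta b ^ k) * hsq
  rw [realE_noisyParity, Finset.sum_congr rfl fun x _ => h x, Finset.sum_add_distrib,
    sum_chi_eq_zero (Finset.card_pos.1 (by omega))]
  simp [mul_comm]

/-- For `|x| ≤ 1` one has `e^x ≤ 1 + x + x²`, and here the square is the constant `g²`. -/
theorem realE_exp_le {α : Type*} [Fintype α] (P : PMF α) (c : α → ℝ) (hc : ∀ a, |c a| = 1) {g : ℝ}
    (hg : |g| ≤ 1) : realE P (fun a => Real.exp (g * c a)) ≤ Real.exp (g * realE P c + g ^ 2) := by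
  have h1 : ∑ a, (P a).toReal = 1 := by
    rw [← ENNReal.toReal_sum fun a _ => PMF.apply_ne_top _ _, ← tsum_fintype (L := .unconditional _),
      P.tsum_coe, ENNReal.toReal_one]
  calc realE P (fun a => Real.exp (g * c a)) ≤ ∑ a, (P a).toReal * (1 + g * c a + g ^ 2) := by
        refine Finset.sum_le_sum fun a _ => mul_le_mul_of_nonneg_left ?_ ENNReal.toReal_nonneg
        have h := (abs_le.1 (Real.abs_exp_sub_one_sub_id_le (x := g * c a) (by
          rw [abs_mul, hc, mul_one]; exact hg))).2
        have h2 : (g * c a) ^ 2 = g ^ 2 := by rw [mul_pow, ← sq_abs (c a), hc]; ring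
        linarith
    _ = g * realE P c + g ^ 2 + 1 := by
        simp only [mul_add, Finset.sum_add_distrib, mul_one, ← Finset.sum_mul, h1, realE, Finset.mul_sum]
        rw [Finset.sum_congr rfl fun a _ => mul_left_comm (P a).toReal g (c a)]
        ring
    _ ≤ _ := Real.add_one_le_exp _

/-- The parameters of the parity test: `K` samples and threshold `θ` per unit of confidence. -/
structure TestParams (δ : ℝ) (K θ : ℕ) : Prop where
  lower : K * δ / 2 ≤ θ
  upper : (θ : ℝ) ≤ K * δ / 2 + 1
  large : δ / 4 + 3 ≤ K * δ ^ 2 / 16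

theorem exists_testParams {δ : ℝ} (hδ : 0 < δ) : ∃ K θ : ℕ, TestParams δ K θ := by
  obtain ⟨K, hK⟩ := exists_nat_ge ((δ / 4 + 3) * 16 / δ ^ 2)
  refine ⟨K, ⌈K * δ / 2⌉₊, Nat.le_ceil _, (Nat.ceil_lt_add_one (by positivity)).le, ?_⟩
  rw [div_le_iff₀ (by positivity)] at hK
  linarith

variable {K θ L : ℕ} {σ : Store}

/-- The test uses `K L` samples and the threshold `θ L`, so the Chernoff exponent is `L` times the
one per unit of confidence. The hypothesis `hb` bounds the latter by `-3`. -/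
theorem test_exp_le {P : PMF (Fin n → ℤˣ)} (hσ : Consts n σ) (ht : σ.var 6 = (K * L : ℕ))
    (hθ : σ.var 7 = (θ * L : ℕ)) {g : ℝ} (hg : |g| ≤ 1)
    (hb : -(g * θ) + K * (g * realE P (chi (marked n σ)) + g ^ 2) ≤ -3) (f : Store → ℝ≥0∞)
    (hf : ∀ s τ, TestPost n σ s τ → f τ ≤ ENNReal.ofReal (Real.exp (g * (s - σ.var 7)))) :
    wp (samples P) testProg f σ ≤ ENNReal.ofReal (Real.exp (-3)) ^ L := by
  refine (test_wp_le hσ ht g f hf).trans ?_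
  rw [sum_mul_ofReal P fun a => (Real.exp_pos _).le]
  refine (mul_le_mul_right (pow_le_pow_left' (ENNReal.ofReal_le_ofReal
    (realE_exp_le P _ (fun a => abs_chi _ a) hg)) _) _).trans ?_
  rw [← ENNReal.ofReal_pow (Real.exp_pos _).le, ← ENNReal.ofReal_pow (Real.exp_pos _).le,
    ← ENNReal.ofReal_mul (Real.exp_pos _).le, ← Real.exp_nat_mul, ← Real.exp_nat_mul, ← Real.exp_add, hθ]
  refine ENNReal.ofReal_le_ofReal (Real.exp_le_exp.2 ?_)
  push_cast
  have hL : (0 : ℝ) ≤ L := Nat.cast_nonneg L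
  nlinarith [mul_le_mul_of_nonneg_left hb hL]

/-- The mean is zero. Write `δ` for `delta b ^ k`: the choice `g = δ/4` gives the exponent
`-(δ/4)(Kδ/2) + Kδ²/16 = -Kδ²/16` when `θ` is replaced by its lower bound. -/
theorem test_wp_wrong (hK : TestParams (delta b ^ k) K θ) (hσ : Consts n σ)
    (ht : σ.var 6 = (K * L : ℕ)) (hθ : σ.var 7 = (θ * L : ℕ)) (hT : (marked n σ).Nonempty)
    (hTS : marked n σ ≠ S) (f : Store → ℝ≥0∞) (hf : ∀ τ, f τ ≤ 1)
    (hf0 : ∀ τ, outSet n τ = outSet n σ → f τ = 0) :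
    wp (samples (noisyParity b k S hS)) testProg f σ ≤ ENNReal.ofReal (Real.exp (-3)) ^ L := by
  have h0 := pow_nonneg (delta_nonneg b) k
  have h1 : delta b ^ k ≤ 1 := pow_le_one₀ (delta_nonneg b) (delta_le_one b)
  refine test_exp_le (g := delta b ^ k / 4) hσ ht hθ ?_ ?_ f fun s τ hτ => ?_
  · rw [abs_of_nonneg (by positivity)]
    linarith
  · rw [realE_noisyParity_chi hT hTS]
    have := mul_le_mul_of_nonneg_left hK.lower h0
    nlinarith [hK.large]
  · by_cases h : σ.var 7 < s
    · refine (hf τ).trans ?_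
      rw [ENNReal.one_le_ofReal]
      refine Real.one_le_exp (mul_nonneg (by positivity) ?_)
      have : (σ.var 7 : ℝ) < s := by exact_mod_cast h
      linarith
    · rw [hf0 τ (hτ.2 h)]
      exact zero_le

/-- The mean is `δ = delta b ^ k`, and `g = -δ/4` gives the exponent `-Kδ²/16 + δ/4` at most. The
term `δ/4` comes from rounding the threshold up and explains the form of `TestParams.large`. -/
theorem test_wp_right (hK : TestParams (delta b ^ k) K θ) (hσ : Consts n σ)
    (ht : σ.var 6 = (K * L : ℕ)) (hθ : σ.var 7 = (θ * L : ℕ)) (hTS : marked n σ = S)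
    (f : Store → ℝ≥0∞) (hf : ∀ τ, f τ ≤ 1)
    (hf0 : ∀ τ, outSet n τ = outSet n σ ∪ S → f τ = 0) :
    wp (samples (noisyParity b k S hS)) testProg f σ ≤ ENNReal.ofReal (Real.exp (-3)) ^ L := by
  have h0 := pow_nonneg (delta_nonneg b) k
  have h1 : delta b ^ k ≤ 1 := pow_le_one₀ (delta_nonneg b) (delta_le_one b)
  refine test_exp_le (g := -(delta b ^ k / 4)) hσ ht hθ ?_ ?_ f fun s τ hτ => ?_
  · rw [abs_neg, abs_of_nonneg (by positivity)]
    linarith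
  · rw [hTS, realE_noisyParity_self]
    have := mul_le_mul_of_nonneg_left hK.upper h0
    nlinarith [hK.large]
  · by_cases h : σ.var 7 < s
    · rw [hf0 τ (hTS ▸ hτ.1 h)]
      exact zero_le
    · refine (hf τ).trans ?_
      rw [ENNReal.one_le_ofReal]
      refine Real.one_le_exp ?_
      have : (s : ℝ) ≤ σ.var 7 := by exact_mod_cast not_lt.1 h
      rw [neg_mul, ← mul_neg]
      exact mul_nonneg (by positivity) (by linarith)

end TestSuccess

end

noncomputable section

variable {D : PMF (List (ℤ × ℤ))}

/-! ### Repetition -/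

/-- Execute `p` a fixed number of times. -/
def rep : ℕ → Prog → Prog
  | 0, _ => .skip
  | m + 1, p => .seq p (rep m p)

theorem rep_wv (m : ℕ) (p : Prog) (y : ℕ) (h : ¬ p.wv y) : ¬ (rep m p).wv y := by
  induction m with
  | zero => simp [rep, Prog.wv]
  | succ m ih => simp [rep, Prog.wv, h, ih]

theorem rep_wa (m : ℕ) (p : Prog) (y : ℕ) (h : ¬ p.wa y) : ¬ (rep m p).wa y := by
  induction m with
  | zero => simp [rep, Prog.wa]
  | succ m ih => simp [rep, Prog.wa, h, ih]

section Rep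

variable {p : Prog} {B : ℕ} {I : ℕ → Store → Prop}

theorem rep_tri (h : ∀ r τ, I (r + 1) τ → Tri D p τ B (I r)) (M : ℕ) (σ : Store) (hI : I M σ) :
    Tri D (rep M p) σ (M * (B + 2) + 1) (I 0) := by
  induction M generalizing σ with
  | zero => exact Tri.straight (p := .skip) trivial (by simp [Prog.cost]) hI
  | succ M ih =>
    refine (Tri.seq ((h M σ hI).mono le_rfl fun τ hτ => ih τ hτ)).mono ?_ fun _ h => h
    rw [Nat.succ_mul]
    omega

theorem rep_wp (h : ∀ r τ, I (r + 1) τ → Tri D p τ B (I r)) (f : ℕ → Store → ℝ≥0∞)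
    (R : ℝ≥0∞ → ℝ≥0∞ → Prop) (hrefl : ∀ a, R a a) (htrans : ∀ a b c, R a b → R b c → R a c)
    (hmono : ∀ (q : Prog) (τ : Store) (B : ℕ) (Q : Store → Prop), Tri D q τ B Q →
      ∀ f g : Store → ℝ≥0∞, (∀ τ, Q τ → R (f τ) (g τ)) → R (wp D q f τ) (wp D q g τ))
    (hf : ∀ r τ, I (r + 1) τ → R (wp D p (f r) τ) (f (r + 1) τ)) (M : ℕ) (σ : Store) (hI : I M σ) :
    R (wp D (rep M p) (f 0) σ) (f M σ) := by
  induction M generalizing σ with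
  | zero =>
    rw [rep, wp_straight (p := .skip) trivial]
    exact hrefl _
  | succ M ih =>
    rw [rep, Tri.wp_seq ((h M σ hI).mono le_rfl fun τ hτ => rep_tri h M τ hτ)]
    exact htrans _ _ _ (hmono _ _ _ _ (h M σ hI) _ (f M) fun τ hτ => ih τ hτ) (hf M σ hI)

theorem rep_wp_eq (h : ∀ r τ, I (r + 1) τ → Tri D p τ B (I r)) (f : ℕ → Store → ℝ≥0∞)
    (hf : ∀ r τ, I (r + 1) τ → wp D p (f r) τ = f (r + 1) τ) (M : ℕ) (σ : Store) (hI : I M σ) :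
    wp D (rep M p) (f 0) σ = f M σ :=
  rep_wp h f (· = ·) (fun _ => rfl) (fun _ _ _ => Eq.trans)
    (fun _ _ _ _ ht _ _ hfg => ht.wp_congr hfg) hf M σ hI

theorem le_rep_wp (h : ∀ r τ, I (r + 1) τ → Tri D p τ B (I r)) (f : ℕ → Store → ℝ≥0∞)
    (hf : ∀ r τ, I (r + 1) τ → f (r + 1) τ ≤ wp D p (f r) τ) (M : ℕ) (σ : Store) (hI : I M σ) :
    f M σ ≤ wp D (rep M p) (f 0) σ :=
  rep_wp h f (· ≥ ·) (fun _ => le_rfl) (fun _ _ _ => ge_trans)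
    (fun _ _ _ _ ht _ _ hfg => ht.wp_mono hfg) hf M σ hI

end Rep

/-! ### Completing a partially determined configuration -/

section Complete

variable {m : ℕ}

/-- The cells from `p` on hold the spins of `x`. -/
def Agree (α : ℤ → ℤ) (p : ℕ) (x : Fin m → ℤˣ) : Prop := ∀ v : Fin m, p ≤ (v : ℕ) → α (v : ℕ) = (x v : ℤ)

open Classical in
/-- The expectation of `F`, weighted with `W`, when the first `p` spins are uniformly random and
the others are given by `α`. -/
def complete (p : ℕ) (W F : (Fin m → ℤˣ) → ℝ≥0∞) (α : ℤ → ℤ) : ℝ≥0∞ :=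
  ∑ x, if Agree α p x then 2⁻¹ ^ p * (W x * F x) else 0

theorem agree_update {α : ℤ → ℤ} {p : ℕ} (hp : p < m) {s : ℤˣ} {x : Fin m → ℤˣ} :
    Agree (Function.update α (p : ℤ) (s : ℤ)) p x ↔ Agree α (p + 1) x ∧ x ⟨p, hp⟩ = s := by
  constructor
  · intro h
    refine ⟨fun v hv => ?_, ?_⟩
    · rw [← h v (by omega), Function.update_of_ne]
      intro he
      have : (v : ℕ) = p := by exact_mod_cast he
      omega
    · have := h ⟨p, hp⟩ le_rfl
      simp only [Function.update_self] at this
      exact (Units.ext this).symm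
  · rintro ⟨h, hs⟩ v hv
    by_cases hvp : (v : ℕ) = p
    · obtain rfl : v = ⟨p, hp⟩ := Fin.ext hvp
      simp [hs]
    · rw [Function.update_of_ne (by exact_mod_cast hvp)]
      exact h v (by omega)

/-- Conditioning on the spin in cell `p`. The generator fills the array from the top down, so each
random write lowers the number of undetermined spins by one. -/
theorem complete_succ {p : ℕ} (hp : p < m) (W F : (Fin m → ℤˣ) → ℝ≥0∞) (α : ℤ → ℤ) :
    complete (p + 1) W F α = 2⁻¹ * complete p W F (Function.update α (p : ℤ) 1)
      + 2⁻¹ * complete p W F (Function.update α (p : ℤ) (-1)) := by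
  classical
  have h1 : (1 : ℤ) = ((1 : ℤˣ) : ℤ) := rfl
  have h2 : (-1 : ℤ) = ((-1 : ℤˣ) : ℤ) := rfl
  simp only [complete]
  rw [h2, h1, Finset.mul_sum, Finset.mul_sum, ← Finset.sum_add_distrib]
  refine Finset.sum_congr rfl fun x _ => ?_
  simp only [agree_update hp]
  rcases Int.units_eq_one_or (x ⟨p, hp⟩) with h | h
  · by_cases hA : Agree α (p + 1) x <;> simp [h, hA, pow_succ']
    ring
  · by_cases hA : Agree α (p + 1) x <;> simp [h, hA, pow_succ']
    ring

theorem complete_mul {p : ℕ} (W w F : (Fin m → ℤˣ) → ℝ≥0∞) (α : ℤ → ℤ) (c : ℝ≥0∞)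
    (h : ∀ x, Agree α p x → w x = c) : complete p (fun x => W x * w x) F α = c * complete p W F α := by
  classical
  simp only [complete, Finset.mul_sum]
  refine Finset.sum_congr rfl fun x _ => ?_
  split_ifs with hA
  · rw [h x hA]
    ring
  · simp

theorem complete_top (W F : (Fin m → ℤˣ) → ℝ≥0∞) (α : ℤ → ℤ) :
    complete m W F α = ∑ x, 2⁻¹ ^ m * (W x * F x) := by
  classical
  refine Finset.sum_congr rfl fun x _ => if_pos fun v hv => ?_
  have := v.2
  omega

/-- The spin in position `c`. -/
def spinAt (x : Fin m → ℤˣ) (c : ℕ) : ℝ := if h : c < m then sgn (x ⟨c, h⟩) else 1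

theorem Agree.spinAt {α : ℤ → ℤ} {p : ℕ} {x : Fin m → ℤˣ} (h : Agree α p x) {c : ℕ} (hc : p ≤ c)
    (hcm : c < m) : spinAt x c = α c := by
  rw [_root_.spinAt, dif_pos hcm, h ⟨c, hcm⟩ hc]
  rfl

end Complete

/-! ### Sampling from a product of noisy parities -/

section Generate

/-- A fair coin. -/
def half : unitInterval := ⟨1 / 2, by norm_num, by norm_num⟩

theorem wp_flip_half (x : ℕ) (f : Store → ℝ≥0∞) (σ : Store) :
    wp D (.flip x half) f σ = 2⁻¹ * f (σ.setVar x 1) + 2⁻¹ * f (σ.setVar x 0) := by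
  have h : ENNReal.ofReal (1 / 2) = 2⁻¹ := by
    rw [one_div, ENNReal.ofReal_inv_of_pos (by norm_num)]
    simp
  rw [wp_flip]
  simp only [half]
  rw [show (1 : ℝ) - 1 / 2 = 1 / 2 by norm_num, h]

/-- The coin that determines the last spin of a parity. -/
def bias (b : ℝ) (k : ℕ) : unitInterval := ⟨(1 + delta b ^ k) / 2, by
  have := pow_nonneg (delta_nonneg b) k
  have h2 : delta b ^ k ≤ 1 := pow_le_one₀ (delta_nonneg b) (delta_le_one b)
  constructor <;> linarith⟩

/-- Write a uniformly random spin in front of position `40`, and update the product `41`. -/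
def unifProg : Prog := .seq (.sub 40 40 1) (.seq (.flip 42 half) (.ite 42 (.store 1 40 1)
  (.seq (.sub 43 9 1) (.seq (.store 1 40 43) (.sub 41 9 41)))))

/-- Write a biased copy of the product `41` in front of position `40`. -/
def biasProg (b : ℝ) (k : ℕ) : Prog := .seq (.sub 40 40 1) (.seq (.flip 42 (bias b k))
  (.ite 42 (.store 1 40 41) (.seq (.sub 43 9 41) (.store 1 40 43))))

/-- Write a noisy parity in front of position `40`. -/
def blockProg (b : ℝ) (k : ℕ) : Prog :=
  .seq (.const 41 1) (.seq (rep (2 * k + 1) unifProg) (biasProg b k))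

variable {m : ℕ} {σ : Store}

theorem unif_tail (h1 : σ.var 1 = 1) (h9 : σ.var 9 = 0) {p : ℕ} (hp : σ.var 40 = (p + 1 : ℕ)) (z : ℤ)
    (hz : z = 0 ∨ z = 1) :
    Tri D (.ite 42 (.store 1 40 1) (.seq (.sub 43 9 1) (.seq (.store 1 40 43) (.sub 41 9 41))))
      (((Prog.sub 40 40 1).exec σ).setVar 42 z) 6 fun τ => τ.var 40 = p ∧
        τ.var 41 = (if z = 1 then 1 else -1) * σ.var 41 ∧
        τ.arr 1 = Function.update (σ.arr 1) (p : ℤ) (if z = 1 then 1 else -1) := by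
  refine Tri.straight (by simp [Prog.straight]) (by simp [Prog.cost]) ?_
  rcases hz with rfl | rfl <;> simp [Prog.exec, hp, h1, h9, Store.setArr]

theorem unif_seq (h1 : σ.var 1 = 1) (h9 : σ.var 9 = 0) {p : ℕ} (hp : σ.var 40 = (p + 1 : ℕ)) :
    Tri D (.seq (.flip 42 half) (.ite 42 (.store 1 40 1)
      (.seq (.sub 43 9 1) (.seq (.store 1 40 43) (.sub 41 9 41))))) ((Prog.sub 40 40 1).exec σ) 8
      fun τ => τ.var 40 = p ∧ ∃ s : ℤˣ, τ.var 41 = s * σ.var 41 ∧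
        τ.arr 1 = Function.update (σ.arr 1) (p : ℤ) s := by
  refine Tri.seq (B := 1) (B' := 6) (Tri.flip fun z hz => (unif_tail h1 h9 hp z hz).mono le_rfl fun τ hτ => ?_)
  refine ⟨hτ.1, if z = 1 then 1 else -1, ?_, ?_⟩
  · rw [hτ.2.1]
    split_ifs <;> rfl
  · rw [hτ.2.2]
    split_ifs <;> rfl

theorem unif_tri (h1 : σ.var 1 = 1) (h9 : σ.var 9 = 0) {p : ℕ} (hp : σ.var 40 = (p + 1 : ℕ)) :
    Tri D unifProg σ 10 fun τ => τ.var 40 = p ∧ ∃ s : ℤˣ, τ.var 41 = s * σ.var 41 ∧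
        τ.arr 1 = Function.update (σ.arr 1) (p : ℤ) s :=
  Tri.straight_seq (p := .sub 40 40 1) trivial (unif_seq h1 h9 hp)

theorem unif_wp (h1 : σ.var 1 = 1) (h9 : σ.var 9 = 0) {p : ℕ} (hpm : p < m)
    (hp : σ.var 40 = (p + 1 : ℕ)) (W F : (Fin m → ℤˣ) → ℝ≥0∞) :
    wp D unifProg (fun τ => complete p W F (τ.arr 1)) σ = complete (p + 1) W F (σ.arr 1) := by
  have ht := unif_tail (D := D) h1 h9 hp
  rw [unifProg, (unif_seq h1 h9 hp).wp_straight_seq (p := .sub 40 40 1) trivial,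
    Tri.wp_seq (B := 1) (B' := 6) (Q := fun _ => True)
      (Tri.flip fun z hz => (ht z hz).mono le_rfl fun _ _ => trivial), wp_flip_half, complete_succ hpm,
    (ht 1 (Or.inr rfl)).wp_eq_const (fun τ hτ => by rw [hτ.2.2]),
    (ht 0 (Or.inl rfl)).wp_eq_const (fun τ hτ => by rw [hτ.2.2])]
  rfl

theorem bias_tail (h1 : σ.var 1 = 1) (h9 : σ.var 9 = 0) {p : ℕ}
    (hp : σ.var 40 = (p + 1 : ℕ)) (z : ℤ) (hz : z = 0 ∨ z = 1) :
    Tri D (.ite 42 (.store 1 40 41) (.seq (.sub 43 9 41) (.store 1 40 43)))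
      (((Prog.sub 40 40 1).exec σ).setVar 42 z) 4 fun τ => τ.var 40 = p ∧
        τ.arr 1 = Function.update (σ.arr 1) (p : ℤ) ((if z = 1 then 1 else -1) * σ.var 41) := by
  refine Tri.straight (by simp [Prog.straight]) (by simp [Prog.cost]) ?_
  rcases hz with rfl | rfl <;> simp [Prog.exec, hp, h1, h9, Store.setArr]

theorem bias_seq (b : ℝ) (k : ℕ) (h1 : σ.var 1 = 1) (h9 : σ.var 9 = 0) {p : ℕ}
    (hp : σ.var 40 = (p + 1 : ℕ)) :
    Tri D (.seq (.flip 42 (bias b k)) (.ite 42 (.store 1 40 41) (.seq (.sub 43 9 41) (.store 1 40 43))))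
      ((Prog.sub 40 40 1).exec σ) 6 fun τ => τ.var 40 = p :=
  Tri.seq (B := 1) (B' := 4) (Tri.flip fun z hz => (bias_tail h1 h9 hp z hz).mono le_rfl fun _ hτ => hτ.1)

theorem bias_tri (b : ℝ) (k : ℕ) (h1 : σ.var 1 = 1) (h9 : σ.var 9 = 0) {p : ℕ}
    (hp : σ.var 40 = (p + 1 : ℕ)) : Tri D (biasProg b k) σ 8 fun τ => τ.var 40 = p :=
  Tri.straight_seq (p := .sub 40 40 1) trivial (bias_seq b k h1 h9 hp)

/-- The coin writes the spin `s` with probability `(1 + δ_b^k)/2` and `-s` otherwise. A spin `e`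
thus has probability `(1 + δ_b^k e s)/2`: a fair coin, reweighted with the density `w`. -/
theorem bias_wp (b : ℝ) (k : ℕ) (h1 : σ.var 1 = 1) (h9 : σ.var 9 = 0) {p : ℕ} (hpm : p < m)
    (hp : σ.var 40 = (p + 1 : ℕ)) {s : ℤˣ} (hs : σ.var 41 = s) (W w F : (Fin m → ℤˣ) → ℝ≥0∞)
    (hw : ∀ x, Agree (σ.arr 1) (p + 1) x →
      w x = ENNReal.ofReal (1 + delta b ^ k * (spinAt x p * sgn s))) :
    wp D (biasProg b k) (fun τ => complete p W F (τ.arr 1)) σ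
      = complete (p + 1) (fun x => W x * w x) F (σ.arr 1) := by
  have ht := bias_tail (D := D) h1 h9 hp
  have h0 := pow_nonneg (delta_nonneg b) k
  have h2 : delta b ^ k ≤ 1 := pow_le_one₀ (delta_nonneg b) (delta_le_one b)
  have hhalf : ∀ y : ℝ, ENNReal.ofReal (y / 2) = 2⁻¹ * ENNReal.ofReal y := fun y => by
    rw [div_eq_inv_mul, ENNReal.ofReal_mul (by norm_num), ENNReal.ofReal_inv_of_pos (by norm_num)]
    simp
  have hv : ∀ e : ℤˣ, complete p (fun x => W x * w x) F (Function.update (σ.arr 1) (p : ℤ) (e : ℤ))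
      = ENNReal.ofReal (1 + delta b ^ k * (sgn e * sgn s))
        * complete p W F (Function.update (σ.arr 1) (p : ℤ) (e : ℤ)) := fun e => by
    refine complete_mul W w F _ _ fun x hx => ?_
    have hx' := (agree_update hpm).1 hx
    rw [hw x hx'.1, spinAt, dif_pos hpm, hx'.2]
  have hv1 := hv 1
  have hv2 := hv (-1)
  simp only [Units.val_one, Units.val_neg] at hv1 hv2
  rw [biasProg, (bias_seq b k h1 h9 hp).wp_straight_seq (p := .sub 40 40 1) trivial,
    Tri.wp_seq (B := 1) (B' := 4) (Q := fun _ => True)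
      (Tri.flip fun z hz => (ht z hz).mono le_rfl fun _ _ => trivial), wp_flip, complete_succ hpm,
    (ht 1 (Or.inr rfl)).wp_eq_const (fun τ hτ => by rw [hτ.2]),
    (ht 0 (Or.inl rfl)).wp_eq_const (fun τ hτ => by rw [hτ.2]), hv1, hv2, hs]
  have hb : ENNReal.ofReal (bias b k) = 2⁻¹ * ENNReal.ofReal (1 + delta b ^ k) := by
    rw [← hhalf]
    rfl
  have hb' : ENNReal.ofReal (1 - bias b k) = 2⁻¹ * ENNReal.ofReal (1 - delta b ^ k) := by
    rw [← hhalf]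
    congr 1
    simp only [bias]
    ring
  rw [hb, hb']
  rcases Int.units_eq_one_or s with rfl | rfl
  · simp [sgn_one, sgn_neg, mul_assoc, sub_eq_add_neg]
  · simp [sgn_one, sgn_neg, mul_assoc, sub_eq_add_neg, add_comm]

/-- The density of a noisy parity in positions `q, …, q + 2 k + 1`. -/
def blockWeight (b : ℝ) (k q : ℕ) (x : Fin m → ℤˣ) : ℝ≥0∞ :=
  ENNReal.ofReal (1 + delta b ^ k * ∏ l ∈ Finset.range (2 * k + 2), spinAt x (q + l))

/-- The state of affairs when `r` uniform spins remain to be written in front of `q + 2 k + 2`. -/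
structure BlockInv (k q r : ℕ) (τ : Store) : Prop where
  one : τ.var 1 = 1
  zero : τ.var 9 = 0
  pos : τ.var 40 = (q + 1 + r : ℕ)
  le : r ≤ 2 * k + 1
  prod : ∃ s : ℤˣ, τ.var 41 = s ∧ ((s : ℤ) : ℝ) = ∏ l ∈ Finset.Ico (r + 1) (2 * k + 2), (τ.arr 1 ((q + l : ℕ) : ℤ) : ℝ)

theorem BlockInv.step {k q r : ℕ} {τ : Store} (h : BlockInv k q (r + 1) τ) :
    Tri D unifProg τ 10 (BlockInv k q r) := by
  refine (unif_tri h.one h.zero (p := q + 1 + r) h.pos).frame.mono le_rfl fun ρ hρ => ?_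
  obtain ⟨⟨h40, s, h41, ha⟩, hF⟩ := hρ
  obtain ⟨s', hs', hprod⟩ := h.prod
  refine ⟨?_, ?_, h40, by have := h.le; omega, s * s', ?_, ?_⟩
  · rw [hF.1 1 (by simp [unifProg, Prog.wv]), h.one]
  · rw [hF.1 9 (by simp [unifProg, Prog.wv]), h.zero]
  · rw [h41, hs']
    simp
  · have hle := h.le
    rw [Finset.prod_eq_prod_Ico_succ_bot (by omega), ha]
    push_cast
    rw [hprod]
    congr 1
    · have : ((q : ℤ) + ((r : ℤ) + 1)) = (q : ℤ) + 1 + r := by ring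
      rw [this, Function.update_self]
    · refine Finset.prod_congr rfl fun l hl => ?_
      rw [Finset.mem_Ico] at hl
      rw [Function.update_of_ne]
      · push_cast
        rfl
      · omega

theorem block_inv {k q : ℕ} (h1 : σ.var 1 = 1) (h9 : σ.var 9 = 0)
    (hp : σ.var 40 = (q + 2 * k + 2 : ℕ)) :
    BlockInv k q (2 * k + 1) ((Prog.const 41 1).exec σ) where
  one := by simp [Prog.exec, h1]
  zero := by simp [Prog.exec, h9]
  pos := by
    simp [Prog.exec, hp]
    ring
  le := le_rfl
  prod := ⟨1, by simp [Prog.exec], by simp⟩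

theorem block_seq (b : ℝ) {k q : ℕ} (h1 : σ.var 1 = 1) (h9 : σ.var 9 = 0)
    (hp : σ.var 40 = (q + 2 * k + 2 : ℕ)) :
    Tri D (rep (2 * k + 1) unifProg) ((Prog.const 41 1).exec σ) (24 * k + 13) fun τ =>
      Tri D (biasProg b k) τ 8 fun τ => τ.var 40 = q :=
  (rep_tri (I := BlockInv k q) (fun r τ hτ => BlockInv.step hτ) _ _ (block_inv h1 h9 hp)).mono (by omega)
    fun τ hτ => bias_tri b k hτ.one hτ.zero hτ.pos

theorem block_tri (b : ℝ) {k q : ℕ} (h1 : σ.var 1 = 1) (h9 : σ.var 9 = 0)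
    (hp : σ.var 40 = (q + 2 * k + 2 : ℕ)) :
    Tri D (blockProg b k) σ (24 * k + 25) fun τ => τ.var 40 = q :=
  (Tri.straight_seq (p := .const 41 1) trivial (Tri.seq (block_seq b h1 h9 hp))).mono
    (by rw [show (Prog.const 41 1).cost = 1 from rfl]; omega) fun _ h => h

/-- Cells `q + 2k + 1, …, q + 1` receive uniform spins, and cell `q` a biased copy of their product.
Only this last write contributes to the density, and at that moment all other spins of the block are
determined. -/
theorem block_wp (b : ℝ) {k q : ℕ} (h1 : σ.var 1 = 1) (h9 : σ.var 9 = 0)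
    (hp : σ.var 40 = (q + 2 * k + 2 : ℕ)) (hm : q + 2 * k + 2 ≤ m) (W F : (Fin m → ℤˣ) → ℝ≥0∞) :
    wp D (blockProg b k) (fun τ => complete q W F (τ.arr 1)) σ
      = complete (q + 2 * k + 2) (fun x => W x * blockWeight b k q x) F (σ.arr 1) := by
  have hI := block_inv (k := k) (q := q) h1 h9 hp
  have hT := rep_tri (D := D) (I := BlockInv k q) (fun r τ hτ => BlockInv.step hτ) _ _ hI
  rw [blockProg, (Tri.seq (block_seq b h1 h9 hp)).wp_straight_seq (p := .const 41 1) trivial,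
    Tri.wp_seq (block_seq b h1 h9 hp)]
  rw [hT.wp_congr (g := fun τ => complete (q + 1) (fun x => W x * blockWeight b k q x) F (τ.arr 1))]
  · rw [rep_wp_eq (I := BlockInv k q) (fun r τ hτ => BlockInv.step hτ) (fun r τ => complete (q + 1 + r)
      (fun x => W x * blockWeight b k q x) F (τ.arr 1)) (fun r τ hτ => ?_) _ _ hI]
    · rw [show q + 1 + (2 * k + 1) = q + 2 * k + 2 by ring]
      rfl
    · exact unif_wp (p := q + 1 + r) hτ.one hτ.zero (by have := hτ.le; omega) hτ.pos _ _
  · intro τ hτ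
    obtain ⟨s, hs, hprod⟩ := hτ.prod
    refine bias_wp b k hτ.one hτ.zero (by omega) hτ.pos hs W _ F fun x hx => ?_
    rw [blockWeight, Finset.range_eq_Ico, Finset.prod_eq_prod_Ico_succ_bot (by omega), add_zero]
    have : sgn s = ((s : ℤ) : ℝ) := rfl
    rw [this, hprod]
    congr 4
    refine Finset.prod_congr rfl fun l hl => ?_
    rw [Finset.mem_Ico] at hl
    exact hx.spinAt (by omega) (by omega)

end Generate

end

noncomputable section

variable {D : PMF (List (ℤ × ℤ))}

/-! ### The simulated samples -/

/-- Both sides have total mass one, so neither leaves room for a strict inequality. For the sample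
generator it therefore suffices to bound expectations on one side. -/
theorem PMF.eq_of_le {α : Type*} {p q : PMF α} (h : ∀ a, p a ≤ q a) : p = q := by
  refine PMF.ext fun a => le_antisymm (h a) ?_
  by_contra hlt
  have := ENNReal.tsum_lt_tsum (by rw [p.tsum_coe]; exact ENNReal.one_ne_top) h (not_le.1 hlt)
  rw [p.tsum_coe, q.tsum_coe] at this
  exact lt_irrefl _ this

theorem pmf_eq_of_expect_le {α : Type*} {p q : PMF α} (h : ∀ f : α → ℝ≥0∞, expect p f ≤ expect q f) :
    p = q := by
  classical
  refine PMF.eq_of_le fun a => ?_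
  have := h fun a' => if a' = a then 1 else 0
  simpa [expect] using this

section Positions

variable {n k : ℕ} (S : Finset (Fin n)) (hS : S.card = 2 * k + 2)

/-- The supports of the noisy parities: the hidden set, followed by consecutive intervals. -/
def pos : Option (Fin n) → ℕ → Fin (n + (2 * k + 2) * n)
  | none, l => Fin.castLE (Nat.le_add_right _ _) (S.orderEmbOfFin hS ⟨l % (2 * k + 2), Nat.mod_lt _ (by omega)⟩)
  | some j, l => ⟨n + (2 * k + 2) * j + l % (2 * k + 2), by
      have h1 := Nat.mod_lt l (show 0 < 2 * k + 2 by omega)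
      have h2 := Nat.mul_le_mul_left (2 * k + 2) (show (j : ℕ) + 1 ≤ n from j.2)
      rw [Nat.mul_succ] at h2
      omega⟩

theorem pos_inj {o o' : Option (Fin n)} {l l' : ℕ} (hl : l < 2 * k + 2) (hl' : l' < 2 * k + 2)
    (h : pos S hS o l = pos S hS o' l') : o = o' ∧ l = l' := by
  cases o with
  | none =>
    cases o' with
    | none =>
      have := (S.orderEmbOfFin hS).injective (Fin.castLE_injective (Nat.le_add_right _ _) h)
      simpa [Nat.mod_eq_of_lt hl, Nat.mod_eq_of_lt hl'] using this
    | some j' =>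
      have h1 := congrArg Fin.val h
      have h2 := (S.orderEmbOfFin hS ⟨l % (2 * k + 2), Nat.mod_lt _ (by omega)⟩).2
      simp only [pos, Fin.val_castLE] at h1
      omega
  | some j =>
    cases o' with
    | none =>
      have h1 := congrArg Fin.val h
      have h2 := (S.orderEmbOfFin hS ⟨l' % (2 * k + 2), Nat.mod_lt _ (by omega)⟩).2
      simp only [pos, Fin.val_castLE] at h1
      omega
    | some j' =>
      have h1 := congrArg Fin.val h
      simp only [pos, Nat.mod_eq_of_lt hl, Nat.mod_eq_of_lt hl', add_assoc, Nat.add_left_cancel_iff] at h1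
      have h3 : (j : ℕ) = j' := by
        have e1 : ((2 * k + 2) * (j : ℕ) + l) / (2 * k + 2) = j := by
          rw [Nat.mul_add_div (by omega), Nat.div_eq_of_lt hl, add_zero]
        have e2 : ((2 * k + 2) * (j' : ℕ) + l') / (2 * k + 2) = j' := by
          rw [Nat.mul_add_div (by omega), Nat.div_eq_of_lt hl', add_zero]
        rw [← e1, ← e2, h1]
      rw [h3] at h1
      exact ⟨congrArg some (Fin.ext h3), by omega⟩

theorem prod_pos_none (x : Fin (n + (2 * k + 2) * n) → ℤˣ) :
    ∏ l ∈ Finset.range (2 * k + 2), sgn (x (pos S hS none l))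
      = chi S fun v => x (Fin.castLE (Nat.le_add_right _ _) v) := by
  have h : S = Finset.univ.map (S.orderEmbOfFin hS).toEmbedding := by
    rw [Finset.map_orderEmbOfFin_univ]
  rw [chi, Finset.prod_range]
  conv_rhs => rw [h]
  rw [Finset.prod_map]
  refine Finset.prod_congr rfl fun l _ => ?_
  simp [pos, Nat.mod_eq_of_lt l.2]

theorem prod_pos_some (x : Fin (n + (2 * k + 2) * n) → ℤˣ) (j : Fin n) :
    ∏ l ∈ Finset.range (2 * k + 2), sgn (x (pos S hS (some j) l))
      = ∏ l ∈ Finset.range (2 * k + 2), spinAt x (n + (2 * k + 2) * j + l) := by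
  refine Finset.prod_congr rfl fun l hl => ?_
  have hl := Finset.mem_range.1 hl
  have : n + (2 * k + 2) * j + l < n + (2 * k + 2) * n := by
    have h2 := Nat.mul_le_mul_left (2 * k + 2) (show (j : ℕ) + 1 ≤ n from j.2)
    rw [Nat.mul_succ] at h2
    omega
  rw [spinAt, dif_pos this]
  simp only [pos, Nat.mod_eq_of_lt hl]

end Positions

section Visible

variable (m N : ℕ)

/-- The visible vertices. -/
def visible : Finset (Fin N) := Finset.univ.filter fun v => (v : ℕ) < m

variable {m N}

/-- The enumeration of the visible vertices. -/
def visibleEquiv (h : m ≤ N) : visible m N ≃ Fin m where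
  toFun v := ⟨v.1, (Finset.mem_filter.1 v.2).2⟩
  invFun v := ⟨Fin.castLE h v, Finset.mem_filter.2 ⟨Finset.mem_univ _, v.2⟩⟩
  left_inv _ := rfl
  right_inv _ := rfl

theorem card_visible (h : m ≤ N) : (visible m N).card = m := by
  have := Fintype.card_congr (visibleEquiv h)
  simpa using this

theorem write_visible_arr (h : m ≤ N) (y : visible m N → ℤˣ) (σ : Store) (a : ℕ) (v : Fin m) :
    (σ.write a (entries (visible m N) y)).arr a (v : ℕ) = (y ((visibleEquiv h).symm v) : ℤˣ) :=
  write_entries_arr (visible m N) y σ a (i := Fin.castLE h v) ((visibleEquiv h).symm v).2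

theorem write_visible_arr_of_le (y : visible m N → ℤˣ) (σ : Store) (a : ℕ) (i : ℤ)
    (hi : ∀ v : Fin m, ((v : ℕ) : ℤ) ≠ i) : (σ.write a (entries (visible m N) y)).arr a i = σ.arr a i :=
  write_entries_arr_of_not_mem _ _ _ _ fun v hv => hi ⟨v, (Finset.mem_filter.1 hv).2⟩

end Visible

section Planted

variable {n k : ℕ} (S : Finset (Fin n)) (hS : S.card = 2 * k + 2) {N : ℕ}
  (hN : n + (2 * k + 2) * n ≤ N) (π : Equiv.Perm (Fin (n + (2 * k + 2) * n)))

/-- The supports of the parities, as sets of visible vertices. -/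
def site (o : Option (Fin n)) (l : ℕ) : visible (n + (2 * k + 2) * n) N :=
  (visibleEquiv hN).symm (π.symm (pos S hS o l))

theorem site_inj (o o' : Option (Fin n)) (l l' : ℕ) (hl : l < 2 * k + 2) (hl' : l' < 2 * k + 2)
    (h : site S hS hN π o l = site S hS hN π o' l') : o = o' ∧ l = l' :=
  pos_inj S hS hl hl' (π.symm.injective ((visibleEquiv hN).symm.injective h))

/-- The joint density of the coordinates. -/
def plantedWeight (b : ℝ) (i : ℕ) (x : Fin (n + (2 * k + 2) * n) → ℤˣ) : ℝ≥0∞ :=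
  ENNReal.ofReal (1 + delta b ^ k * chi S fun v => x (Fin.castLE (Nat.le_add_right _ _) v))
    * ∏ j ∈ Finset.range i, blockWeight b k (n + (2 * k + 2) * j) x

theorem plantedWeight_eq (b : ℝ) (x : Fin (n + (2 * k + 2) * n) → ℤˣ) :
    plantedWeight (k := k) S b n x = ENNReal.ofReal (parityDensity (delta b) k (site S hS hN π)
      fun v => x (π (visibleEquiv hN v))) := by
  have h0 := pow_nonneg (delta_nonneg b) k
  have h1 : delta b ^ k ≤ 1 := pow_le_one₀ (delta_nonneg b) (delta_le_one b)
  rw [parityDensity, ENNReal.ofReal_prod_of_nonneg fun o _ => one_add_mul_prod_nonneg h0 h1 _ fun l => _,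
    Fintype.prod_option, plantedWeight]
  simp only [site, Equiv.apply_symm_apply]
  rw [prod_pos_none, Finset.prod_range]
  congr 1
  refine Finset.prod_congr rfl fun j _ => ?_
  rw [prod_pos_some, blockWeight]

/-- Relabelling is a bijection of configurations, and under it the joint density of the coordinates
becomes the density of the planted parities at their sites. -/
theorem sum_planted (b : ℝ) {Q : PMF (visible (n + (2 * k + 2) * n) N → ℤˣ)}
    (hQ : ∀ y, Q y = ENNReal.ofReal ((2 : ℝ)⁻¹ ^ (visible (n + (2 * k + 2) * n) N).card *
      parityDensity (delta b) k (site S hS hN π) y)) (f : (visible (n + (2 * k + 2) * n) N → ℤˣ) → ℝ≥0∞) :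
    complete (n + (2 * k + 2) * n) (plantedWeight (k := k) S b n)
      (fun x => f fun v => x (π (visibleEquiv hN v))) (fun _ => 0) = expect Q f := by
  rw [complete_top, expect_fintype]
  refine Fintype.sum_equiv (Equiv.arrowCongr ((visibleEquiv hN).trans π).symm (Equiv.refl _)) _ _ fun x => ?_
  have hx : (Equiv.arrowCongr ((visibleEquiv hN).trans π).symm (Equiv.refl ℤˣ)) x
      = fun v => x (π (visibleEquiv hN v)) := rfl
  rw [hx, hQ, card_visible hN, plantedWeight_eq S hS hN π, ENNReal.ofReal_mul (by positivity),
    ENNReal.ofReal_pow (by norm_num), ENNReal.ofReal_inv_of_pos (by norm_num)]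
  simp [mul_assoc]

end Planted

/-! ### The sample generator -/

section Generator

/-- Copy the permuted coordinates into a simulated array. -/
def copyProg (a : ℕ) : Prog := .seq (.load 44 2 14) (.seq (.load 45 1 44)
  (.seq (.store (2 * a + 10) 14 45) (.store (2 * a + 11) 14 4)))

/-- The last part of the sample generator. -/
def genTail (a : ℕ) : Prog := .seq (.sample 1) (forTo 14 2 (copyProg a))

/-- Produce a sample of the planted distribution in a simulated array. -/
def genProg (b : ℝ) (k a : ℕ) : Prog := .seq (.add 40 2 9) (.seq (forTo 13 0 (blockProg b k)) (genTail a))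

variable {n k m N : ℕ} {σ : Store}

theorem blockProg_wv (b : ℝ) (k y : ℕ) (h : y < 40 ∨ 43 < y) : ¬ (blockProg b k).wv y := by
  simp only [blockProg, biasProg, Prog.wv, not_or, not_false_eq_true, and_true, true_and]
  exact ⟨by omega, rep_wv _ _ _ (by simp only [unifProg, Prog.wv, false_or]; omega), by omega⟩

theorem blockProg_wa (b : ℝ) (k a : ℕ) (h : a ≠ 1) : ¬ (blockProg b k).wa a := by
  simp only [blockProg, biasProg, Prog.wa, not_or]
  exact ⟨by tauto, rep_wa _ _ _ (by simp only [unifProg, Prog.wa]; tauto), by tauto⟩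

theorem genProg_wv (b : ℝ) (k a y : ℕ) (h : y ≠ 13) (h' : y ≠ 14) (h2 : y < 40 ∨ 45 < y) :
    ¬ (genProg b k a).wv y := by
  simp only [genProg, genTail, copyProg, forTo_wv, Prog.wv, not_or, not_false_eq_true, and_true, true_and]
  exact ⟨by omega, ⟨h, blockProg_wv b k y (by omega)⟩, h', by omega⟩

theorem genProg_wa (b : ℝ) (k a c : ℕ) (h : c ≠ 1) (h1 : c ≠ 2 * a + 10) (h2 : c ≠ 2 * a + 11) :
    ¬ (genProg b k a).wa c := by
  simp only [genProg, genTail, copyProg, forTo_wa, Prog.wa, not_or]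
  exact ⟨by tauto, blockProg_wa b k c h, h, by tauto⟩

/-- The state of affairs when samples are generated: the relabelling `π` is in array `2`. -/
structure GenInv (n k : ℕ) (π : Equiv.Perm (Fin (n + (2 * k + 2) * n))) (σ : Store) : Prop where
  consts : Consts n σ
  count : σ.var 2 = (n + (2 * k + 2) * n : ℕ)
  perm : ∀ v, σ.arr 2 ((v : Fin (n + (2 * k + 2) * n)) : ℕ) = (π v : ℕ)

variable {π : Equiv.Perm (Fin (n + (2 * k + 2) * n))}

/-- The copy also stamps the cells with the current round. Cells outside the sample keep both value
and stamp, as they would when a real sample is written. -/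
theorem copy_hyp (h : GenInv n k π σ) (a : ℕ) :
    ForHyp D 14 2 (copyProg a) (n + (2 * k + 2) * n) 7 (fun i τ =>
      (∀ v : Fin (n + (2 * k + 2) * n), i ≤ (v : ℕ) →
        τ.arr (2 * a + 10) (v : ℕ) = σ.arr 1 (π v : ℕ) ∧ τ.arr (2 * a + 11) (v : ℕ) = σ.var 4) ∧
      ∀ z : ℤ, (∀ v : Fin (n + (2 * k + 2) * n), i ≤ (v : ℕ) → ((v : ℕ) : ℤ) ≠ z) →
        τ.arr (2 * a + 10) z = σ.arr (2 * a + 10) z ∧ τ.arr (2 * a + 11) z = σ.arr (2 * a + 11) z) σ where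
  bound := h.count
  one := h.consts.one
  zero := h.consts.zero
  ne := by decide
  counter := by simp [copyProg, Prog.wv]
  wone := by simp [copyProg, Prog.wv]
  init := ⟨fun v hv => absurd v.2 (not_lt.2 hv), fun z _ => ⟨rfl, rfl⟩⟩
  body := by
    intro i hi τ hI hc hF
    have h1 : τ.arr 1 = σ.arr 1 := hF.2 1 (by simp [copyProg, Prog.wa])
    have h2 : τ.arr 2 = σ.arr 2 := hF.2 2 (by simp [copyProg, Prog.wa])
    have h4 : τ.var 4 = σ.var 4 := hF.1 4 (by simp [copyProg, Prog.wv])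
    refine Tri.straight (by simp [copyProg, Prog.straight]) (by simp [copyProg, Prog.cost]) ?_
    have hp := h.perm ⟨i, hi⟩
    simp only at hp
    simp only [copyProg, Prog.exec, Store.setVar_var, Store.setVar_arr, Store.setArr_var,
      Store.setArr_arr, h1, h2, h4, if_true, true_and]
    constructor
    · intro v hv
      by_cases hvi : (v : ℕ) = i
      · obtain rfl : v = ⟨i, hi⟩ := Fin.ext hvi
        simp [hp]
      · have := hI.1 v (by omega)
        simp [hvi, this]
    · intro z hz
      have hzi : z ≠ i := fun he => hz ⟨i, hi⟩ le_rfl he.symm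
      have := hI.2 z fun v hv => hz v (by omega)
      simp [hzi, this]

theorem copy_tri (h : GenInv n k π σ) (hN : n + (2 * k + 2) * n ≤ N) (a : ℕ) :
    Tri D (forTo 14 2 (copyProg a)) σ (10 * (n + (2 * k + 2) * n) + 3) fun τ =>
      (Stamped σ → Stamped τ) ∧ ∀ x : Fin (n + (2 * k + 2) * n) → ℤˣ, Agree (σ.arr 1) 0 x →
        τ.decode = σ.decode.write a (entries (visible (n + (2 * k + 2) * n) N)
          fun v => x (π (visibleEquiv hN v))) := by
  refine (copy_hyp h a).tri.mono (by omega) fun τ hτ => ?_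
  obtain ⟨hτ, -, hF⟩ := hτ
  have hF1 : ∀ b, b ≠ 2 * a + 10 → b ≠ 2 * a + 11 → τ.arr b = σ.arr b := fun b h1 h2 =>
    hF.2 b (by simp [copyProg, Prog.wa, h1, h2])
  have hFv : ∀ y, 60 ≤ y ∨ y = 4 → τ.var y = σ.var y := fun y hy =>
    hF.1 y (by simp only [forTo_wv, copyProg, Prog.wv, or_false]; omega)
  have h4 := hFv 4 (by simp)
  refine ⟨fun hs c z => ?_, fun x hx => ?_⟩
  · by_cases hc : c = a
    · subst hc
      by_cases hz : ∃ v : Fin (n + (2 * k + 2) * n), ((v : ℕ) : ℤ) = z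
      · obtain ⟨v, rfl⟩ := hz
        rw [(hτ.1 v (Nat.zero_le _)).2, h4]
      · push Not at hz
        rw [(hτ.2 z fun v _ => hz v).2, h4]
        exact hs _ _
    · rw [hF1 _ (by omega) (by omega), h4]
      exact hs _ _
  · refine Store.ext ?_ ?_
    · rw [Store.write_var]
      funext y
      exact hFv _ (by omega)
    · funext c z
      by_cases hc : c = a
      · subst hc
        by_cases hz : ∃ v : Fin (n + (2 * k + 2) * n), ((v : ℕ) : ℤ) = z
        · obtain ⟨v, rfl⟩ := hz
          rw [write_visible_arr hN]
          simp only [Store.decode, hτ.1 v (Nat.zero_le _), h4, if_true, Equiv.apply_symm_apply]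
          exact hx (π v) (Nat.zero_le _)
        · push Not at hz
          rw [write_visible_arr_of_le _ _ _ _ hz]
          simp only [Store.decode, hτ.2 z fun v _ => hz v, h4]
      · rw [Store.write_arr_of_ne _ _ hc]
        simp only [Store.decode, h4]
        rw [hF1 _ (by omega) (by omega), hF1 _ (by omega) (by omega)]

theorem GenInv.write (h : GenInv n k π σ) (l : List (ℤ × ℤ)) : GenInv n k π (σ.write 1 l) where
  consts := h.consts.write 1 l
  count := by rw [Store.write_var, h.count]
  perm v := by rw [Store.write_arr_of_ne _ _ (by decide), h.perm]

variable {S : Finset (Fin n)} {hS : S.card = 2 * k + 2} {b : ℝ}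

theorem decode_write (σ : Store) (l : List (ℤ × ℤ)) : (σ.write 1 l).decode = σ.decode :=
  decode_congr (fun y _ => by rw [Store.write_var]) fun b hb => Store.write_arr_of_ne _ _ (by omega)

theorem genTail_seq (h : GenInv n k π σ) (hN : n + (2 * k + 2) * n ≤ N) (a : ℕ)
    (y : Fin n → ℤˣ) :
    Tri D (forTo 14 2 (copyProg a)) (σ.write 1 (fullEntries y)) (10 * (n + (2 * k + 2) * n) + 3) fun τ =>
      (Stamped σ → Stamped τ) ∧ ∀ x : Fin (n + (2 * k + 2) * n) → ℤˣ, Agree (σ.arr 1) n x →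
        (fun v => x (Fin.castLE (Nat.le_add_right _ _) v)) = y →
        τ.decode = σ.decode.write a (entries (visible (n + (2 * k + 2) * n) N)
          fun v => x (π (visibleEquiv hN v))) := by
  refine (copy_tri (h.write (fullEntries y)) hN a).mono le_rfl fun τ hτ => ⟨fun hs => hτ.1 ?_, fun x hx hy => ?_⟩
  · intro c z
    rw [Store.write_arr_of_ne _ _ (by omega), Store.write_var]
    exact hs c z
  · rw [hτ.2 x ?_, decode_write]
    intro v _
    by_cases hv : (v : ℕ) < n
    · rw [show ((v : ℕ) : ℤ) = (((⟨v, hv⟩ : Fin n) : ℕ) : ℤ) from rfl, write_fullEntries_arr, ← hy]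
      rfl
    · rw [← hx v (not_lt.1 hv)]
      refine write_entries_arr_of_not_mem _ _ _ _ fun u _ he => ?_
      have : (u : ℕ) = v := by exact_mod_cast he
      omega

theorem genTail_tri (h : GenInv n k π σ) (hN : n + (2 * k + 2) * n ≤ N) (a : ℕ)
    {P : PMF (Fin n → ℤˣ)} :
    Tri (samples P) (genTail a) σ (11 * (n + (2 * k + 2) * n) + 5) fun τ => Stamped σ → Stamped τ :=
  (Tri.seq (tri_sample fun y => (genTail_seq h hN a y).mono le_rfl fun _ hτ => hτ.1)).mono
    (by have := Nat.zero_le ((2 * k + 2) * n); omega) fun _ h => h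

/-- The real sample fills the cells below `n`, and the artificial blocks already occupy the cells
from `n` on. Splitting the sum according to the sample `y`, at most one full configuration is
compatible with `y` and with the array. -/
theorem genTail_wp (h : GenInv n k π σ) (hN : n + (2 * k + 2) * n ≤ N) (a : ℕ)
    (φ : Store → ℝ≥0∞) :
    complete n (plantedWeight (k := k) S b 0) (fun x => φ (σ.decode.write a
      (entries (visible (n + (2 * k + 2) * n) N) fun v => x (π (visibleEquiv hN v))))) (σ.arr 1)
      ≤ wp (samples (noisyParity b k S hS)) (genTail a) (fun τ => φ τ.decode) σ := by
  classical
  rw [genTail, Tri.wp_seq (tri_sample fun y => (genTail_seq h hN a y).mono le_rfl fun _ _ => trivial),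
    wp_samples, complete, ← Finset.sum_fiberwise Finset.univ
      fun x : Fin (n + (2 * k + 2) * n) → ℤˣ => fun v : Fin n => x (Fin.castLE (Nat.le_add_right _ _) v)]
  refine Finset.sum_le_sum fun y _ => ?_
  have huniq : ∀ x x' : Fin (n + (2 * k + 2) * n) → ℤˣ, Agree (σ.arr 1) n x → Agree (σ.arr 1) n x' →
      (fun v => x (Fin.castLE (Nat.le_add_right _ _) v)) = y →
      (fun v => x' (Fin.castLE (Nat.le_add_right _ _) v)) = y → x = x' := by
    intro x x' h1 h2 h3 h4
    funext v
    by_cases hv : (v : ℕ) < n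
    · exact congrFun (h3.trans h4.symm) ⟨v, hv⟩
    · exact Units.ext ((h1 v (not_lt.1 hv)).symm.trans (h2 v (not_lt.1 hv)))
  by_cases hex : ∃ x : Fin (n + (2 * k + 2) * n) → ℤˣ, Agree (σ.arr 1) n x ∧
      (fun v => x (Fin.castLE (Nat.le_add_right _ _) v)) = y
  · obtain ⟨x, hx, hy⟩ := hex
    rw [Finset.sum_eq_single x]
    · rw [if_pos hx, (genTail_seq h hN a y).wp_eq_const fun τ hτ => by rw [hτ.2 x hx hy], plantedWeight,
        Finset.prod_range_zero, mul_one, hy, noisyParity_apply, ENNReal.ofReal_mul (by positivity),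
        ENNReal.ofReal_pow (by norm_num), ENNReal.ofReal_inv_of_pos (by norm_num), mul_assoc]
      simp
    · intro x' hx' hne
      rw [if_neg]
      exact fun hA => hne (huniq x' x hA hx (Finset.mem_filter.1 hx').2 hy)
    · intro hn
      exact absurd (Finset.mem_filter.2 ⟨Finset.mem_univ x, hy⟩) hn
  · rw [Finset.sum_eq_zero]
    · exact zero_le
    · intro x hx
      rw [if_neg]
      exact fun hA => hex ⟨x, hA, (Finset.mem_filter.1 hx).2⟩

theorem GenInv.congr {τ : Store} (h : GenInv n k π σ) (h0 : τ.var 0 = σ.var 0) (h1 : τ.var 1 = σ.var 1)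
    (h2 : τ.var 2 = σ.var 2) (h9 : τ.var 9 = σ.var 9) (ha : τ.arr 2 = σ.arr 2) : GenInv n k π τ :=
  ⟨h.consts.congr h0 h1 h9, h2.trans h.count, fun v => by rw [ha, h.perm]⟩

theorem blocks_hyp (b : ℝ) (h : GenInv n k π σ) :
    ForHyp D 13 0 (blockProg b k) n (24 * k + 25)
      (fun i τ => τ.var 40 = (n + (2 * k + 2) * i : ℕ)) ((Prog.add 40 2 9).exec σ) where
  bound := by simp [Prog.exec, h.consts.size]
  one := by simp [Prog.exec, h.consts.one]
  zero := by simp [Prog.exec, h.consts.zero]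
  ne := by decide
  counter := blockProg_wv _ _ _ (by omega)
  wone := blockProg_wv _ _ _ (by omega)
  init := by simp [Prog.exec, h.count, h.consts.zero]
  body := by
    intro i hi τ hI hc hF
    refine block_tri b ?_ ?_ ?_
    · rw [Store.setVar_var, if_neg (by decide),
        hF.1 1 (by rw [forTo_wv, not_or]; exact ⟨by decide, blockProg_wv _ _ _ (by omega)⟩)]
      simp [Prog.exec, h.consts.one]
    · rw [Store.setVar_var, if_neg (by decide),
        hF.1 9 (by rw [forTo_wv, not_or]; exact ⟨by decide, blockProg_wv _ _ _ (by omega)⟩)]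
      simp [Prog.exec, h.consts.zero]
    · rw [Store.setVar_var, if_neg (by decide), hI]
      congr 1
      ring

theorem gen_inv_after {τ : Store} (h : GenInv n k π σ)
    (hF : Fr (forTo 13 0 (blockProg b k)) ((Prog.add 40 2 9).exec σ) τ) :
    GenInv n k π τ ∧ τ.decode = σ.decode ∧ (Stamped σ → Stamped τ) := by
  have hv : ∀ y, y ≠ 13 → y < 40 ∨ 43 < y → τ.var y = σ.var y := fun y h1 h2 => by
    rw [hF.1 y (by rw [forTo_wv, not_or]; exact ⟨h1, blockProg_wv _ _ _ h2⟩)]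
    simp only [Prog.exec, Store.setVar_var]
    rw [if_neg (by omega)]
  have ha : ∀ c, c ≠ 1 → τ.arr c = σ.arr c := fun c hc => by
    rw [hF.2 c (by rw [forTo_wa]; exact blockProg_wa _ _ _ hc)]
    rfl
  refine ⟨h.congr (hv _ (by decide) (by omega)) (hv _ (by decide) (by omega)) (hv _ (by decide) (by omega))
    (hv _ (by decide) (by omega)) (ha _ (by decide)),
    decode_congr (fun y hy => hv y (by omega) (by omega)) fun c hc => ha c (by omega), fun hs c z => ?_⟩
  rw [ha _ (by omega), hv 4 (by decide) (by omega)]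
  exact hs c z

theorem gen_seq (b : ℝ) (h : GenInv n k π σ) (hN : n + (2 * k + 2) * n ≤ N) (a : ℕ)
    {P : PMF (Fin n → ℤˣ)} :
    Tri (samples P) (forTo 13 0 (blockProg b k)) ((Prog.add 40 2 9).exec σ) (n * (24 * k + 28) + 3)
      fun τ => Tri (samples P) (genTail a) τ (11 * (n + (2 * k + 2) * n) + 5)
        fun τ => Stamped σ → Stamped τ := by
  refine (blocks_hyp b h).tri.mono le_rfl fun τ hτ => ?_
  have := gen_inv_after h hτ.2.2
  exact (genTail_tri this.1 hN a).mono le_rfl fun ρ hρ hs => hρ (this.2.2 hs)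

theorem gen_tri (b : ℝ) (h : GenInv n k π σ) (hN : n + (2 * k + 2) * n ≤ N) (a : ℕ)
    {P : PMF (Fin n → ℤˣ)} :
    Tri (samples P) (genProg b k a) σ (30 * (n + (2 * k + 2) * n + 1))
      fun τ => Stamped σ → Stamped τ := by
  refine (Tri.straight_seq (p := .add 40 2 9) trivial (Tri.seq (gen_seq b h hN a))).mono ?_ fun _ h => h
  rw [show (Prog.add 40 2 9).cost = 1 from rfl]
  ring_nf
  omega

/-- Each block contributes one factor `blockWeight`, the real sample contributes the parity of `S`,
and nothing is undetermined at the end. The total is the planted density, read through `π`. -/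
theorem gen_wp (h : GenInv n k π σ) (hN : n + (2 * k + 2) * n ≤ N) (a : ℕ) (φ : Store → ℝ≥0∞)
    {Q : PMF (visible (n + (2 * k + 2) * n) N → ℤˣ)}
    (hQ : ∀ y, Q y = ENNReal.ofReal ((2 : ℝ)⁻¹ ^ (visible (n + (2 * k + 2) * n) N).card *
      parityDensity (delta b) k (site S hS hN π) y)) :
    expect Q (fun y => φ (σ.decode.write a (entries _ y)))
      ≤ wp (samples (noisyParity b k S hS)) (genProg b k a) (fun τ => φ τ.decode) σ := by
  have hs := gen_seq b h hN a (P := noisyParity b k S hS)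
  have hb := blocks_hyp (D := samples (noisyParity b k S hS)) b h
  set F : (Fin (n + (2 * k + 2) * n) → ℤˣ) → ℝ≥0∞ := fun x => φ (σ.decode.write a
    (entries (visible (n + (2 * k + 2) * n) N) fun v => x (π (visibleEquiv hN v)))) with hF
  have hstage := hb.wp_eq (fun i τ => complete (n + (2 * k + 2) * i) (plantedWeight (k := k) S b i) F (τ.arr 1))
    fun i hi τ hI _ hFr => by
      have h1 : (τ.setVar 13 i).var 1 = 1 := by
        rw [Store.setVar_var, if_neg (by decide), hFr.1 1
          (by rw [forTo_wv, not_or]; exact ⟨by decide, blockProg_wv _ _ _ (by omega)⟩)]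
        simp [Prog.exec, h.consts.one]
      have h9 : (τ.setVar 13 i).var 9 = 0 := by
        rw [Store.setVar_var, if_neg (by decide), hFr.1 9
          (by rw [forTo_wv, not_or]; exact ⟨by decide, blockProg_wv _ _ _ (by omega)⟩)]
        simp [Prog.exec, h.consts.zero]
      have hle : n + (2 * k + 2) * i + 2 * k + 2 ≤ n + (2 * k + 2) * n := by
        have h2 := Nat.mul_le_mul_left (2 * k + 2) (show i + 1 ≤ n from hi)
        rw [Nat.mul_succ] at h2
        omega
      have := block_wp (D := samples (noisyParity b k S hS)) b h1 h9 (q := n + (2 * k + 2) * i) (by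
        rw [Store.setVar_var, if_neg (by decide), hI]
        congr 1
        ring) hle (plantedWeight (k := k) S b i) F
      rw [this, show n + (2 * k + 2) * i + 2 * k + 2 = n + (2 * k + 2) * (i + 1) by ring]
      congr 1
      funext x
      rw [plantedWeight, plantedWeight, Finset.prod_range_succ, mul_assoc]
  rw [← sum_planted S hS hN π b hQ, genProg, (Tri.seq hs).wp_straight_seq (p := .add 40 2 9) trivial,
    Tri.wp_seq hs, complete_top]
  rw [complete_top] at hstage
  refine hstage.ge.trans ?_
  · refine hb.tri.wp_mono fun τ hτ => ?_
    have := gen_inv_after h hτ.2.2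
    have ht := genTail_wp (S := S) (hS := hS) (b := b) this.1 hN a φ
    rw [this.2.1] at ht
    simpa using ht

end Generator

end

noncomputable section

variable {D : PMF (List (ℤ × ℤ))}

/-! ### Running the learning algorithm on planted samples -/

section Model

variable {n k : ℕ} (S : Finset (Fin n)) (hS : S.card = 2 * k + 2) {N : ℕ}
  (hN : n + (2 * k + 2) * n ≤ N)

/-- `Q` is the planted distribution, with vertices relabelled by `π`. -/
def PlantedLaw (b : ℝ) (π : Equiv.Perm (Fin (n + (2 * k + 2) * n)))
    (Q : PMF (visible (n + (2 * k + 2) * n) N → ℤˣ)) : Prop :=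
  ∀ y, Q y = ENNReal.ofReal ((2 : ℝ)⁻¹ ^ (visible (n + (2 * k + 2) * n) N).card *
    parityDensity (delta b) k (site S hS hN π) y)

/-- Each of the `n + 1` chains needs at most `4k` centres and `k` slots for links, and `N` leaves
that many vertices invisible. Only the existence of the model matters: the program never constructs
it. -/
theorem exists_model (hk : 0 < k) (hcap : n + (2 * k + 2) * n + (n + 1) * (5 * k) ≤ N) {b : ℝ}
    (hb : 0 < b) {d : ℕ} (hd : 8 ≤ d) (π : Equiv.Perm (Fin (n + (2 * k + 2) * n))) :
    ∃ M : Matrix (Fin N) (Fin N) ℝ, IsAdmissible b d M 0 ∧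
      PlantedLaw S hS hN b π (cmrf (visible (n + (2 * k + 2) * n) N) M 0) := by
  have hcard : Fintype.card (Option (Fin n) × (Fin k × Fin 4 ⊕ Fin k))
      ≤ Fintype.card {v : Fin N // v ∉ visible (n + (2 * k + 2) * n) N} := by
    rw [Fintype.card_subtype_compl, Fintype.card_coe, card_visible hN]
    simp only [Fintype.card_prod, Fintype.card_option, Fintype.card_fin, Fintype.card_sum]
    have : (n + 1) * (k * 4 + k) = (n + 1) * (5 * k) := by ring
    omega
  obtain ⟨hid⟩ := Function.Embedding.nonempty_of_card_le hcard
  have hG : GadgetHyp (site S hS hN π) fun e => (hid e : Fin N) :=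
    { pos := hk
      sv_inj := site_inj S hS hN π
      hid_inj := fun e e' h => hid.injective (Subtype.ext h)
      hid_not_mem := fun e => (hid e).2 }
  exact ⟨gadgetWeights (site S hS hN π) (fun e => (hid e : Fin N)) b, hG.isAdmissible hb hd,
    hG.cmrf_eq b⟩

variable {S hS hN} {b : ℝ} {π : Equiv.Perm (Fin (n + (2 * k + 2) * n))} {σ : Store}
  {Q : PMF (visible (n + (2 * k + 2) * n) N → ℤˣ)}

/-- What the simulation of the learning algorithm preserves. -/
def SimInv (σ τ : Store) : Prop :=
  Stamped τ ∧ (∀ y < 13, τ.var y = σ.var y) ∧ τ.arr 0 = σ.arr 0 ∧ τ.arr 2 = σ.arr 2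

theorem GenInv.of_simInv {τ : Store} (h : GenInv n k π σ) (hτ : SimInv σ τ) : GenInv n k π τ :=
  h.congr (hτ.2.1 _ (by decide)) (hτ.2.1 _ (by decide)) (hτ.2.1 _ (by decide)) (hτ.2.1 _ (by decide))
    hτ.2.2.2

theorem simHyp (h : GenInv n k π σ) (hQ : PlantedLaw S hS hN b π Q) :
    SimHyp (samples (noisyParity b k S hS)) (samplesOn _ Q) (genProg b k) (SimInv σ) 30 where
  cost := by norm_num
  stamped τ hτ := hτ.1
  congr τ ρ hτ hv ha hs := ⟨hs, fun y hy => (hv y (by omega) (by omega)).trans (hτ.2.1 y hy),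
    (ha 0 (by decide)).trans hτ.2.2.1, (ha 2 (by decide)).trans hτ.2.2.2⟩
  gen := by
    refine ⟨n + (2 * k + 2) * n, ?_, fun a τ hτ => ?_⟩
    · intro l hl
      obtain ⟨y, -, rfl⟩ := (PMF.mem_support_map_iff _ _ _).1 hl
      rw [length_entries, card_visible hN]
    · have hI := h.of_simInv hτ
      have ht := (gen_tri b hI hN a (P := noisyParity b k S hS)).frame
      refine ⟨_, ht.1, fun ρ hρ => ?_, ?_⟩
      · obtain ⟨h1, h2⟩ := ht.2 ρ hρ
        refine ⟨h1 hτ.1, fun y hy => ?_, ?_, ?_⟩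
        · rw [h2.1 y (genProg_wv _ _ _ _ (by omega) (by omega) (by omega)), hτ.2.1 y hy]
        · rw [h2.2 0 (genProg_wa _ _ _ _ (by omega) (by omega) (by omega)), hτ.2.2.1]
        · rw [h2.2 2 (genProg_wa _ _ _ _ (by omega) (by omega) (by omega)), hτ.2.2.2]
      · symm
        refine pmf_eq_of_expect_le fun φ => ?_
        rw [samplesOn, PMF.map_comp, expect_map, expect_map]
        exact gen_wp hI hN a φ hQ

/-- The initial memory of a program on input `n`. -/
def initStore (n : ℕ) : Store := ⟨Function.update (fun _ => 0) 0 (n : ℤ), fun _ _ => 0⟩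

/-- The law of the memory after `T` steps of `A`. -/
def outLaw (A : Prog) (N T : ℕ) (DA : PMF (List (ℤ × ℤ))) : PMF Store := (run A N DA T).map Prod.snd

theorem outputProb_le (A : Prog) (N T : ℕ) (DA : PMF (List (ℤ × ℤ))) (E : Set Store) :
    outputProb A N DA T E ≤ (outLaw A N T DA).toOuterMeasure E := by
  rw [outLaw, PMF.toOuterMeasure_map_apply, outputProb]
  exact MeasureTheory.measure_mono fun C hC => hC.2

/-- In the decoded memory the translated program behaves exactly like the learner on samples of the
planted field, although it only has access to samples of the noisy parity. -/
theorem learn_sim (h : GenInv n k π σ) (hs : Stamped σ) (hQ : PlantedLaw S hS hN b π Q) {A : Prog} {T : ℕ}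
    (hd : σ.decode = initStore N) (hT : HaltsWithin A N (samplesOn _ Q) T) :
    Tri (samples (noisyParity b k S hS)) (tr (genProg b k) A) σ (30 * T) (SimInv σ) ∧
    ∀ φ : Store → ℝ≥0∞, wp (samples (noisyParity b k S hS)) (tr (genProg b k) A) (fun τ => φ τ.decode) σ
      = expect (outLaw A N T (samplesOn _ Q)) φ := by
  have := simulate (simHyp h hQ) T [A] σ ⟨hs, fun _ _ => rfl, rfl, rfl⟩ (by
    rw [hd]
    exact hT)
  obtain ⟨ν, h1, h2, h3⟩ := this
  refine ⟨Spec.tri h1 h2, fun φ => ?_⟩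
  rw [wp, Spec.den_eq h1, outLaw, run, ← initStore, ← hd, ← h3, expect_map]

end Model

end

noncomputable section

/-! ### Exchangeability of the parities -/

section Exchange

variable {n k : ℕ} {S : Finset (Fin n)} {hS : S.card = 2 * k + 2} {N : ℕ}
  {hN : n + (2 * k + 2) * n ≤ N}

/-- The permutation of the coordinates that exchanges two supports. -/
def exchange (S : Finset (Fin n)) (hS : S.card = 2 * k + 2) (o o' : Option (Fin n)) :
    Equiv.Perm (Fin (n + (2 * k + 2) * n)) :=
  Equiv.Perm.viaEmbedding ((Equiv.swap o o').prodCongr (Equiv.refl (Fin (2 * k + 2))))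
    ⟨fun z : Option (Fin n) × Fin (2 * k + 2) => pos S hS z.1 z.2, fun z z' h => by
      have := pos_inj S hS z.2.2 z'.2.2 h
      exact Prod.ext this.1 (Fin.ext this.2)⟩

theorem exchange_pos (o o' o'' : Option (Fin n)) {l : ℕ} (hl : l < 2 * k + 2) :
    exchange S hS o o' (pos S hS o'' l) = pos S hS (Equiv.swap o o' o'') l := by
  have := Equiv.Perm.viaEmbedding_apply ((Equiv.swap o o').prodCongr (Equiv.refl (Fin (2 * k + 2))))
    ⟨fun z : Option (Fin n) × Fin (2 * k + 2) => pos S hS z.1 z.2, fun z z' h => by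
      have := pos_inj S hS z.2.2 z'.2.2 h
      exact Prod.ext this.1 (Fin.ext this.2)⟩ (o'', ⟨l, hl⟩)
  exact this

theorem site_exchange (π : Equiv.Perm (Fin (n + (2 * k + 2) * n))) (o o' o'' : Option (Fin n)) {l : ℕ}
    (hl : l < 2 * k + 2) :
    site S hS hN (exchange S hS o o' * π) o'' l = site S hS hN π (Equiv.swap o o' o'') l := by
  have h : (exchange S hS o o').symm (pos S hS o'' l) = pos S hS (Equiv.swap o o' o'') l := by
    rw [Equiv.symm_apply_eq, exchange_pos _ _ _ hl, Equiv.swap_apply_self]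
  rw [site, site]
  congr 1
  change π.symm ((exchange S hS o o').symm (pos S hS o'' l)) = _
  rw [h]

theorem parityDensity_exchange (δ : ℝ) (π : Equiv.Perm (Fin (n + (2 * k + 2) * n)))
    (o o' : Option (Fin n)) (y : visible (n + (2 * k + 2) * n) N → ℤˣ) :
    parityDensity δ k (site S hS hN (exchange S hS o o' * π)) y = parityDensity δ k (site S hS hN π) y := by
  rw [parityDensity, parityDensity, ← Equiv.prod_comp (Equiv.swap o o')]
  refine Finset.prod_congr rfl fun o'' _ => ?_
  congr 2
  refine Finset.prod_congr rfl fun l hl => ?_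
  rw [site_exchange π o o' _ (Finset.mem_range.1 hl), Equiv.swap_apply_self]

/-- The planted density is a product over the blocks and is symmetric in them. Relabellings that
differ by an exchange of blocks present the same field to the learner. -/
theorem PlantedLaw.exchange {b : ℝ} {π : Equiv.Perm (Fin (n + (2 * k + 2) * n))} {o o' : Option (Fin n)}
    {Q Q' : PMF (visible (n + (2 * k + 2) * n) N → ℤˣ)} (h : PlantedLaw S hS hN b π Q)
    (h' : PlantedLaw S hS hN b (exchange S hS o o' * π) Q') : Q' = Q :=
  PMF.ext fun y => by rw [h, h', parityDensity_exchange]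

/-- The vertices of the support `o` are within distance `R` of each other in the returned graph. -/
def Clustered (S : Finset (Fin n)) (hS : S.card = 2 * k + 2) (hN : n + (2 * k + 2) * n ≤ N) (R : ℕ)
    (π : Equiv.Perm (Fin (n + (2 * k + 2) * n))) (o : Option (Fin n)) : Set Store :=
  {s | ∀ l < 2 * k + 2, ∀ l' < 2 * k + 2,
    Reach (outWeights N s) R (site S hS hN π o l : Fin N) (site S hS hN π o l' : Fin N)}

theorem clustered_exchange (R : ℕ) (π : Equiv.Perm (Fin (n + (2 * k + 2) * n))) (o : Option (Fin n)) :
    Clustered S hS hN R (exchange S hS none o * π) none = Clustered S hS hN R π o := by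
  ext s
  simp only [Clustered, Set.mem_ofPred_eq]
  refine forall_congr' fun l => forall_congr' fun hl => forall_congr' fun l' => forall_congr' fun hl' => ?_
  rw [site_exchange _ _ _ _ hl, site_exchange _ _ _ _ hl', Equiv.swap_apply_left]

/-- The learning algorithm succeeds. -/
def Learned (b : ℝ) (d : ℕ) (x : ℝ) {V : Finset (Fin N)} (Q : PMF (V → ℤˣ)) : Set Store :=
  {s | IsAdmissible b d (outWeights N s) (outBiases N s) ∧
    earthMover Q (cmrf V (outWeights N s) (outBiases N s)) ≤ ENNReal.ofReal x}

open Classical in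
-- By the transport bound there are at most `32 x / δ_b^k` blocks that are not clusters, and `hxn`
-- makes this at most `3/8` of the `n + 1` blocks.
theorem card_clustered {b : ℝ} (hb : 0 < b) (hk : 0 < k) {d R : ℕ} (hbd : b * d ≤ 1 / 2)
    (hR : ((2 * k + 2 : ℕ) : ℝ) * (4 * 2⁻¹ ^ R) ≤ delta b ^ k / 2) {x : ℝ} (hx : 0 < x)
    (hxn : 32 * x ≤ 3 / 8 * (n + 1) * delta b ^ k) {π : Equiv.Perm (Fin (n + (2 * k + 2) * n))}
    {Q : PMF (visible (n + (2 * k + 2) * n) N → ℤˣ)} (hQ : PlantedLaw S hS hN b π Q) {s : Store}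
    (hs : s ∈ Learned b d x Q) :
    5 / 8 * ((n : ℝ) + 1) ≤ ((Finset.univ.filter fun o : Option (Fin n) =>
      s ∈ Clustered S hS hN ((2 * k + 2) * R) π o).card : ℝ) := by
  have hδ : 0 < delta b := by
    have h := sinh_pow_four_lt (2 * b)
    have h0 : 0 < Real.sinh (2 * b) := Real.sinh_pos_iff.2 (by linarith)
    exact div_pos (by positivity) (by nlinarith [pow_pos h0 4])
  have hP : PlantedHyp (delta b) k (site S hS hN π) Q :=
    { pos := hk
      inj := site_inj S hS hN π
      nonneg := delta_nonneg b
      le_one := delta_le_one b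
      law := hQ }
  have hbad := hP.card_bad_le hδ hbd hR hs.1 hx hs.2
    (Finset.univ.filter fun o => ¬ s ∈ Clustered S hS hN ((2 * k + 2) * R) π o) (fun o ho => by
      have := (Finset.mem_filter.1 ho).2
      simp only [Clustered, Set.mem_ofPred_eq] at this
      push Not at this
      obtain ⟨l, hl, l', hl', h⟩ := this
      exact ⟨l, hl, l', hl', h⟩)
  have hsum := Finset.card_filter_add_card_filter_not (s := (Finset.univ : Finset (Option (Fin n))))
    (fun o => s ∈ Clustered S hS hN ((2 * k + 2) * R) π o)
  rw [Finset.card_univ, Fintype.card_option, Fintype.card_fin] at hsum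
  have hsum' : (_ : ℝ) = _ := congrArg (Nat.cast (R := ℝ)) hsum
  push_cast at hsum'
  have hd : 0 < delta b ^ k := pow_pos hδ k
  have : ((Finset.univ.filter fun o => ¬ s ∈ Clustered S hS hN ((2 * k + 2) * R) π o).card : ℝ)
      ≤ 3 / 8 * (n + 1) := by
    rw [← mul_le_mul_iff_left₀ hd]
    linarith
  linarith

/-- Summed over blocks and relabellings, success together with a clustered block has mass at least
`5/8 · 1/2` per pair. All blocks contribute equally by exchangeability, so the true block gets
`5/16`, which exceeds `1/4`. -/
theorem quarter_le_clustered {b : ℝ} (hb : 0 < b) (hk : 0 < k) {d R : ℕ} (hbd : b * d ≤ 1 / 2)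
    (hR : ((2 * k + 2 : ℕ) : ℝ) * (4 * 2⁻¹ ^ R) ≤ delta b ^ k / 2) {x : ℝ} (hx : 0 < x)
    (hxn : 32 * x ≤ 3 / 8 * (n + 1) * delta b ^ k)
    (Q : Equiv.Perm (Fin (n + (2 * k + 2) * n)) → PMF (visible (n + (2 * k + 2) * n) N → ℤˣ))
    (hQ : ∀ π, PlantedLaw S hS hN b π (Q π))
    (μ : PMF (visible (n + (2 * k + 2) * n) N → ℤˣ) → PMF Store)
    (hμ : ∀ π, 1 / 2 ≤ (μ (Q π)).toOuterMeasure (Learned b d x (Q π))) :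
    (Fintype.card (Equiv.Perm (Fin (n + (2 * k + 2) * n))) : ℝ≥0∞) * 4⁻¹
      ≤ ∑ π, (μ (Q π)).toOuterMeasure
        (Learned b d x (Q π) ∩ Clustered S hS hN ((2 * k + 2) * R) π none) := by
  classical
  set g : Option (Fin n) → Equiv.Perm (Fin (n + (2 * k + 2) * n)) → ℝ≥0∞ := fun o π =>
    (μ (Q π)).toOuterMeasure (Learned b d x (Q π) ∩ Clustered S hS hN ((2 * k + 2) * R) π o) with hg
  -- Composition with the exchange of the blocks `none` and `o` permutes the relabellings. It
  -- preserves the law `Q π`, hence the output, while it moves the event from one block to the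
  -- other.
  have hex : ∀ o, ∑ π, g none π = ∑ π, g o π := by
    intro o
    rw [← Equiv.sum_comp (Equiv.mulLeft (exchange S hS none o))]
    refine Finset.sum_congr rfl fun π _ => ?_
    simp only [hg, Equiv.coe_mulLeft]
    rw [clustered_exchange, (hQ π).exchange (hQ (exchange S hS none o * π))]
  have hrow : ∀ π, ENNReal.ofReal (5 / 8 * ((n : ℝ) + 1)) * (1 / 2) ≤ ∑ o, g o π := by
    intro π
    refine (mul_le_mul_right (hμ π) _).trans ?_
    simp only [hg, ← expect_indicator]
    rw [← expect_const_mul, ← expect_finset_sum]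
    refine expect_mono fun s _ => ?_
    by_cases hs : s ∈ Learned b d x (Q π)
    · rw [Set.indicator_of_mem hs, mul_one]
      have := card_clustered hb hk hbd hR hx hxn (hQ π) hs
      refine (ENNReal.ofReal_le_ofReal this).trans ?_
      rw [ENNReal.ofReal_natCast, Finset.card_filter]
      push_cast
      refine Finset.sum_le_sum fun o _ => ?_
      simp [Set.indicator_apply, hs]
    · rw [Set.indicator_of_notMem hs, mul_zero]
      exact zero_le
  have hall : (Fintype.card (Equiv.Perm (Fin (n + (2 * k + 2) * n))) : ℝ≥0∞) *
      (ENNReal.ofReal (5 / 8 * ((n : ℝ) + 1)) * (1 / 2)) ≤ (n + 1 : ℕ) * ∑ π, g none π := by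
    calc _ = ∑ π : Equiv.Perm (Fin (n + (2 * k + 2) * n)), ENNReal.ofReal (5 / 8 * ((n : ℝ) + 1)) * (1 / 2) := by
          rw [Finset.sum_const, Finset.card_univ, nsmul_eq_mul]
      _ ≤ ∑ π, ∑ o, g o π := Finset.sum_le_sum fun π _ => hrow π
      _ = ∑ o, ∑ π, g o π := Finset.sum_comm
      _ = ∑ o : Option (Fin n), ∑ π, g none π := Finset.sum_congr rfl fun o _ => (hex o).symm
      _ = _ := by
          rw [Finset.sum_const, Finset.card_univ, nsmul_eq_mul, Fintype.card_option, Fintype.card_fin]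
  have hc : ENNReal.ofReal (5 / 8 * ((n : ℝ) + 1)) * (1 / 2) = (n + 1 : ℕ) * ENNReal.ofReal (5 / 16) := by
    have e1 : (1 / 2 : ℝ≥0∞) = ENNReal.ofReal (1 / 2) := by
      rw [ENNReal.ofReal_div_of_pos (by norm_num)]
      simp
    rw [e1, ← ENNReal.ofReal_mul (by positivity), ← ENNReal.ofReal_natCast, ← ENNReal.ofReal_mul (by positivity)]
    congr 1
    push_cast
    ring
  rw [hc, mul_left_comm, ENNReal.mul_le_mul_iff_right (by simp) (ENNReal.natCast_ne_top _)] at hall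
  refine le_trans ?_ hall
  refine mul_le_mul_right ?_ _
  have e1 : (4⁻¹ : ℝ≥0∞) = ENNReal.ofReal 4⁻¹ := by
    rw [ENNReal.ofReal_inv_of_pos (by norm_num)]
    simp
  rw [e1]
  exact ENNReal.ofReal_le_ofReal (by norm_num)

end Exchange

end

noncomputable section

variable {D : PMF (List (ℤ × ℤ))}

/-! ### A uniformly random relabelling -/

section Shuffle

variable {m : ℕ}

/-- The expectation over the remaining `i` steps of the shuffle. -/
def shuffleAvg (g : Equiv.Perm (Fin m) → ℝ≥0∞) : ℕ → Equiv.Perm (Fin m) → ℝ≥0∞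
  | 0, α => g α
  | i + 1, α => if h : i < m then ((i + 1 : ℕ) : ℝ≥0∞)⁻¹ * ∑ j : Fin (i + 1),
      shuffleAvg g i (α * Equiv.swap ⟨i, h⟩ ⟨j, by omega⟩) else 0

/-- The permutations that move only the first `i` points. -/
def movesBelow (m i : ℕ) : Finset (Equiv.Perm (Fin m)) :=
  Finset.univ.filter fun β => ∀ v : Fin m, i ≤ (v : ℕ) → β v = v

/-- Coset decomposition: a permutation `β` of the first `i + 1` points is the transposition of `i`
and `β i` composed with a unique permutation of the first `i` points. -/
theorem sum_movesBelow_succ {i : ℕ} (h : i < m) (f : Equiv.Perm (Fin m) → ℝ≥0∞) :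
    ∑ β ∈ movesBelow m (i + 1), f β
      = ∑ j : Fin (i + 1), ∑ β ∈ movesBelow m i, f (Equiv.swap ⟨i, h⟩ ⟨j, by omega⟩ * β) := by
  rw [← Finset.sum_product']
  symm
  have hle : ∀ β ∈ movesBelow m (i + 1), (β ⟨i, h⟩ : ℕ) < i + 1 := by
    intro β hβ
    by_contra hlt
    have h1 := (Finset.mem_filter.1 hβ).2 (β ⟨i, h⟩) (by omega)
    have h2 := congrArg Fin.val (β.injective h1)
    simp only at h2
    omega
  refine Finset.sum_bij' (fun z _ => Equiv.swap ⟨i, h⟩ ⟨z.1, by omega⟩ * z.2)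
    (fun β hβ => (⟨β ⟨i, h⟩, hle β hβ⟩, Equiv.swap ⟨i, h⟩ (β ⟨i, h⟩) * β)) ?_ ?_ ?_ ?_ ?_
  · rintro ⟨j, β⟩ hz
    have hβ := (Finset.mem_filter.1 (Finset.mem_product.1 hz).2).2
    refine Finset.mem_filter.2 ⟨Finset.mem_univ _, fun v hv => ?_⟩
    have hj := j.2
    rw [Equiv.Perm.mul_apply, hβ v (by omega), Equiv.swap_apply_of_ne_of_ne]
    · rintro rfl
      simp only at hv
      omega
    · rintro rfl
      simp only at hv
      omega
  · intro β hβ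
    have hβ' := (Finset.mem_filter.1 hβ).2
    refine Finset.mem_product.2 ⟨Finset.mem_univ _, Finset.mem_filter.2 ⟨Finset.mem_univ _, fun v hv => ?_⟩⟩
    rw [Equiv.Perm.mul_apply]
    by_cases hvi : (v : ℕ) = i
    · obtain rfl : v = ⟨i, h⟩ := Fin.ext hvi
      rw [Equiv.swap_apply_right]
    · rw [hβ' v (by omega), Equiv.swap_apply_of_ne_of_ne]
      · rintro rfl
        exact hvi rfl
      · intro he
        have h1 := hle β hβ
        rw [← he] at h1
        omega
  · rintro ⟨j, β⟩ hz
    have hβ := (Finset.mem_filter.1 (Finset.mem_product.1 hz).2).2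
    have h1 : (Equiv.swap (⟨i, h⟩ : Fin m) ⟨j, by omega⟩ * β) ⟨i, h⟩ = ⟨j, by omega⟩ := by
      rw [Equiv.Perm.mul_apply, hβ _ le_rfl, Equiv.swap_apply_left]
    refine Prod.ext (Fin.ext ?_) ?_
    · have := congrArg Fin.val h1
      exact this
    · simp only [h1]
      rw [← mul_assoc, Equiv.swap_mul_self, one_mul]
  · intro β hβ
    simp only [Fin.eta]
    rw [← mul_assoc, Equiv.swap_mul_self, one_mul]
  · rintro ⟨j, β⟩ _
    rfl

/-- Correctness of the Fisher–Yates shuffle: every permutation of the first `i` points arises from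
exactly one sequence of choices, of which there are `i!`. -/
theorem shuffleAvg_eq (g : Equiv.Perm (Fin m) → ℝ≥0∞) {i : ℕ} (hi : i ≤ m) (α : Equiv.Perm (Fin m)) :
    shuffleAvg g i α = ((i.factorial : ℕ) : ℝ≥0∞)⁻¹ * ∑ β ∈ movesBelow m i, g (α * β) := by
  induction i generalizing α with
  | zero =>
    have : movesBelow m 0 = {1} := by
      ext β
      simp only [movesBelow, Finset.mem_filter, Finset.mem_univ, true_and, Nat.zero_le, forall_const,
        Finset.mem_singleton]
      exact ⟨fun h => Equiv.ext h, fun h v => by rw [h]; rfl⟩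
    simp [shuffleAvg, this]
  | succ i ih =>
    rw [shuffleAvg, dif_pos (by omega), sum_movesBelow_succ (by omega)]
    simp only [ih (by omega : i ≤ m), ← Finset.mul_sum, mul_assoc α]
    rw [← mul_assoc, Nat.factorial_succ, Nat.cast_mul, ENNReal.mul_inv (by simp) (by simp)]

theorem shuffleAvg_top (g : Equiv.Perm (Fin m) → ℝ≥0∞) :
    shuffleAvg g m 1 = (Fintype.card (Equiv.Perm (Fin m)) : ℝ≥0∞)⁻¹ * ∑ π, g π := by
  have : movesBelow m m = Finset.univ := by
    ext β
    simp only [movesBelow, Finset.mem_filter, Finset.mem_univ, true_and, iff_true]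
    exact fun v hv => absurd v.2 (not_lt.2 hv)
  rw [shuffleAvg_eq g le_rfl, this, Fintype.card_perm, Fintype.card_fin]
  simp

/-- Exchange the cell `12` of array `2` with a random previous cell. -/
def swapProg : Prog := .seq (.rand 46 12) (.seq (.load 47 2 12) (.seq (.load 48 2 46)
  (.seq (.store 2 12 48) (.store 2 46 47))))

/-- Write a uniformly random permutation into array `2`. -/
def shuffleProg : Prog := .seq (forTo 11 2 (.store 2 11 11)) (forTo 12 2 swapProg)

/-- Array `2` holds the permutation `α`. -/
def HoldsPerm (α : Equiv.Perm (Fin m)) (τ : Store) : Prop := ∀ v : Fin m, τ.arr 2 (v : ℕ) = (α v : ℕ)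

theorem HoldsPerm.unique {α β : Equiv.Perm (Fin m)} {τ : Store} (h : HoldsPerm α τ) (h' : HoldsPerm β τ) :
    α = β := by
  refine Equiv.ext fun v => Fin.ext ?_
  have := (h v).symm.trans (h' v)
  exact_mod_cast this

variable {n : ℕ} {σ : Store}

theorem ident_hyp (hσ : Consts n σ) (hm : σ.var 2 = m) :
    ForHyp D 11 2 (.store 2 11 11) m 1 (fun i τ => ∀ v : Fin m, i ≤ (v : ℕ) → τ.arr 2 (v : ℕ) = (v : ℕ)) σ where
  bound := hm
  one := hσ.one
  zero := hσ.zero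
  ne := by decide
  counter := by simp [Prog.wv]
  wone := by simp [Prog.wv]
  init := fun v hv => absurd v.2 (not_lt.2 hv)
  body := by
    intro i hi τ hI hc hF
    refine Tri.straight (p := .store 2 11 11) trivial le_rfl fun v hv => ?_
    simp only [Prog.exec, Store.setVar_var, Store.setVar_arr, Store.setArr_arr, if_true, true_and]
    by_cases hvi : (v : ℕ) = i
    · simp [hvi]
    · rw [if_neg (by exact_mod_cast hvi)]
      exact hI v (by omega)

theorem swap_tail {i : ℕ} (hi : i < m) (h12 : σ.var 12 = i) {α : Equiv.Perm (Fin m)}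
    (hα : HoldsPerm α σ) (j : ℕ) (hj : j ≤ i) :
    Tri D (.seq (.load 47 2 12) (.seq (.load 48 2 46) (.seq (.store 2 12 48) (.store 2 46 47))))
      (σ.setVar 46 j) 7 (HoldsPerm (α * Equiv.swap ⟨i, hi⟩ ⟨j, by omega⟩)) := by
  refine Tri.straight (by simp [Prog.straight]) (by simp [Prog.cost]) fun v => ?_
  have h1 := hα ⟨i, hi⟩
  have h2 := hα ⟨j, by omega⟩
  simp only at h1 h2
  simp only [Prog.exec, Store.setVar_var, Store.setVar_arr, Store.setArr_arr, Store.setArr_var, h12,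
    Equiv.Perm.mul_apply]
  by_cases hvj : (v : ℕ) = j
  · have hv : v = ⟨j, by omega⟩ := Fin.ext hvj
    rw [hv]
    simp [h1]
  · by_cases hvi : (v : ℕ) = i
    · obtain rfl : v = ⟨i, hi⟩ := Fin.ext hvi
      have : ¬ ((i : ℤ) = j) := by exact_mod_cast hvj
      simp [h2, this]
    · rw [Equiv.swap_apply_of_ne_of_ne (by simpa [Fin.ext_iff] using hvi) (by simpa [Fin.ext_iff] using hvj)]
      simp [hvi, hvj, hα v]

theorem swap_hyp (hσ : Consts n σ) (hm : σ.var 2 = m) (hα : HoldsPerm (1 : Equiv.Perm (Fin m)) σ) :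
    ForHyp D 12 2 swapProg m 9 (fun _ τ => ∃ α : Equiv.Perm (Fin m), HoldsPerm α τ) σ where
  bound := hm
  one := hσ.one
  zero := hσ.zero
  ne := by decide
  counter := by simp [swapProg, Prog.wv]
  wone := by simp [swapProg, Prog.wv]
  init := ⟨1, hα⟩
  body := by
    rintro i hi τ ⟨α, hα⟩ hc hF
    refine Tri.seq (B := 1) (B' := 7) (Tri.rand (m := i) (by simp) fun j hj => ?_)
    have : HoldsPerm α (τ.setVar 12 i) := hα
    exact (swap_tail hi (by simp) this j hj).mono le_rfl fun ρ hρ => ⟨_, hρ⟩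

open Classical in
-- The array determines its permutation, so the sum over `α` is just `g` evaluated at the
-- permutation in memory.
theorem swap_wp (hσ : Consts n σ) (hm : σ.var 2 = m) (hα : HoldsPerm (1 : Equiv.Perm (Fin m)) σ)
    (g : Equiv.Perm (Fin m) → ℝ≥0∞) :
    wp D (forTo 12 2 swapProg) (fun τ => ∑ α, if HoldsPerm α τ then g α else 0) σ = shuffleAvg g m 1 := by
  have hsum : ∀ (i : ℕ) (α : Equiv.Perm (Fin m)) (τ : Store), HoldsPerm α τ →
      (∑ α, if HoldsPerm α τ then shuffleAvg g i α else 0) = shuffleAvg g i α := fun i α τ h => by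
    rw [Finset.sum_eq_single α, if_pos h]
    · intro β _ hne
      exact if_neg fun hβ => hne (hβ.unique h)
    · exact fun hn => absurd (Finset.mem_univ _) hn
  have := (swap_hyp (D := D) hσ hm hα).wp_eq
    (fun i τ => ∑ α, if HoldsPerm α τ then shuffleAvg g i α else 0) fun i hi τ hI hc hF => by
      obtain ⟨α, hα⟩ := hI
      have hα' : HoldsPerm α (τ.setVar 12 i) := hα
      have ht := fun j hj => swap_tail (D := D) hi (by simp) hα' j hj
      rw [hsum _ α τ hα, swapProg, Tri.wp_seq (B := 1) (B' := 7) (Q := fun _ => True)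
        (Tri.rand (m := i) (by simp) fun j hj => (ht j hj).mono le_rfl fun _ _ => trivial),
        wp_rand (m := i) (by simp), shuffleAvg, dif_pos hi]
      congr 1
      refine Finset.sum_congr rfl fun j _ => ?_
      exact (ht j (by omega)).wp_eq_const fun ρ hρ => hsum _ _ _ hρ
  rw [hsum m 1 _ (show HoldsPerm 1 (σ.setVar 12 m) from hα)] at this
  exact this

theorem shuffle_seq (hσ : Consts n σ) (hm : σ.var 2 = m) :
    Tri D (forTo 11 2 (.store 2 11 11)) σ (4 * m + 3) fun τ =>
      (Consts n τ ∧ τ.var 2 = m ∧ HoldsPerm (1 : Equiv.Perm (Fin m)) τ) ∧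
      Tri D (forTo 12 2 swapProg) τ (12 * m + 3) fun τ => ∃ α : Equiv.Perm (Fin m), HoldsPerm α τ := by
  refine (ident_hyp hσ hm).tri.mono (by omega) fun τ hτ => ?_
  have h1 : Consts n τ := hσ.congr (hτ.2.2.1 _ (by simp [Prog.wv])) (hτ.2.2.1 _ (by simp [Prog.wv]))
    (hτ.2.2.1 _ (by simp [Prog.wv]))
  have h2 : τ.var 2 = m := by rw [hτ.2.2.1 2 (by simp [Prog.wv]), hm]
  have h3 : HoldsPerm (1 : Equiv.Perm (Fin m)) τ := fun v => hτ.1 v (Nat.zero_le _)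
  exact ⟨⟨h1, h2, h3⟩, (swap_hyp h1 h2 h3).tri.mono (by omega) fun ρ hρ => hρ.1⟩

theorem shuffle_tri (hσ : Consts n σ) (hm : σ.var 2 = m) :
    Tri D shuffleProg σ (16 * m + 7) fun τ => ∃ α : Equiv.Perm (Fin m), HoldsPerm α τ :=
  (Tri.seq ((shuffle_seq hσ hm).mono le_rfl fun _ h => h.2)).mono (by omega) fun _ h => h

theorem le_shuffle_wp (hσ : Consts n σ) (hm : σ.var 2 = m) (g : Equiv.Perm (Fin m) → ℝ≥0∞)
    (h : Store → ℝ≥0∞) (hgh : ∀ α τ, HoldsPerm α τ → Fr shuffleProg σ τ → g α ≤ h τ) :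
    (Fintype.card (Equiv.Perm (Fin m)) : ℝ≥0∞)⁻¹ * ∑ π, g π ≤ wp D shuffleProg h σ := by
  classical
  refine le_trans ?_ ((shuffle_tri hσ hm).frame.wp_mono
    (f := fun τ => ∑ α, if HoldsPerm (m := m) α τ then g α else 0) fun τ hτ => ?_)
  · have hs := shuffle_seq (D := D) hσ hm
    rw [← shuffleAvg_top, shuffleProg, Tri.wp_seq (hs.mono le_rfl fun _ h => h.2)]
    exact (hs.wp_eq_const fun τ hτ => swap_wp hτ.1.1 hτ.1.2.1 hτ.1.2.2 g).ge
  · obtain ⟨⟨α, hα⟩, hF⟩ := hτ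
    rw [Finset.sum_eq_single α, if_pos hα]
    · exact hgh α τ hα hF
    · intro β _ hne
      exact if_neg fun hβ => hne (hβ.unique hα)
    · exact fun hn => absurd (Finset.mem_univ _) hn

end Shuffle

end

noncomputable section

variable {D : PMF (List (ℤ × ℤ))}

/-! ### Lower bounds for probabilities -/

section Hit

open Classical in
/-- The indicator function of a predicate. -/
def ind (Q : Store → Prop) (τ : Store) : ℝ≥0∞ := if Q τ then 1 else 0

theorem ind_pos {Q : Store → Prop} {τ : Store} (h : Q τ) : ind Q τ = 1 := if_pos h

theorem ind_neg {Q : Store → Prop} {τ : Store} (h : ¬ Q τ) : ind Q τ = 0 := if_neg h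

theorem ind_congr {Q Q' : Store → Prop} {τ τ' : Store} (h : Q τ ↔ Q' τ') : ind Q τ = ind Q' τ' := by
  by_cases hQ : Q τ
  · rw [ind_pos hQ, ind_pos (h.1 hQ)]
  · rw [ind_neg hQ, ind_neg fun h' => hQ (h.2 h')]

theorem ind_le_one (Q : Store → Prop) (τ : Store) : ind Q τ ≤ 1 := by
  rw [ind]
  split_ifs <;> simp

end Hit

/-! ### Random walks in the returned graph -/

section Walk

/-- Execute `p` if variable `x` is not zero. -/
def nonzeroProg (x : ℕ) (p : Prog) : Prog := .ite x p (.seq (.sub x 9 x) (.ite x p .skip))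

/-- Set variable `56` to `1` if the returned graph has an edge, whose address is the sum of the
variables `53` and `16`. -/
def edgeProg : Prog :=
  .seq (.const 56 0) (.seq (.add 54 53 16) (.seq (.load 55 11 54) (.seq (.sub 55 4 55) (.ite 55 .skip
    (.seq (.load 55 13 54) (.seq (.sub 55 4 55) (.ite 55 .skip
      (.seq (.load 55 10 54) (nonzeroProg 55 (.seq (.load 55 12 54) (nonzeroProg 55 (.const 56 1))))))))))))

/-- Move to vertex `16` with probability one half, if there is an edge. -/
def scanProg : Prog :=
  .seq edgeProg (.ite 56 (.seq (.flip 57 half) (.ite 57 (.add 52 16 9) .skip)) .skip)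

/-- A random step in the returned graph, from vertex `51`. -/
def stepProg : Prog :=
  .seq (.const 53 0) (.seq (.seq (forTo 17 51 (.add 53 53 3)) (.add 52 51 9))
    (.seq (forTo 16 3 scanProg) (.add 51 52 9)))

variable {N : ℕ} {σ : Store}

/-- The output arrays `0` and `1` of the learner live in arrays `10` and `12`, with stamps in `11`
and `13`. A weight is nonzero exactly if numerator and denominator are both present and nonzero,
division by zero being zero. -/
theorem edge_exec {v j : Fin N} (hs : Stamped σ) (h9 : σ.var 9 = 0)
    (h53 : σ.var 53 = (N : ℤ) * (v : ℕ)) (h16 : σ.var 16 = (j : ℕ)) :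
    (edgeProg.exec σ).var 56 = if outWeights N σ.decode v j ≠ 0 then 1 else 0 := by
  have h0 := hs 0 ((N : ℤ) * (v : ℕ) + (j : ℕ))
  have h1 := hs 1 ((N : ℤ) * (v : ℕ) + (j : ℕ))
  simp only [mul_zero, zero_add, mul_one, Nat.reduceAdd] at h0 h1
  simp only [outWeights, Store.decode, mul_zero, zero_add, mul_one, Nat.reduceAdd]
  set u := (N : ℤ) * (v : ℕ) + (j : ℕ) with hu
  by_cases e0 : σ.arr 11 u = σ.var 4
  · by_cases e1 : σ.arr 13 u = σ.var 4
    · have tri : ∀ z : ℤ, (z < 0 ∧ ¬ 0 < z ∧ z ≠ 0) ∨ z = 0 ∨ (0 < z ∧ z ≠ 0) := fun z => by omega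
      rcases tri (σ.arr 10 u) with ha | ha | ha <;> rcases tri (σ.arr 12 u) with hb | hb | hb <;>
      simp [edgeProg, nonzeroProg, Prog.exec, h53, h16, ← hu, e0, e1, h9, ha, hb]
    · have : σ.arr 13 u < σ.var 4 := lt_of_le_of_ne h1 e1
      simp [edgeProg, Prog.exec, h53, h16, ← hu, e0, e1, this]
  · have : σ.arr 11 u < σ.var 4 := lt_of_le_of_ne h0 e0
    simp [edgeProg, Prog.exec, h53, h16, ← hu, e0, this]

theorem edgeProg_straight : edgeProg.straight := by simp [edgeProg, nonzeroProg, Prog.straight]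

theorem edgeProg_cost : edgeProg.cost ≤ 40 := by simp [edgeProg, nonzeroProg, Prog.cost]

theorem edge_frame (σ : Store) : Fr edgeProg σ (edgeProg.exec σ) :=
  (edgeProg.spec_straight (D := PMF.pure []) edgeProg_straight σ).frame _ (by simp)

/-- The memory for the random walks agrees with `σ` outside of scratch variables and marks. -/
def Same (σ τ : Store) : Prop := (∀ y < 16, τ.var y = σ.var y) ∧ ∀ c, c ≠ 3 → τ.arr c = σ.arr c

theorem Same.trans {ρ τ : Store} (h : Same σ τ) (h' : Same τ ρ) : Same σ ρ :=
  ⟨fun y hy => (h'.1 y hy).trans (h.1 y hy), fun c hc => (h'.2 c hc).trans (h.2 c hc)⟩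

theorem Same.outWeights {τ : Store} (h : Same σ τ) : outWeights N τ.decode = outWeights N σ.decode := by
  funext i j
  simp [_root_.outWeights, Store.decode, h.1 4, h.2]

theorem Same.stamped {τ : Store} (h : Same σ τ) (hs : Stamped σ) : Stamped τ := fun a i => by
  rw [h.2 _ (by omega), h.1 4 (by omega)]
  exact hs a i

variable {n : ℕ}

theorem Same.consts {τ : Store} (h : Same σ τ) (hs : Consts n σ) : Consts n τ :=
  hs.congr (h.1 _ (by omega)) (h.1 _ (by omega)) (h.1 _ (by omega))

/-- The program `p` uses only scratch variables and marks. -/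
def Local (p : Prog) : Prop := (∀ y < 16, ¬ p.wv y) ∧ ∀ c, c ≠ 3 → ¬ p.wa c

theorem Local.same {p : Prog} (hp : Local p) {τ : Store} (h : Fr p σ τ) : Same σ τ :=
  ⟨fun y hy => h.1 y (hp.1 y hy), fun c hc => h.2 c (hp.2 c hc)⟩

theorem local_scan : Local (forTo 16 3 scanProg) := by
  constructor
  · intro y hy
    simp only [scanProg, edgeProg, nonzeroProg, forTo_wv, Prog.wv, or_false, false_or]
    omega
  · intro c hc
    simp [scanProg, edgeProg, nonzeroProg, Prog.wa]

theorem local_step : Local stepProg := by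
  constructor
  · intro y hy
    simp only [stepProg, scanProg, edgeProg, nonzeroProg, forTo_wv, Prog.wv, or_false, false_or]
    omega
  · intro c hc
    simp [stepProg, scanProg, edgeProg, nonzeroProg, Prog.wa]

/-- The precondition of a step of the random walk from `v`. -/
structure WalkPre (n N : ℕ) (σ : Store) : Prop where
  consts : Consts n σ
  count : σ.var 3 = N
  stamped : Stamped σ

theorem WalkPre.congr {τ : Store} (h : WalkPre n N σ) (hs : Same σ τ) : WalkPre n N τ :=
  ⟨hs.consts h.consts, (hs.1 _ (by omega)).trans h.count, hs.stamped h.stamped⟩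

theorem scan_tail (h9 : σ.var 9 = 0) {j : ℕ} (h16 : σ.var 16 = j) (z : ℤ) (hz : z = 0 ∨ z = 1) :
    Tri D (.ite 57 (.add 52 16 9) .skip) (σ.setVar 57 z) 2
      fun τ => τ.var 52 = if z = 1 then (j : ℤ) else σ.var 52 := by
  refine Tri.straight (by simp [Prog.straight]) (by simp [Prog.cost]) ?_
  rcases hz with rfl | rfl <;> simp [Prog.exec, h9, h16]

theorem scan_flip (h9 : σ.var 9 = 0) {j : ℕ} (h16 : σ.var 16 = j) :
    Tri D (.seq (.flip 57 half) (.ite 57 (.add 52 16 9) .skip)) σ 4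
      fun τ => τ.var 52 = j ∨ τ.var 52 = σ.var 52 := by
  refine Tri.seq (B := 1) (B' := 2) (Tri.flip fun z hz => (scan_tail h9 h16 z hz).mono le_rfl fun τ hτ => ?_)
  rw [hτ]
  split_ifs <;> simp

theorem scan_ite (h9 : σ.var 9 = 0) {j : ℕ} (h16 : σ.var 16 = j) :
    Tri D (if 0 < σ.var 56 then .seq (.flip 57 half) (.ite 57 (.add 52 16 9) .skip) else .skip) σ 4
      fun τ => τ.var 52 = j ∨ τ.var 52 = σ.var 52 := by
  split_ifs
  · exact scan_flip h9 h16
  · exact Tri.straight (p := .skip) trivial (by simp [Prog.cost]) (Or.inr rfl)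

theorem edge_facts (σ : Store) : (edgeProg.exec σ).var 9 = σ.var 9 ∧ (edgeProg.exec σ).var 16 = σ.var 16 ∧
    (edgeProg.exec σ).var 52 = σ.var 52 := by
  have hF := (edge_frame σ).1
  exact ⟨hF 9 (by simp [edgeProg, nonzeroProg, Prog.wv]), hF 16 (by simp [edgeProg, nonzeroProg, Prog.wv]),
    hF 52 (by simp [edgeProg, nonzeroProg, Prog.wv])⟩

theorem scan_tri (h9 : σ.var 9 = 0) {j : ℕ} (h16 : σ.var 16 = j) :
    Tri D scanProg σ 46 fun τ => τ.var 52 = j ∨ τ.var 52 = σ.var 52 := by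
  obtain ⟨e9, e16, e52⟩ := edge_facts σ
  have := scan_ite (D := D) (e9.trans h9) (e16.trans h16)
  refine (Tri.straight_seq edgeProg_straight (Tri.ite this)).mono ?_ fun τ hτ => ?_
  · have := edgeProg_cost
    omega
  · rwa [e52] at hτ

theorem scan_wp (hs : Stamped σ) (h9 : σ.var 9 = 0) {v j : Fin N} (h53 : σ.var 53 = (N : ℤ) * (v : ℕ))
    (h16 : σ.var 16 = (j : ℕ)) (f : ℤ → ℝ≥0∞) :
    wp D scanProg (fun τ => f (τ.var 52)) σ = if outWeights N σ.decode v j ≠ 0 then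
      2⁻¹ * f (j : ℕ) + 2⁻¹ * f (σ.var 52) else f (σ.var 52) := by
  obtain ⟨e9, e16, e52⟩ := edge_facts σ
  have hT := scan_ite (D := D) (e9.trans h9) (e16.trans h16)
  have h56 := edge_exec hs h9 h53 h16
  rw [scanProg, Tri.wp_straight_seq edgeProg_straight (Tri.ite hT), Tri.wp_ite hT, h56]
  split_ifs with h h' h'
  · rw [Tri.wp_seq (B := 1) (B' := 2) (Q := fun _ => True)
      (Tri.flip fun z hz => (scan_tail (e9.trans h9) (e16.trans h16) z hz).mono le_rfl fun _ _ => trivial),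
      wp_flip_half, (scan_tail (e9.trans h9) (e16.trans h16) 1 (Or.inr rfl)).wp_eq_const
        (c := f (j : ℕ)) (fun τ hτ => by rw [hτ, if_pos rfl]),
      (scan_tail (e9.trans h9) (e16.trans h16) 0 (Or.inl rfl)).wp_eq_const
        (c := f (σ.var 52)) (fun τ hτ => by rw [hτ, if_neg (by decide), e52])]
  · simp at h'
  · simp at h'
  · rw [wp_straight (p := .skip) trivial]
    exact congrArg f e52

theorem scan_hyp (h : WalkPre n N σ) {w : Fin N} (h52 : σ.var 52 = (w : ℕ)) :
    ForHyp D 16 3 scanProg N 46 (fun _ τ => ∃ u : Fin N, τ.var 52 = (u : ℕ)) σ where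
  bound := h.count
  one := h.consts.one
  zero := h.consts.zero
  ne := by decide
  counter := by simp [scanProg, edgeProg, nonzeroProg, Prog.wv]
  wone := by simp [scanProg, edgeProg, nonzeroProg, Prog.wv]
  init := ⟨w, by simpa using h52⟩
  body := by
    rintro i hi τ ⟨u, hu⟩ hc hF
    have hS := local_scan.same hF
    refine (scan_tri (j := i) ?_ (by simp)).mono le_rfl fun ρ hρ => ?_
    · rw [Store.setVar_var, if_neg (by decide), hS.1 9 (by omega), h.consts.zero]
    · rcases hρ with hρ | hρ
      · exact ⟨⟨i, hi⟩, hρ⟩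
      · exact ⟨u, by rw [hρ, Store.setVar_var, if_neg (by decide), hu]⟩

open Classical in
-- The last neighbour whose coin succeeds becomes the new vertex. To end in `u` it suffices to
-- prescribe the coins of all neighbours: failure for all of them when staying put, and success at
-- `u` only when moving. That has probability `2^{-deg}`.
theorem scan_loop_wp (h : WalkPre n N σ) {v u : Fin N} (h52 : σ.var 52 = (v : ℕ))
    (h53 : σ.var 53 = (N : ℤ) * (v : ℕ)) (hu : u = v ∨ outWeights N σ.decode v u ≠ 0) :
    2⁻¹ ^ (Finset.univ.filter fun j => outWeights N σ.decode v j ≠ 0).card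
      ≤ wp D (forTo 16 3 scanProg) (ind fun τ => τ.var 52 = (u : ℕ)) σ := by
  set E : Fin N → Prop := fun j => outWeights N σ.decode v j ≠ 0 with hE
  -- Potential when the vertices below `i` are still to be scanned: the target is either the current
  -- choice or a neighbour yet to come.
  set f : ℕ → ℤ → ℝ≥0∞ := fun i z => 2⁻¹ ^ (Finset.univ.filter fun j : Fin N => E j ∧ (j : ℕ) < i).card *
    if z = (u : ℕ) ∨ (E u ∧ (u : ℕ) < i) then 1 else 0 with hf
  have hcard : ∀ i (hi : i < N), (Finset.univ.filter fun j : Fin N => E j ∧ (j : ℕ) < i + 1).card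
      = (Finset.univ.filter fun j : Fin N => E j ∧ (j : ℕ) < i).card + if E ⟨i, hi⟩ then 1 else 0 := by
    intro i hi
    split_ifs with he
    · rw [← Finset.card_insert_of_notMem (a := (⟨i, hi⟩ : Fin N)) (by simp)]
      congr 1
      ext j
      simp only [Finset.mem_filter, Finset.mem_univ, true_and, Finset.mem_insert, Fin.ext_iff]
      constructor
      · rintro ⟨h1, h2⟩
        by_cases hji : (j : ℕ) = i
        · exact Or.inl hji
        · exact Or.inr ⟨h1, by omega⟩
      · rintro (h1 | ⟨h1, h2⟩)
        · obtain rfl : j = ⟨i, hi⟩ := Fin.ext h1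
          exact ⟨he, by simp⟩
        · exact ⟨h1, by omega⟩
    · rw [add_zero]
      congr 1
      ext j
      simp only [Finset.mem_filter, Finset.mem_univ, true_and]
      refine and_congr_right fun h1 => ?_
      have : (j : ℕ) ≠ i := by
        rintro rfl
        exact he h1
      omega
  have := (scan_hyp (D := D) h h52).le_wp (fun i τ => f i (τ.var 52)) fun i hi τ hI hc hF => by
    have hS := local_scan.same hF
    have hS' : Same σ (τ.setVar 16 i) :=
      hS.trans ⟨fun y hy => by rw [Store.setVar_var, if_neg (by omega)], fun _ _ => rfl⟩
    have e53 : (τ.setVar 16 i).var 53 = (N : ℤ) * (v : ℕ) := by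
      rw [Store.setVar_var, if_neg (by decide),
        hF.1 53 (by simp [scanProg, edgeProg, nonzeroProg, Prog.wv]), h53]
    have e52 : (τ.setVar 16 i).var 52 = τ.var 52 := by simp
    rw [scan_wp (j := ⟨i, hi⟩) (hS'.stamped h.stamped) ((hS'.consts h.consts).zero) e53 (by simp) (f i),
      hS'.outWeights, e52]
    simp only [hf, hcard i hi]
    by_cases hEi : E ⟨i, hi⟩
    · rw [if_pos hEi, if_pos hEi, pow_succ, mul_comm (2⁻¹ ^ _) (2⁻¹ : ℝ≥0∞), mul_assoc]
      by_cases hui : (u : ℕ) = i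
      · refine le_trans ?_ le_self_add
        gcongr
        rw [if_pos (Or.inl (by exact_mod_cast hui.symm) : ((i : ℕ) : ℤ) = ((u : ℕ) : ℤ) ∨ _)]
        split_ifs <;> simp
      · refine le_trans ?_ le_add_self
        have : (u : ℕ) < i + 1 ↔ (u : ℕ) < i := by omega
        simp only [this, le_refl]
    · have hui : E u → (u : ℕ) ≠ i := by
        rintro h1 rfl
        exact hEi h1
      have : (E u ∧ (u : ℕ) < i + 1) ↔ (E u ∧ (u : ℕ) < i) :=
        and_congr_right fun h1 => by have := hui h1; omega
      rw [if_neg hEi, if_neg hEi, add_zero]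
      simp only [this, le_refl]
  have hend : ∀ τ, f 0 (τ.var 52) = ind (fun τ => τ.var 52 = (u : ℕ)) τ := fun τ => by
    simp [hf, ind]
  simp only [hend] at this
  refine le_trans ?_ this
  have h1 : ((σ.setVar 16 N).var 52 = (u : ℕ) ∨ (E u ∧ (u : ℕ) < N)) := by
    rcases hu with rfl | hu
    · exact Or.inl (by simpa using h52)
    · exact Or.inr ⟨hu, u.2⟩
  simp only [hf]
  rw [if_pos h1, mul_one]
  refine pow_le_pow_of_le_one zero_le (by simp) (Finset.card_le_card fun j hj => ?_)
  exact Finset.mem_filter.2 ⟨Finset.mem_univ _, (Finset.mem_filter.1 hj).2.1⟩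

/-- The machine has no multiplication; the row address `N * w` is computed by repeated addition. -/
theorem base_hyp (h : WalkPre n N σ) {w : Fin N} (h51 : σ.var 51 = (w : ℕ)) (h53 : σ.var 53 = 0) :
    ForHyp D 17 51 (.add 53 53 3) w 1 (fun i τ => τ.var 53 = (N : ℤ) * ((w : ℕ) - (i : ℤ))) σ where
  bound := h51
  one := h.consts.one
  zero := h.consts.zero
  ne := by decide
  counter := by simp [Prog.wv]
  wone := by simp [Prog.wv]
  init := by simp [h53]
  body := by
    intro i hi τ hI hc hF
    have h3 : τ.var 3 = N := by rw [hF.1 3 (by simp [Prog.wv]), h.count]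
    refine Tri.straight (p := .add 53 53 3) trivial le_rfl ?_
    simp [Prog.exec, hI, h3]
    ring

theorem base_tri (h : WalkPre n N σ) {w : Fin N} (h51 : σ.var 51 = (w : ℕ)) (h53 : σ.var 53 = 0) :
    Tri D (.seq (forTo 17 51 (.add 53 53 3)) (.add 52 51 9)) σ (4 * N + 5) fun τ => WalkPre n N τ ∧
      Same σ τ ∧ τ.var 52 = (w : ℕ) ∧ τ.var 53 = (N : ℤ) * (w : ℕ) := by
  have hw := w.2
  refine ((Tri.seq (B' := 1) ((base_hyp h h51 h53).tri.mono le_rfl fun τ hτ =>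
    Tri.straight (p := .add 52 51 9) trivial le_rfl ?_)).mono (by omega) fun _ h => h)
  obtain ⟨h1, -, hF⟩ := hτ
  have e51 : τ.var 51 = (w : ℕ) := by rw [hF.1 51 (by simp [Prog.wv]), h51]
  have e9 : τ.var 9 = 0 := by rw [hF.1 9 (by simp [Prog.wv]), h.consts.zero]
  have hS : Same σ ((Prog.add 52 51 9).exec τ) := by
    refine ⟨fun y hy => ?_, fun c hc => hF.2 c (by simp [Prog.wa])⟩
    simp only [Prog.exec, Store.setVar_var]
    rw [if_neg (by omega), hF.1 y (by simp only [forTo_wv, Prog.wv]; omega)]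
  exact ⟨h.congr hS, hS, by simp [Prog.exec, e51, e9], by simp [Prog.exec, h1]⟩

theorem scan_end (h : WalkPre n N σ) {w : Fin N} (h52 : σ.var 52 = (w : ℕ)) :
    Tri D (forTo 16 3 scanProg) σ (49 * N + 3) fun τ => Tri D (.add 51 52 9) τ 1 fun ρ =>
      ρ.var 51 = τ.var 52 ∧ ∃ u : Fin N, ρ.var 51 = (u : ℕ) := by
  refine (scan_hyp h h52).tri.mono (by omega) fun τ hτ => ?_
  obtain ⟨⟨u, hu⟩, -, hF⟩ := hτ
  have h9 : τ.var 9 = 0 := by rw [(local_scan.same hF).1 9 (by omega), h.consts.zero]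
  have : ((Prog.add 51 52 9).exec τ).var 51 = τ.var 52 := by simp [Prog.exec, h9]
  exact Tri.straight (p := .add 51 52 9) trivial le_rfl ⟨this, u, this.trans hu⟩

theorem same_const (σ : Store) : Same σ ((Prog.const 53 0).exec σ) :=
  ⟨fun y hy => by simp only [Prog.exec, Store.setVar_var]; rw [if_neg (by omega)], fun _ _ => rfl⟩

theorem step_seq (h : WalkPre n N σ) {w : Fin N} (h51 : σ.var 51 = (w : ℕ)) :
    Tri D (.seq (forTo 17 51 (.add 53 53 3)) (.add 52 51 9)) ((Prog.const 53 0).exec σ) (4 * N + 5) fun τ =>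
      (WalkPre n N τ ∧ Same σ τ ∧ τ.var 52 = (w : ℕ) ∧ τ.var 53 = (N : ℤ) * (w : ℕ)) ∧
      Tri D (.seq (forTo 16 3 scanProg) (.add 51 52 9)) τ (49 * N + 5)
        fun ρ => ∃ u : Fin N, ρ.var 51 = (u : ℕ) := by
  refine (base_tri (h.congr (same_const σ)) (by simpa [Prog.exec] using h51) (by simp [Prog.exec])).mono
    le_rfl fun τ hτ => ⟨⟨hτ.1, (same_const σ).trans hτ.2.1, hτ.2.2⟩, ?_⟩
  exact (Tri.seq ((scan_end hτ.1 hτ.2.2.1).mono le_rfl fun ρ hρ => hρ.mono le_rfl fun _ h => h.2)).mono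
    (by omega) fun _ h => h

theorem step_tri (h : WalkPre n N σ) {w : Fin N} (h51 : σ.var 51 = (w : ℕ)) :
    Tri D stepProg σ (53 * N + 13) fun τ => WalkPre n N τ ∧ Same σ τ ∧ ∃ u : Fin N, τ.var 51 = (u : ℕ) := by
  refine (Tri.straight_seq (p := .const 53 0) trivial (Tri.seq ((step_seq h h51).mono le_rfl
    fun τ hτ => hτ.2))).frame.mono ?_ fun τ hτ => ?_
  · rw [show (Prog.const 53 0).cost = 1 from rfl]
    omega
  · have hS := local_step.same hτ.2
    exact ⟨h.congr hS, hS, hτ.1⟩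

open Classical in
theorem step_wp (h : WalkPre n N σ) {w u : Fin N} (h51 : σ.var 51 = (w : ℕ)) {d : ℕ}
    (hdeg : (Finset.univ.filter fun j => outWeights N σ.decode w j ≠ 0).card ≤ d)
    (hu : u = w ∨ outWeights N σ.decode w u ≠ 0) :
    2⁻¹ ^ d ≤ wp D stepProg (ind fun τ => τ.var 51 = (u : ℕ)) σ := by
  have hs := step_seq (D := D) h h51
  rw [stepProg, (Tri.seq (hs.mono le_rfl fun τ hτ => hτ.2)).wp_straight_seq (p := .const 53 0) trivial,
    Tri.wp_seq (hs.mono le_rfl fun τ hτ => hτ.2), ← hs.wp_eq_const (f := fun _ => 2⁻¹ ^ d) fun _ _ => rfl]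
  refine hs.wp_mono fun τ hτ => ?_
  obtain ⟨⟨hW, hS, h52, h53⟩, -⟩ := hτ
  have he := scan_end (D := D) hW h52
  have hloop := scan_loop_wp (D := D) (u := u) hW h52 h53 (by rwa [hS.outWeights])
  rw [hS.outWeights] at hloop
  rw [Tri.wp_seq (he.mono le_rfl fun ρ hρ => hρ.mono le_rfl fun _ _ => trivial)]
  refine (pow_le_pow_of_le_one zero_le (by simp) hdeg).trans (hloop.trans (he.wp_mono fun ρ hρ => ?_))
  refine (hρ.wp_eq_const (c := ind (fun τ => τ.var 52 = (u : ℕ)) ρ) fun ξ hξ => ?_).ge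
  exact ind_congr (by rw [hξ.1])

/-- The precondition of the random walks. -/
structure StepInv (n N : ℕ) (σ τ : Store) : Prop where
  pre : WalkPre n N τ
  same : Same σ τ
  at_vertex : ∃ w : Fin N, τ.var 51 = (w : ℕ)

theorem StepInv.step {τ : Store} (h : StepInv n N σ τ) : Tri D stepProg τ (53 * N + 13) (StepInv n N σ) := by
  obtain ⟨w, hw⟩ := h.at_vertex
  exact (step_tri h.pre hw).mono le_rfl fun ρ hρ => ⟨hρ.1, h.same.trans hρ.2.1, hρ.2.2⟩

open Classical in
-- Following one given walk of `r` steps costs at most a factor `2^{-d}` for each step, since all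
-- degrees are at most `d`.
theorem steps_wp (h : WalkPre n N σ) {w u : Fin N} (h51 : σ.var 51 = (w : ℕ)) {d r : ℕ}
    (hdeg : ∀ v, (Finset.univ.filter fun j => outWeights N σ.decode v j ≠ 0).card ≤ d)
    (hr : Reach (outWeights N σ.decode) r w u) :
    (2⁻¹ ^ d) ^ r ≤ wp D (rep r stepProg) (ind fun τ => τ.var 51 = (u : ℕ)) σ := by
  have hI : StepInv n N σ σ := ⟨h, ⟨fun _ _ => rfl, fun _ _ => rfl⟩, w, h51⟩
  have := le_rep_wp (D := D) (I := fun _ => StepInv n N σ) (fun r τ hτ => hτ.step)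
    (fun r τ => (2⁻¹ ^ d) ^ r * ind (fun τ => ∃ v : Fin N, τ.var 51 = (v : ℕ) ∧
      Reach (outWeights N σ.decode) r v u) τ) (fun r τ hτ => ?_) r σ hI
  · rw [ind_pos ⟨w, h51, hr⟩, mul_one] at this
    refine this.trans (le_of_eq ?_)
    congr 1
    funext τ
    have : (∃ v : Fin N, τ.var 51 = (v : ℕ) ∧ Reach (outWeights N σ.decode) 0 v u) ↔ τ.var 51 = (u : ℕ) :=
      ⟨fun ⟨v, hv, hvu⟩ => by cases hvu; exact hv, fun hv => ⟨u, hv, rfl⟩⟩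
    simp only [pow_zero, one_mul]
    exact ind_congr this
  · by_cases hQ : ∃ v : Fin N, τ.var 51 = (v : ℕ) ∧ Reach (outWeights N σ.decode) (r + 1) v u
    · rw [ind_pos hQ, mul_one]
      obtain ⟨v, hv, v', hvv', hr'⟩ := hQ
      have hst := step_wp (D := D) (u := v') (d := d) hτ.pre hv
        (by simpa only [hτ.same.outWeights] using hdeg v) (by rwa [hτ.same.outWeights])
      rw [pow_succ, mul_comm]
      refine (mul_le_mul_left hst _).trans ?_
      rw [mul_comm, wp, ← expect_const_mul]
      refine expect_mono fun ρ _ => ?_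
      refine mul_le_mul_right ?_ _
      by_cases h' : ρ.var 51 = (v' : ℕ)
      · exact (ind_le_one _ _).trans (ind_pos ⟨v', h', hr'⟩).ge
      · rw [ind_neg h']
        exact zero_le
    · rw [ind_neg hQ, mul_zero]
      exact zero_le

end Walk

/-! ### Candidate sets -/

section Candidate

/-- Walk from vertex `15`, and mark the coordinate of the vertex that is reached. -/
def walkProg (r : ℕ) : Prog :=
  .seq (.add 51 15 9) (.seq (rep r stepProg) (.seq (.load 58 2 51) (.store 3 58 1)))

/-- Mark the endpoints of `q` random walks from vertex `15`. -/
def candProg (q r : ℕ) : Prog := .seq (forTo 18 0 (.store 3 18 9)) (rep q (walkProg r))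

variable {n N : ℕ} {σ : Store}

theorem local_walk (r : ℕ) : Local (walkProg r) := by
  constructor
  · intro y hy
    simp only [walkProg, Prog.wv, not_or]
    exact ⟨by omega, rep_wv _ _ _ (local_step.1 y hy), by omega, not_false⟩
  · intro c hc
    simp only [walkProg, Prog.wa, not_or]
    exact ⟨not_false, rep_wa _ _ _ (local_step.2 c hc), not_false, hc⟩

theorem local_cand (q r : ℕ) : Local (candProg q r) := by
  constructor
  · intro y hy
    simp only [candProg, forTo_wv, Prog.wv, not_or]
    exact ⟨⟨by omega, not_false⟩, rep_wv _ _ _ ((local_walk r).1 y hy)⟩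
  · intro c hc
    simp only [candProg, forTo_wa, Prog.wa, not_or]
    exact ⟨hc, rep_wa _ _ _ ((local_walk r).2 c hc)⟩

theorem walk_seq (h : WalkPre n N σ) {w : Fin N} (h15 : σ.var 15 = (w : ℕ)) (r : ℕ) :
    Tri D (rep r stepProg) ((Prog.add 51 15 9).exec σ) (r * (53 * N + 15) + 1) fun τ =>
      (WalkPre n N τ ∧ Same σ τ ∧ τ.arr 3 = σ.arr 3) ∧
      Tri D (.seq (.load 58 2 51) (.store 3 58 1)) τ 3
        fun ρ => ρ.arr 3 = Function.update (σ.arr 3) (σ.arr 2 (τ.var 51)) 1 := by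
  have h51 : ((Prog.add 51 15 9).exec σ).var 51 = (w : ℕ) := by simp [Prog.exec, h15, h.consts.zero]
  have hS : Same σ ((Prog.add 51 15 9).exec σ) :=
    ⟨fun y hy => by simp only [Prog.exec, Store.setVar_var]; rw [if_neg (by omega)], fun _ _ => rfl⟩
  refine (rep_tri (I := fun _ => StepInv n N σ) (fun r τ hτ => hτ.step) r _
    ⟨h.congr hS, hS, w, h51⟩).frame.mono (by ring_nf; omega) fun τ hτ => ?_
  have h3 : τ.arr 3 = σ.arr 3 := by
    rw [hτ.2.2 3 (rep_wa _ _ _ (by simp [stepProg, scanProg, edgeProg, nonzeroProg, Prog.wa]))]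
    rfl
  have h2 := hτ.1.same.2 2 (by decide)
  have h1 := hτ.1.pre.consts.one
  refine ⟨⟨hτ.1.pre, hτ.1.same, h3⟩, Tri.straight (by simp [Prog.straight]) (by simp [Prog.cost]) ?_⟩
  simp [Prog.exec, Store.setArr, h1, h2, h3]

theorem walk_tri (h : WalkPre n N σ) {w : Fin N} (h15 : σ.var 15 = (w : ℕ)) (r : ℕ) :
    Tri D (walkProg r) σ (r * (53 * N + 15) + 7) fun τ => WalkPre n N τ ∧ Same σ τ := by
  refine (Tri.straight_seq (p := .add 51 15 9) trivial (Tri.seq ((walk_seq h h15 r).mono le_rfl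
    fun τ hτ => hτ.2.mono le_rfl fun _ _ => trivial))).frame.mono ?_ fun τ hτ => ?_
  · rw [show (Prog.add 51 15 9).cost = 1 from rfl]
    omega
  · have hS := (local_walk r).same hτ.2
    exact ⟨h.congr hS, hS⟩

open Classical in
theorem walk_wp (h : WalkPre n N σ) {w u : Fin N} (h15 : σ.var 15 = (w : ℕ)) {d r : ℕ}
    (hdeg : ∀ v, (Finset.univ.filter fun j => outWeights N σ.decode v j ≠ 0).card ≤ d)
    (hr : Reach (outWeights N σ.decode) r w u) :
    (2⁻¹ ^ d) ^ r ≤ wp D (walkProg r)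
      (ind fun τ => τ.arr 3 = Function.update (σ.arr 3) (σ.arr 2 ((u : ℕ) : ℤ)) 1) σ := by
  have hs := walk_seq (D := D) h h15 r
  have h51 : ((Prog.add 51 15 9).exec σ).var 51 = (w : ℕ) := by simp [Prog.exec, h15, h.consts.zero]
  have hS : Same σ ((Prog.add 51 15 9).exec σ) :=
    ⟨fun y hy => by simp only [Prog.exec, Store.setVar_var]; rw [if_neg (by omega)], fun _ _ => rfl⟩
  have hw := steps_wp (D := D) (h.congr hS) (u := u) (d := d) (r := r) h51
    (by simpa only [hS.outWeights] using hdeg) (by rwa [hS.outWeights])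
  rw [walkProg, (Tri.seq (hs.mono le_rfl fun τ hτ => hτ.2.mono le_rfl
    fun _ _ => trivial)).wp_straight_seq (p := .add 51 15 9) trivial,
    Tri.wp_seq (hs.mono le_rfl fun τ hτ => hτ.2.mono le_rfl fun _ _ => trivial)]
  refine hw.trans (hs.wp_mono fun τ hτ => ?_)
  by_cases hτu : τ.var 51 = (u : ℕ)
  · refine (ind_le_one _ _).trans (hτ.2.wp_eq_const fun ρ hρ => ind_pos ?_).ge
    rw [hρ, hτu]
  · rw [ind_neg hτu]
    exact zero_le

end Candidate

end

noncomputable section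

variable {D : PMF (List (ℤ × ℤ))}

/-! ### Testing random candidates and searching all starting points -/

section Attempt

variable {n N : ℕ} {σ : Store}

theorem clear_tri (h : Consts n σ) : Tri D (forTo 18 0 (.store 3 18 9)) σ (4 * n + 3)
    fun τ => Same σ τ ∧ ∀ i : Fin n, τ.arr 3 (i : ℕ) = 0 := by
  have hF : ForHyp D 18 0 (.store 3 18 9) n 1
      (fun i τ => ∀ v : Fin n, i ≤ (v : ℕ) → τ.arr 3 (v : ℕ) = 0) σ :=
    { bound := h.size
      one := h.one
      zero := h.zero
      ne := by decide
      counter := by simp [Prog.wv]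
      wone := by simp [Prog.wv]
      init := fun v hv => absurd v.2 (not_lt.2 hv)
      body := by
        intro i hi τ hI hc hF
        have h9 : τ.var 9 = 0 := by rw [hF.1 9 (by simp [Prog.wv]), h.zero]
        refine Tri.straight (p := .store 3 18 9) trivial le_rfl fun v hv => ?_
        simp only [Prog.exec, Store.setVar_var, Store.setVar_arr, Store.setArr_arr, if_true, true_and]
        by_cases hvi : (v : ℕ) = i
        · simp [hvi, h9]
        · rw [if_neg (by exact_mod_cast hvi)]
          exact hI v (by omega) }
  refine hF.tri.mono (by omega) fun τ hτ => ⟨⟨fun y hy => hτ.2.2.1 y ?_, fun c hc => hτ.2.2.2 c ?_⟩,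
    fun i => hτ.1 i (Nat.zero_le _)⟩
  · simp only [forTo_wv, Prog.wv, or_false]
    omega
  · simpa [Prog.wa] using hc

theorem cand_seq (h : WalkPre n N σ) {w : Fin N} (h15 : σ.var 15 = (w : ℕ)) (q r : ℕ) :
    Tri D (forTo 18 0 (.store 3 18 9)) σ (4 * n + 3) fun τ =>
      (WalkPre n N τ ∧ Same σ τ ∧ ∀ i : Fin n, τ.arr 3 (i : ℕ) = 0) ∧
      Tri D (rep q (walkProg r)) τ (q * (r * (53 * N + 15) + 9) + 1) fun ρ => WalkPre n N ρ ∧ Same σ ρ := by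
  refine (clear_tri h.consts).mono le_rfl fun τ hτ => ⟨⟨h.congr hτ.1, hτ.1, hτ.2⟩, ?_⟩
  refine rep_tri (I := fun _ ρ => WalkPre n N ρ ∧ Same σ ρ) (fun _ ρ hρ => ?_) q τ ⟨h.congr hτ.1, hτ.1⟩
  exact (walk_tri hρ.1 (w := w) (by rw [hρ.2.1 15 (by omega), h15]) r).mono le_rfl
    fun ξ hξ => ⟨hξ.1, hρ.2.trans hξ.2⟩

theorem cand_tri (h : WalkPre n N σ) {w : Fin N} (h15 : σ.var 15 = (w : ℕ)) (q r : ℕ) :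
    Tri D (candProg q r) σ (4 * n + q * (r * (53 * N + 15) + 9) + 5)
      fun ρ => WalkPre n N ρ ∧ Same σ ρ :=
  (Tri.seq ((cand_seq h h15 q r).mono le_rfl fun _ hτ => hτ.2)).mono (by omega) fun _ h => h

open Classical in
-- The `q` walks use independent coins, so the `l`-th one can be required to end in `u l` for every
-- `l`. Array `2` translates the endpoints into coordinates; the marks start out cleared.
theorem cand_wp (h : WalkPre n N σ) {w : Fin N} (h15 : σ.var 15 = (w : ℕ)) {d q r : ℕ}
    (hdeg : ∀ v, (Finset.univ.filter fun j => outWeights N σ.decode v j ≠ 0).card ≤ d)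
    (u : ℕ → Fin N) (hr : ∀ l < q, Reach (outWeights N σ.decode) r w (u l)) :
    ((2⁻¹ ^ d) ^ r) ^ q ≤ wp D (candProg q r) (ind fun τ => ∀ i : Fin n, i ∈ marked n τ ↔
      ∃ l < q, σ.arr 2 ((u l : ℕ) : ℤ) = (i : ℕ)) σ := by
  have hs := cand_seq (D := D) h h15 q r
  rw [candProg, Tri.wp_seq (hs.mono le_rfl fun _ hτ => hτ.2), ← hs.wp_eq_const
    (f := fun _ => ((2⁻¹ ^ d) ^ r) ^ q) fun _ _ => rfl]
  refine hs.wp_mono fun τ hτ => ?_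
  obtain ⟨⟨hW, hS, h0⟩, -⟩ := hτ
  have := le_rep_wp (D := D) (p := walkProg r) (B := r * (53 * N + 15) + 7)
    (I := fun t ρ => t ≤ q ∧ WalkPre n N ρ ∧ Same σ ρ)
    (fun t ρ hρ => (walk_tri hρ.2.1 (w := w) (by rw [hρ.2.2.1 15 (by omega), h15]) r).mono le_rfl
      fun ξ hξ => ⟨by have := hρ.1; omega, hξ.1, hρ.2.2.trans hξ.2⟩)
    (fun t ρ => ((2⁻¹ ^ d) ^ r) ^ t * ind (fun ρ => ∀ i : Fin n, i ∈ marked n ρ ↔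
      ∃ l, t ≤ l ∧ l < q ∧ σ.arr 2 ((u l : ℕ) : ℤ) = (i : ℕ)) ρ) (fun t ρ hρ => ?_) q τ ⟨le_rfl, hW, hS⟩
  · rw [ind_pos, mul_one] at this
    · refine this.trans (le_of_eq ?_)
      congr 1
      funext ρ
      rw [pow_zero, one_mul]
      exact ind_congr (by simp)
    · intro i
      simp only [marked, Finset.mem_filter, Finset.mem_univ, true_and, h0 i, lt_irrefl, false_iff, not_exists]
      rintro l ⟨h1, h2, -⟩
      omega
  · obtain ⟨ht, hWρ, hSρ⟩ := hρ
    by_cases hQ : ∀ i : Fin n, i ∈ marked n ρ ↔ ∃ l, t + 1 ≤ l ∧ l < q ∧ σ.arr 2 ((u l : ℕ) : ℤ) = (i : ℕ)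
    · rw [ind_pos hQ, mul_one]
      have hw := walk_wp (D := D) (d := d) (u := u t) (r := r) hWρ (w := w)
        (by rw [hSρ.1 15 (by omega), h15]) (by simpa only [hSρ.outWeights] using hdeg)
        (by rw [hSρ.outWeights]; exact hr t (by omega))
      rw [pow_succ]
      refine (mul_le_mul_right hw _).trans ?_
      simp only [wp]
      rw [← expect_const_mul]
      refine expect_mono fun ξ _ => ?_
      refine mul_le_mul_right ?_ _
      by_cases h' : ξ.arr 3 = Function.update (ρ.arr 3) (ρ.arr 2 ((u t : ℕ) : ℤ)) 1
      · refine (ind_le_one _ _).trans (ind_pos fun i => ?_).ge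
        have hi := hQ i
        simp only [marked, Finset.mem_filter, Finset.mem_univ, true_and] at hi ⊢
        rw [h', hSρ.2 2 (by decide)]
        by_cases hit : σ.arr 2 ((u t : ℕ) : ℤ) = (i : ℕ)
        · rw [← hit, Function.update_self]
          simp only [zero_lt_one, true_iff]
          exact ⟨t, le_rfl, by omega, rfl⟩
        · rw [Function.update_of_ne (Ne.symm hit), hi]
          refine exists_congr fun l => ⟨fun ⟨h1, h2⟩ => ⟨by omega, h2⟩, fun ⟨h1, h2⟩ => ⟨?_, h2⟩⟩
          rcases Nat.lt_or_ge t l with h3 | h3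
          · exact h3
          · obtain rfl : l = t := by omega
            exact absurd h2.2 hit
      · rw [ind_neg h']
        exact zero_le
    · rw [ind_neg hQ, mul_zero]
      exact zero_le

/-- Test a random candidate near vertex `15`. -/
def attemptProg (q r : ℕ) : Prog := .seq (candProg q r) testProg

variable {k : ℕ} {b : ℝ} {S : Finset (Fin n)} {hS : S.card = 2 * k + 2} {K θ L : ℕ}

/-- The precondition for testing candidates. -/
structure AttemptPre (n N K θ L : ℕ) (σ : Store) : Prop extends WalkPre n N σ where
  rounds : σ.var 6 = (K * L : ℕ)
  threshold : σ.var 7 = (θ * L : ℕ)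

theorem AttemptPre.congr {τ : Store} (h : AttemptPre n N K θ L σ) (hs : Same σ τ) : AttemptPre n N K θ L τ :=
  ⟨h.toWalkPre.congr hs, (hs.1 _ (by omega)).trans h.rounds, (hs.1 _ (by omega)).trans h.threshold⟩

/-- The output is neither empty nor correct. -/
def Wrong (S : Finset (Fin n)) (σ : Store) : Prop := outSet n σ ≠ ∅ ∧ outSet n σ ≠ S

/-- The output is not empty. -/
def Found (n : ℕ) (σ : Store) : Prop := outSet n σ ≠ ∅

/-- The running time of an attempt. -/
def attemptCost (n N q r t : ℕ) : ℕ :=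
  4 * n + q * (r * (53 * N + 15) + 9) + 5 + (t * (12 * n + 12) + 7 * n + 12) + 1

theorem attempt_seq (h : AttemptPre n N K θ L σ) {w : Fin N} (h15 : σ.var 15 = (w : ℕ)) (q r : ℕ)
    {P : PMF (Fin n → ℤˣ)} :
    Tri (samples P) (candProg q r) σ (4 * n + q * (r * (53 * N + 15) + 9) + 5) fun τ =>
      (AttemptPre n N K θ L τ ∧ outSet n τ = outSet n σ) ∧
      Tri (samples P) testProg τ (K * L * (12 * n + 12) + 7 * n + 12) fun ρ =>
        outSet n ρ = outSet n σ ∨ outSet n ρ = outSet n σ ∪ marked n τ := by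
  refine (cand_tri h.toWalkPre h15 q r).mono le_rfl fun τ hτ => ?_
  have h1 := h.congr hτ.2
  have h2 : outSet n τ = outSet n σ := outSet_congr (hτ.2.2 0 (by decide))
  refine ⟨⟨h1, h2⟩, ?_⟩
  have := test_tri (P := P) h1.consts h1.rounds
  rwa [h2] at this

theorem attempt_tri (h : AttemptPre n N K θ L σ) {w : Fin N} (h15 : σ.var 15 = (w : ℕ)) (q r : ℕ)
    {P : PMF (Fin n → ℤˣ)} :
    Tri (samples P) (attemptProg q r) σ (attemptCost n N q r (K * L)) fun τ =>
      outSet n σ ⊆ outSet n τ := by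
  refine Tri.seq ((attempt_seq h h15 q r).mono le_rfl fun τ hτ => hτ.2.mono le_rfl fun ρ hρ => ?_)
  rcases hρ with hρ | hρ <;> rw [hρ]
  exact Finset.subset_union_left

/-- Adding the empty set or `S` to an output that is empty or equal to `S` does no damage. The
output can only be spoilt by accepting a nonempty candidate other than `S`. -/
theorem attempt_wrong (hK : TestParams (delta b ^ k) K θ) (h : AttemptPre n N K θ L σ) {w : Fin N}
    (h15 : σ.var 15 = (w : ℕ)) (q r : ℕ) :
    wp (samples (noisyParity b k S hS)) (attemptProg q r) (ind (Wrong S)) σ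
      ≤ ind (Wrong S) σ + ENNReal.ofReal (Real.exp (-3)) ^ L := by
  have hs := attempt_seq h h15 q r (P := noisyParity b k S hS)
  rw [attemptProg, Tri.wp_seq (hs.mono le_rfl fun τ hτ => hτ.2.mono le_rfl fun _ _ => trivial)]
  refine (hs.wp_mono fun τ hτ => ?_).trans_eq (hs.wp_eq_const fun _ _ => rfl)
  obtain ⟨⟨h1, h2⟩, h3⟩ := hτ
  by_cases hw : Wrong S σ
  · rw [ind_pos hw]
    refine le_trans ?_ le_self_add
    exact (h3.wp_mono fun ρ _ => ind_le_one _ _).trans_eq (h3.wp_eq_const fun _ _ => rfl)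
  · refine le_trans ?_ le_add_self
    have hw' : outSet n σ = ∅ ∨ outSet n σ = S := by
      by_contra hcon
      exact hw ⟨fun e => hcon (Or.inl e), fun e => hcon (Or.inr e)⟩
    by_cases hm : marked n τ = ∅ ∨ marked n τ = S
    · refine (h3.wp_eq_const (c := 0) fun ρ hρ => ind_neg fun hρ' => ?_).trans_le zero_le
      have : outSet n ρ = ∅ ∨ outSet n ρ = S := by
        rcases hρ with hρ | hρ
        · rwa [hρ]
        · rw [hρ]
          rcases hw' with e | e <;> rcases hm with e' | e' <;> simp [e, e']
      rcases this with e | e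
      · exact hρ'.1 e
      · exact hρ'.2 e
    · push Not at hm
      refine test_wp_wrong hK h1.consts h1.rounds h1.threshold hm.1 hm.2 _
        (fun _ => ind_le_one _ _) fun ρ hρ => ind_neg fun hρ' => hw ?_
      rwa [Wrong, hρ, h2] at hρ'

theorem exp_neg_three_le : ENNReal.ofReal (Real.exp (-3)) ≤ 16⁻¹ := by
  have h : (2.7 : ℝ) < Real.exp 1 := by
    have := Real.exp_one_gt_d9
    linarith
  have h3 : Real.exp 3 = Real.exp 1 ^ 3 := by rw [← Real.exp_nat_mul]; norm_num
  have h4 : (16 : ℝ) ≤ Real.exp 3 := by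
    rw [h3]
    calc (16 : ℝ) ≤ 2.7 ^ 3 := by norm_num
      _ ≤ _ := by gcongr
  have e : (16⁻¹ : ℝ≥0∞) = ENNReal.ofReal 16⁻¹ := by
    rw [ENNReal.ofReal_inv_of_pos (by norm_num)]
    simp
  rw [e, Real.exp_neg]
  exact ENNReal.ofReal_le_ofReal (inv_anti₀ (by norm_num) h4)

/-- Given that the candidate is `S`, it is rejected with probability at most `e^{-3L} ≤ 1/16`, hence
accepted with probability at least one half. -/
theorem attempt_right (hK : TestParams (delta b ^ k) K θ) (hL : 0 < L) (h : AttemptPre n N K θ L σ)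
    {w : Fin N} (h15 : σ.var 15 = (w : ℕ)) {q r : ℕ} {a : ℝ≥0∞}
    (ha : a ≤ wp (samples (noisyParity b k S hS)) (candProg q r) (ind fun τ => marked n τ = S) σ) :
    a * 2⁻¹ ≤ wp (samples (noisyParity b k S hS)) (attemptProg q r) (ind (Found n)) σ := by
  have hs := attempt_seq h h15 q r (P := noisyParity b k S hS)
  rw [attemptProg, Tri.wp_seq (hs.mono le_rfl fun τ hτ => hτ.2.mono le_rfl fun _ _ => trivial)]
  rw [mul_comm]
  refine (mul_le_mul_right ha _).trans ?_
  nth_rewrite 1 [wp]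
  rw [← expect_const_mul]
  refine hs.wp_mono fun τ hτ => ?_
  obtain ⟨⟨h1, h2⟩, h3⟩ := hτ
  by_cases hm : marked n τ = S
  · rw [ind_pos hm, mul_one]
    have hempty := test_wp_right (S := S) (hS := hS) hK h1.consts h1.rounds h1.threshold hm
      (ind fun ρ => ¬ Found n ρ) (fun _ => ind_le_one _ _) fun ρ hρ => ind_neg fun hρ' => by
        have : S.Nonempty := Finset.card_pos.1 (by omega)
        refine hρ' fun he => ?_
        rw [hρ, Finset.union_eq_empty] at he
        exact this.ne_empty he.2
    have hsum : 1 = wp (samples (noisyParity b k S hS)) testProg (ind (Found n)) τ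
        + wp (samples (noisyParity b k S hS)) testProg (ind fun ρ => ¬ Found n ρ) τ := by
      simp only [wp]
      rw [← expect_add, ← expect_const (den _ testProg τ) 1]
      refine expect_congr fun ρ _ => ?_
      by_cases hf : Found n ρ
      · rw [ind_pos hf, ind_neg (not_not.2 hf), add_zero]
      · rw [ind_neg hf, ind_pos hf, zero_add]
    have hρ : ENNReal.ofReal (Real.exp (-3)) ^ L ≤ 2⁻¹ := by
      refine (pow_le_of_le_one zero_le (exp_neg_three_le.trans ?_) hL.ne').trans (exp_neg_three_le.trans ?_)
      · exact ENNReal.inv_le_one.2 (by norm_num)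
      · exact ENNReal.inv_le_inv.2 (by norm_num)
    have h5 : (1 : ℝ≥0∞) - 2⁻¹ ≤ wp (samples (noisyParity b k S hS)) testProg (ind (Found n)) τ := by
      rw [tsub_le_iff_right]
      nth_rewrite 1 [hsum]
      gcongr
      exact hempty.trans hρ
    rwa [ENNReal.one_sub_inv_two] at h5
  · rw [ind_neg hm, mul_zero]
    exact zero_le

/-- Test a random candidate near each vertex. -/
def searchProg (q r : ℕ) : Prog := forTo 15 2 (attemptProg q r)

theorem attempt_wv (q r y : ℕ) (hy : y < 16 ∨ 60 ≤ y) : ¬ (attemptProg q r).wv y := by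
  have hstep : ¬ stepProg.wv y := by
    simp only [stepProg, scanProg, edgeProg, nonzeroProg, forTo_wv, Prog.wv, or_false, false_or]
    omega
  have hwalk : ¬ (walkProg r).wv y := by
    simp only [walkProg, Prog.wv, not_or]
    exact ⟨by omega, rep_wv _ _ _ hstep, by omega, not_false⟩
  simp only [attemptProg, candProg, forTo_wv, Prog.wv, not_or]
  refine ⟨⟨⟨by omega, not_false⟩, rep_wv _ _ _ hwalk⟩, ?_⟩
  simp only [testProg, scoreProg, roundProg, coordProg, unionProg, forTo_wv, Prog.wv, or_false, false_or]
  omega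

theorem attempt_wa (q r c : ℕ) (hc : c ≠ 0 ∧ c ≠ 3 ∧ c ≠ 4) : ¬ (attemptProg q r).wa c := by
  simp only [attemptProg, Prog.wa, not_or]
  refine ⟨(local_cand q r).2 c hc.2.1, ?_⟩
  simp [testProg, scoreProg, roundProg, coordProg, unionProg, Prog.wa]
  tauto

/-- `τ` differs from `σ` only in what the search may modify. -/
def SearchFr (σ τ : Store) : Prop :=
  (∀ y, y < 15 ∨ 60 ≤ y → τ.var y = σ.var y) ∧ ∀ c, c ≠ 0 ∧ c ≠ 3 ∧ c ≠ 4 → τ.arr c = σ.arr c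

theorem SearchFr.of_fr {q r : ℕ} {τ : Store} (h : Fr (searchProg q r) σ τ) : SearchFr σ τ := by
  refine ⟨fun y hy => h.1 y ?_, fun c hc => h.2 c ?_⟩
  · rw [searchProg, forTo_wv, not_or]
    exact ⟨by omega, attempt_wv q r y (by omega)⟩
  · rw [searchProg, forTo_wa]
    exact attempt_wa q r c hc

theorem SearchFr.setVar {τ : Store} (h : SearchFr σ τ) (z : ℤ) : SearchFr σ (τ.setVar 15 z) := by
  refine ⟨fun y hy => ?_, h.2⟩
  rw [Store.setVar_var, if_neg (by omega)]
  exact h.1 y hy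

theorem SearchFr.decode {τ : Store} (h : SearchFr σ τ) : τ.decode = σ.decode :=
  decode_congr (fun y hy => h.1 y (by omega)) fun c hc => h.2 c (by omega)

theorem AttemptPre.of_searchFr {τ : Store} (h : AttemptPre n N K θ L σ) (hs : SearchFr σ τ) :
    AttemptPre n N K θ L τ where
  consts := h.consts.congr (hs.1 _ (by omega)) (hs.1 _ (by omega)) (hs.1 _ (by omega))
  count := (hs.1 _ (by omega)).trans h.count
  stamped a i := by
    rw [hs.2 _ (by omega), hs.1 4 (by omega)]
    exact h.stamped a i
  rounds := (hs.1 _ (by omega)).trans h.rounds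
  threshold := (hs.1 _ (by omega)).trans h.threshold

theorem search_hyp {m : ℕ} (h : AttemptPre n N K θ L σ) (hm : σ.var 2 = m) (hmN : m ≤ N) (q r : ℕ)
    {P : PMF (Fin n → ℤˣ)} :
    ForHyp (samples P) 15 2 (attemptProg q r) m (attemptCost n N q r (K * L))
      (fun _ τ => outSet n σ ⊆ outSet n τ) σ where
  bound := hm
  one := h.consts.one
  zero := h.consts.zero
  ne := by decide
  counter := attempt_wv _ _ _ (by omega)
  wone := attempt_wv _ _ _ (by omega)
  init := subset_rfl
  body := by
    intro i hi τ hI hc hF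
    have hs := (SearchFr.of_fr hF).setVar i
    refine (attempt_tri (h.of_searchFr hs) (w := ⟨i, by omega⟩) (by simp) q r).mono le_rfl
      fun ρ hρ => hI.trans hρ

theorem search_tri {m : ℕ} (h : AttemptPre n N K θ L σ) (hm : σ.var 2 = m) (hmN : m ≤ N) (q r : ℕ)
    {P : PMF (Fin n → ℤˣ)} :
    Tri (samples P) (searchProg q r) σ (m * (attemptCost n N q r (K * L) + 3) + 3)
      fun τ => outSet n σ ⊆ outSet n τ ∧ SearchFr σ τ :=
  (search_hyp h hm hmN q r).tri.mono le_rfl fun _ hτ => ⟨hτ.1, SearchFr.of_fr hτ.2.2⟩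

theorem search_wrong (hK : TestParams (delta b ^ k) K θ) {m : ℕ} (h : AttemptPre n N K θ L σ)
    (hm : σ.var 2 = m) (hmN : m ≤ N) (q r : ℕ) :
    wp (samples (noisyParity b k S hS)) (searchProg q r) (ind (Wrong S)) σ
      ≤ ind (Wrong S) σ + m * ENNReal.ofReal (Real.exp (-3)) ^ L := by
  have := (search_hyp (P := noisyParity b k S hS) h hm hmN q r).wp_le
    (fun i τ => ind (Wrong S) τ + i * ENNReal.ofReal (Real.exp (-3)) ^ L) fun i hi τ hI hc hF => by
      have hs := (SearchFr.of_fr hF).setVar i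
      simp only [wp]
      rw [expect_add, expect_const]
      refine (add_le_add_left (attempt_wrong hK (h.of_searchFr hs) (w := ⟨i, by omega⟩) (by simp) q r) _).trans ?_
      have : ind (Wrong S) (τ.setVar 15 i) = ind (Wrong S) τ := ind_congr Iff.rfl
      rw [this]
      push_cast
      rw [add_mul, one_mul, add_assoc, add_comm (ENNReal.ofReal _ ^ L)]
  have e : ind (Wrong S) (σ.setVar 15 m) = ind (Wrong S) σ := ind_congr Iff.rfl
  simp only [Nat.cast_zero, zero_mul, add_zero, e] at this
  exact this

/-- Outputs never shrink, so earlier and later attempts cannot destroy a success. A single good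
starting point `w` suffices. -/
theorem search_right (hK : TestParams (delta b ^ k) K θ) (hL : 0 < L) {m : ℕ}
    (h : AttemptPre n N K θ L σ) (hm : σ.var 2 = m) (hmN : m ≤ N) {q r : ℕ} {w : ℕ} (hw : w < m)
    {a : ℝ≥0∞} (ha1 : a ≤ 1) (ha : ∀ τ, SearchFr σ τ → τ.var 15 = w →
      a ≤ wp (samples (noisyParity b k S hS)) (candProg q r) (ind fun τ => marked n τ = S) τ) :
    a * 2⁻¹ ≤ wp (samples (noisyParity b k S hS)) (searchProg q r) (ind (Found n)) σ := by
  have hc1 : a * 2⁻¹ ≤ 1 := mul_le_one' ha1 (by simp)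
  have := (search_hyp (P := noisyParity b k S hS) h hm hmN q r).le_wp
    -- The potential is `1` once something has been found; before that it is the guaranteed chance
    -- of the attempt at `w`, as long as this attempt lies ahead.
    (fun i τ => max (ind (Found n) τ) (if w < i then a * 2⁻¹ else 0)) fun i hi τ hI hc hF => by
      have hs := (SearchFr.of_fr hF).setVar i
      have hp := h.of_searchFr hs
      have ht := attempt_tri hp (w := ⟨i, by omega⟩) (by simp) q r (P := noisyParity b k S hS)
      refine max_le ?_ ?_
      · by_cases hf : Found n τ
        · rw [ind_pos hf]
          refine (ht.wp_eq_const (f := fun _ => 1) fun _ _ => rfl).ge.trans (ht.wp_mono fun ρ hρ => ?_)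
          refine le_max_of_le_left (ind_pos fun he => hf ?_).ge
          rw [he, Finset.subset_empty] at hρ
          exact hρ
        · rw [ind_neg hf]
          exact zero_le
      · by_cases hwi : w < i
        · rw [if_pos (by omega)]
          refine (ht.wp_eq_const (f := fun _ => a * 2⁻¹) fun _ _ => rfl).ge.trans (ht.wp_mono fun ρ _ => ?_)
          rw [if_pos hwi]
          exact le_max_right _ _
        · by_cases hwi' : w < i + 1
          · obtain rfl : w = i := by omega
            rw [if_pos hwi']
            refine (attempt_right hK hL hp (w := ⟨w, by omega⟩) (by simp) (ha _ hs (by simp))).trans ?_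
            exact ht.wp_mono fun ρ _ => le_max_left _ _
          · rw [if_neg hwi']
            exact zero_le
  rw [if_pos hw] at this
  refine (le_max_right _ _).trans (this.trans_eq ?_)
  congr 1
  funext τ
  simp

end Attempt

end

noncomputable section

variable {D : PMF (List (ℤ × ℤ))}

/-! ### One iteration of the algorithm -/

section Iteration

theorem tr_wv (gen : ℕ → Prog) (p : Prog) (y : ℕ) (hy : y ≠ 50) (hgen : ∀ a, ¬ (gen a).wv y)
    (hp : ∀ x, y = x + 60 → ¬ p.wv x) : ¬ (tr gen p).wv y := by
  induction p with
  | skip => simp [tr, Prog.wv]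
  | sample a => exact hgen a
  | seq p q ihp ihq =>
    simp only [tr, Prog.wv, not_or] at hp ⊢
    exact ⟨ihp fun x hx => (hp x hx).1, ihq fun x hx => (hp x hx).2⟩
  | ite x p q ihp ihq =>
    simp only [tr, Prog.wv, not_or] at hp ⊢
    exact ⟨ihp fun x hx => (hp x hx).1, ihq fun x hx => (hp x hx).2⟩
  | loop x p ih =>
    simp only [tr, Prog.wv] at hp ⊢
    exact ih hp
  | store a x z => simp [tr, Prog.wv]
  | load x a z =>
    simp only [tr, Prog.wv, not_or] at hp ⊢
    exact ⟨hy, hy, fun h => hp x h rfl, fun h => hp x h rfl⟩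
  | _ =>
    simp only [tr, Prog.wv] at hp ⊢
    exact fun h => hp _ h rfl

/-- A program is a finite text and assigns only finitely many variables, so its variables can be
reset in constant time. -/
theorem Prog.exists_wv_bound (p : Prog) : ∃ V, ∀ x, V ≤ x → ¬ p.wv x := by
  induction p with
  | seq p q ihp ihq =>
    obtain ⟨V, hV⟩ := ihp
    obtain ⟨W, hW⟩ := ihq
    refine ⟨max V W, fun x hx => ?_⟩
    simp only [Prog.wv, not_or]
    exact ⟨hV x (by omega), hW x (by omega)⟩
  | ite z p q ihp ihq =>
    obtain ⟨V, hV⟩ := ihp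
    obtain ⟨W, hW⟩ := ihq
    refine ⟨max V W, fun x hx => ?_⟩
    simp only [Prog.wv, not_or]
    exact ⟨hV x (by omega), hW x (by omega)⟩
  | loop z p ih =>
    obtain ⟨V, hV⟩ := ih
    exact ⟨V, hV⟩
  | skip => exact ⟨0, by simp [Prog.wv]⟩
  | sample a => exact ⟨0, by simp [Prog.wv]⟩
  | store a y z => exact ⟨0, by simp [Prog.wv]⟩
  | const y z => exact ⟨y + 1, fun x hx => by simp only [Prog.wv]; omega⟩
  | add y z w => exact ⟨y + 1, fun x hx => by simp only [Prog.wv]; omega⟩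
  | sub y z w => exact ⟨y + 1, fun x hx => by simp only [Prog.wv]; omega⟩
  | load y z w => exact ⟨y + 1, fun x hx => by simp only [Prog.wv]; omega⟩
  | flip y z => exact ⟨y + 1, fun x hx => by simp only [Prog.wv]; omega⟩
  | rand y z => exact ⟨y + 1, fun x hx => by simp only [Prog.wv]; omega⟩

/-- Reset the first `V` simulated variables. -/
def resetProg : ℕ → Prog
  | 0 => .add 60 3 9
  | V + 1 => .seq (.const (V + 60) 0) (resetProg V)

theorem resetProg_straight (V : ℕ) : (resetProg V).straight := by
  induction V with
  | zero => trivial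
  | succ V ih => exact ⟨trivial, ih⟩

theorem resetProg_cost (V : ℕ) : (resetProg V).cost = 2 * V + 1 := by
  induction V with
  | zero => rfl
  | succ V ih =>
    simp only [resetProg, Prog.cost, ih]
    ring

theorem resetProg_wv (V y : ℕ) (hy : y < 60) : ¬ (resetProg V).wv y := by
  induction V with
  | zero =>
    simp only [resetProg, Prog.wv]
    omega
  | succ V ih =>
    simp only [resetProg, Prog.wv, not_or]
    exact ⟨by omega, ih⟩

theorem resetProg_exec (V : ℕ) (σ : Store) : ((resetProg V).exec σ).arr = σ.arr ∧
    ∀ y, ((resetProg V).exec σ).var y = if y = 60 then σ.var 3 + σ.var 9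
      else if 60 ≤ y ∧ y < V + 60 then 0 else σ.var y := by
  induction V generalizing σ with
  | zero =>
    refine ⟨rfl, fun y => ?_⟩
    simp only [resetProg, Prog.exec, Store.setVar_var]
    split_ifs <;> first | rfl | omega
  | succ V ih =>
    obtain ⟨h1, h2⟩ := ih (σ.setVar (V + 60) 0)
    refine ⟨h1, fun y => ?_⟩
    simp only [resetProg, Prog.exec]
    rw [h2]
    simp only [Store.setVar_var]
    split_ifs <;> first | rfl | omega

/-- Relabel at random and reset the simulated memory. -/
def prepProg (V : ℕ) : Prog := .seq (.add 4 4 1) (.seq shuffleProg (resetProg V))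

/-- Learn a relabelled planted model and search the returned graph. -/
def iterProg (A : Prog) (V : ℕ) (b : ℝ) (k q r : ℕ) : Prog :=
  .seq (prepProg V) (.seq (tr (genProg b k) A) (searchProg q r))

theorem iterProg_wv (A : Prog) (V : ℕ) (b : ℝ) (k q r y : ℕ) (hy : y < 11) (hy4 : y ≠ 4) :
    ¬ (iterProg A V b k q r).wv y := by
  simp only [iterProg, prepProg, shuffleProg, swapProg, searchProg, forTo_wv, Prog.wv, not_or]
  refine ⟨⟨hy4, ?_, resetProg_wv V y (by omega)⟩,
    tr_wv _ _ _ (by omega) (fun a => genProg_wv _ _ _ _ (by omega) (by omega) (by omega)) (fun x hx => by omega),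
    by omega, attempt_wv q r y (by omega)⟩
  refine ⟨⟨by omega, not_false⟩, by omega, by omega, by omega, by omega, not_false, not_false⟩

variable {n k N V K θ L : ℕ} {σ : Store}

/-- The invariant of the main loop. -/
structure MainInv (n k N V K θ L : ℕ) (σ : Store) : Prop extends AttemptPre n N K θ L σ where
  width : σ.var 2 = (n + (2 * k + 2) * n : ℕ)
  fresh : ∀ x, V ≤ x → 0 < x → σ.var (x + 60) = 0

theorem MainInv.of_eq {τ : Store} (h : MainInv n k N V K θ L σ)
    (hv : ∀ y, y < 10 → y ≠ 4 → τ.var y = σ.var y) (hf : ∀ x, V ≤ x → τ.var (x + 60) = σ.var (x + 60))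
    (hs : Stamped τ) : MainInv n k N V K θ L τ where
  consts := h.consts.congr (hv _ (by omega) (by omega)) (hv _ (by omega) (by omega)) (hv _ (by omega) (by omega))
  count := (hv _ (by omega) (by omega)).trans h.count
  stamped := hs
  rounds := (hv _ (by omega) (by omega)).trans h.rounds
  threshold := (hv _ (by omega) (by omega)).trans h.threshold
  width := (hv _ (by omega) (by omega)).trans h.width
  fresh x hx h0 := (hf x hx).trans (h.fresh x hx h0)

theorem MainInv.of_searchFr {τ : Store} (h : MainInv n k N V K θ L σ) (hs : SearchFr σ τ) :
    MainInv n k N V K θ L τ :=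
  h.of_eq (fun y hy _ => hs.1 y (by omega)) (fun x _ => hs.1 _ (by omega))
    (h.toAttemptPre.of_searchFr hs).stamped

/-- The state of affairs when the learning algorithm is started. -/
structure Ready (n k N V K θ L : ℕ) (σ : Store) (π : Equiv.Perm (Fin (n + (2 * k + 2) * n))) (τ : Store) :
    Prop extends MainInv n k N V K θ L τ where
  perm : HoldsPerm π τ
  decode : τ.decode = initStore N
  out : τ.arr 0 = σ.arr 0

theorem Ready.genInv {π : Equiv.Perm (Fin (n + (2 * k + 2) * n))} {τ : Store}
    (h : Ready n k N V K θ L σ π τ) : GenInv n k π τ := ⟨h.consts, h.width, h.perm⟩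

/-- Increasing the round number makes every stamp outdated, which empties all simulated arrays at
once. Only finitely many variables have to be cleared, and simulated variable `0`, kept in variable
`60`, receives the input `N`. -/
theorem prep_ready (h : MainInv n k N V K θ L σ) {π : Equiv.Perm (Fin (n + (2 * k + 2) * n))} {τ : Store}
    (hτ : HoldsPerm π τ) (hF : Fr shuffleProg ((Prog.add 4 4 1).exec σ) τ) :
    Ready n k N V K θ L σ π ((resetProg V).exec τ) := by
  obtain ⟨ha, hv⟩ := resetProg_exec V τ
  have hτv : ∀ y, (y < 11 ∨ 48 < y) → τ.var y = if y = 4 then σ.var 4 + 1 else σ.var y := fun y hy => by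
    rw [hF.1 y]
    · simp only [Prog.exec, Store.setVar_var, h.consts.one]
    · simp only [shuffleProg, swapProg, forTo_wv, Prog.wv, or_false]
      omega
  have hτa : ∀ c, c ≠ 2 → τ.arr c = σ.arr c := fun c hc => by
    rw [hF.2 c]
    · rfl
    · simp [shuffleProg, swapProg, Prog.wa, hc]
  have hv' : ∀ y, y < 10 → ((resetProg V).exec τ).var y = if y = 4 then σ.var 4 + 1 else σ.var y := fun y hy => by
    rw [hv, if_neg (by omega), if_neg (by omega), hτv y (by omega)]
  have hst : ∀ a i, ((resetProg V).exec τ).arr (2 * a + 11) i < ((resetProg V).exec τ).var 4 := fun a i => by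
    rw [hv' 4 (by omega), if_pos rfl, ha, hτa _ (by omega)]
    have := h.stamped a i
    omega
  have h3 : τ.var 3 = N := by rw [hτv 3 (by omega), if_neg (by omega), h.count]
  have h9 : τ.var 9 = 0 := by rw [hτv 9 (by omega), if_neg (by omega), h.consts.zero]
  have hf : ∀ x, V ≤ x → 0 < x → ((resetProg V).exec τ).var (x + 60) = 0 := fun x hx hx0 => by
    rw [hv, if_neg (by omega), if_neg (by omega), hτv _ (by omega), if_neg (by omega), h.fresh x hx hx0]
  refine ⟨⟨⟨⟨h.consts.congr ?_ ?_ ?_, ?_, fun a i => (hst a i).le⟩, ?_, ?_⟩, ?_, hf⟩, fun v => ?_, ?_, ?_⟩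
  · rw [hv' 0 (by omega), if_neg (by omega)]
  · rw [hv' 1 (by omega), if_neg (by omega)]
  · rw [hv' 9 (by omega), if_neg (by omega)]
  · rw [hv' 3 (by omega), if_neg (by omega), h.count]
  · rw [hv' 6 (by omega), if_neg (by omega), h.rounds]
  · rw [hv' 7 (by omega), if_neg (by omega), h.threshold]
  · rw [hv' 2 (by omega), if_neg (by omega), h.width]
  · rw [ha, hτ v]
  · ext a i
    · simp only [Store.decode, initStore, Function.update_apply]
      split_ifs with hx
      · rw [hx, hv, if_pos rfl, h3, h9, add_zero]
      · by_cases hV : V ≤ a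
        · exact hf a hV (by omega)
        · rw [hv, if_neg (by omega), if_pos (by omega)]
    · simp only [Store.decode, initStore]
      rw [if_neg (hst a i).ne]
  · rw [ha, hτa 0 (by omega)]

theorem prep_seq (h : MainInv n k N V K θ L σ) :
    Tri D shuffleProg ((Prog.add 4 4 1).exec σ) (16 * (n + (2 * k + 2) * n) + 7) fun τ =>
      Tri D (resetProg V) τ (2 * V + 1) fun ρ => ∃ π, Ready n k N V K θ L σ π ρ := by
  have hc : Consts n ((Prog.add 4 4 1).exec σ) :=
    h.consts.congr (by simp [Prog.exec]) (by simp [Prog.exec]) (by simp [Prog.exec])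
  refine (shuffle_tri hc (m := n + (2 * k + 2) * n) (by simp [Prog.exec, h.width])).frame.mono le_rfl
    fun τ hτ => ?_
  obtain ⟨⟨π, hπ⟩, hF⟩ := hτ
  exact Tri.straight (resetProg_straight V) (resetProg_cost V).le ⟨π, prep_ready h hπ hF⟩

theorem prep_tri (h : MainInv n k N V K θ L σ) :
    Tri D (prepProg V) σ (16 * (n + (2 * k + 2) * n) + 2 * V + 11) fun τ => ∃ π, Ready n k N V K θ L σ π τ :=
  (Tri.straight_seq (p := .add 4 4 1) trivial (Tri.seq (prep_seq h))).mono
    (by rw [show (Prog.add 4 4 1).cost = 1 from rfl]; omega) fun _ h => h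

theorem le_prep_wp (h : MainInv n k N V K θ L σ) (g : Equiv.Perm (Fin (n + (2 * k + 2) * n)) → ℝ≥0∞)
    (f : Store → ℝ≥0∞) (hgf : ∀ π τ, Ready n k N V K θ L σ π τ → g π ≤ f τ) :
    (Fintype.card (Equiv.Perm (Fin (n + (2 * k + 2) * n))) : ℝ≥0∞)⁻¹ * ∑ π, g π ≤ wp D (prepProg V) f σ := by
  have hc : Consts n ((Prog.add 4 4 1).exec σ) :=
    h.consts.congr (by simp [Prog.exec]) (by simp [Prog.exec]) (by simp [Prog.exec])
  rw [prepProg, (Tri.seq (prep_seq h)).wp_straight_seq (p := .add 4 4 1) trivial, Tri.wp_seq (prep_seq h)]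
  refine le_shuffle_wp hc (by simp [Prog.exec, h.width]) g _ fun π τ hπ hF => ?_
  rw [wp_straight (resetProg_straight V)]
  exact hgf π _ (prep_ready h hπ hF)

variable {S : Finset (Fin n)} {hS : S.card = 2 * k + 2} {hN : n + (2 * k + 2) * n ≤ N} {b : ℝ}

/-- The learning algorithm halts on the planted models. -/
structure LearnHyp (S : Finset (Fin n)) (hS : S.card = 2 * k + 2) (hN : n + (2 * k + 2) * n ≤ N) (b : ℝ)
    (A : Prog) (V T : ℕ)
    (Q : Equiv.Perm (Fin (n + (2 * k + 2) * n)) → PMF (visible (n + (2 * k + 2) * n) N → ℤˣ)) : Prop where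
  wv : ∀ x, V ≤ x → ¬ A.wv x
  law : ∀ π, PlantedLaw S hS hN b π (Q π)
  halts : ∀ π, HaltsWithin A N (samplesOn _ (Q π)) T

variable {A : Prog} {T : ℕ}
  {Q : Equiv.Perm (Fin (n + (2 * k + 2) * n)) → PMF (visible (n + (2 * k + 2) * n) N → ℤˣ)}

theorem learn_seq (hA : LearnHyp S hS hN b A V T Q) {π : Equiv.Perm (Fin (n + (2 * k + 2) * n))} {τ : Store}
    (h : Ready n k N V K θ L σ π τ) (q r : ℕ) :
    Tri (samples (noisyParity b k S hS)) (tr (genProg b k) A) τ (30 * T) fun ρ =>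
      (MainInv n k N V K θ L ρ ∧ HoldsPerm π ρ ∧ outSet n ρ = outSet n σ) ∧
      Tri (samples (noisyParity b k S hS)) (searchProg q r) ρ
        ((n + (2 * k + 2) * n) * (attemptCost n N q r (K * L) + 3) + 3)
        fun ξ => outSet n ρ ⊆ outSet n ξ ∧ SearchFr ρ ξ := by
  refine ((learn_sim h.genInv h.stamped (hA.law π) h.decode (hA.halts π)).1.frame).mono le_rfl fun ρ hρ => ?_
  obtain ⟨⟨h1, h2, h3, h4⟩, hF⟩ := hρ
  have hI : MainInv n k N V K θ L ρ := h.toMainInv.of_eq (fun y hy _ => h2 y (by omega)) (fun x hx => hF.1 _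
    (tr_wv _ _ _ (by omega) (fun a => genProg_wv _ _ _ _ (by omega) (by omega) (by omega))
      fun x' hx' => by rw [← Nat.add_right_cancel hx']; exact hA.wv x hx)) h1
  refine ⟨⟨hI, fun v => by rw [h4, h.perm v], outSet_congr (h3.trans h.out)⟩, ?_⟩
  exact search_tri hI.toAttemptPre hI.width hN q r

/-- The running time of an iteration. -/
def iterCost (n k N V T q r t : ℕ) : ℕ := 16 * (n + (2 * k + 2) * n) + 2 * V + 11 + (30 * T +
  ((n + (2 * k + 2) * n) * (attemptCost n N q r t + 3) + 3) + 1) + 1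

theorem iter_seq (hA : LearnHyp S hS hN b A V T Q) (h : MainInv n k N V K θ L σ) (q r : ℕ) :
    Tri (samples (noisyParity b k S hS)) (prepProg V) σ (16 * (n + (2 * k + 2) * n) + 2 * V + 11) fun τ =>
      Tri (samples (noisyParity b k S hS)) (.seq (tr (genProg b k) A) (searchProg q r)) τ
        (30 * T + ((n + (2 * k + 2) * n) * (attemptCost n N q r (K * L) + 3) + 3) + 1)
        fun ξ => MainInv n k N V K θ L ξ ∧ outSet n σ ⊆ outSet n ξ := by
  refine (prep_tri h).mono le_rfl fun τ hτ => ?_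
  obtain ⟨π, hπ⟩ := hτ
  refine Tri.seq ((learn_seq hA hπ q r).mono le_rfl fun ρ hρ => hρ.2.mono le_rfl fun ξ hξ => ?_)
  exact ⟨hρ.1.1.of_searchFr hξ.2, hρ.1.2.2 ▸ hξ.1⟩

theorem iter_tri (hA : LearnHyp S hS hN b A V T Q) (h : MainInv n k N V K θ L σ) (q r : ℕ) :
    Tri (samples (noisyParity b k S hS)) (iterProg A V b k q r) σ (iterCost n k N V T q r (K * L))
      fun ξ => MainInv n k N V K θ L ξ ∧ outSet n σ ⊆ outSet n ξ :=
  Tri.seq (iter_seq hA h q r)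

theorem iter_wrong (hK : TestParams (delta b ^ k) K θ) (hA : LearnHyp S hS hN b A V T Q)
    (h : MainInv n k N V K θ L σ) (q r : ℕ) :
    wp (samples (noisyParity b k S hS)) (iterProg A V b k q r) (ind (Wrong S)) σ ≤ ind (Wrong S) σ +
      (n + (2 * k + 2) * n : ℕ) * ENNReal.ofReal (Real.exp (-3)) ^ L := by
  have hp := prep_tri (D := samples (noisyParity b k S hS)) h
  rw [iterProg, Tri.wp_seq (iter_seq hA h q r)]
  refine (hp.wp_mono fun τ hτ => ?_).trans_eq (hp.wp_eq_const fun _ _ => rfl)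
  obtain ⟨π, hπ⟩ := hτ
  have hl := learn_seq hA hπ q r
  rw [Tri.wp_seq (hl.mono le_rfl fun ρ hρ => hρ.2.mono le_rfl fun _ _ => trivial)]
  refine (hl.wp_mono fun ρ hρ => ?_).trans_eq (hl.wp_eq_const fun _ _ => rfl)
  refine (search_wrong hK hρ.1.1.toAttemptPre hρ.1.1.width hN q r).trans_eq ?_
  congr 1
  exact ind_congr (by rw [Wrong, Wrong, hρ.1.2.2])

/-- The walks start from the vertex that carries the first coordinate of `S`. In a clustered output
every other vertex of the true block is within reach, and array `2` maps the block back onto `S`. -/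
theorem search_planted (hK : TestParams (delta b ^ k) K θ) (hL : 0 < L) {π : Equiv.Perm (Fin (n + (2 * k + 2) * n))}
    (h : MainInv n k N V K θ L σ) (hπ : HoldsPerm π σ) {d r : ℕ} {x : ℝ}
    (hl : σ.decode ∈ Learned b d x (Q π)) (hr : σ.decode ∈ Clustered S hS hN r π none) :
    ((2⁻¹ ^ d) ^ r) ^ (2 * k + 2) * 2⁻¹ ≤ wp (samples (noisyParity b k S hS)) (searchProg (2 * k + 2) r)
      (ind (Found n)) σ := by
  classical
  have hhalf : (2⁻¹ : ℝ≥0∞) ≤ 1 := by simp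
  have hpos : ∀ l, σ.arr 2 (((site S hS hN π none l : Fin N) : ℕ) : ℤ) = (pos S hS none l : ℕ) := fun l => by
    have := hπ (π.symm (pos S hS none l))
    rw [Equiv.apply_symm_apply] at this
    exact this
  have hmem : ∀ i : Fin n, (∃ l < 2 * k + 2, ((pos S hS none l : ℕ) : ℤ) = (i : ℕ)) ↔ i ∈ S := fun i => by
    rw [← Finset.mem_coe, ← Finset.range_orderEmbOfFin S hS]
    constructor
    · rintro ⟨l, hl, he⟩
      refine ⟨⟨l % (2 * k + 2), Nat.mod_lt _ (by omega)⟩, Fin.ext ?_⟩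
      exact_mod_cast he
    · rintro ⟨l, rfl⟩
      refine ⟨l, l.2, ?_⟩
      simp [pos, Nat.mod_eq_of_lt l.2]
  have hdeg : ∀ v, (Finset.univ.filter fun j => outWeights N σ.decode v j ≠ 0).card ≤ d := fun v => by
    have := hl.1.degree v
    rwa [Set.ncard_eq_toFinset_card', Set.toFinset_ofPred] at this
  refine search_right hK hL h.toAttemptPre h.width hN
    (w := (site S hS hN π none 0 : Fin N)) (Finset.mem_filter.1 (site S hS hN π none 0).2).2
    (pow_le_one' (pow_le_one' (pow_le_one' hhalf _) _) _) fun τ hτ h15 => ?_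
  have := cand_wp (D := samples (noisyParity b k S hS)) (h.toAttemptPre.of_searchFr hτ).toWalkPre h15
    (q := 2 * k + 2) (r := r) (d := d) (by simpa only [hτ.decode] using hdeg)
    (fun l => site S hS hN π none l) (fun l hl => by rw [hτ.decode]; exact hr 0 (by omega) l hl)
  refine this.trans_eq ?_
  congr 1
  funext ρ
  refine ind_congr ?_
  rw [hτ.2 2 (by omega)]
  simp only [hpos, hmem, Finset.ext_iff]

/-- The uniformly random relabelling makes the true block a cluster of a successful output with
probability at least `1/4`; the search then succeeds with a probability that depends on `d`, `k` and
`R` only. -/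
theorem iter_right (hK : TestParams (delta b ^ k) K θ) (hL : 0 < L) (hA : LearnHyp S hS hN b A V T Q)
    (h : MainInv n k N V K θ L σ) (hb : 0 < b) (hk : 0 < k) {d R : ℕ} (hbd : b * d ≤ 1 / 2)
    (hR : ((2 * k + 2 : ℕ) : ℝ) * (4 * 2⁻¹ ^ R) ≤ delta b ^ k / 2) {x : ℝ} (hx : 0 < x)
    (hxn : 32 * x ≤ 3 / 8 * (n + 1) * delta b ^ k)
    (hQ : ∀ π, 1 / 2 ≤ (outLaw A N T (samplesOn _ (Q π))).toOuterMeasure (Learned b d x (Q π))) :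
    4⁻¹ * (((2⁻¹ ^ d) ^ ((2 * k + 2) * R)) ^ (2 * k + 2) * 2⁻¹) ≤ wp (samples (noisyParity b k S hS))
      (iterProg A V b k (2 * k + 2) ((2 * k + 2) * R)) (ind (Found n)) σ := by
  have hq := quarter_le_clustered (hN := hN) hb hk hbd hR hx hxn Q hA.law
    (fun Q => outLaw A N T (samplesOn _ Q)) hQ
  set r := (2 * k + 2) * R with hr
  set c : ℝ≥0∞ := ((2⁻¹ ^ d) ^ r) ^ (2 * k + 2) * 2⁻¹ with hc
  rw [iterProg, Tri.wp_seq (iter_seq hA h _ _)]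
  refine le_trans ?_ (le_prep_wp h (fun π => c * (outLaw A N T (samplesOn _ (Q π))).toOuterMeasure
    (Learned b d x (Q π) ∩ Clustered S hS hN r π none)) _ fun π τ hτ => ?_)
  · rw [← Finset.mul_sum]
    set E : ℝ≥0∞ := ∑ π, (outLaw A N T (samplesOn _ (Q π))).toOuterMeasure
      (Learned b d x (Q π) ∩ Clustered S hS hN r π none)
    have key : (4⁻¹ : ℝ≥0∞) ≤ (Fintype.card (Equiv.Perm (Fin (n + (2 * k + 2) * n))) : ℝ≥0∞)⁻¹ * E := by
      rw [mul_comm, ← div_eq_mul_inv, ENNReal.le_div_iff_mul_le (Or.inl (by simp [Fintype.card_ne_zero]))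
        (Or.inl (ENNReal.natCast_ne_top _)), mul_comm]
      exact hq
    refine (mul_le_mul_left key c).trans_eq ?_
    ring
  · have hl := learn_seq hA hτ (2 * k + 2) r
    rw [Tri.wp_seq (hl.mono le_rfl fun ρ hρ => hρ.2.mono le_rfl fun _ _ => trivial), ← expect_indicator, ← expect_const_mul,
      ← (learn_sim hτ.genInv hτ.stamped (hA.law π) hτ.decode (hA.halts π)).2]
    refine hl.wp_mono fun ρ hρ => ?_
    by_cases hE : ρ.decode ∈ Learned b d x (Q π) ∩ Clustered S hS hN r π none
    · rw [Set.indicator_of_mem hE, mul_one]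
      exact search_planted hK hL hρ.1.1 hρ.1.2.1 hE.1 hE.2
    · rw [Set.indicator_of_notMem hE, mul_zero]
      exact zero_le

end Iteration

end

noncomputable section

variable {D : PMF (List (ℤ × ℤ))}

/-! ### The complete algorithm -/

section Setup

/-- One round of the computation of the parameters. -/
def countProg : Prog :=
  .seq (.add 2 2 59) (.seq (.add 3 3 58) (.seq (.sub 54 0 55)
    (.ite 54 (.seq (.add 55 55 55) (.seq (.add 5 5 1) (.seq (.add 6 6 57) (.add 7 7 56)))) .skip)))

/-- The constants of the algorithm. -/
def constProg (k K θ : ℕ) : Prog :=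
  .seq (.const 1 1) (.seq (.const 59 (2 * k + 3 : ℕ)) (.seq (.const 58 (12 * k + 3 : ℕ))
    (.seq (.const 57 (K : ℕ)) (.seq (.const 56 (θ : ℕ)) (.const 55 1)))))

/-- Compute the parameters. -/
def setupProg (k K θ : ℕ) : Prog := .seq (constProg k K θ) (forTo 8 0 countProg)

variable {n : ℕ}

theorem const_facts (k K θ : ℕ) :
    (∀ y, y ≠ 0 → y ≠ 1 → (y < 55 ∨ 59 < y) → ((constProg k K θ).exec (initStore n)).var y = 0) ∧
    ((constProg k K θ).exec (initStore n)).var 0 = n ∧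
    ((constProg k K θ).exec (initStore n)).var 1 = 1 ∧
    ((constProg k K θ).exec (initStore n)).var 59 = (2 * k + 3 : ℕ) ∧
    ((constProg k K θ).exec (initStore n)).var 58 = (12 * k + 3 : ℕ) ∧
    ((constProg k K θ).exec (initStore n)).var 57 = (K : ℕ) ∧
    ((constProg k K θ).exec (initStore n)).var 56 = (θ : ℕ) ∧
    ((constProg k K θ).exec (initStore n)).var 55 = 1 ∧
    ((constProg k K θ).exec (initStore n)).arr = fun _ _ => 0 := by
  refine ⟨fun y h0 h1 hy => ?_, ?_, ?_, ?_, ?_, ?_, ?_, ?_, rfl⟩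
  · simp only [constProg, Prog.exec, initStore, Store.setVar_var, Function.update_apply]
    rw [if_neg (by omega), if_neg (by omega), if_neg (by omega), if_neg (by omega), if_neg (by omega),
      if_neg h1, if_neg h0]
  all_goals simp [constProg, Prog.exec, initStore]

/-- The values of the counters when `i` rounds remain. -/
structure CountInv (n k K θ i : ℕ) (τ : Store) : Prop where
  width : τ.var 2 = (2 * k + 3 : ℕ) * ((n : ℤ) - i)
  count : τ.var 3 = (12 * k + 3 : ℕ) * ((n : ℤ) - i)
  log : ∃ j : ℕ, τ.var 55 = (2 ^ j : ℕ) ∧ 2 ^ j < 2 * n ∧ (n ≤ 2 ^ j ∨ n ≤ j + i) ∧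
    τ.var 5 = j ∧ τ.var 6 = (K * j : ℕ) ∧ τ.var 7 = (θ * j : ℕ)

theorem count_exec (ρ : Store) : (countProg.exec ρ).var 2 = ρ.var 2 + ρ.var 59 ∧
    (countProg.exec ρ).var 3 = ρ.var 3 + ρ.var 58 ∧
    (countProg.exec ρ).var 55 = (if ρ.var 55 < ρ.var 0 then ρ.var 55 + ρ.var 55 else ρ.var 55) ∧
    (countProg.exec ρ).var 5 = (if ρ.var 55 < ρ.var 0 then ρ.var 5 + ρ.var 1 else ρ.var 5) ∧
    (countProg.exec ρ).var 6 = (if ρ.var 55 < ρ.var 0 then ρ.var 6 + ρ.var 57 else ρ.var 6) ∧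
    (countProg.exec ρ).var 7 = (if ρ.var 55 < ρ.var 0 then ρ.var 7 + ρ.var 56 else ρ.var 7) := by
  by_cases h : ρ.var 55 < ρ.var 0 <;> simp [countProg, Prog.exec, h]

/-- One loop over `n` computes all multiples of `n` by addition, and the logarithm by doubling
variable `55` until it reaches `n`. The second alternative in `CountInv.log` records that, while `n`
has not been reached, each completed round has doubled it. -/
theorem count_hyp (hn : 0 < n) (k K θ : ℕ) :
    ForHyp D 8 0 countProg n 20 (CountInv n k K θ) ((constProg k K θ).exec (initStore n)) := by
  obtain ⟨h, h0, h1, h59, h58, h57, h56, h55, -⟩ := const_facts (n := n) k K θ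
  refine ⟨h0, h1, h 9 (by omega) (by omega) (by omega), by decide, by simp [countProg, Prog.wv],
    by simp [countProg, Prog.wv], ⟨?_, ?_, 0, ?_, by omega, by omega, ?_, ?_, ?_⟩, ?_⟩
  · rw [Store.setVar_var, if_neg (by decide), h 2 (by omega) (by omega) (by omega)]
    simp
  · rw [Store.setVar_var, if_neg (by decide), h 3 (by omega) (by omega) (by omega)]
    simp
  · rw [Store.setVar_var, if_neg (by decide), h55]
    simp
  · rw [Store.setVar_var, if_neg (by decide), h 5 (by omega) (by omega) (by omega)]
    simp
  · rw [Store.setVar_var, if_neg (by decide), h 6 (by omega) (by omega) (by omega)]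
    simp
  · rw [Store.setVar_var, if_neg (by decide), h 7 (by omega) (by omega) (by omega)]
    simp
  · intro i hi τ hI hc hF
    obtain ⟨j, h55, hj, hj', h5, h6, h7⟩ := hI.log
    have e0 : τ.var 0 = n := by rw [hF.1 0 (by simp [countProg, Prog.wv]), h0]
    have e1 : τ.var 1 = 1 := by rw [hF.1 1 (by simp [countProg, Prog.wv]), h1]
    have e59 : τ.var 59 = (2 * k + 3 : ℕ) := by rw [hF.1 59 (by simp [countProg, Prog.wv]), h59]
    have e58 : τ.var 58 = (12 * k + 3 : ℕ) := by rw [hF.1 58 (by simp [countProg, Prog.wv]), h58]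
    have e57 : τ.var 57 = (K : ℕ) := by rw [hF.1 57 (by simp [countProg, Prog.wv]), h57]
    have e56 : τ.var 56 = (θ : ℕ) := by rw [hF.1 56 (by simp [countProg, Prog.wv]), h56]
    have e2 := hI.width
    have e3 := hI.count
    refine Tri.straight (by simp [countProg, Prog.straight]) (by simp [countProg, Prog.cost]) ?_
    obtain ⟨x2, x3, x55, x5, x6, x7⟩ := count_exec (τ.setVar 8 i)
    simp only [Store.setVar_var, show ¬ (2 : ℕ) = 8 by decide, show ¬ (3 : ℕ) = 8 by decide,
      show ¬ (5 : ℕ) = 8 by decide, show ¬ (6 : ℕ) = 8 by decide, show ¬ (7 : ℕ) = 8 by decide,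
      show ¬ (0 : ℕ) = 8 by decide, show ¬ (1 : ℕ) = 8 by decide, show ¬ (55 : ℕ) = 8 by decide,
      show ¬ (56 : ℕ) = 8 by decide, show ¬ (57 : ℕ) = 8 by decide, show ¬ (58 : ℕ) = 8 by decide,
      show ¬ (59 : ℕ) = 8 by decide, if_false] at x2 x3 x55 x5 x6 x7
    have hcond : τ.var 55 < τ.var 0 ↔ 2 ^ j < n := by
      rw [h55, e0]
      exact Nat.cast_lt
    refine ⟨?_, ?_, ?_⟩
    · rw [x2, e2, e59]
      push_cast
      ring
    · rw [x3, e3, e58]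
      push_cast
      ring
    · by_cases hlt : 2 ^ j < n
      · rw [if_pos (hcond.2 hlt)] at x55 x5 x6 x7
        refine ⟨j + 1, ?_, by rw [pow_succ]; omega, by omega, ?_, ?_, ?_⟩
        · rw [x55, h55]
          push_cast
          ring
        · rw [x5, h5, e1]
          push_cast
          ring
        · rw [x6, h6, e57]
          push_cast
          ring
        · rw [x7, h7, e56]
          push_cast
          ring
      · rw [if_neg fun hc => hlt (hcond.1 hc)] at x55 x5 x6 x7
        exact ⟨j, x55.trans h55, hj, Or.inl (not_lt.1 hlt), x5.trans h5, x6.trans h6, x7.trans h7⟩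

theorem setup_tri (hn : 0 < n) (k K θ V : ℕ) :
    Tri D (setupProg k K θ) (initStore n) (23 * n + 20) fun τ =>
      MainInv n k ((12 * k + 3) * n) V K θ (Nat.clog 2 n) τ ∧ τ.var 5 = Nat.clog 2 n ∧ outSet n τ = ∅ := by
  obtain ⟨h, h0, h1, -, -, -, -, -, ha⟩ := const_facts (n := n) k K θ
  refine (Tri.straight_seq (p := constProg k K θ) (by simp [constProg, Prog.straight])
    ((count_hyp hn k K θ).tri.mono le_rfl fun τ hτ => ?_)).mono ?_ fun _ h => h
  · obtain ⟨hI, -, hF⟩ := hτ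
    have hv : ∀ y, y ≠ 2 → y ≠ 3 → (y < 5 ∨ 7 < y) → (y < 8 ∨ 8 < y) → (y < 54 ∨ 59 < y) →
        τ.var y = ((constProg k K θ).exec (initStore n)).var y := fun y h2 h3 h5 h8 hy => by
      refine hF.1 y ?_
      simp only [countProg, forTo_wv, Prog.wv, or_false]
      omega
    have harr : τ.arr = fun _ _ => 0 := by
      funext c
      rw [hF.2 c (by simp [countProg, Prog.wa]), ha]
    obtain ⟨j, -, hj, hj', h5, h6, h7⟩ := hI.log
    have hjn : n ≤ 2 ^ j := by
      rcases hj' with hj' | hj'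
      · exact hj'
      · exact (hj'.trans (by omega : j + 0 ≤ j)).trans Nat.lt_two_pow_self.le
    -- The final power of two lies in `[n, 2n)`, which determines its exponent.
    obtain rfl : j = Nat.clog 2 n := by
      refine le_antisymm ?_ (Nat.clog_le_of_le_pow hjn)
      have h1 : 2 ^ j < 2 ^ (Nat.clog 2 n + 1) := by
        have := Nat.le_pow_clog (b := 2) (by norm_num) n
        rw [pow_succ]
        omega
      exact Nat.lt_succ_iff.1 ((Nat.pow_lt_pow_iff_right (by norm_num)).1 h1)
    refine ⟨⟨⟨⟨⟨?_, ?_, ?_⟩, ?_, fun a i => ?_⟩, h6, h7⟩, ?_, fun x hx h0 => ?_⟩, h5, ?_⟩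
    · rw [hv 0 (by omega) (by omega) (by omega) (by omega) (by omega), h0]
    · rw [hv 1 (by omega) (by omega) (by omega) (by omega) (by omega), h1]
    · rw [hv 9 (by omega) (by omega) (by omega) (by omega) (by omega), h 9 (by omega) (by omega) (by omega)]
    · rw [hI.count]
      push_cast
      ring
    · rw [harr, hv 4 (by omega) (by omega) (by omega) (by omega) (by omega), h 4 (by omega) (by omega) (by omega)]
    · rw [hI.width]
      push_cast
      ring
    · rw [hv _ (by omega) (by omega) (by omega) (by omega) (by omega), h _ (by omega) (by omega) (by omega)]
    · rw [outSet, harr]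
      simp
  · simp [constProg, Prog.cost]
    omega

end Setup

/-! ### Error probability and running time of the whole procedure -/

section Main

variable {n k N V K θ L : ℕ} {S : Finset (Fin n)} {hS : S.card = 2 * k + 2}
  {hN : n + (2 * k + 2) * n ≤ N} {b : ℝ} {A : Prog} {T : ℕ}
  {Q : Equiv.Perm (Fin (n + (2 * k + 2) * n)) → PMF (visible (n + (2 * k + 2) * n) N → ℤˣ)} {σ : Store}

theorem MainInv.setVar {τ : Store} (h : MainInv n k N V K θ L τ) (z : ℤ) :
    MainInv n k N V K θ L (τ.setVar 10 z) := by
  refine h.of_eq (fun y hy _ => ?_) (fun x _ => ?_) fun a i => h.stamped a i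
  · rw [Store.setVar_var, if_neg (by omega)]
  · rw [Store.setVar_var, if_neg (by omega)]

theorem main_hyp (hA : LearnHyp S hS hN b A V T Q) (h : MainInv n k N V K θ L σ) (h5 : σ.var 5 = L) (q r : ℕ) :
    ForHyp (samples (noisyParity b k S hS)) 10 5 (iterProg A V b k q r) L (iterCost n k N V T q r (K * L))
      (fun _ => MainInv n k N V K θ L) σ where
  bound := h5
  one := h.consts.one
  zero := h.consts.zero
  ne := by decide
  counter := iterProg_wv _ _ _ _ _ _ _ (by omega) (by omega)
  wone := iterProg_wv _ _ _ _ _ _ _ (by omega) (by omega)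
  init := h.setVar _
  body _ _ _ hI _ _ := (iter_tri hA (hI.setVar _) q r).mono le_rfl fun _ h => h.1

/-- Union bound over the `L` iterations, each of which makes one test per visible vertex. -/
theorem main_wrong (hK : TestParams (delta b ^ k) K θ) (hA : LearnHyp S hS hN b A V T Q)
    (h : MainInv n k N V K θ L σ) (h5 : σ.var 5 = L) (q r : ℕ) :
    wp (samples (noisyParity b k S hS)) (forTo 10 5 (iterProg A V b k q r)) (ind (Wrong S)) σ ≤
      ind (Wrong S) σ + L * ((n + (2 * k + 2) * n : ℕ) * ENNReal.ofReal (Real.exp (-3)) ^ L) := by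
  set c : ℝ≥0∞ := (n + (2 * k + 2) * n : ℕ) * ENNReal.ofReal (Real.exp (-3)) ^ L
  have := (main_hyp hA h h5 q r).wp_le (fun i τ => ind (Wrong S) τ + i * c) fun i hi τ hI hc hF => by
    simp only [wp]
    rw [expect_add, expect_const]
    have e : ind (Wrong S) (τ.setVar 10 i) = ind (Wrong S) τ := ind_congr Iff.rfl
    have key : expect _ _ ≤ ind (Wrong S) (τ.setVar 10 i) + c := iter_wrong hK hA (hI.setVar _) q r
    rw [e] at key
    refine (add_le_add_left key _).trans_eq ?_
    rw [Nat.cast_succ]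
    ring
  have e : ind (Wrong S) (σ.setVar 10 L) = ind (Wrong S) σ := ind_congr Iff.rfl
  simp only [Nat.cast_zero, zero_mul, add_zero, e] at this
  exact this

theorem wp_add_wp_not {p : Prog} {B : ℕ} {R : Store → Prop} (_ : Tri D p σ B R) (E : Store → Prop) :
    wp D p (ind E) σ + wp D p (ind fun τ => ¬ E τ) σ = 1 := by
  simp only [wp]
  rw [← expect_add, ← expect_const (den D p σ) 1]
  refine expect_congr fun ρ _ => ?_
  by_cases hf : E ρ
  · rw [ind_pos hf, ind_neg (not_not.2 hf), add_zero]
  · rw [ind_neg hf, ind_pos hf, zero_add]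

/-- The lower bound `a` holds from every state that satisfies the invariant, whatever happened
before. Conditioned on the past, each iteration therefore fails with probability at most `1 - a`. -/
theorem main_lost (hA : LearnHyp S hS hN b A V T Q) (h : MainInv n k N V K θ L σ) (h5 : σ.var 5 = L)
    (q r : ℕ) {a : ℝ≥0∞} (ha : ∀ τ, MainInv n k N V K θ L τ →
      a ≤ wp (samples (noisyParity b k S hS)) (iterProg A V b k q r) (ind (Found n)) τ) :
    wp (samples (noisyParity b k S hS)) (forTo 10 5 (iterProg A V b k q r)) (ind fun τ => ¬ Found n τ) σ ≤
      (1 - a) ^ L := by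
  have := (main_hyp hA h h5 q r).wp_le (fun i τ => (1 - a) ^ i * ind (fun τ => ¬ Found n τ) τ)
    fun i hi τ hI hc hF => by
      have ht := iter_tri hA (hI.setVar i) q r
      simp only [wp]
      rw [expect_const_mul, pow_succ, mul_assoc]
      refine mul_le_mul_right ?_ _
      by_cases hf : Found n τ
      · refine (ht.wp_eq_const (c := 0) fun ρ hρ => ind_neg (not_not.2 fun he => hf ?_)).trans_le zero_le
        have := hρ.2
        rw [he, Finset.subset_empty] at this
        exact this
      · rw [ind_pos hf, mul_one]
        refine ENNReal.le_sub_of_add_le_left (ne_top_of_le_ne_top ENNReal.one_ne_top ?_) ?_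
        · exact (ha _ (hI.setVar i)).trans ((ht.wp_mono fun ρ _ => ind_le_one _ _).trans_eq
            (ht.wp_eq_const fun _ _ => rfl))
        · refine (add_le_add_left (ha _ (hI.setVar i)) _).trans ?_
          exact (wp_add_wp_not ht (Found n)).le
  refine (this.trans (mul_le_of_le_one_right' (ind_le_one _ _))).trans' ?_
  simp only [pow_zero, one_mul, le_refl]

/-- Recover the parity from the learning algorithm `A`. -/
def mainProg (A : Prog) (V : ℕ) (b : ℝ) (k K θ R : ℕ) : Prog :=
  .seq (setupProg k K θ) (forTo 10 5 (iterProg A V b k (2 * k + 2) ((2 * k + 2) * R)))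

/-- The running time of the algorithm. -/
def mainCost (n k V T R K : ℕ) : ℕ :=
  23 * n + 24 + Nat.clog 2 n * (iterCost n k ((12 * k + 3) * n) V T (2 * k + 2) ((2 * k + 2) * R)
    (K * Nat.clog 2 n) + 3)

variable {hN' : n + (2 * k + 2) * n ≤ (12 * k + 3) * n}
  {Q' : Equiv.Perm (Fin (n + (2 * k + 2) * n)) → PMF (visible (n + (2 * k + 2) * n) ((12 * k + 3) * n) → ℤˣ)}

theorem main_seq (hn : 0 < n) (hA : LearnHyp S hS hN' b A V T Q') (K θ R : ℕ) :
    Tri (samples (noisyParity b k S hS)) (setupProg k K θ) (initStore n) (23 * n + 20) fun τ =>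
      (MainInv n k ((12 * k + 3) * n) V K θ (Nat.clog 2 n) τ ∧ τ.var 5 = Nat.clog 2 n ∧ outSet n τ = ∅) ∧
      Tri (samples (noisyParity b k S hS)) (forTo 10 5 (iterProg A V b k (2 * k + 2) ((2 * k + 2) * R))) τ
        (Nat.clog 2 n * (iterCost n k ((12 * k + 3) * n) V T (2 * k + 2) ((2 * k + 2) * R)
          (K * Nat.clog 2 n) + 3) + 3) fun _ => True :=
  (setup_tri hn k K θ V).mono le_rfl fun _ hτ =>
    ⟨hτ, (main_hyp hA hτ.1 hτ.2.1 _ _).tri.mono le_rfl fun _ _ => trivial⟩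

theorem main_tri (hn : 0 < n) (hA : LearnHyp S hS hN' b A V T Q') (K θ R : ℕ) :
    Tri (samples (noisyParity b k S hS)) (mainProg A V b k K θ R) (initStore n) (mainCost n k V T R K)
      fun _ => True :=
  (Tri.seq ((main_seq hn hA K θ R).mono le_rfl fun _ h => h.2)).mono (by rw [mainCost]; omega) fun _ h => h

/-- A bound for the probability of failure when `L` iterations are made. -/
def failBound (k : ℕ) (a : ℝ≥0∞) (L : ℕ) : ℝ≥0∞ := (2 * k + 3 : ℕ) * 4⁻¹ ^ L + (1 - a) ^ L

theorem tendsto_failBound (k : ℕ) {a : ℝ≥0∞} (ha : a ≠ 0) :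
    Filter.Tendsto (failBound k a) Filter.atTop (nhds 0) := by
  have h1 : Filter.Tendsto (fun L => ((2 * k + 3 : ℕ) : ℝ≥0∞) * 4⁻¹ ^ L) Filter.atTop (nhds 0) := by
    have := ENNReal.Tendsto.const_mul (a := ((2 * k + 3 : ℕ) : ℝ≥0∞))
      (ENNReal.tendsto_pow_atTop_nhds_zero_of_lt_one (r := 4⁻¹) (ENNReal.inv_lt_one.2 (by norm_num)))
      (Or.inr (ENNReal.natCast_ne_top _))
    rwa [mul_zero] at this
  have h2 := ENNReal.tendsto_pow_atTop_nhds_zero_of_lt_one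
    (ENNReal.sub_lt_self ENNReal.one_ne_top one_ne_zero ha)
  have := h1.add h2
  rwa [add_zero] at this

/-- Both `L` and `n` are at most `2^L`, while `e^{-3} ≤ 1/16`; of `4^L 16^{-L}` there remains
`4^{-L}`. This fixes the exponent `3` in the confidence of the test. -/
theorem wrong_bound_le (n k : ℕ) :
    (Nat.clog 2 n : ℝ≥0∞) * ((n + (2 * k + 2) * n : ℕ) * ENNReal.ofReal (Real.exp (-3)) ^ Nat.clog 2 n)
      ≤ (2 * k + 3 : ℕ) * 4⁻¹ ^ Nat.clog 2 n := by
  set L := Nat.clog 2 n with hL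
  have h1 : (L : ℝ≥0∞) ≤ 2 ^ L := by exact_mod_cast Nat.lt_two_pow_self.le
  have h2 : (n : ℝ≥0∞) ≤ 2 ^ L := by exact_mod_cast Nat.le_pow_clog (by norm_num) n
  have h16 : (16⁻¹ : ℝ≥0∞) = 4⁻¹ * 4⁻¹ := by
    rw [← ENNReal.mul_inv (by simp) (by simp)]
    norm_num
  have h4 : (2 : ℝ≥0∞) ^ L * 2 ^ L * 4⁻¹ ^ L = 1 := by
    rw [← mul_pow, ← mul_pow, show (2 : ℝ≥0∞) * 2 = 4 by norm_num,
      ENNReal.mul_inv_cancel (by norm_num) (by norm_num), one_pow]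
  calc _ ≤ (2 : ℝ≥0∞) ^ L * (((2 * k + 3 : ℕ) * 2 ^ L) * 16⁻¹ ^ L) := by
        have : ((n + (2 * k + 2) * n : ℕ) : ℝ≥0∞) = (2 * k + 3 : ℕ) * n := by
          push_cast
          ring
        rw [this]
        gcongr
        exact exp_neg_three_le
    _ = (2 * k + 3 : ℕ) * 4⁻¹ ^ L * ((2 : ℝ≥0∞) ^ L * 2 ^ L * 4⁻¹ ^ L) := by
        rw [h16, mul_pow]
        ring
    _ = _ := by rw [h4, mul_one]

/-- An output other than `S` is either empty, so that every iteration missed `S`, or wrong, so that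
some false candidate was accepted. -/
theorem main_fail (hn : 0 < n) (hK : TestParams (delta b ^ k) K θ)
    (hA : LearnHyp S hS hN' b A V T Q') {R : ℕ} {a : ℝ≥0∞}
    (ha : ∀ τ, MainInv n k ((12 * k + 3) * n) V K θ (Nat.clog 2 n) τ →
      a ≤ wp (samples (noisyParity b k S hS)) (iterProg A V b k (2 * k + 2) ((2 * k + 2) * R)) (ind (Found n)) τ) :
    wp (samples (noisyParity b k S hS)) (mainProg A V b k K θ R) (ind fun τ => ¬ outSet n τ = S) (initStore n) ≤
      failBound k a (Nat.clog 2 n) := by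
  have hs := main_seq hn hA K θ R
  rw [mainProg, Tri.wp_seq (hs.mono le_rfl fun τ hτ => hτ.2)]
  refine (hs.wp_mono fun τ hτ => ?_).trans_eq (hs.wp_eq_const fun _ _ => rfl)
  obtain ⟨⟨hI, h5, hout⟩, ht⟩ := hτ
  have h1 := (main_wrong hK hA hI h5 (2 * k + 2) ((2 * k + 2) * R)).trans (add_le_add_right (wrong_bound_le n k) _)
  rw [ind_neg fun hw => hw.1 hout, zero_add] at h1
  refine le_trans ?_ (add_le_add h1 (main_lost hA hI h5 _ _ ha))
  simp only [wp]
  rw [← expect_add]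
  refine expect_mono fun ρ _ => ?_
  by_cases hf : outSet n ρ = ∅
  · refine le_trans (ind_le_one _ _) (le_trans ?_ le_add_self)
    exact (ind_pos (not_not.2 hf)).ge
  · by_cases hρ : outSet n ρ = S
    · rw [ind_neg (not_not.2 hρ)]
      exact zero_le
    · exact (ind_le_one _ _).trans ((ind_pos (⟨hf, hρ⟩ : Wrong S ρ)).ge.trans le_self_add)

end Main

end

noncomputable section

/-! ### Asymptotics of the running time -/

section Cost

theorem sq_le_two_pow (L : ℕ) : L ^ 2 ≤ 2 * 2 ^ L := by
  induction L with
  | zero => norm_num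
  | succ L ih =>
    by_cases hL : 3 ≤ L
    · have : (L + 1) ^ 2 ≤ 2 * L ^ 2 := by nlinarith
      rw [pow_succ 2 L]
      omega
    · interval_cases L <;> norm_num

theorem two_pow_clog_lt {n : ℕ} (hn : 2 ≤ n) : 2 ^ Nat.clog 2 n < 2 * n := by
  have h := Nat.pow_pred_clog_lt_self (b := 2) (by norm_num) (x := n) (by omega)
  have h0 := Nat.clog_pos (b := 2) (by norm_num) hn
  obtain ⟨j, hj⟩ := Nat.exists_eq_succ_of_ne_zero h0.ne'
  rw [hj] at h ⊢
  simp only [Nat.succ_eq_add_one, Nat.pred_succ] at h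
  rw [pow_succ]
  omega

/-- For `n ≥ 2` one has `2^L ≤ 2n ≤ n²`, and `log 2 ≥ 1/2`. -/
theorem clog_le_log {n : ℕ} (hn : 2 ≤ n) : (Nat.clog 2 n : ℝ) ≤ 4 * Real.log n := by
  have h : ((2 ^ Nat.clog 2 n : ℕ) : ℝ) ≤ (n : ℝ) ^ 2 := by
    have := two_pow_clog_lt hn
    have h2 : 2 * n ≤ n ^ 2 := by nlinarith
    exact_mod_cast this.le.trans h2
  have h1 := Real.log_le_log (by positivity) h
  push_cast at h1
  rw [Real.log_pow, Real.log_pow] at h1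
  have h2 : (0.5 : ℝ) ≤ Real.log 2 := by
    have := Real.log_two_gt_d9
    linarith
  have h3 : (Nat.clog 2 n : ℝ) * 0.5 ≤ Nat.clog 2 n * Real.log 2 := by gcongr
  push_cast at h1
  linarith

/-- The factor of `n ^ 3` in the running time. -/
def costFactor (k V R K : ℕ) : ℕ :=
  47 + (16 * (2 * k + 3) + 2 * V + 19 + (2 * k + 3) * (4 + (2 * k + 2) *
    ((2 * k + 2) * R * (53 * (12 * k + 3) + 15) + 9) + 9 + 24 * K + 19))

/-- One attempt costs `O(n L)`: a walk step scans all `N` vertices, and a test reads `O(L)` samples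
of length `n`. With `O(n)` starting points and `L` iterations the search costs `O(n² L²)`, which is
`O(n³)` because `L² ≤ 4n`. -/
theorem mainCost_le {n : ℕ} (hn : 2 ≤ n) (k V T R K : ℕ) :
    mainCost n k V T R K ≤ Nat.clog 2 n * (30 * T) + 4 * costFactor k V R K * n ^ 3 := by
  set L := Nat.clog 2 n with hL
  have hL1 : 1 ≤ L := Nat.clog_pos (by norm_num) hn
  have hn1 : 1 ≤ n := by omega
  have hLn : L ^ 2 ≤ 4 * n := by
    have h1 := sq_le_two_pow L
    have h2 := two_pow_clog_lt hn
    rw [← hL] at h2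
    omega
  set r := (2 * k + 2) * R
  set C := 4 + (2 * k + 2) * (r * (53 * (12 * k + 3) + 15) + 9) + 9 + 24 * K + 19 with hC
  have hnL : n ≤ n * L := Nat.le_mul_of_pos_right n hL1
  have hnL1 : 1 ≤ n * L := hn1.trans hnL
  have h1 : attemptCost n ((12 * k + 3) * n) (2 * k + 2) r (K * L) + 3 ≤ C * (n * L) := by
    have e1 : (2 * k + 2) * (r * (53 * ((12 * k + 3) * n) + 15) + 9)
        ≤ ((2 * k + 2) * (r * (53 * (12 * k + 3) + 15) + 9)) * (n * L) := by
      calc _ ≤ (2 * k + 2) * (r * (53 * ((12 * k + 3) * (n * L)) + 15 * (n * L)) + 9 * (n * L)) := by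
            gcongr <;> omega
        _ = _ := by ring
    have e2 : K * L * (12 * n + 12) ≤ 24 * K * (n * L) := by
      calc _ ≤ K * L * (12 * n + 12 * n) := by gcongr; omega
        _ = _ := by ring
    rw [attemptCost, hC]
    have e3 : (4 + (2 * k + 2) * (r * (53 * (12 * k + 3) + 15) + 9) + 9 + 24 * K + 19) * (n * L)
      = ((2 * k + 2) * (r * (53 * (12 * k + 3) + 15) + 9)) * (n * L) + 24 * K * (n * L) + 32 * (n * L) := by ring
    rw [e3]
    omega
  have h2 : iterCost n k ((12 * k + 3) * n) V T (2 * k + 2) r (K * L) + 3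
      ≤ 30 * T + (16 * (2 * k + 3) + 2 * V + 19 + (2 * k + 3) * C) * (n ^ 2 * L) := by
    have e0 : n ≤ n ^ 2 * L := by nlinarith
    have e1 : (n + (2 * k + 2) * n) * (attemptCost n ((12 * k + 3) * n) (2 * k + 2) r (K * L) + 3)
        ≤ (2 * k + 3) * C * (n ^ 2 * L) := by
      calc _ ≤ (n + (2 * k + 2) * n) * (C * (n * L)) := by gcongr
        _ = _ := by ring
    have e2 : 16 * (n + (2 * k + 2) * n) ≤ 16 * (2 * k + 3) * (n ^ 2 * L) := by
      calc 16 * (n + (2 * k + 2) * n) = 16 * (2 * k + 3) * n := by ring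
        _ ≤ _ := by gcongr
    have e3 : 2 * V ≤ 2 * V * (n ^ 2 * L) := Nat.le_mul_of_pos_right _ (by omega)
    rw [iterCost]
    have e4 : (16 * (2 * k + 3) + 2 * V + 19 + (2 * k + 3) * C) * (n ^ 2 * L)
      = 16 * (2 * k + 3) * (n ^ 2 * L) + 2 * V * (n ^ 2 * L) + 19 * (n ^ 2 * L)
        + (2 * k + 3) * C * (n ^ 2 * L) := by ring
    rw [e4]
    omega
  set C' := 16 * (2 * k + 3) + 2 * V + 19 + (2 * k + 3) * C
  have h3 : L * (n ^ 2 * L) ≤ 4 * n ^ 3 := by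
    calc L * (n ^ 2 * L) = n ^ 2 * L ^ 2 := by ring
      _ ≤ n ^ 2 * (4 * n) := by gcongr
      _ = _ := by ring
  have h4 : n ≤ n ^ 3 := Nat.le_self_pow (by norm_num) n
  calc mainCost n k V T R K ≤ 23 * n + 24 + L * (30 * T + C' * (n ^ 2 * L)) := by
        rw [mainCost]
        gcongr
    _ = 23 * n + 24 + (L * (30 * T) + C' * (L * (n ^ 2 * L))) := by ring
    _ ≤ 47 * n ^ 3 + (L * (30 * T) + C' * (4 * n ^ 3)) := by
        gcongr
        omega
    _ ≤ _ := by
        have : costFactor k V R K = 47 + C' := rfl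
        rw [this]
        nlinarith

end Cost

theorem mainTheorem3 (b c : ℝ) (d k : ℕ) (hb : 0 < b) (hc : 0 < c) (hk : 0 < k) (hd : 8 ≤ d)
    (hbd : b * (d + 1) ≤ 1 / 2)
    (hA : ∃ A : Prog,
      ProperlyLearns A b d c ((2 : ℝ)⁻¹ ^ (2 * k + 8) * delta b ^ k / (k + 1))) :
    ∃ A' : Prog,
      RecoversParity A' b k (fun n => (n : ℝ) ^ c * Real.log n + (n : ℝ) ^ 3) := by
  obtain ⟨A, C, hA⟩ := hA
  set ε : ℝ := (2 : ℝ)⁻¹ ^ (2 * k + 8) * delta b ^ k / (k + 1) with hε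
  have hδ : 0 < delta b := by
    have h := sinh_pow_four_lt (2 * b)
    have h0 : 0 < Real.sinh (2 * b) := Real.sinh_pos_iff.2 (by linarith)
    exact div_pos (by positivity) (by nlinarith [pow_pos h0 4])
  have hδk : 0 < delta b ^ k := pow_pos hδ k
  obtain ⟨K, θ, hK⟩ := exists_testParams hδk
  obtain ⟨V, hV⟩ := A.exists_wv_bound
  -- At distance `R` the covariance bound for a block drops below half of the amplitude of the
  -- parity; `R` does not depend on `n`.
  obtain ⟨R, hR⟩ : ∃ R : ℕ, ((2 * k + 2 : ℕ) : ℝ) * (4 * 2⁻¹ ^ R) ≤ delta b ^ k / 2 := by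
    obtain ⟨R, hR⟩ := exists_pow_lt_of_lt_one
      (show (0 : ℝ) < delta b ^ k / 2 / ((2 * k + 2 : ℕ) * 4) by positivity) (show (2⁻¹ : ℝ) < 1 by norm_num)
    refine ⟨R, ?_⟩
    rw [lt_div_iff₀ (by positivity)] at hR
    linarith
  have hbd' : b * d ≤ 1 / 2 := by nlinarith
  set a : ℝ≥0∞ := 4⁻¹ * (((2⁻¹ ^ d) ^ ((2 * k + 2) * R)) ^ (2 * k + 2) * 2⁻¹) with ha
  have ha0 : a ≠ 0 := by simp [ha]
  -- The factor `120` is `4 · 30`: `4` from `L ≤ 4 log n`, and `30` for the slowdown of the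
  -- simulation. The power `(12k+3)^c` accounts for running the learner on `N` instead of `n`
  -- vertices.
  refine ⟨mainProg A V b k K θ R, 120 * |C| * ((12 * k + 3 : ℕ) : ℝ) ^ c + 4 * costFactor k V R K,
    fun n => (failBound k a (Nat.clog 2 n)).toReal, ?_, fun n hn S hS => ?_⟩
  · have h1 : Filter.Tendsto (fun n => Nat.clog 2 n) Filter.atTop Filter.atTop :=
      Filter.tendsto_atTop_atTop.2 fun m => ⟨2 ^ m, fun n hn => by
        have := Nat.clog_mono_right 2 hn
        rwa [Nat.clog_pow 2 m (by norm_num)] at this⟩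
    exact (ENNReal.tendsto_toReal ENNReal.zero_ne_top).comp ((tendsto_failBound k ha0).comp h1)
  -- A set of `2k + 2 ≥ 4` elements must fit into `[n]`, so smaller `n` are vacuous.
  · have hn4 : 4 ≤ n := by
      have := Finset.card_le_univ S
      rw [hS, Fintype.card_fin] at this
      omega
    set N := (12 * k + 3) * n with hN
    -- The visible vertices number `(2k+3) n`; with `5k (n+1) ≤ 10 k n` hidden ones the total stays
    -- within `(12k+3) n`.
    have hcap : n + (2 * k + 2) * n + (n + 1) * (5 * k) ≤ N := by
      rw [hN]
      nlinarith
    have hNle : n + (2 * k + 2) * n ≤ N := le_trans (Nat.le_add_right _ _) hcap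
    have hN0 : 0 < N := by positivity
    choose M hM hlaw using fun π => exists_model S hS hNle hk hcap hb hd π
    set T := ⌊C * (N : ℝ) ^ c⌋₊ with hT
    have hlearn := fun π => hA N hN0 (visible (n + (2 * k + 2) * n) N) (M π) 0 (hM π)
    have hL : LearnHyp S hS hNle b A V T fun π => cmrf (visible (n + (2 * k + 2) * n) N) (M π) 0 :=
      ⟨hV, hlaw, fun π => (hlearn π).1⟩
    have hx : 0 < ε * N := by positivity
    -- This is what the size of `ε` is made for: `(12k+3)/(k+1) ≤ 12`, `2k + 8 ≥ 10`, and `32 · 12 /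
    -- 2^10 = 3/8`.
    have hxn : 32 * (ε * N) ≤ 3 / 8 * (n + 1) * delta b ^ k := by
      have h1 : (2 : ℝ)⁻¹ ^ (2 * k + 8) ≤ 2⁻¹ ^ 10 :=
        pow_le_pow_of_le_one (by norm_num) (by norm_num) (by omega)
      have h2 : ((12 * k + 3 : ℕ) : ℝ) / (k + 1) ≤ 12 := by
        rw [div_le_iff₀ (by positivity)]
        push_cast
        linarith
      calc 32 * (ε * N) = 32 * ((2 : ℝ)⁻¹ ^ (2 * k + 8) * (((12 * k + 3 : ℕ) : ℝ) / (k + 1)) * n * delta b ^ k) := by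
            rw [hε, hN]
            push_cast
            ring
        _ ≤ 32 * (2⁻¹ ^ 10 * 12 * n * delta b ^ k) := by gcongr
        _ ≤ 3 / 8 * (n + 1) * delta b ^ k := by
            have e : 32 * ((2 : ℝ)⁻¹ ^ 10 * 12 * n * delta b ^ k) = 3 / 8 * n * delta b ^ k := by ring
            rw [e]
            gcongr
            linarith
    have ht := main_tri (by omega) hL K θ R
    have hf := main_fail (R := R) (a := a) (by omega) hK hL fun τ hτ =>
      iter_right hK (Nat.clog_pos (by norm_num) (by omega)) hL hτ hb hk hbd' hR hx hxn fun π =>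
        (hlearn π).2.trans (outputProb_le _ _ _ _ _)
    have hcost : mainCost n k V T R K ≤ ⌊(120 * |C| * ((12 * k + 3 : ℕ) : ℝ) ^ c + 4 * costFactor k V R K) *
        ((n : ℝ) ^ c * Real.log n + (n : ℝ) ^ 3)⌋₊ := by
      refine Nat.le_floor ?_
      have hlog : 0 ≤ Real.log n := Real.log_natCast_nonneg n
      have hT' : (T : ℝ) ≤ |C| * (((12 * k + 3 : ℕ) : ℝ) ^ c * (n : ℝ) ^ c) := by
        have h1 : (T : ℝ) ≤ |C| * (N : ℝ) ^ c := by
          rw [← abs_of_nonneg (Real.rpow_nonneg (Nat.cast_nonneg N) c), ← abs_mul]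
          refine (Nat.cast_le.2 (Nat.floor_mono (le_abs_self _))).trans (Nat.floor_le (abs_nonneg _))
        rwa [hN, Nat.cast_mul, Real.mul_rpow (Nat.cast_nonneg _) (Nat.cast_nonneg _)] at h1
      have h1 : (mainCost n k V T R K : ℝ) ≤ Nat.clog 2 n * (30 * T) + 4 * costFactor k V R K * n ^ 3 := by
        exact_mod_cast mainCost_le (by omega) k V T R K
      calc (mainCost n k V T R K : ℝ) ≤ Nat.clog 2 n * (30 * T) + 4 * costFactor k V R K * n ^ 3 := h1
        _ ≤ 4 * Real.log n * (30 * (|C| * (((12 * k + 3 : ℕ) : ℝ) ^ c * (n : ℝ) ^ c)))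
            + 4 * costFactor k V R K * n ^ 3 := by
            gcongr
            exact clog_le_log (by omega)
        _ = 120 * |C| * ((12 * k + 3 : ℕ) : ℝ) ^ c * ((n : ℝ) ^ c * Real.log n)
            + 4 * costFactor k V R K * n ^ 3 := by ring
        _ ≤ _ := by
            rw [add_mul, mul_add, mul_add]
            have e1 : 0 ≤ 120 * |C| * ((12 * k + 3 : ℕ) : ℝ) ^ c * (n : ℝ) ^ 3 := by positivity
            have e2 : 0 ≤ 4 * (costFactor k V R K : ℝ) * ((n : ℝ) ^ c * Real.log n) := by positivity
            linarith
    refine ⟨ht.1.haltsWithin hcost, ?_⟩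
    rw [ht.1.outputProb hcost, ← expect_indicator]
    have hsum := wp_add_wp_not ht fun τ => outSet n τ = S
    have hne : failBound k a (Nat.clog 2 n) ≠ ⊤ :=
       ENNReal.add_ne_top.2 ⟨ENNReal.mul_ne_top (ENNReal.natCast_ne_top _) (ENNReal.pow_ne_top (by simp)),
        ENNReal.pow_ne_top (ENNReal.sub_ne_top ENNReal.one_ne_top)⟩
    rw [ENNReal.ofReal_sub _ ENNReal.toReal_nonneg, ENNReal.ofReal_one, ENNReal.ofReal_toReal hne,
      tsub_le_iff_right]
    refine hsum.ge.trans (add_le_add (le_of_eq ?_) hf)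
    refine expect_congr fun τ _ => ?_
    by_cases h : outSet n τ = S
    · exact (ind_pos (Q := fun τ => outSet n τ = S) h).trans
        (Set.indicator_of_mem (s := {σ | outSet n σ = S}) h fun _ => (1 : ℝ≥0∞)).symm
    · exact (ind_neg (Q := fun τ => outSet n τ = S) h).trans
        (Set.indicator_of_notMem (s := {σ | outSet n σ = S}) h fun _ => (1 : ℝ≥0∞)).symm

end
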